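/- Let $M$ be a closed (compact, without boundary) smooth manifold of dimension $n$, let $\tau>0$, and let $g_0$ be a smooth Riemannian metric and $f_0$ a smooth function on $M$ with $$\mathrm{Ric}(g_0)+\nabla^2 f_0-\tfrac1{2\tau}g_0=0 .$$ For a smooth metric $g$ and a smooth function $f$ put $d\nu_{g,f}=(4\pi\tau)^{-n/2}e^{-f}dV_g$, $$\mathcal W(g,f,\tau)=\int_M\big[\tau(|\nabla f|^2+R_g)+f-n\big]\,d\nu_{g,f},\qquad \mu(g,\tau)=\inf\Big\{\mathcal W(g,f,\tau): f\in C^\infty(M),\ \int_M d\nu_{g,f}=1\Big\}.$$ A *path* is a family of smooth metrics $g_s$, smooth jointly in the parameter $s$ near $0$ and in the point of $M$; its *velocity* is $h=\frac{d}{ds}g_s|_{s=0}\in S^2(T^*M)$, the space of smooth symmetric $(0,2)$ tensors. Let $\mathcal U$ be a regular neighborhood of $g_0$, that is: $g_0\in\mathcal U$; every path that starts in $\mathcal U$ stays in $\mathcal U$ for small $|s|$; for each $g\in\mathcal U$ the infimum defining $\mu(g,\tau)$ is attained by exactly one normalized smooth function $P(g)$; and along every path that starts in $\mathcal U$, $s\mapsto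 P(g_s)$ is differentiable at $s=0$ in $C^2(M)$. (All this holds if $\mathcal U$ is open in the $C^{k,\gamma}$ topology, $k\ge2$, $0<\gamma<1$, and $P$ is real analytic into $C^{k,\gamma}(M)$.) Write $\nabla\mu(g)=-\tau\big(\mathrm{Ric}(g)+\nabla^2P(g)-\frac1{2\tau}g\big)$ for $g\in\mathcal U$. Geometric operators without a subscript are those of $g_0$. For $h\in S^2(T^*M)$ let $(\delta h)_j=g^{ik}\nabla_ih_{kj}$, let $\delta^*$ be the operator on smooth one-forms given by $(\delta^*\omega)_{ij}=-\frac12(\nabla_i\omega_j+\nabla_j\omega_i)$, let $$\delta^{f_0}h=\delta h-h(\nabla f_0,\cdot),\qquad \delta^{f_0}\omega=g^{ij}\nabla_i\omega_j-\langle df_0,\omega\rangle,\qquad \Delta^{f_0}u=\Delta u-\langle du,df_0\rangle,$$ let $\Delta_L$ be the Lichnerowicz Laplacian $(\Delta_Lh)_{ij}=\Delta h_{ij}+2R_{pijq}h^{pq}-R_{ip}h^p{}_j-R_{jp}h_i{}^p$ (with the sign of the curvature for which $R_{pijq}g^{pq}=R_{ij}$), and let $$\Psi(h)_{ij}=-\tfrac12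 g^{kl}\big(\nabla_ih_{jl}+\nabla_jh_{il}-\nabla_lh_{ij}\big)\nabla_kf_0 .$$ Then the following hold. 1. For every $h\in S^2(T^*M)$ there is a unique $\Phi(h)\in C^2(M)$ with $$\Delta^{f_0}\Phi(h)+\tfrac1{2\tau}\Phi(h)=-\tfrac12\,\delta^{f_0}\delta^{f_0}h .$$ If $\delta^{f_0}h=0$, then $\Phi(h)\equiv0$. 2. $\delta^*$ is the dual of $\delta$ for the $L^2$ inner product of $dV_{g_0}$: $\int_M\langle\delta^*\omega,k\rangle\,dV_{g_0}=\int_M\langle\omega,\delta k\rangle\,dV_{g_0}$ for all smooth one-forms $\omega$ and all $k\in S^2(T^*M)$. 3. $\nabla\mu$ is the gradient of $\mu(\cdot,\tau)$ on $\mathcal U$: for every path $g_s$ through $g_0'\in\mathcal U$ at $s=0$ with velocity $h$, $\frac{d}{ds}\mu(g_s,\tau)|_{s=0}=\int_M\langle\nabla\mu(g_0'),h\rangle_{g_0'}\,d\nu_{g_0',P(g_0')}$. 4. The second variation of $\mu(\cdot,\tau)$ at $g_0$ is given by the operator $$Lh=-\tau\Big(-\tfrac12\Delta_Lh-\delta^*\delta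 h+\nabla^2\Phi(h)+\Psi(h)-\tfrac1{2\tau}h\Big).$$ That is, for every path $g_s$ with $g_s|_{s=0}=g_0$ and velocity $h$, and every $k\in S^2(T^*M)$: the derivative $P'_{g_0}(h)$ of $P(g_s)$ at $s=0$, in $C^2(M)$, satisfies $\Phi(h)=P'_{g_0}(h)-\frac12\mathrm{tr}_{g_0}h$; $\frac{d}{ds}\nabla\mu(g_s)|_{s=0}=Lh$ pointwise on $M$; and $$\frac{d}{ds}\Big|_{s=0}\int_M\langle\nabla\mu(g_s),k\rangle_{g_s}d\nu_{g_s,P(g_s)}=\int_M\langle Lh,k\rangle_{g_0}\,d\nu_{g_0,P(g_0)},\qquad \frac{d^2}{ds^2}\Big|_{s=0}\mu(g_s,\tau)=\int_M\langle Lh,h\rangle_{g_0}\,d\nu_{g_0,P(g_0)} .$$ -/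

import Mathlib

open Set Filter Topology MeasureTheory Manifold Bundle
open scoped ContDiff BigOperators

noncomputable section

namespace SolitonVariation

/-! ### Riemannian geometry in a coordinate patch

Coordinates take values in `ℝⁿ`.  The functions below are given the components of a tensor as
functions of the coordinates `y`, and return components of the resulting tensor at `y`. -/

/-- Coordinate space. -/
abbrev Coord (n : ℕ) : Type := EuclideanSpace ℝ (Fin n)

variable {n : ℕ}

/-- The partial derivative `∂ᵢ u` at `y`. -/
def pd (i : Fin n) (u : Coord n → ℝ) (y : Coord n) : ℝ :=
  fderiv ℝ u y (EuclideanSpace.single i 1)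

/-- Components `g_{ij}` of a metric in coordinates. -/
abbrev LocalMetric (n : ℕ) : Type := Coord n → Fin n → Fin n → ℝ

/-- The inverse metric `g^{ij}`. -/
def invG (G : LocalMetric n) (y : Coord n) (i j : Fin n) : ℝ :=
  ((Matrix.of (G y))⁻¹ : Matrix (Fin n) (Fin n) ℝ) i j

/-- Christoffel symbols `Γ^k_{ij}` of the Levi-Civita connection. -/
def christoffel (G : LocalMetric n) (y : Coord n) (k i j : Fin n) : ℝ :=
  (1 / 2) * ∑ l, invG G y k l *
    (pd i (fun z => G z j l) y + pd j (fun z => G z i l) y - pd l (fun z => G z i j) y)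

/-- `∇_k α_i`. -/
def nabla1 (G : LocalMetric n) (α : Coord n → Fin n → ℝ) (y : Coord n) (k i : Fin n) : ℝ :=
  pd k (fun z => α z i) y - ∑ l, christoffel G y l k i * α y l

/-- `∇_k h_{ij}`. -/
def nabla2 (G : LocalMetric n) (h : Coord n → Fin n → Fin n → ℝ) (y : Coord n)
    (k i j : Fin n) : ℝ :=
  pd k (fun z => h z i j) y - ∑ l, christoffel G y l k i * h y l j
    - ∑ l, christoffel G y l k j * h y i l

/-- `∇_k T_{pij}`. -/
def nabla3 (G : LocalMetric n) (T : Coord n → Fin n → Fin n → Fin n → ℝ) (y : Coord n)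
    (k p i j : Fin n) : ℝ :=
  pd k (fun z => T z p i j) y - ∑ l, christoffel G y l k p * T y l i j
    - ∑ l, christoffel G y l k i * T y p l j - ∑ l, christoffel G y l k j * T y p i l

/-- The Riemann tensor `R_{ijk}{}^l`, where `R(∂ᵢ, ∂ⱼ) ∂ₖ = ∑ₗ R_{ijk}{}^l ∂ₗ`. -/
def riem (G : LocalMetric n) (y : Coord n) (i j k l : Fin n) : ℝ :=
  pd i (fun z => christoffel G z l j k) y - pd j (fun z => christoffel G z l i k) y
    + ∑ m, (christoffel G y m j k * christoffel G y l i m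
      - christoffel G y m i k * christoffel G y l j m)

/-- The Ricci tensor `R_{jk} = ∑ₗ R_{ljk}{}^l` (positive on round spheres). -/
def ricciC (G : LocalMetric n) (y : Coord n) (j k : Fin n) : ℝ :=
  ∑ l, riem G y l j k l

/-- The Hessian `∇ᵢ∇ⱼ u` of a function. -/
def hessC (G : LocalMetric n) (u : Coord n → ℝ) (y : Coord n) (i j : Fin n) : ℝ :=
  nabla1 G (fun z a => pd a u z) y i j

/-- The trace `g^{ij} T_{ij}`. -/
def traceC (G : LocalMetric n) (y : Coord n) (T : Fin n → Fin n → ℝ) : ℝ :=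
  ∑ i, ∑ j, invG G y i j * T i j

/-- The rough Laplacian `g^{pq} ∇_p ∇_q h_{ij}`. -/
def roughLapC (G : LocalMetric n) (h : Coord n → Fin n → Fin n → ℝ) (y : Coord n)
    (i j : Fin n) : ℝ :=
  ∑ p, ∑ q, invG G y p q * nabla3 G (fun z => nabla2 G h z) y p q i j

/-- The Lichnerowicz Laplacian
`(Δ_L h)_{ij} = Δ h_{ij} + 2 R_{pij}{}^q g^{pr} h_{rq} - R_{ip} g^{pq} h_{qj} - R_{jp} g^{pq} h_{iq}`. -/
def lichC (G : LocalMetric n) (h : Coord n → Fin n → Fin n → ℝ) (y : Coord n)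
    (i j : Fin n) : ℝ :=
  roughLapC G h y i j
    + 2 * ∑ p, ∑ q, ∑ r, riem G y p i j q * invG G y p r * h y r q
    - ∑ p, ∑ q, ricciC G y i p * invG G y p q * h y q j
    - ∑ p, ∑ q, ricciC G y j p * invG G y p q * h y i q

/-- The divergence `(δ h)_j = g^{ik} ∇_i h_{kj}`. -/
def divC (G : LocalMetric n) (h : Coord n → Fin n → Fin n → ℝ) (y : Coord n) (j : Fin n) : ℝ :=
  ∑ i, ∑ k, invG G y i k * nabla2 G h y i k j

/-- The first order operator
`Ψ(h)_{ij} = -½ g^{kl} (∇ᵢ h_{jl} + ∇ⱼ h_{il} - ∇_l h_{ij}) ∇_k f`. -/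
def psiC (G : LocalMetric n) (f : Coord n → ℝ) (h : Coord n → Fin n → Fin n → ℝ) (y : Coord n)
    (i j : Fin n) : ℝ :=
  -(1 / 2) * ∑ k, ∑ l, invG G y k l *
    (nabla2 G h y i j l + nabla2 G h y j i l - nabla2 G h y l i j) * pd k f y

/-! ### Tensor fields on a manifold

`M` is a manifold modelled on `ℝⁿ`, without boundary.  A tensor field is evaluated at a point `x`
by computing its components in the preferred chart at `x`; all operators below are
tensorial, so that any other chart around `x` gives the same value. -/

variable {M : Type*} [TopologicalSpace M] [ChartedSpace (Coord n) M]

/-- The tangent space of `M` at `x`. -/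
abbrev TM (n : ℕ) {M : Type*} [TopologicalSpace M] [ChartedSpace (Coord n) M] (x : M) : Type :=
  TangentSpace (𝓡 n) x

/-- Smooth real functions on `M`. -/
abbrev SmoothFun (n : ℕ) (M : Type*) [TopologicalSpace M] [ChartedSpace (Coord n) M] : Type _ :=
  C^∞⟮𝓡 n, M; 𝓘(ℝ, ℝ), ℝ⟯

/-- Fields of forms of degree one, no regularity required. -/
abbrev Field1 (n : ℕ) (M : Type*) [TopologicalSpace M] [ChartedSpace (Coord n) M] : Type _ :=
  ∀ x : M, TM n x → ℝ

/-- Fields of `(0,2)` tensors, no regularity required. -/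
abbrev Field2 (n : ℕ) (M : Type*) [TopologicalSpace M] [ChartedSpace (Coord n) M] : Type _ :=
  ∀ x : M, TM n x → TM n x → ℝ

/-- Smooth Riemannian metrics on `M`. -/
abbrev RMetric (n : ℕ) (M : Type*) [TopologicalSpace M] [ChartedSpace (Coord n) M]
    [IsManifold (𝓡 n) ∞ M] : Type _ :=
  ContMDiffRiemannianMetric (𝓡 n) ∞ (Coord n) (fun x : M => TangentSpace (𝓡 n) x)

/-- Smooth one-forms on `M`. -/
structure OneForm (n : ℕ) (M : Type*) [TopologicalSpace M] [ChartedSpace (Coord n) M]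
    [IsManifold (𝓡 n) ∞ M] where
  /-- The value at a point. -/
  val (x : M) : TangentSpace (𝓡 n) x →L[ℝ] ℝ
  smooth : ContMDiff (𝓡 n) ((𝓡 n).prod 𝓘(ℝ, Coord n →L[ℝ] ℝ)) ∞
    (fun x : M => TotalSpace.mk' (Coord n →L[ℝ] ℝ) x (val x))

/-- Smooth symmetric `(0,2)` tensors on `M`. -/
structure SymTensor (n : ℕ) (M : Type*) [TopologicalSpace M] [ChartedSpace (Coord n) M]
    [IsManifold (𝓡 n) ∞ M] where
  /-- The value at a point. -/
  val (x : M) : TangentSpace (𝓡 n) x →L[ℝ] TangentSpace (𝓡 n) x →L[ℝ] ℝ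
  symm (x : M) (v w : TangentSpace (𝓡 n) x) : val x v w = val x w v
  smooth : ContMDiff (𝓡 n) ((𝓡 n).prod 𝓘(ℝ, Coord n →L[ℝ] Coord n →L[ℝ] ℝ)) ∞
    (fun x : M => TotalSpace.mk' (Coord n →L[ℝ] Coord n →L[ℝ] ℝ) x (val x))

/-- The chart around `x₀`, as a map to `ℝⁿ`. -/
abbrev crd (n : ℕ) {M : Type*} [TopologicalSpace M] [ChartedSpace (Coord n) M] (x₀ : M) :
    PartialEquiv M (Coord n) :=
  extChartAt (𝓡 n) x₀

/-- The coordinate vector field `∂ᵢ` of the chart around `x₀`, at the point with coordinates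
`y`. -/
def frame (x₀ : M) (y : Coord n) (i : Fin n) : TM n ((crd n x₀).symm y) :=
  mfderiv 𝓘(ℝ, Coord n) (𝓡 n) (crd n x₀).symm y (EuclideanSpace.single i (1 : ℝ) : Coord n)

/-- The coordinate `dxⁱ(v)` of a tangent vector at `x`, in the preferred chart at `x`. -/
def vcoord (x : M) (v : TM n x) (i : Fin n) : ℝ :=
  let c : Coord n := mfderiv (𝓡 n) 𝓘(ℝ, Coord n) (crd n x) x v
  c i

/-- The coordinate expression of a function. -/
def comp0 (x₀ : M) (u : M → ℝ) (y : Coord n) : ℝ := u ((crd n x₀).symm y)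

/-- The components of a one-form. -/
def comp1 (x₀ : M) (α : Field1 n M) (y : Coord n) (i : Fin n) : ℝ :=
  α ((crd n x₀).symm y) (frame x₀ y i)

/-- The components of a `(0,2)` tensor. -/
def comp2 (x₀ : M) (h : Field2 n M) (y : Coord n) (i j : Fin n) : ℝ :=
  h ((crd n x₀).symm y) (frame x₀ y i) (frame x₀ y j)

/-- The one-form at `x` with components `c` in the preferred chart at `x`. -/
def of1 (x : M) (c : Fin n → ℝ) (v : TM n x) : ℝ := ∑ i, c i * vcoord x v i

/-- The `(0,2)` tensor at `x` with components `c` in the preferred chart at `x`. -/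
def of2 (x : M) (c : Fin n → Fin n → ℝ) (v w : TM n x) : ℝ :=
  ∑ i, ∑ j, c i j * vcoord x v i * vcoord x w j

variable [IsManifold (𝓡 n) ∞ M]

/-- The `(0,2)` field underlying a metric. -/
def RMetric.field (g : RMetric n M) : Field2 n M := fun x v w => g.inner x v w

/-- The `(0,2)` field underlying a smooth symmetric tensor. -/
def SymTensor.field (h : SymTensor n M) : Field2 n M := fun x v w => h.val x v w

/-- The field underlying a smooth one-form. -/
def OneForm.field (α : OneForm n M) : Field1 n M := fun x v => α.val x v

/-- The components of the metric in the chart around `x₀`. -/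
def locG (g : RMetric n M) (x₀ : M) : LocalMetric n := comp2 x₀ (RMetric.field g)

/-- The Ricci tensor. -/
def ricci (g : RMetric n M) : Field2 n M := fun x =>
  of2 x (ricciC (locG g x) (crd n x x))

/-- The trace of a `(0,2)` tensor. -/
def tr (g : RMetric n M) (h : Field2 n M) (x : M) : ℝ :=
  traceC (locG g x) (crd n x x) (comp2 x h (crd n x x))

/-- The scalar curvature. -/
def scal (g : RMetric n M) : M → ℝ := tr g (ricci g)

/-- The Hessian `∇² u`. -/
def hess (g : RMetric n M) (u : M → ℝ) : Field2 n M := fun x =>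
  of2 x (hessC (locG g x) (comp0 x u) (crd n x x))

/-- The differential `du`. -/
def diff (u : M → ℝ) : Field1 n M := fun x => of1 x (fun i => pd i (comp0 x u) (crd n x x))

/-- The pointwise inner product of one-forms. -/
def inner1 (g : RMetric n M) (α η : Field1 n M) (x : M) : ℝ :=
  ∑ i, ∑ j, invG (locG g x) (crd n x x) i j * comp1 x α (crd n x x) i * comp1 x η (crd n x x) j

/-- The pointwise inner product `g^{ik} g^{jl} A_{ij} B_{kl}` of `(0,2)` tensors. -/
def inner2 (g : RMetric n M) (A B : Field2 n M) (x : M) : ℝ :=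
  ∑ i, ∑ j, ∑ k, ∑ l, invG (locG g x) (crd n x x) i k * invG (locG g x) (crd n x x) j l *
    comp2 x A (crd n x x) i j * comp2 x B (crd n x x) k l

/-- The drift Laplacian `Δ^f u = Δ u - ⟨du, df⟩`. -/
def driftLap (g : RMetric n M) (f u : M → ℝ) (x : M) : ℝ :=
  tr g (hess g u) x - inner1 g (diff u) (diff f) x

/-- The Lichnerowicz Laplacian. -/
def lichnerowicz (g : RMetric n M) (h : Field2 n M) : Field2 n M := fun x =>
  of2 x (lichC (locG g x) (comp2 x h) (crd n x x))

/-- The divergence `δ h` of a symmetric `(0,2)` tensor. -/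
def div2 (g : RMetric n M) (h : Field2 n M) : Field1 n M := fun x =>
  of1 x (divC (locG g x) (comp2 x h) (crd n x x))

/-- The divergence `g^{ij} ∇ᵢ α_j` of a one-form. -/
def div1 (g : RMetric n M) (α : Field1 n M) (x : M) : ℝ :=
  traceC (locG g x) (crd n x x) (nabla1 (locG g x) (comp1 x α) (crd n x x))

/-- The weighted divergence `δ^f h = δ h - i_{∇f} h`. -/
def driftDiv2 (g : RMetric n M) (f : M → ℝ) (h : Field2 n M) : Field1 n M := fun x v =>
  div2 g h x v - of1 x (fun j => ∑ i, ∑ k, invG (locG g x) (crd n x x) i k *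
    pd i (comp0 x f) (crd n x x) * comp2 x h (crd n x x) k j) v

/-- The weighted divergence `δ^f α = δ α - ⟨df, α⟩` of a one-form. -/
def driftDiv1 (g : RMetric n M) (f : M → ℝ) (α : Field1 n M) (x : M) : ℝ :=
  div1 g α x - inner1 g (diff f) α x

/-- `δ^* α = -½ (∇ᵢ α_j + ∇_j α_i)`; it is part of the theorem that this is the `L²` dual
of `δ`. -/
def deltaStar (g : RMetric n M) (α : Field1 n M) : Field2 n M := fun x =>
  of2 x (fun i j => -(1 / 2) * (nabla1 (locG g x) (comp1 x α) (crd n x x) i j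
    + nabla1 (locG g x) (comp1 x α) (crd n x x) j i))

/-- The operator `Ψ`. -/
def psi (g : RMetric n M) (f : M → ℝ) (h : Field2 n M) : Field2 n M := fun x =>
  of2 x (psiC (locG g x) (comp0 x f) (comp2 x h) (crd n x x))

/-- The shrinking gradient Ricci soliton equation `Ric + ∇² f = g / (2τ)`. -/
def IsShrinkingSoliton (τ : ℝ) (g : RMetric n M) (f : SmoothFun n M) : Prop :=
  ∀ (x : M) (v w : TM n x), ricci g x v w + hess g f x v w - (1 / (2 * τ)) * g.inner x v w = 0

/-! ### The Riemannian measure and the functionals `W` and `μ` -/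

section Volume

variable [T2Space M] [SigmaCompactSpace M]

/-- A smooth partition of unity subordinate to the preferred charts. -/
def chartPartition (n : ℕ) (M : Type*) [TopologicalSpace M] [ChartedSpace (Coord n) M]
    [IsManifold (𝓡 n) ∞ M] [T2Space M] [SigmaCompactSpace M] :
    SmoothPartitionOfUnity M (𝓡 n) M univ :=
  (SmoothPartitionOfUnity.exists_isSubordinate_chartAt_source (𝓡 n) M).choose

variable [MeasurableSpace M]

/-- The Riemannian measure `dV_g`: it is `√(det g_{ij}) dy` in coordinates, glued with a partition
of unity (the result does not depend on the partition). -/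
def vol (g : RMetric n M) : Measure M :=
  Measure.sum fun x₀ : M =>
    Measure.map (crd n x₀).symm
      ((volume.restrict (crd n x₀).target).withDensity fun y =>
        ENNReal.ofReal (chartPartition n M x₀ ((crd n x₀).symm y) *
          Real.sqrt (Matrix.of (locG g x₀ y)).det))

/-- The integral of `u` against `dν = (4πτ)^{-n/2} e^{-f} dV_g`. -/
def nuIntegral (τ : ℝ) (g : RMetric n M) (f : M → ℝ) (u : M → ℝ) : ℝ :=
  ∫ x, u x * ((4 * Real.pi * τ) ^ (-(n : ℝ) / 2) * Real.exp (-f x)) ∂(vol g)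

/-- Perelman's functional `W(g, f, τ)`. -/
def entropyW (τ : ℝ) (g : RMetric n M) (f : SmoothFun n M) : ℝ :=
  nuIntegral τ g f fun x =>
    τ * (inner1 g (diff f) (diff f) x + scal g x) + (f x - n)

/-- The constraint `∫ (4πτ)^{-n/2} e^{-f} dV_g = 1`. -/
def IsNormalized (τ : ℝ) (g : RMetric n M) (f : SmoothFun n M) : Prop :=
  nuIntegral τ g f (fun _ => 1) = 1

/-- `μ(g, τ)`, the infimum of `W(g, f, τ)` over normalized smooth `f`. -/
def mu (τ : ℝ) (g : RMetric n M) : ℝ :=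
  sInf (entropyW τ g '' {f : SmoothFun n M | IsNormalized τ g f})

/-- `f` is normalized and the infimum that defines `μ(g, τ)` is attained at `f`. -/
def IsMinimizer (τ : ℝ) (g : RMetric n M) (f : SmoothFun n M) : Prop :=
  IsNormalized τ g f ∧ ∀ f' : SmoothFun n M, IsNormalized τ g f' → entropyW τ g f ≤ entropyW τ g f'

end Volume

/-! ### Paths of metrics, linearization, regular neighbourhoods -/

/-- `γ` is a path of metrics near the parameter `0`, smooth jointly in the parameter and in the
point of `M`. -/
def IsSmoothPath (γ : ℝ → RMetric n M) : Prop :=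
  ∃ ε : ℝ, 0 < ε ∧
    ContMDiffOn (𝓘(ℝ, ℝ).prod (𝓡 n)) ((𝓡 n).prod 𝓘(ℝ, Coord n →L[ℝ] Coord n →L[ℝ] ℝ)) ∞
      (fun p : ℝ × M => TotalSpace.mk' (Coord n →L[ℝ] Coord n →L[ℝ] ℝ)
        (E := fun x : M => TangentSpace (𝓡 n) x →L[ℝ] TangentSpace (𝓡 n) x →L[ℝ] ℝ)
        p.2 ((γ p.1).inner p.2))
      (Ioo (-ε) ε ×ˢ univ)

/-- `γ` is a smooth path of metrics with `γ 0 = g` and velocity `h` at `0`. -/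
structure IsPathThrough (γ : ℝ → RMetric n M) (g : RMetric n M) (h : SymTensor n M) : Prop where
  smooth : IsSmoothPath γ
  start : γ 0 = g
  velocity : ∀ (x : M) (v w : TM n x), HasDerivAt (fun s => (γ s).inner x v w) (h.val x v w) 0

/-- The curve `F` of functions on `M` is differentiable at `0` with derivative `p`, in the
`C²` topology: in each chart, the difference quotients converge to `p` together with their
coordinate derivatives of order at most two, uniformly on compact sets. -/
def HasC2DerivAt (F : ℝ → M → ℝ) (p : M → ℝ) : Prop :=
  ContMDiff (𝓡 n) 𝓘(ℝ, ℝ) 2 p ∧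
    ∀ (x₀ : M) (j : ℕ), j ≤ 2 →
      TendstoLocallyUniformlyOn
        (fun (s : ℝ) (y : Coord n) => iteratedFDeriv ℝ j
          (fun z => s⁻¹ * (comp0 x₀ (F s) z - comp0 x₀ (F 0) z)) y)
        (iteratedFDeriv ℝ j (comp0 x₀ p)) (𝓝[≠] 0) (crd n x₀).target

section Functional

variable [T2Space M] [SigmaCompactSpace M] [MeasurableSpace M]

/-- `U` is a regular neighbourhood of `g₀` and `P` assigns to each metric in `U` its unique
minimizer.  Of the openness of `U` in a Hölder topology `C^{k,γ}`, `k ≥ 2`, and of the real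
analytic dependence of `P(g)` on `g` as a map into `C^{k,γ}`, only a consequence is demanded: smooth
paths of metrics that start in `U` stay in `U` for a short time, and `P` is differentiable along
them in the `C²` sense. -/
structure IsRegularNeighborhood (τ : ℝ) (g₀ : RMetric n M) (U : Set (RMetric n M))
    (P : RMetric n M → SmoothFun n M) : Prop where
  mem : g₀ ∈ U
  path_mem : ∀ γ : ℝ → RMetric n M, IsSmoothPath γ → γ 0 ∈ U → ∀ᶠ s in 𝓝 (0 : ℝ), γ s ∈ U
  minimizer : ∀ g ∈ U, IsMinimizer τ g (P g)
  unique : ∀ g ∈ U, ∀ f : SmoothFun n M, IsMinimizer τ g f → f = P g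
  path_deriv : ∀ γ : ℝ → RMetric n M, IsSmoothPath γ → γ 0 ∈ U →
    ∃ p : M → ℝ, HasC2DerivAt (n := n) (fun s => P (γ s)) p

end Functional

/-- `-τ (Ric(g) + ∇² f - g / (2τ))`, which for `f = P(g)` is the gradient `∇μ(g)`. -/
def gradMu (τ : ℝ) (g : RMetric n M) (f : M → ℝ) : Field2 n M := fun x v w =>
  -τ * (ricci g x v w + hess g f x v w - (1 / (2 * τ)) * g.inner x v w)

/-- `-τ (-½ Δ_L h - δ^* δ h + ∇² φ + Ψ(h) - h / (2τ))`. -/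
def opL (τ : ℝ) (g : RMetric n M) (f : M → ℝ) (h : SymTensor n M) (φ : M → ℝ) : Field2 n M :=
  fun x v w =>
    -τ * (-(1 / 2) * lichnerowicz g h.field x v w - deltaStar g (div2 g h.field) x v w
      + hess g φ x v w + psi g f h.field x v w - (1 / (2 * τ)) * h.val x v w)

end SolitonVariation

end

open SolitonVariation

/-!
The statement is a coordinate computation combined with three global arguments, none of which needs
elliptic theory, because the regular neighbourhood supplies differentiable families of minimizers.

*Local calculus.* In a coordinate patch, tensors are handled as multilinear forms evaluated on a
basis that is orthonormal at the point under consideration, so that contractions are plain sums.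
This gives the contracted Bianchi identity, the Bochner formula and the linearizations of the Ricci
tensor and of the Hessian along a path of metrics (`PatchPath.hasDerivAt_ricciC`, `hasDerivAt_hessC`).
All operators are natural under changes of coordinates, and `isometricChange` transfers the
identities to fields on the manifold.

*The Euler–Lagrange density* `τ (2 Δf - |∇f|² + R) + f - n` carries the argument.
* Its integral against `dν` is `W`, and it is constant, with value `μ(g)`, at a minimizer
  (`IsMinimizer.euler_eq`, `mu_eq_euler`).
* Its differential is the weighted divergence of `∇μ`, up to a factor
  (`PatchMetric.fderiv_eulerC`, `driftDiv2_gradMu`).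
* Differentiating `μ(g_s) = ` (density of `P(g_s)` at a point) gives a pointwise identity. Its
  integral against `dν` leaves `∫ ⟨∇μ, h⟩ dν`, since weighted divergences integrate to zero
  (`integral_div1`) and the normalization `∫ dν = 1` is differentiated under the integral sign. This
  is the first variation (`IsRegularNeighborhood.hasDerivAt_mu`).

*Rigidity.* At the soliton, `∇μ(g₀)` is `-τ ∇²(P(g₀) - f₀)`. It has weighted divergence zero, so that
integration by parts makes it vanish (`hess_sub_eq_zero_of_euler_const`). Hence `P(g₀) - f₀` is locally
constant, and `P(g₀)` may replace `f₀` in every operator (`IsRegularNeighborhood.diff_eq`).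

*The potential `Φ`.* As `∇μ(g₀) = 0`, the pointwise first variation along any path with velocity `h`
says that `P'(h) - ½ tr h` solves the equation for `Φ(h)`. Every `h` is the velocity of a path
(`exists_isPathThrough`), whence existence. Solvability for the conformal velocities `w g₀` forces the
kernel of the symmetric operator `Δ^{f₀} + 1 / (2τ)` to be trivial (`kernel_eq_zero`), whence
uniqueness. With `Φ(h)` identified, the linearization of `∇μ` is `L h`, and since `∇μ(g₀) = 0` no other
term survives when the first variation is differentiated again (`hasDerivAt_nuIntegral_gradMu`,
`hasDerivAt_deriv_mu`).
-/

open Set Filter Topology MeasureTheory Manifold Bundle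
open scoped ContDiff BigOperators

noncomputable section

namespace SolitonVariation

set_option maxSynthPendingDepth 3

/-! ### Multilinear maps from components -/

section Bundling

variable {n : ℕ} {F : Type*} [NormedAddCommGroup F] [NormedSpace ℝ F]

/-- The standard basis vector `eᵢ` of coordinate space. -/
abbrev bv (i : Fin n) : Coord n := EuclideanSpace.single i 1

/-- The linear map on coordinate space that sends `eᵢ` to `c i`. -/
def ofBasis (c : Fin n → F) : Coord n →L[ℝ] F :=
  ∑ i, (EuclideanSpace.proj i : Coord n →L[ℝ] ℝ).smulRight (c i)

theorem ofBasis_apply (c : Fin n → F) (v : Coord n) : ofBasis c v = ∑ i, v i • c i := by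
  simp [ofBasis]

@[simp] theorem ofBasis_bv (c : Fin n → F) (i : Fin n) : ofBasis c (bv i) = c i := by
  simp [ofBasis_apply]

theorem sum_bv (v : Coord n) : ∑ i, v i • bv i = v := by
  ext j
  simp [Pi.single_apply]

theorem clm_eq_ofBasis (A : Coord n →L[ℝ] F) : A = ofBasis fun i => A (bv i) := by
  ext v
  conv_lhs => rw [← sum_bv v]
  simp [ofBasis_apply]

theorem clm_ext {A B : Coord n →L[ℝ] F} (h : ∀ i, A (bv i) = B (bv i)) : A = B := by
  rw [clm_eq_ofBasis A, clm_eq_ofBasis B]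
  simp [h]

/-- `ofBasis` as a continuous linear map of the components. -/
def ofBasisL : (Fin n → F) →L[ℝ] (Coord n →L[ℝ] F) :=
  ∑ i, (ContinuousLinearMap.smulRightL ℝ (Coord n) F (EuclideanSpace.proj i)).comp
    (ContinuousLinearMap.proj i)

theorem ofBasisL_apply (c : Fin n → F) : ofBasisL c = ofBasis c := by
  simp [ofBasisL, ofBasis]

theorem contDiffOn_ofBasis {X : Type*} [NormedAddCommGroup X] [NormedSpace ℝ X] {k : ℕ∞ω} {V : Set X}
    {c : X → Fin n → F} (hc : ∀ i, ContDiffOn ℝ k (fun z => c z i) V) :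
    ContDiffOn ℝ k (fun z => ofBasis (c z)) V := by
  simp only [← ofBasisL_apply]
  exact ofBasisL.contDiff.comp_contDiffOn (contDiffOn_pi.2 hc)

theorem hasFDerivAt_ofBasis {X : Type*} [NormedAddCommGroup X] [NormedSpace ℝ X] {x : X}
    {c : X → Fin n → F} (hc : ∀ i, DifferentiableAt ℝ (fun z => c z i) x) (w : X) :
    fderiv ℝ (fun z => ofBasis (c z)) x w = ofBasis fun i => fderiv ℝ (fun z => c z i) x w := by
  simp only [← ofBasisL_apply]
  have h := (ofBasisL (n := n) (F := F)).hasFDerivAt.comp x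
    (hasFDerivAt_pi.2 fun i => (hc i).hasFDerivAt)
  have h2 := h.fderiv
  simp only [Function.comp_def] at h2
  rw [h2]
  simp only [ContinuousLinearMap.comp_apply]
  congr 1

theorem differentiableAt_ofBasis {X : Type*} [NormedAddCommGroup X] [NormedSpace ℝ X] {x : X}
    {c : X → Fin n → F} (hc : ∀ i, DifferentiableAt ℝ (fun z => c z i) x) :
    DifferentiableAt ℝ (fun z => ofBasis (c z)) x := by
  simp only [← ofBasisL_apply]
  exact (ofBasisL (n := n) (F := F)).differentiableAt.comp x (differentiableAt_pi.2 hc)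

/-- The linear form with components `c`. -/
def m1 (c : Fin n → ℝ) : Coord n →L[ℝ] ℝ := ofBasis c

/-- The bilinear form with components `c`. -/
def m2 (c : Fin n → Fin n → ℝ) : Coord n →L[ℝ] Coord n →L[ℝ] ℝ := ofBasis fun i => m1 (c i)

/-- The vector with components `c`. -/
def vec (c : Fin n → ℝ) : Coord n := WithLp.toLp 2 c

@[simp] theorem vec_apply (c : Fin n → ℝ) (i : Fin n) : vec c i = c i := rfl

@[simp] theorem m1_bv (c : Fin n → ℝ) (i) : m1 c (bv i) = c i := by simp [m1]
@[simp] theorem m2_bv (c : Fin n → Fin n → ℝ) (i j) : m2 c (bv i) (bv j) = c i j := by simp [m2]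
theorem m1_apply (c : Fin n → ℝ) (v : Coord n) : m1 c v = ∑ i, v i * c i := by
  simp [m1, ofBasis_apply]

theorem m2_apply (c : Fin n → Fin n → ℝ) (u v : Coord n) :
    m2 c u v = ∑ i, ∑ j, u i * (v j * c i j) := by
  simp [m2, ofBasis_apply, m1_apply, Finset.mul_sum]

theorem vec_eq_sum (c : Fin n → ℝ) : vec c = ∑ i, c i • bv i := (sum_bv (vec c)).symm

/-- Linear maps that agree on the standard basis agree. Identities between multilinear
expressions are reduced to components by applying this to one slot after the other. -/
theorem isLinearMap_eq {f g : Coord n → F} (hf : IsLinearMap ℝ f) (hg : IsLinearMap ℝ g)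
    (h : ∀ i, f (bv i) = g (bv i)) (v : Coord n) : f v = g v := by
  have : hf.mk' f = hg.mk' g := by
    apply (EuclideanSpace.basisFun (Fin n) ℝ).toBasis.ext
    intro i
    simpa using h i
  exact congrArg (fun A : Coord n →ₗ[ℝ] F => A v) this

theorem m1_clm (A : Coord n →L[ℝ] ℝ) : m1 (fun i => A (bv i)) = A := (clm_eq_ofBasis A).symm

theorem m2_clm (A : Coord n →L[ℝ] Coord n →L[ℝ] ℝ) :
    m2 (fun i j => A (bv i) (bv j)) = A := clm_ext fun i => clm_ext fun j => by simp

theorem m1_sub (c d : Fin n → ℝ) (v : Coord n) :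
    m1 (fun i => c i - d i) v = m1 c v - m1 d v := by
  simp [m1_apply, mul_sub, Finset.sum_sub_distrib]

theorem m1_smul (r : ℝ) (c : Fin n → ℝ) (v : Coord n) :
    m1 (fun i => r * c i) v = r * m1 c v := by
  simp [m1_apply, Finset.mul_sum, mul_left_comm]

theorem m2_add (c d : Fin n → Fin n → ℝ) (u v : Coord n) :
    m2 (fun i j => c i j + d i j) u v = m2 c u v + m2 d u v := by
  simp [m2_apply, mul_add, Finset.sum_add_distrib]

theorem m2_sub (c d : Fin n → Fin n → ℝ) (u v : Coord n) :
    m2 (fun i j => c i j - d i j) u v = m2 c u v - m2 d u v := by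
  simp [m2_apply, mul_sub, Finset.sum_sub_distrib]

theorem m2_smul (r : ℝ) (c : Fin n → Fin n → ℝ) (u v : Coord n) :
    m2 (fun i j => r * c i j) u v = r * m2 c u v := by
  simp [m2_apply, Finset.mul_sum, mul_left_comm]

theorem m2_swap (c : Fin n → Fin n → ℝ) (u v : Coord n) :
    m2 (fun i j => c j i) u v = m2 c v u := by
  rw [m2_apply, m2_apply, Finset.sum_comm]
  simp [mul_left_comm]

theorem m2_symm {c : Fin n → Fin n → ℝ} (h : ∀ i j, c i j = c j i) (u v : Coord n) :
    m2 c u v = m2 c v u := by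
  rw [← m2_swap]
  simp only [h]

end Bundling

/-! ### Partial derivatives -/

section Partial

variable {n : ℕ} {F : Type*} [NormedAddCommGroup F] [NormedSpace ℝ F]

theorem fderiv_eq_m1 (u : Coord n → ℝ) (y : Coord n) : fderiv ℝ u y = m1 fun i => pd i u y :=
  clm_eq_ofBasis _

theorem contDiffOn_pd {V : Set (Coord n)} (hV : IsOpen V) {k l : ℕ∞ω} (hk : k + 1 ≤ l)
    {u : Coord n → ℝ} (hu : ContDiffOn ℝ l u V) (i : Fin n) : ContDiffOn ℝ k (pd i u) V :=
  (hu.fderiv_of_isOpen hV hk).clm_apply contDiffOn_const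

theorem pd_congr {u v : Coord n → ℝ} {y : Coord n} (h : u =ᶠ[𝓝 y] v) (i : Fin n) :
    pd i u y = pd i v y := by
  simp only [pd, h.fderiv_eq]

theorem pd_congr_on {V : Set (Coord n)} (hV : IsOpen V) {u v : Coord n → ℝ}
    (h : ∀ z ∈ V, u z = v z) {y : Coord n} (hy : y ∈ V) (i : Fin n) : pd i u y = pd i v y :=
  pd_congr (Filter.eventuallyEq_of_mem (hV.mem_nhds hy) h) i

theorem fderiv_fderiv_comm {V : Set (Coord n)} (hV : IsOpen V) {f : Coord n → F}
    (hf : ContDiffOn ℝ 2 f V) {y : Coord n} (hy : y ∈ V) (u v : Coord n) :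
    fderiv ℝ (fderiv ℝ f) y u v = fderiv ℝ (fderiv ℝ f) y v u := by
  have h : ContDiffAt ℝ 2 f y := hf.contDiffAt (hV.mem_nhds hy)
  exact (h.isSymmSndFDerivAt (by simp)) u v

theorem fderiv_apply_const {X : Type*} [NormedAddCommGroup X] [NormedSpace ℝ X]
    {A : X → (Coord n →L[ℝ] F)} {y : X} (hA : DifferentiableAt ℝ A y) (u : X) (v : Coord n) :
    fderiv ℝ (fun z => A z v) y u = fderiv ℝ A y u v := by
  have := (hA.hasFDerivAt.clm_apply (hasFDerivAt_const v y)).fderiv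
  rw [this]
  simp

theorem pd_comm {V : Set (Coord n)} (hV : IsOpen V) {f : Coord n → ℝ}
    (hf : ContDiffOn ℝ 2 f V) {y : Coord n} (hy : y ∈ V) (i j : Fin n) :
    pd i (pd j f) y = pd j (pd i f) y := by
  have hd : DifferentiableAt ℝ (fderiv ℝ f) y :=
    ((hf.fderiv_of_isOpen hV (m := 1) (by norm_num)).contDiffAt (hV.mem_nhds hy)).differentiableAt
      (by norm_num)
  have := fderiv_fderiv_comm hV hf hy (bv i) (bv j)
  rw [← fderiv_apply_const hd, ← fderiv_apply_const hd] at this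
  exact this

theorem differentiableAt_of_contDiffOn {X : Type*} [NormedAddCommGroup X] [NormedSpace ℝ X]
    {V : Set X} (hV : IsOpen V) {k : ℕ∞ω} (hk : 1 ≤ k) {f : X → F} (hf : ContDiffOn ℝ k f V)
    {y : X} (hy : y ∈ V) : DifferentiableAt ℝ f y :=
  (hf.contDiffAt (hV.mem_nhds hy)).differentiableAt (by
    intro h; simp [h] at hk)

end Partial

/-! ### Orthonormal frames and traces -/

section Frames

variable {n : ℕ}

/-- `b` is an orthonormal frame for the matrix `A`. -/
def IsFrame (A : Fin n → Fin n → ℝ) (b : Fin n → Coord n) : Prop :=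
  ∀ a c, m2 A (b a) (b c) = if a = c then 1 else 0

theorem isFrame_iff (A : Fin n → Fin n → ℝ) (b : Fin n → Coord n) :
    IsFrame A b ↔ (Matrix.of fun i a => b a i).transpose * Matrix.of A *
      (Matrix.of fun i a => b a i) = 1 := by
  rw [← Matrix.ext_iff]
  refine forall_congr' fun a => forall_congr' fun c => ?_
  rw [Matrix.mul_apply, Matrix.one_apply, m2_apply]
  simp only [Matrix.mul_apply, Matrix.transpose_apply, Matrix.of_apply, Finset.sum_mul]
  rw [Finset.sum_comm]
  have : ∀ x y, b a y * (b c x * A y x) = b a y * A y x * b c x := fun x y => by ring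
  simp only [this]

open scoped MatrixOrder in
theorem exists_frame {A : Fin n → Fin n → ℝ} (hA : (Matrix.of A).PosDef) :
    ∃ b, IsFrame A b := by
  obtain ⟨S, hS, hAS⟩ := CStarAlgebra.isStrictlyPositive_iff_eq_star_mul_self.mp
    hA.isStrictlyPositive
  have hd : IsUnit S.det := (Matrix.isUnit_iff_isUnit_det S).1 hS
  refine ⟨fun a => vec fun i => S⁻¹ i a, (isFrame_iff _ _).2 ?_⟩
  have : (Matrix.of fun i a => (vec fun i => S⁻¹ i a) i) = S⁻¹ := by
    ext i a; simp
  rw [this, hAS, Matrix.star_eq_conjTranspose, Matrix.conjTranspose_eq_transpose_of_trivial]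
  have h1 : (S⁻¹).transpose * S.transpose = 1 := by
    rw [← Matrix.transpose_mul, Matrix.mul_nonsing_inv _ hd, Matrix.transpose_one]
  rw [← Matrix.mul_assoc, h1, Matrix.one_mul, Matrix.mul_nonsing_inv _ hd]

theorem IsFrame.inv {A : Fin n → Fin n → ℝ} {b : Fin n → Coord n} (hb : IsFrame A b) :
    (Matrix.of A)⁻¹ = (Matrix.of fun i a => b a i) * (Matrix.of fun i a => b a i).transpose := by
  have h := (isFrame_iff _ _).1 hb
  set b' : Matrix (Fin n) (Fin n) ℝ := Matrix.of fun i a => b a i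
  have h1 : b'.transpose * (Matrix.of A * b') = 1 := by rw [← Matrix.mul_assoc]; exact h
  have h2 : (Matrix.of A * b') * b'.transpose = 1 := mul_eq_one_comm.1 h1
  apply Matrix.inv_eq_right_inv
  rw [← Matrix.mul_assoc]; exact h2

theorem IsFrame.inv_apply {A : Fin n → Fin n → ℝ} {b : Fin n → Coord n} (hb : IsFrame A b)
    (i j : Fin n) : (Matrix.of A)⁻¹ i j = ∑ a, b a i * b a j := by
  rw [hb.inv, Matrix.mul_apply]
  simp

theorem IsFrame.invG {G : LocalMetric n} {y : Coord n} {b : Fin n → Coord n}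
    (hb : IsFrame (G y) b) (i j : Fin n) : invG G y i j = ∑ a, b a i * b a j :=
  hb.inv_apply i j

theorem sum_frame_mul (b : Fin n → Coord n) (T : Fin n → Fin n → ℝ) :
    ∑ i, ∑ j, (∑ a, b a i * b a j) * T i j = ∑ a, m2 T (b a) (b a) := by
  simp only [m2_apply, Finset.sum_mul]
  calc _ = ∑ i, ∑ a, ∑ j, b a i * b a j * T i j :=
        Finset.sum_congr rfl fun i _ => Finset.sum_comm
    _ = _ := by
        rw [Finset.sum_comm]
        simp only [mul_assoc]

theorem IsFrame.sum_invG {G : LocalMetric n} {y : Coord n} {b : Fin n → Coord n}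
    (hb : IsFrame (G y) b) (T : Fin n → Fin n → ℝ) :
    ∑ i, ∑ j, SolitonVariation.invG G y i j * T i j = ∑ a, m2 T (b a) (b a) := by
  simp only [hb.invG]
  exact sum_frame_mul b T

theorem IsFrame.traceC {G : LocalMetric n} {y : Coord n} {b : Fin n → Coord n}
    (hb : IsFrame (G y) b) (T : Fin n → Fin n → ℝ) :
    traceC G y T = ∑ a, m2 T (b a) (b a) := hb.sum_invG T

theorem IsFrame.det_mul {A : Fin n → Fin n → ℝ} {b : Fin n → Coord n} (hb : IsFrame A b) :
    (Matrix.of fun i a => b a i).det * (Matrix.of A).det * (Matrix.of fun i a => b a i).det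
      = 1 := by
  have h := congrArg Matrix.det ((isFrame_iff _ _).1 hb)
  simpa using h

theorem IsFrame.det_ne_zero {A : Fin n → Fin n → ℝ} {b : Fin n → Coord n} (hb : IsFrame A b) :
    (Matrix.of A).det ≠ 0 := fun h => by simpa [h] using hb.det_mul

/-- Expansion of a vector in an orthonormal frame. -/
theorem IsFrame.expand {A : Fin n → Fin n → ℝ} {b : Fin n → Coord n} (hb : IsFrame A b)
    (v : Coord n) : ∑ a, m2 A (b a) v • b a = v := by
  have h := (isFrame_iff _ _).1 hb
  have h1 := mul_eq_one_comm.1 h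
  ext i
  have h2 := fun j => congrFun (congrFun h1 i) j
  simp only [Matrix.mul_apply, Matrix.of_apply, Matrix.transpose_apply, Matrix.one_apply] at h2
  have h3 : v i = ∑ j, v j * (if i = j then 1 else 0) := by simp
  rw [h3]
  simp only [← h2, m2_apply, WithLp.ofLp_sum, Finset.sum_apply, WithLp.ofLp_smul, Pi.smul_apply,
    smul_eq_mul, Finset.sum_mul, Finset.mul_sum]
  calc _ = ∑ a, ∑ j, ∑ k, b a k * (v j * A k j) * b a i :=
        Finset.sum_congr rfl fun a _ => Finset.sum_comm
    _ = ∑ j, ∑ a, ∑ k, b a k * (v j * A k j) * b a i := Finset.sum_comm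
    _ = _ := Finset.sum_congr rfl fun j _ => Finset.sum_congr rfl fun a _ =>
        Finset.sum_congr rfl fun k _ => by ring

theorem frame_conj (T : Fin n → Fin n → ℝ) (b : Fin n → Coord n) (a c : Fin n) :
    ((Matrix.of fun i a => b a i).transpose * Matrix.of T * Matrix.of fun i a => b a i) a c
      = m2 T (b a) (b c) := by
  simp only [Matrix.mul_apply, Matrix.transpose_apply, m2_apply, Finset.sum_mul, Matrix.of_apply]
  rw [Finset.sum_comm]
  exact Finset.sum_congr rfl fun i _ => Finset.sum_congr rfl fun j _ => by ring

theorem IsFrame.nondeg {A : Fin n → Fin n → ℝ} {b : Fin n → Coord n} (hb : IsFrame A b)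
    {u v : Coord n} (h : ∀ w, m2 A w u = m2 A w v) : u = v := by
  rw [← hb.expand u, ← hb.expand v]
  simp [h]

/-! ### Derivatives of inverse, trace and determinant -/

theorem contDiff_det {k : ℕ∞ω} :
    ContDiff ℝ k (fun A : Fin n → Fin n → ℝ => (Matrix.of A).det) := by
  simp only [Matrix.det_apply]
  refine ContDiff.sum fun σ _ => ContDiff.const_smul _ (contDiff_prod fun i _ => ?_)
  exact contDiff_apply_apply ℝ ℝ (σ i) i

theorem contDiff_adjugate {k : ℕ∞ω} (i j : Fin n) :
    ContDiff ℝ k (fun A : Fin n → Fin n → ℝ => (Matrix.of A).adjugate i j) := by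
  simp only [Matrix.adjugate_apply]
  refine contDiff_det.comp (f := fun (A : Fin n → Fin n → ℝ) (p q : Fin n) =>
    (Matrix.of A).updateRow j (Pi.single i 1) p q) ?_
  refine contDiff_pi.2 fun p => contDiff_pi.2 fun q => ?_
  by_cases hp : p = j
  · subst hp
    simpa using contDiff_const
  · simpa [Matrix.updateRow_ne hp] using contDiff_apply_apply ℝ ℝ p q

theorem contDiffOn_inv {X : Type*} [NormedAddCommGroup X] [NormedSpace ℝ X] {k : ℕ∞ω} {V : Set X}
    {A : X → Fin n → Fin n → ℝ} (hA : ∀ i j, ContDiffOn ℝ k (fun z => A z i j) V)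
    (hd : ∀ z ∈ V, (Matrix.of (A z)).det ≠ 0) (i j : Fin n) :
    ContDiffOn ℝ k (fun z => (Matrix.of (A z))⁻¹ i j) V := by
  have hA' : ContDiffOn ℝ k A V := contDiffOn_pi.2 fun i => contDiffOn_pi.2 fun j => hA i j
  simp only [Matrix.inv_def, Matrix.smul_apply, Ring.inverse_eq_inv', smul_eq_mul]
  exact ((contDiff_det.comp_contDiffOn hA').inv hd).mul ((contDiff_adjugate i j).comp_contDiffOn hA')

theorem sum_comm4 {κ : Type*} [Fintype κ] (F : κ → κ → κ → κ → ℝ) :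
    ∑ a, ∑ c, ∑ i, ∑ j, F a c i j = ∑ i, ∑ j, ∑ a, ∑ c, F a c i j :=
  calc _ = ∑ a, ∑ i, ∑ c, ∑ j, F a c i j := Finset.sum_congr rfl fun a _ => Finset.sum_comm
    _ = ∑ i, ∑ a, ∑ c, ∑ j, F a c i j := Finset.sum_comm
    _ = ∑ i, ∑ a, ∑ j, ∑ c, F a c i j :=
        Finset.sum_congr rfl fun i _ => Finset.sum_congr rfl fun a _ => Finset.sum_comm
    _ = _ := Finset.sum_congr rfl fun i _ => Finset.sum_comm

theorem differentiableAt_inv {A : ℝ → Fin n → Fin n → ℝ} {t : ℝ}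
    (hA : ∀ i j, DifferentiableAt ℝ (fun z => A z i j) t)
    (hd : (Matrix.of (A t)).det ≠ 0) (i j : Fin n) :
    DifferentiableAt ℝ (fun z => (Matrix.of (A z))⁻¹ i j) t := by
  have hA' : DifferentiableAt ℝ A t := differentiableAt_pi.2 fun i =>
    differentiableAt_pi.2 fun j => hA i j
  simp only [Matrix.inv_def, Matrix.smul_apply, Ring.inverse_eq_inv', smul_eq_mul]
  have h1 : DifferentiableAt ℝ (fun z => (Matrix.of (A z)).det) t :=
    ((contDiff_det (k := 1)).differentiable (by norm_num)).differentiableAt.comp t hA'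
  have h2 : DifferentiableAt ℝ (fun z => (Matrix.of (A z)).adjugate i j) t :=
    ((contDiff_adjugate (k := 1) i j).differentiable (by norm_num)).differentiableAt.comp t hA'
  exact (h1.inv hd).mul h2

theorem hasDerivAt_inv {A : ℝ → Fin n → Fin n → ℝ} {A' : Fin n → Fin n → ℝ} {t : ℝ}
    (hA : ∀ i j, HasDerivAt (fun z => A z i j) (A' i j) t) {b : Fin n → Coord n}
    (hb : IsFrame (A t) b) (i j : Fin n) :
    HasDerivAt (fun z => (Matrix.of (A z))⁻¹ i j)
      (-∑ a, ∑ c, m2 A' (b a) (b c) * (b a i * b c j)) t := by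
  have hd := hb.det_ne_zero
  have hdiff := fun i j => (differentiableAt_inv (fun i j => (hA i j).differentiableAt) hd i j)
  set X' : Matrix (Fin n) (Fin n) ℝ := Matrix.of fun i j =>
    deriv (fun z => (Matrix.of (A z))⁻¹ i j) t with hX'
  have hcont : ContinuousAt (fun z => (Matrix.of (A z)).det) t :=
    (contDiff_det (k := 1)).continuous.continuousAt.comp
      (continuousAt_pi.2 fun i => continuousAt_pi.2 fun j => (hA i j).continuousAt)
  have hne : ∀ᶠ z in 𝓝 t, (Matrix.of (A z)).det ≠ 0 := hcont.eventually_ne hd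
  have key : Matrix.of A' * (Matrix.of (A t))⁻¹ + Matrix.of (A t) * X' = 0 := by
    ext p q
    have h1 : HasDerivAt (fun z => ∑ k, A z p k * (Matrix.of (A z))⁻¹ k q)
        (∑ k, (A' p k * (Matrix.of (A t))⁻¹ k q + A t p k * X' k q)) t :=
      HasDerivAt.fun_sum fun k _ => (hA p k).mul (hdiff k q).hasDerivAt
    have h2 : (fun z => ∑ k, A z p k * (Matrix.of (A z))⁻¹ k q) =ᶠ[𝓝 t]
        fun _ => (1 : Matrix (Fin n) (Fin n) ℝ) p q := by
      filter_upwards [hne] with z hz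
      rw [← Matrix.mul_nonsing_inv (Matrix.of (A z)) (isUnit_iff_ne_zero.2 hz), Matrix.mul_apply]
      rfl
    have h3 := (h1.congr_of_eventuallyEq h2.symm).unique (hasDerivAt_const _ _)
    rw [Finset.sum_add_distrib] at h3
    simpa [Matrix.mul_apply] using h3
  have hX : X' = -((Matrix.of (A t))⁻¹ * Matrix.of A' * (Matrix.of (A t))⁻¹) := by
    have := congrArg (fun M => (Matrix.of (A t))⁻¹ * M) key
    simp only [Matrix.mul_add, Matrix.mul_zero] at this
    rw [← Matrix.mul_assoc _ _ X', Matrix.nonsing_inv_mul _ (isUnit_iff_ne_zero.2 hd),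
      Matrix.one_mul, add_comm] at this
    rw [eq_neg_of_add_eq_zero_left this, Matrix.mul_assoc]
  have h4 : X' i j = -∑ a, ∑ c, m2 A' (b a) (b c) * (b a i * b c j) := by
    rw [hX, hb.inv]
    set b' : Matrix (Fin n) (Fin n) ℝ := Matrix.of fun i a => b a i with hb'
    have e : b' * b'.transpose * Matrix.of A' * (b' * b'.transpose)
        = b' * (b'.transpose * Matrix.of A' * b') * b'.transpose := by
      simp only [Matrix.mul_assoc]
    rw [e]
    have e2 : ∀ a c, (b'.transpose * Matrix.of A' * b') a c = m2 A' (b a) (b c) := frame_conj A' b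
    rw [Matrix.neg_apply, Matrix.mul_apply]
    simp only [Matrix.mul_apply (M := b'), e2, Finset.sum_mul]
    rw [Finset.sum_comm]
    congr 1
    refine Finset.sum_congr rfl fun a _ => Finset.sum_congr rfl fun c _ => ?_
    simp only [hb', Matrix.of_apply, Matrix.transpose_apply]
    ring
  rw [← h4]
  exact (hdiff i j).hasDerivAt

/-- The derivative of a trace with respect to a varying metric. -/
theorem hasDerivAt_trace {A T : ℝ → Fin n → Fin n → ℝ} {A' T' : Fin n → Fin n → ℝ} {t : ℝ}
    (hA : ∀ i j, HasDerivAt (fun z => A z i j) (A' i j) t)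
    (hT : ∀ i j, HasDerivAt (fun z => T z i j) (T' i j) t) {b : Fin n → Coord n}
    (hb : IsFrame (A t) b) :
    HasDerivAt (fun z => ∑ i, ∑ j, (Matrix.of (A z))⁻¹ i j * T z i j)
      (∑ a, m2 T' (b a) (b a) - ∑ a, ∑ c, m2 A' (b a) (b c) * m2 (T t) (b a) (b c)) t := by
  have h : HasDerivAt (fun z => ∑ i, ∑ j, (Matrix.of (A z))⁻¹ i j * T z i j)
      (∑ i, ∑ j, ((-∑ a, ∑ c, m2 A' (b a) (b c) * (b a i * b c j)) * T t i j +
        (Matrix.of (A t))⁻¹ i j * T' i j)) t :=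
    HasDerivAt.fun_sum fun i _ => HasDerivAt.fun_sum fun j _ =>
      (hasDerivAt_inv hA hb i j).mul (hT i j)
  convert h using 1
  simp only [hb.inv_apply, Finset.sum_add_distrib]
  rw [sum_frame_mul, add_comm, sub_eq_add_neg, ← sub_eq_add_neg, sub_eq_add_neg]
  congr 1
  simp only [neg_mul, Finset.sum_neg_distrib, Finset.sum_mul]
  congr 1
  calc _ = ∑ a, ∑ c, ∑ i, ∑ j, m2 A' (b a) (b c) * (b a i * b c j) * T t i j := by
        refine Finset.sum_congr rfl fun a _ => Finset.sum_congr rfl fun c _ => ?_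
        rw [m2_apply (T t), Finset.mul_sum]
        simp only [Finset.mul_sum, mul_assoc]
    _ = _ := sum_comm4 _

/-- Jacobi's formula. -/
theorem hasDerivAt_det {A : ℝ → Fin n → Fin n → ℝ} {A' : Fin n → Fin n → ℝ} {t : ℝ}
    (hA : ∀ i j, HasDerivAt (fun z => A z i j) (A' i j) t) {b : Fin n → Coord n}
    (hb : IsFrame (A t) b) :
    HasDerivAt (fun z => (Matrix.of (A z)).det)
      ((Matrix.of (A t)).det * ∑ a, m2 A' (b a) (b a)) t := by
  have hA' : HasDerivAt A A' t := hasDerivAt_pi.2 fun i => hasDerivAt_pi.2 fun j => hA i j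
  have hdet : DifferentiableAt ℝ (fun A : Fin n → Fin n → ℝ => (Matrix.of A).det) (A t) :=
    ((contDiff_det (k := 1)).differentiable (by norm_num)).differentiableAt
  have h1 := hdet.hasFDerivAt.comp_hasDerivAt t hA'
  have h2 := hdet.hasFDerivAt.comp_hasDerivAt_of_eq (0 : ℝ) (f := fun s : ℝ => A t + s • A')
    (f' := A') (by simpa using ((hasDerivAt_id (0 : ℝ)).smul_const A').const_add (A t)) (by simp)
  refine h1.congr_deriv ?_
  set b' : Matrix (Fin n) (Fin n) ℝ := Matrix.of fun i a => b a i with hb'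
  have hfr := (isFrame_iff _ _).1 hb
  have h3 : ∀ s : ℝ, (Matrix.of (A t + s • A')).det
      = (Matrix.of (A t)).det * (1 + s • (b'.transpose * Matrix.of A' * b')).det := by
    intro s
    have e1 : b'.transpose * Matrix.of (A t + s • A') * b' =
        1 + s • (b'.transpose * Matrix.of A' * b') := by
      have : Matrix.of (A t + s • A') = Matrix.of (A t) + s • Matrix.of A' := rfl
      rw [this, Matrix.mul_add, Matrix.add_mul, hfr, Matrix.mul_smul, Matrix.smul_mul]
    rw [← e1, Matrix.det_mul, Matrix.det_mul, Matrix.det_transpose]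
    have := hb.det_mul
    linear_combination (-(Matrix.of (A t + s • A')).det) * this
  have h4 : HasDerivAt (fun s : ℝ => (1 + s • (b'.transpose * Matrix.of A' * b')).det)
      (b'.transpose * Matrix.of A' * b').trace 0 := by
    rw [funext fun s => Matrix.det_one_add_smul s (b'.transpose * Matrix.of A' * b')]
    have hp := fun p : Polynomial ℝ => (((hasDerivAt_id (0:ℝ)).const_mul
      (b'.transpose * Matrix.of A' * b').trace).const_add 1).add ((p.hasDerivAt (0 : ℝ)).mul
        ((hasDerivAt_id (0:ℝ)).pow 2))
    refine ((hp (Polynomial.divX (Polynomial.divX (1 + (Polynomial.X : Polynomial ℝ) •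
      (b'.transpose * Matrix.of A' * b').map Polynomial.C).det))).congr_deriv
        (by simp)).congr_of_eventuallyEq (Filter.Eventually.of_forall fun s => ?_)
    simp
  have h6 := h4.const_mul (Matrix.of (A t)).det
  have h7 : (fun s : ℝ => (Matrix.of (A t + s • A')).det) =
    fun s => (Matrix.of (A t)).det * (1 + s • (b'.transpose * Matrix.of A' * b')).det := funext h3
  have h8 : HasDerivAt (fun s : ℝ => (Matrix.of (A t + s • A')).det) _ 0 := h2
  rw [h7] at h8
  refine (h8.unique h6).trans ?_
  congr 1
  rw [Matrix.trace]
  refine Finset.sum_congr rfl fun a _ => ?_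
  rw [Matrix.diag_apply, hb', frame_conj]

end Frames

/-! ### The Levi-Civita connection of a metric on a coordinate patch -/

section Connection

variable {n : ℕ}

/-- The trilinear form with components `c`. -/
def m3 (c : Fin n → Fin n → Fin n → ℝ) : Coord n →L[ℝ] Coord n →L[ℝ] Coord n →L[ℝ] ℝ :=
  ofBasis fun i => m2 (c i)

@[simp] theorem m3_bv (c : Fin n → Fin n → Fin n → ℝ) (i j k) :
    m3 c (bv i) (bv j) (bv k) = c i j k := by simp [m3]

/-- The quadrilinear form with components `c`. -/
def m4 (c : Fin n → Fin n → Fin n → Fin n → ℝ) :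
    Coord n →L[ℝ] Coord n →L[ℝ] Coord n →L[ℝ] Coord n →L[ℝ] ℝ :=
  ofBasis fun i => m3 (c i)

@[simp] theorem m4_bv (c : Fin n → Fin n → Fin n → Fin n → ℝ) (i j k l) :
    m4 c (bv i) (bv j) (bv k) (bv l) = c i j k l := by simp [m4]

/-- The directional derivatives `(D_w α)(v)` of a one-form with components `α`. -/
def d1 (α : Coord n → Fin n → ℝ) (y : Coord n) : Coord n →L[ℝ] Coord n →L[ℝ] ℝ :=
  m2 fun k i => pd k (fun z => α z i) y

/-- The directional derivatives `(D_w h)(u, v)` of a `(0,2)` tensor. -/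
def d2 (h : Coord n → Fin n → Fin n → ℝ) (y : Coord n) :
    Coord n →L[ℝ] Coord n →L[ℝ] Coord n →L[ℝ] ℝ :=
  m3 fun k i j => pd k (fun z => h z i j) y

/-- The directional derivatives `(D_w T)(p, u, v)` of a `(0,3)` tensor. -/
def d3 (T : Coord n → Fin n → Fin n → Fin n → ℝ) (y : Coord n) :
    Coord n →L[ℝ] Coord n →L[ℝ] Coord n →L[ℝ] Coord n →L[ℝ] ℝ :=
  m4 fun k p i j => pd k (fun z => T z p i j) y

/-- The vector valued bilinear map with components `c k i j`, where `k` is the index of the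
value. -/
def gam (c : Fin n → Fin n → Fin n → ℝ) : Coord n →L[ℝ] Coord n →L[ℝ] Coord n :=
  ofBasis fun i => ofBasis fun j => vec fun k => c k i j

@[simp] theorem gam_bv (c : Fin n → Fin n → Fin n → ℝ) (i j : Fin n) :
    gam c (bv i) (bv j) = vec fun k => c k i j := by simp [gam]

/-- The Christoffel symbols as a vector valued bilinear map `Γ(u, v)`. -/
def chr (G : LocalMetric n) (y : Coord n) : Coord n →L[ℝ] Coord n →L[ℝ] Coord n :=
  gam (christoffel G y)

/-- The directional derivatives `(D_u Γ)(v, w)`. -/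
def dchr (G : LocalMetric n) (y : Coord n) :
    Coord n →L[ℝ] Coord n →L[ℝ] Coord n →L[ℝ] Coord n :=
  ofBasis fun m => gam fun k i j => pd m (fun z => christoffel G z k i j) y

/-- The second directional derivatives `(D_t D_u Γ)(v, w)`. -/
def ddchr (G : LocalMetric n) (y : Coord n) :
    Coord n →L[ℝ] Coord n →L[ℝ] Coord n →L[ℝ] Coord n →L[ℝ] Coord n :=
  ofBasis fun p => ofBasis fun m => gam fun k i j =>
    pd p (fun x => pd m (fun z => christoffel G z k i j) x) y

/-- The curvature as a vector valued trilinear map `R(u, v) w`. -/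
def crv (G : LocalMetric n) (y : Coord n) :
    Coord n →L[ℝ] Coord n →L[ℝ] Coord n →L[ℝ] Coord n :=
  ofBasis fun i => ofBasis fun j => ofBasis fun k => vec fun l => riem G y i j k l

@[simp] theorem crv_bv (G : LocalMetric n) (y : Coord n) (i j k : Fin n) :
    crv G y (bv i) (bv j) (bv k) = vec fun l => riem G y i j k l := by simp [crv]

/-! #### Leibniz rules -/

theorem fderiv_m1 {α : Coord n → Fin n → ℝ} {p : Coord n → Coord n} {y : Coord n}
    (hα : ∀ i, DifferentiableAt ℝ (fun z => α z i) y) (hp : DifferentiableAt ℝ p y) (w : Coord n) :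
    fderiv ℝ (fun z => m1 (α z) (p z)) y w
      = d1 α y w (p y) + m1 (α y) (fderiv ℝ p y w) := by
  have h := ((differentiableAt_ofBasis hα).hasFDerivAt.clm_apply hp.hasFDerivAt).fderiv
  unfold m1
  rw [h]
  simp only [ContinuousLinearMap.add_apply, ContinuousLinearMap.comp_apply,
    ContinuousLinearMap.flip_apply]
  rw [hasFDerivAt_ofBasis hα, add_comm]
  congr 1
  refine isLinearMap_eq (f := fun w => (ofBasis fun i => fderiv ℝ (fun z => α z i) y w) (p y))
    (g := fun w => d1 α y w (p y)) ⟨?_, ?_⟩ ⟨by simp, by simp⟩ (fun i => ?_) w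
  · intro u v; simp [ofBasis_apply, mul_add, Finset.sum_add_distrib]
  · intro u v; simp [ofBasis_apply, Finset.mul_sum, mul_left_comm]
  · simp [d1, m2, pd, m1]

theorem fderiv_ofBasis_m1 {h : Coord n → Fin n → Fin n → ℝ} {p : Coord n → Coord n} {y : Coord n}
    (hh : ∀ i j, DifferentiableAt ℝ (fun z => h z i j) y) (hp : DifferentiableAt ℝ p y)
    (u w : Coord n) :
    fderiv ℝ (fun z => m2 (h z) u (p z)) y w
      = d2 h y w u (p y) + m2 (h y) u (fderiv ℝ p y w) := by
  have e : ∀ z v, m2 (h z) u v = m1 (fun j => ∑ i, u i * h z i j) v := by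
    intro z v
    rw [m2_apply, m1_apply, Finset.sum_comm]
    simp only [Finset.mul_sum, mul_left_comm]
  simp only [e]
  rw [fderiv_m1 (fun j => by fun_prop) hp]
  congr 1
  revert w
  refine isLinearMap_eq ⟨by simp, by simp⟩ ⟨by simp, by simp⟩ (fun k => ?_)
  generalize p y = q
  revert q
  refine isLinearMap_eq ⟨by simp, by simp⟩ ⟨by simp, by simp⟩ (fun j => ?_)
  simp only [d1, m2_bv, pd]
  rw [fderiv_fun_sum (fun i _ => (hh i j).const_mul _)]
  simp only [ContinuousLinearMap.sum_apply]
  conv_rhs => rw [← sum_bv u]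
  simp only [map_sum, map_smul, ContinuousLinearMap.sum_apply, ContinuousLinearMap.smul_apply, d2,
    m3_bv, pd, smul_eq_mul]
  refine Finset.sum_congr rfl fun i _ => ?_
  rw [fderiv_const_mul (hh i j)]
  simp

theorem fderiv_m2 {h : Coord n → Fin n → Fin n → ℝ} {p q : Coord n → Coord n} {y : Coord n}
    (hh : ∀ i j, DifferentiableAt ℝ (fun z => h z i j) y) (hp : DifferentiableAt ℝ p y)
    (hq : DifferentiableAt ℝ q y) (w : Coord n) :
    fderiv ℝ (fun z => m2 (h z) (p z) (q z)) y w
      = d2 h y w (p y) (q y) + m2 (h y) (fderiv ℝ p y w) (q y)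
        + m2 (h y) (p y) (fderiv ℝ q y w) := by
  have hA : DifferentiableAt ℝ (fun z => m2 (h z)) y :=
    differentiableAt_ofBasis fun i => differentiableAt_ofBasis fun j => hh i j
  have h1 := ((hA.hasFDerivAt.clm_apply hp.hasFDerivAt).clm_apply hq.hasFDerivAt).fderiv
  have h2 : fderiv ℝ (fun z => m2 (h z)) y w (p y) (q y) = d2 h y w (p y) (q y) := by
    have h3 := fderiv_ofBasis_m1 hh (differentiableAt_const (q y)) (p y) w
    simp only [fderiv_fun_const, Pi.zero_apply, ContinuousLinearMap.zero_apply, map_zero,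
      add_zero] at h3
    rw [← h3]
    have h4 := ((hA.hasFDerivAt.clm_apply (hasFDerivAt_const (p y) y)).clm_apply
      (hasFDerivAt_const (q y) y)).fderiv
    rw [h4]
    simp
  rw [h1]
  simp only [ContinuousLinearMap.add_apply, ContinuousLinearMap.comp_apply,
    ContinuousLinearMap.flip_apply]
  rw [h2]
  ring

theorem fderiv_gam {c : Coord n → Fin n → Fin n → Fin n → ℝ} {q : Coord n → Coord n}
    {y : Coord n} (hc : ∀ k i j, DifferentiableAt ℝ (fun z => c z k i j) y)
    (hq : DifferentiableAt ℝ q y) (v w : Coord n) :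
    fderiv ℝ (fun z => gam (c z) v (q z)) y w
      = (ofBasis fun m => gam fun k i j => pd m (fun z => c z k i j) y : Coord n →L[ℝ] _) w v (q y)
        + gam (c y) v (fderiv ℝ q y w) := by
  have key : ∀ z u v, gam (c z) u v = vec fun k => m2 (c z k) u v := by
    intro z u v
    refine isLinearMap_eq (f := fun u => gam (c z) u v) (g := fun u => vec fun k => m2 (c z k) u v)
      ⟨by simp, by simp⟩ ⟨?_, ?_⟩ (fun i => ?_) u
    · intro a b; ext k; simp
    · intro a b; ext k; simp
    refine isLinearMap_eq (f := fun v => gam (c z) (bv i) v)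
      (g := fun v => vec fun k => m2 (c z k) (bv i) v)
      ⟨by simp, by simp⟩ ⟨?_, ?_⟩ (fun j => ?_) v
    · intro a b; ext k; simp
    · intro a b; ext k; simp
    · simp
  have hd : ∀ k, DifferentiableAt ℝ (fun z => m2 (c z k) v (q z)) y := fun k =>
    ((differentiableAt_ofBasis fun i => differentiableAt_ofBasis fun j => hc k i j).clm_apply
      (differentiableAt_const v)).clm_apply hq
  have h0 : DifferentiableAt ℝ (fun z => vec fun k => m2 (c z k) v (q z)) y :=
    (differentiableAt_euclidean).2 hd
  simp only [key]
  ext k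
  have hk : (fderiv ℝ (fun z => vec fun k => m2 (c z k) v (q z)) y w) k
      = fderiv ℝ (fun z => m2 (c z k) v (q z)) y w := by
    have := ((EuclideanSpace.proj k : Coord n →L[ℝ] ℝ).hasFDerivAt.comp y h0.hasFDerivAt).fderiv
    have h5 := congrArg (fun A : Coord n →L[ℝ] ℝ => A w) this
    simpa [Function.comp_def] using h5.symm
  rw [hk, fderiv_ofBasis_m1 (hc k) hq]
  simp only [PiLp.add_apply, vec_apply]
  congr 1
  have e2 : ∀ u v w : Coord n,
      (ofBasis fun m => gam fun k i j => pd m (fun z => c z k i j) y : Coord n →L[ℝ] _) u v w k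
      = d2 (fun z => c z k) y u v w := by
    intro u v w
    revert u
    refine isLinearMap_eq ⟨by simp, by simp⟩ ⟨by simp, by simp⟩ (fun a => ?_)
    revert v
    refine isLinearMap_eq ⟨by simp, by simp⟩ ⟨by simp, by simp⟩ (fun b => ?_)
    revert w
    refine isLinearMap_eq ⟨by simp, by simp⟩ ⟨by simp, by simp⟩ (fun e => ?_)
    simp [d2]
  rw [e2]

theorem d2_comm {V : Set (Coord n)} (hV : IsOpen V) {α : Coord n → Fin n → ℝ}
    (hα : ∀ i, ContDiffOn ℝ 2 (fun z => α z i) V) {y : Coord n} (hy : y ∈ V) (u v w : Coord n) :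
    d2 (fun z k i => pd k (fun x => α x i) z) y u v w
      = d2 (fun z k i => pd k (fun x => α x i) z) y v u w := by
  revert u
  refine isLinearMap_eq ⟨by simp, by simp⟩ ⟨by simp, by simp⟩ (fun a => ?_)
  revert v
  refine isLinearMap_eq ⟨by simp, by simp⟩ ⟨by simp, by simp⟩ (fun b => ?_)
  revert w
  refine isLinearMap_eq ⟨by simp, by simp⟩ ⟨by simp, by simp⟩ (fun c => ?_)
  simp only [d2, m3_bv]
  exact pd_comm hV (hα c) hy a b

theorem d3_comm {V : Set (Coord n)} (hV : IsOpen V) {h : Coord n → Fin n → Fin n → ℝ}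
    (hh : ∀ i j, ContDiffOn ℝ 2 (fun z => h z i j) V) {y : Coord n} (hy : y ∈ V)
    (u v w t : Coord n) :
    d3 (fun z k i j => pd k (fun x => h x i j) z) y u v w t
      = d3 (fun z k i j => pd k (fun x => h x i j) z) y v u w t := by
  revert u
  refine isLinearMap_eq ⟨by simp, by simp⟩ ⟨by simp, by simp⟩ (fun a => ?_)
  revert v
  refine isLinearMap_eq ⟨by simp, by simp⟩ ⟨by simp, by simp⟩ (fun b => ?_)
  revert w
  refine isLinearMap_eq ⟨by simp, by simp⟩ ⟨by simp, by simp⟩ (fun c => ?_)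
  revert t
  refine isLinearMap_eq ⟨by simp, by simp⟩ ⟨by simp, by simp⟩ (fun d => ?_)
  simp only [d3, m4_bv]
  exact pd_comm hV (hh c d) hy a b

theorem ddchr_comm {V : Set (Coord n)} (hV : IsOpen V) {G : LocalMetric n}
    (hG : ∀ k i j, ContDiffOn ℝ 2 (fun z => christoffel G z k i j) V) {y : Coord n} (hy : y ∈ V)
    (u v w t : Coord n) : ddchr G y u v w t = ddchr G y v u w t := by
  revert u
  refine isLinearMap_eq ⟨by simp, by simp⟩ ⟨by simp, by simp⟩ (fun a => ?_)
  revert v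
  refine isLinearMap_eq ⟨by simp, by simp⟩ ⟨by simp, by simp⟩ (fun b => ?_)
  simp only [ddchr, ofBasis_bv]
  congr 2
  congr 1
  ext k i j
  exact pd_comm hV (hG k i j) hy a b

/-! #### Covariant derivatives in terms of multilinear maps -/

theorem m2_nabla1 (G : LocalMetric n) (α : Coord n → Fin n → ℝ) (y u v : Coord n) :
    m2 (nabla1 G α y) u v = d1 α y u v - m1 (α y) (chr G y u v) := by
  revert u
  refine isLinearMap_eq ⟨by simp, by simp⟩ ⟨?_, ?_⟩ (fun i => ?_)
  · intro a b; simp; ring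
  · intro a b; simp; ring
  revert v
  refine isLinearMap_eq ⟨by simp, by simp⟩ ⟨?_, ?_⟩ (fun j => ?_)
  · intro a b; simp; ring
  · intro a b; simp; ring
  simp [nabla1, d1, chr, m1_apply]

theorem m3_nabla2 (G : LocalMetric n) (h : Coord n → Fin n → Fin n → ℝ) (y w u v : Coord n) :
    m3 (nabla2 G h y) w u v
      = d2 h y w u v - m2 (h y) (chr G y w u) v - m2 (h y) u (chr G y w v) := by
  revert w
  refine isLinearMap_eq ⟨by simp, by simp⟩ ⟨?_, ?_⟩ (fun i => ?_)
  · intro a b; simp; ring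
  · intro a b; simp; ring
  revert u
  refine isLinearMap_eq ⟨by simp, by simp⟩ ⟨?_, ?_⟩ (fun j => ?_)
  · intro a b; simp; ring
  · intro a b; simp; ring
  revert v
  refine isLinearMap_eq ⟨by simp, by simp⟩ ⟨?_, ?_⟩ (fun k => ?_)
  · intro a b; simp; ring
  · intro a b; simp; ring
  have e1 : ∀ p : Coord n, m2 (h y) p (bv k) = ∑ l, p l * h y l k := by
    intro p; simp [m2_apply]
  have e2 : ∀ p : Coord n, m2 (h y) (bv j) p = ∑ l, p l * h y j l := by
    intro p; simp [m2_apply]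
  rw [e1, e2]
  simp [nabla2, d2, chr]

theorem m4_nabla3 (G : LocalMetric n) (T : Coord n → Fin n → Fin n → Fin n → ℝ)
    (y t p u v : Coord n) :
    m4 (nabla3 G T y) t p u v = d3 T y t p u v - m3 (T y) (chr G y t p) u v
      - m3 (T y) p (chr G y t u) v - m3 (T y) p u (chr G y t v) := by
  revert t
  refine isLinearMap_eq ⟨by simp, by simp⟩ ⟨?_, ?_⟩ (fun i => ?_)
  · intro a b; simp; ring
  · intro a b; simp; ring
  revert p
  refine isLinearMap_eq ⟨by simp, by simp⟩ ⟨?_, ?_⟩ (fun j => ?_)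
  · intro a b; simp; ring
  · intro a b; simp; ring
  revert u
  refine isLinearMap_eq ⟨by simp, by simp⟩ ⟨?_, ?_⟩ (fun k => ?_)
  · intro a b; simp; ring
  · intro a b; simp; ring
  revert v
  refine isLinearMap_eq ⟨by simp, by simp⟩ ⟨?_, ?_⟩ (fun l => ?_)
  · intro a b; simp; ring
  · intro a b; simp; ring
  have e1 : ∀ q : Coord n, m3 (T y) q (bv k) (bv l) = ∑ m, q m * T y m k l := by
    intro q; simp [m3, ofBasis_apply]
  have e2 : ∀ q : Coord n, m3 (T y) (bv j) q (bv l) = ∑ m, q m * T y j m l := by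
    intro q; simp [m3, m2_apply]
  have e3 : ∀ q : Coord n, m3 (T y) (bv j) (bv k) q = ∑ m, q m * T y j k m := by
    intro q; simp [m3, m2_apply]
  rw [e1, e2, e3]
  simp [nabla3, d3, chr]

theorem crv_apply (G : LocalMetric n) (y u v w : Coord n) :
    crv G y u v w = dchr G y u v w - dchr G y v u w + chr G y u (chr G y v w)
      - chr G y v (chr G y u w) := by
  revert u
  refine isLinearMap_eq ⟨by simp, by simp⟩ ⟨?_, ?_⟩ (fun i => ?_)
  · intro a b; simp; abel
  · intro a b; simp [smul_sub, smul_add]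
  revert v
  refine isLinearMap_eq ⟨by simp, by simp⟩ ⟨?_, ?_⟩ (fun j => ?_)
  · intro a b; simp; abel
  · intro a b; simp [smul_sub, smul_add]
  revert w
  refine isLinearMap_eq ⟨by simp, by simp⟩ ⟨?_, ?_⟩ (fun k => ?_)
  · intro a b; simp; abel
  · intro a b; simp [smul_sub, smul_add]
  have e1 : ∀ (i : Fin n) (q : Coord n) (l : Fin n),
      chr G y (bv i) q l = ∑ m, q m * christoffel G y l i m := by
    intro i q l
    conv_lhs => rw [← sum_bv q]
    simp [chr]
  ext l
  simp only [PiLp.sub_apply, PiLp.add_apply, e1]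
  simp [riem, dchr, chr, Finset.sum_sub_distrib, add_sub_assoc]

end Connection

section LeviCivita

theorem two_le_infty : (2 : ℕ∞ω) ≤ ∞ := WithTop.coe_le_coe.2 (le_top : (2 : ℕ∞) ≤ ⊤)

theorem three_le_infty : (3 : ℕ∞ω) ≤ ∞ := WithTop.coe_le_coe.2 (le_top : (3 : ℕ∞) ≤ ⊤)

variable {n : ℕ}

/-- `G` is a smooth Riemannian metric on the open set `V` of coordinate space. -/
structure PatchMetric (V : Set (Coord n)) (G : LocalMetric n) : Prop where
  isOpen : IsOpen V
  smooth : ∀ i j, ContDiffOn ℝ ∞ (fun z => G z i j) V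
  posDef : ∀ z ∈ V, (Matrix.of (G z)).PosDef

variable {V : Set (Coord n)} {G : LocalMetric n}

theorem posDef_symm {A : Fin n → Fin n → ℝ} (h : (Matrix.of A).PosDef) (i j : Fin n) :
    A i j = A j i := by
  have := h.isHermitian.apply j i
  simpa using this

theorem PatchMetric.symm (hG : PatchMetric V G) {y : Coord n} (hy : y ∈ V) (i j : Fin n) :
    G y i j = G y j i := posDef_symm (hG.posDef y hy) i j

theorem PatchMetric.m2_symm (hG : PatchMetric V G) {y : Coord n} (hy : y ∈ V) (u v : Coord n) :
    m2 (G y) u v = m2 (G y) v u := SolitonVariation.m2_symm (hG.symm hy) u v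

theorem PatchMetric.exists_frame (hG : PatchMetric V G) {y : Coord n} (hy : y ∈ V) :
    ∃ b, IsFrame (G y) b := SolitonVariation.exists_frame (hG.posDef y hy)

theorem PatchMetric.contDiffOn_invG (hG : PatchMetric V G) (i j : Fin n) :
    ContDiffOn ℝ ∞ (fun z => invG G z i j) V :=
  contDiffOn_inv hG.smooth (fun z hz => (hG.posDef z hz).det_pos.ne') i j

theorem contDiffOn_pd_top (hV : IsOpen V) {u : Coord n → ℝ} (hu : ContDiffOn ℝ ∞ u V)
    (i : Fin n) : ContDiffOn ℝ ∞ (pd i u) V :=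
  contDiffOn_pd hV (by simp) hu i

theorem PatchMetric.contDiffOn_christoffel (hG : PatchMetric V G) (k i j : Fin n) :
    ContDiffOn ℝ ∞ (fun z => christoffel G z k i j) V := by
  have h1 := hG.contDiffOn_invG
  have h2 := fun i j l => contDiffOn_pd_top hG.isOpen (hG.smooth i j) l
  unfold christoffel
  fun_prop

theorem PatchMetric.contDiffOn_riem (hG : PatchMetric V G) (i j k l : Fin n) :
    ContDiffOn ℝ ∞ (fun z => riem G z i j k l) V := by
  have h1 := hG.contDiffOn_christoffel
  have h2 := fun i j k l => contDiffOn_pd_top hG.isOpen (h1 i j k) l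
  unfold riem
  fun_prop

theorem PatchMetric.contDiffOn_ricciC (hG : PatchMetric V G) (j k : Fin n) :
    ContDiffOn ℝ ∞ (fun z => ricciC G z j k) V := by
  have h1 := hG.contDiffOn_riem
  unfold ricciC
  fun_prop

theorem PatchMetric.contDiffOn_nabla1 (hG : PatchMetric V G) {k l : ℕ∞} (hk : k + 1 ≤ l)
    {α : Coord n → Fin n → ℝ} (hα : ∀ i, ContDiffOn ℝ l (fun z => α z i) V) (i j : Fin n) :
    ContDiffOn ℝ k (fun z => nabla1 G α z i j) V := by
  have hk' : (k : ℕ∞ω) + 1 ≤ l := by exact_mod_cast hk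
  have h1 := fun i j k' => (hG.contDiffOn_christoffel i j k').of_le (m := k) (by simp)
  have h2 := fun i j => contDiffOn_pd hG.isOpen hk' (hα i) j
  have h3 := fun i => (hα i).of_le (m := k) (le_trans (by exact_mod_cast le_self_add) hk')
  unfold nabla1
  fun_prop

theorem PatchMetric.contDiffOn_nabla2 (hG : PatchMetric V G) {k l : ℕ∞} (hk : k + 1 ≤ l)
    {h : Coord n → Fin n → Fin n → ℝ} (hh : ∀ i j, ContDiffOn ℝ l (fun z => h z i j) V)
    (a i j : Fin n) :
    ContDiffOn ℝ k (fun z => nabla2 G h z a i j) V := by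
  have hk' : (k : ℕ∞ω) + 1 ≤ l := by exact_mod_cast hk
  have h1 := fun i j k' => (hG.contDiffOn_christoffel i j k').of_le (m := k) (by simp)
  have h2 := fun i j a => contDiffOn_pd hG.isOpen hk' (hh i j) a
  have h3 := fun i j => (hh i j).of_le (m := k) (le_trans (by exact_mod_cast le_self_add) hk')
  unfold nabla2
  fun_prop

theorem PatchMetric.diffAt (hG : PatchMetric V G) {f : Coord n → ℝ} {k : ℕ∞ω}
    (hf : ContDiffOn ℝ k f V) {y : Coord n} (hy : y ∈ V) (hk : 1 ≤ k := by norm_num) :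
    DifferentiableAt ℝ f y :=
  differentiableAt_of_contDiffOn hG.isOpen hk hf hy

theorem invG_mul {A : Fin n → Fin n → ℝ} (h : (Matrix.of A).PosDef) (l m : Fin n) :
    ∑ k, A l k * (Matrix.of A)⁻¹ k m = if l = m then 1 else 0 := by
  have := Matrix.mul_nonsing_inv (Matrix.of A) (isUnit_iff_ne_zero.2 h.det_pos.ne')
  have h2 := congrFun (congrFun this l) m
  simpa [Matrix.mul_apply, Matrix.one_apply] using h2

/-- The Koszul formula. -/
theorem PatchMetric.koszul (hG : PatchMetric V G) {y : Coord n} (hy : y ∈ V) (u v w : Coord n) :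
    2 * m2 (G y) w (chr G y u v) = d2 G y u v w + d2 G y v u w - d2 G y w u v := by
  revert w
  refine isLinearMap_eq ⟨?_, ?_⟩ ⟨?_, ?_⟩ (fun c => ?_)
  · intro a b; simp; ring
  · intro a b; simp; ring
  · intro a b; simp; ring
  · intro a b; simp; ring
  revert u
  refine isLinearMap_eq ⟨?_, ?_⟩ ⟨?_, ?_⟩ (fun a => ?_)
  · intro a b; simp; ring
  · intro a b; simp; ring
  · intro a b; simp; ring
  · intro a b; simp; ring
  revert v
  refine isLinearMap_eq ⟨?_, ?_⟩ ⟨?_, ?_⟩ (fun b => ?_)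
  · intro a b; simp; ring
  · intro a b; simp; ring
  · intro a b; simp; ring
  · intro a b; simp; ring
  simp only [d2, m3_bv, chr, gam_bv, m2_apply, vec_apply]
  simp only [christoffel]
  have e : ∀ S : Fin n → ℝ, ∑ k, G y c k * ((1/2) * ∑ l, invG G y k l * S l) = (1/2) * S c := by
    intro S
    calc _ = (1/2) * ∑ l, (∑ k, G y c k * (Matrix.of (G y))⁻¹ k l) * S l := by
          simp only [Finset.mul_sum, Finset.sum_mul]
          rw [Finset.sum_comm]
          refine Finset.sum_congr rfl fun l _ => Finset.sum_congr rfl fun k _ => ?_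
          rw [invG]; ring
      _ = _ := by simp [invG_mul (hG.posDef y hy)]
  have e2 : ∀ X : Fin n → ℝ, ∑ i, ∑ j, (bv c : Coord n) i * (X j * G y i j)
      = ∑ k, G y c k * X k := by
    intro X
    simp [Pi.single_apply, mul_comm]
  rw [e2, e]
  have e3 : ∀ z, G z a c = G z a c := fun _ => rfl
  ring

theorem d2_symm (hV : IsOpen V) {h : Coord n → Fin n → Fin n → ℝ}
    (hs : ∀ z ∈ V, ∀ i j, h z i j = h z j i) {y : Coord n} (hy : y ∈ V) (w u v : Coord n) :
    d2 h y w u v = d2 h y w v u := by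
  revert w
  refine isLinearMap_eq ⟨by simp, by simp⟩ ⟨by simp, by simp⟩ (fun a => ?_)
  revert u
  refine isLinearMap_eq ⟨by simp, by simp⟩ ⟨by simp, by simp⟩ (fun b => ?_)
  revert v
  refine isLinearMap_eq ⟨by simp, by simp⟩ ⟨by simp, by simp⟩ (fun c => ?_)
  simp only [d2, m3_bv]
  exact pd_congr_on hV (fun z hz => hs z hz b c) hy a

theorem PatchMetric.d2_symm (hG : PatchMetric V G) {y : Coord n} (hy : y ∈ V) (w u v : Coord n) :
    d2 G y w u v = d2 G y w v u :=
  SolitonVariation.d2_symm hG.isOpen (fun _ hz => hG.symm hz) hy w u v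

/-- Torsion freeness. -/
theorem PatchMetric.chr_symm (hG : PatchMetric V G) {y : Coord n} (hy : y ∈ V) (u v : Coord n) :
    chr G y u v = chr G y v u := by
  obtain ⟨b, hb⟩ := hG.exists_frame hy
  refine hb.nondeg fun w => ?_
  have h1 := hG.koszul hy u v w
  have h2 := hG.koszul hy v u w
  have h3 := hG.d2_symm hy w u v
  linarith

/-- Metric compatibility. -/
theorem PatchMetric.d2_self (hG : PatchMetric V G) {y : Coord n} (hy : y ∈ V) (w u v : Coord n) :
    d2 G y w u v = m2 (G y) (chr G y w u) v + m2 (G y) u (chr G y w v) := by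
  have h1 := hG.koszul hy w u v
  have h2 := hG.koszul hy w v u
  rw [hG.m2_symm hy _ v]
  have h3 := hG.d2_symm hy w u v
  have h4 := hG.d2_symm hy u w v
  have h5 := hG.d2_symm hy v w u
  linarith

/-- The metric is parallel. -/
theorem PatchMetric.m3_nabla2_self (hG : PatchMetric V G) {y : Coord n} (hy : y ∈ V)
    (w u v : Coord n) : m3 (nabla2 G G y) w u v = 0 := by
  rw [m3_nabla2, hG.d2_self hy]; ring

theorem PatchMetric.nabla2_self (hG : PatchMetric V G) {y : Coord n} (hy : y ∈ V)
    (k i j : Fin n) : nabla2 G G y k i j = 0 := by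
  rw [← m3_bv (nabla2 G G y), hG.m3_nabla2_self hy]

theorem differentiableAt_chr (hG : PatchMetric V G) {y : Coord n} (hy : y ∈ V) (v w : Coord n) :
    DifferentiableAt ℝ (fun z => chr G z v w) y := by
  have : DifferentiableAt ℝ (fun z => chr G z) y :=
    differentiableAt_ofBasis fun i => differentiableAt_ofBasis fun j =>
      (differentiableAt_euclidean).2 fun k => hG.diffAt (hG.contDiffOn_christoffel k i j) hy
  exact (this.clm_apply (differentiableAt_const v)).clm_apply (differentiableAt_const w)

theorem PatchMetric.differentiableAt_chr_apply (hG : PatchMetric V G) {y : Coord n} (hy : y ∈ V)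
    (v : Coord n) {q : Coord n → Coord n} (hq : DifferentiableAt ℝ q y) :
    DifferentiableAt ℝ (fun z => chr G z v (q z)) y := by
  have : DifferentiableAt ℝ (fun z => chr G z) y :=
    differentiableAt_ofBasis fun i => differentiableAt_ofBasis fun j =>
      (differentiableAt_euclidean).2 fun k => hG.diffAt (hG.contDiffOn_christoffel k i j) hy
  exact (this.clm_apply (differentiableAt_const v)).clm_apply hq

theorem PatchMetric.fderiv_chr (hG : PatchMetric V G) {y : Coord n} (hy : y ∈ V)
    (v w : Coord n) {q : Coord n → Coord n} (hq : DifferentiableAt ℝ q y) :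
    fderiv ℝ (fun z => chr G z v (q z)) y w
      = dchr G y w v (q y) + chr G y v (fderiv ℝ q y w) :=
  fderiv_gam (fun k i j => hG.diffAt (hG.contDiffOn_christoffel k i j) hy) hq v w

theorem PatchMetric.fderiv_chr_const (hG : PatchMetric V G) {y : Coord n} (hy : y ∈ V)
    (w u v : Coord n) : fderiv ℝ (fun z => chr G z u v) y w = dchr G y w u v := by
  rw [hG.fderiv_chr hy u w (differentiableAt_const v)]
  simp

theorem fderiv_congr_on (hV : IsOpen V) {F : Type*} [NormedAddCommGroup F] [NormedSpace ℝ F]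
    {f g : Coord n → F} (h : ∀ z ∈ V, f z = g z) {y : Coord n} (hy : y ∈ V) :
    fderiv ℝ f y = fderiv ℝ g y :=
  (Filter.eventuallyEq_of_mem (hV.mem_nhds hy) h).fderiv_eq

theorem fderiv_m1_const {α : Coord n → Fin n → ℝ} {y : Coord n}
    (hα : ∀ i, DifferentiableAt ℝ (fun z => α z i) y) (w v : Coord n) :
    fderiv ℝ (fun z => m1 (α z) v) y w = d1 α y w v := by
  rw [fderiv_m1 hα (differentiableAt_const v)]; simp

theorem fderiv_m2_const {h : Coord n → Fin n → Fin n → ℝ} {y : Coord n}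
    (hh : ∀ i j, DifferentiableAt ℝ (fun z => h z i j) y) (w u v : Coord n) :
    fderiv ℝ (fun z => m2 (h z) u v) y w = d2 h y w u v := by
  rw [fderiv_m2 hh (differentiableAt_const u) (differentiableAt_const v)]; simp

theorem m3_apply_eq (c : Fin n → Fin n → Fin n → ℝ) (u v w : Coord n) :
    m3 c u v w = m2 (fun i j => ∑ k, u k * c k i j) v w := by
  revert v
  refine isLinearMap_eq ⟨by simp, by simp⟩ ⟨by simp, by simp⟩ (fun i => ?_)
  revert w
  refine isLinearMap_eq ⟨by simp, by simp⟩ ⟨by simp, by simp⟩ (fun j => ?_)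
  simp [m3, ofBasis_apply]

theorem fderiv_m3_const {T : Coord n → Fin n → Fin n → Fin n → ℝ} {y : Coord n}
    (hT : ∀ p i j, DifferentiableAt ℝ (fun z => T z p i j) y) (w p u v : Coord n) :
    fderiv ℝ (fun z => m3 (T z) p u v) y w = d3 T y w p u v := by
  simp only [m3_apply_eq]
  rw [fderiv_m2_const (fun i j => by fun_prop)]
  revert w
  refine isLinearMap_eq ⟨by simp, by simp⟩ ⟨by simp, by simp⟩ (fun a => ?_)
  revert u
  refine isLinearMap_eq ⟨by simp, by simp⟩ ⟨by simp, by simp⟩ (fun b => ?_)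
  revert v
  refine isLinearMap_eq ⟨by simp, by simp⟩ ⟨by simp, by simp⟩ (fun c => ?_)
  simp only [d2, m3_bv, pd]
  rw [fderiv_fun_sum (fun i _ => (hT i b c).const_mul _)]
  simp only [ContinuousLinearMap.sum_apply]
  conv_rhs => rw [← sum_bv p]
  simp only [map_sum, map_smul, ContinuousLinearMap.sum_apply, ContinuousLinearMap.smul_apply, d3,
    m4_bv, pd, smul_eq_mul]
  refine Finset.sum_congr rfl fun i _ => ?_
  rw [fderiv_const_mul (hT i b c)]
  simp

/-! #### Ricci identities -/

/-- Commutation of second covariant derivatives of a one-form. -/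
theorem PatchMetric.ricci_identity1 (hG : PatchMetric V G) {α : Coord n → Fin n → ℝ}
    (hα : ∀ i, ContDiffOn ℝ 2 (fun z => α z i) V) {y : Coord n} (hy : y ∈ V) (u v w : Coord n) :
    m3 (nabla2 G (nabla1 G α) y) u v w - m3 (nabla2 G (nabla1 G α) y) v u w
      = - m1 (α y) (crv G y u v w) := by
  have hα1 : ∀ i, DifferentiableAt ℝ (fun z => α z i) y := fun i => hG.diffAt (hα i) hy
  have hn : ∀ i j, DifferentiableAt ℝ (fun z => nabla1 G α z i j) y := fun i j =>
    hG.diffAt (hG.contDiffOn_nabla1 (k := 1) (l := 2) (by norm_num) hα i j) hy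
  have hd : ∀ k i, DifferentiableAt ℝ (fun z => pd k (fun x => α x i) z) y := fun k i =>
    hG.diffAt (contDiffOn_pd hG.isOpen (k := 1) (by norm_num) (hα i) k) hy
  have key : ∀ u v, d2 (nabla1 G α) y u v w
      = d2 (fun z k i => pd k (fun x => α x i) z) y u v w - d1 α y u (chr G y v w)
        - m1 (α y) (dchr G y u v w) := by
    intro u v
    rw [← fderiv_m2_const hn]
    simp only [m2_nabla1]
    have h1 : DifferentiableAt ℝ (fun z => d1 α z v w) y :=
      ((differentiableAt_ofBasis fun i => differentiableAt_ofBasis fun j => hd i j).clm_apply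
        (differentiableAt_const v)).clm_apply (differentiableAt_const w)
    have h2 : DifferentiableAt ℝ (fun z => m1 (α z) (chr G z v w)) y :=
      (differentiableAt_ofBasis hα1).clm_apply (differentiableAt_chr hG hy v w)
    rw [fderiv_fun_sub h1 h2, ContinuousLinearMap.sub_apply,
      fderiv_m1 hα1 (differentiableAt_chr hG hy v w), hG.fderiv_chr_const hy]
    have h3 : fderiv ℝ (fun z => d1 α z v w) y u
      = d2 (fun z k i => pd k (fun x => α x i) z) y u v w := fderiv_m2_const hd u v w
    rw [h3]; ring
  simp only [m3_nabla2, m2_nabla1]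
  rw [key u v, key v u, d2_comm hG.isOpen hα hy, crv_apply, hG.chr_symm hy v u]
  simp only [map_add, map_sub]
  ring

/-- Commutation of second covariant derivatives of a `(0,2)` tensor. -/
theorem PatchMetric.ricci_identity2 (hG : PatchMetric V G) {h : Coord n → Fin n → Fin n → ℝ}
    (hh : ∀ i j, ContDiffOn ℝ 2 (fun z => h z i j) V) {y : Coord n} (hy : y ∈ V)
    (u v w t : Coord n) :
    m4 (nabla3 G (nabla2 G h) y) u v w t - m4 (nabla3 G (nabla2 G h) y) v u w t
      = - m2 (h y) (crv G y u v w) t - m2 (h y) w (crv G y u v t) := by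
  have hh1 : ∀ i j, DifferentiableAt ℝ (fun z => h z i j) y := fun i j => hG.diffAt (hh i j) hy
  have hn : ∀ a i j, DifferentiableAt ℝ (fun z => nabla2 G h z a i j) y := fun a i j =>
    hG.diffAt (hG.contDiffOn_nabla2 (k := 1) (l := 2) (by norm_num) hh a i j) hy
  have hd : ∀ k i j, DifferentiableAt ℝ (fun z => pd k (fun x => h x i j) z) y := fun k i j =>
    hG.diffAt (contDiffOn_pd hG.isOpen (k := 1) (by norm_num) (hh i j) k) hy
  have key : ∀ u v, d3 (nabla2 G h) y u v w t
      = d3 (fun z k i j => pd k (fun x => h x i j) z) y u v w t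
        - (d2 h y u (chr G y v w) t + m2 (h y) (dchr G y u v w) t)
        - (d2 h y u w (chr G y v t) + m2 (h y) w (dchr G y u v t)) := by
    intro u v
    rw [← fderiv_m3_const hn]
    simp only [m3_nabla2]
    have h1 : DifferentiableAt ℝ (fun z => d2 h z v w t) y :=
      (((differentiableAt_ofBasis fun k => differentiableAt_ofBasis fun i => differentiableAt_ofBasis fun j =>
        hd k i j).clm_apply (differentiableAt_const v)).clm_apply
          (differentiableAt_const w)).clm_apply (differentiableAt_const t)
    have hm : DifferentiableAt ℝ (fun z => m2 (h z)) y :=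
      differentiableAt_ofBasis fun i => differentiableAt_ofBasis fun j => hh1 i j
    have h2 : DifferentiableAt ℝ (fun z => m2 (h z) (chr G z v w) t) y :=
      (hm.clm_apply (differentiableAt_chr hG hy v w)).clm_apply (differentiableAt_const t)
    have h2' : DifferentiableAt ℝ (fun z => m2 (h z) w (chr G z v t)) y :=
      (hm.clm_apply (differentiableAt_const w)).clm_apply (differentiableAt_chr hG hy v t)
    rw [fderiv_fun_sub (h1.fun_sub h2) h2', fderiv_fun_sub h1 h2, ContinuousLinearMap.sub_apply,
      ContinuousLinearMap.sub_apply,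
      fderiv_m2 hh1 (differentiableAt_chr hG hy v w) (differentiableAt_const t),
      fderiv_m2 hh1 (differentiableAt_const w) (differentiableAt_chr hG hy v t),
      hG.fderiv_chr_const hy, hG.fderiv_chr_const hy]
    have h3 : fderiv ℝ (fun z => d2 h z v w t) y u
      = d3 (fun z k i j => pd k (fun x => h x i j) z) y u v w t := fderiv_m3_const hd u v w t
    rw [h3]
    simp
  simp only [m4_nabla3, m3_nabla2]
  rw [key u v, key v u, d3_comm hG.isOpen hh hy, crv_apply, crv_apply, hG.chr_symm hy v u]
  simp only [map_add, map_sub, ContinuousLinearMap.add_apply, ContinuousLinearMap.sub_apply]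
  ring

/-! #### Symmetries of the curvature -/

theorem ofBasis_zero {F : Type*} [NormedAddCommGroup F] [NormedSpace ℝ F] :
    (ofBasis fun _ : Fin n => (0 : F)) = 0 := clm_ext fun i => by simp

theorem crv_antisymm (G : LocalMetric n) (y u v w : Coord n) :
    crv G y u v w = - crv G y v u w := by
  rw [crv_apply, crv_apply]; abel

/-- `R(u, v)` is skew-adjoint, by the Ricci identity for the parallel tensor `g`. -/
theorem PatchMetric.crv_skew (hG : PatchMetric V G) {y : Coord n} (hy : y ∈ V)
    (u v w t : Coord n) :
    m2 (G y) (crv G y u v w) t = - m2 (G y) (crv G y u v t) w := by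
  have h := hG.ricci_identity2 (h := G) (fun i j => (hG.smooth i j).of_le two_le_infty) hy u v w t
  have h0 : ∀ u v w t, m4 (nabla3 G (nabla2 G G) y) u v w t = 0 := by
    intro u v w t
    rw [m4_nabla3]
    have hz : m3 (nabla2 G G y) = 0 := by
      ext a b c; simp [hG.m3_nabla2_self hy]
    rw [hz]
    have : d3 (nabla2 G G) y = 0 := by
      unfold d3
      have e : (fun k p i j => pd k (fun z => nabla2 G G z p i j) y) = fun _ _ _ _ => 0 := by
        ext k p i j
        rw [pd_congr_on hG.isOpen (v := fun _ => 0) (fun z hz => hG.nabla2_self hz p i j) hy]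
        simp [pd]
      rw [e]
      simp [m4, m3, m2, m1, ofBasis_zero]
    rw [this]
    simp
  rw [h0, h0, hG.m2_symm hy w] at h
  linarith

theorem PatchMetric.first_bianchi (hG : PatchMetric V G) {y : Coord n} (hy : y ∈ V)
    (u v w : Coord n) : crv G y u v w + crv G y v w u + crv G y w u v = 0 := by
  have hd : ∀ a b c, dchr G y a b c = dchr G y a c b := by
    intro a b c
    rw [← hG.fderiv_chr_const hy, ← hG.fderiv_chr_const hy,
      fderiv_congr_on hG.isOpen (fun z hz => hG.chr_symm hz b c) hy]
  simp only [crv_apply]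
  rw [hd u v w, hd v w u, hd w u v, hG.chr_symm hy v w, hG.chr_symm hy w u, hG.chr_symm hy u v]
  abel

/-! #### Traces -/

theorem IsFrame.symm_of {A : Fin n → Fin n → ℝ} {b : Fin n → Coord n} (hb : IsFrame A b)
    (hA : ∀ u v, m2 A u v = m2 A v u) (v : Coord n) : ∑ a, m2 A v (b a) • b a = v := by
  simp only [hA v]
  exact hb.expand v

/-- The trace of an endomorphism computed in an orthonormal frame. -/
theorem IsFrame.trace_end {A : Fin n → Fin n → ℝ} {b : Fin n → Coord n} (hb : IsFrame A b)
    (T : Coord n →L[ℝ] Coord n) : ∑ l, T (bv l) l = ∑ a, m2 A (b a) (T (b a)) := by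
  have h1 : ∀ l, T (bv l) l = ∑ a, m2 A (b a) (T (bv l)) * b a l := by
    intro l
    conv_lhs => rw [← hb.expand (T (bv l))]
    simp
  simp only [h1]
  rw [Finset.sum_comm]
  refine Finset.sum_congr rfl fun a _ => ?_
  have h2 : T (b a) = ∑ l, b a l • T (bv l) := by
    conv_lhs => rw [← sum_bv (b a)]
    simp
  rw [h2]
  simp [mul_comm]

theorem PatchMetric.m2_ricciC (hG : PatchMetric V G) {y : Coord n} (hy : y ∈ V)
    {b : Fin n → Coord n} (hb : IsFrame (G y) b) (v w : Coord n) :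
    m2 (ricciC G y) v w = ∑ a, m2 (G y) (b a) (crv G y (b a) v w) := by
  have h := hb.trace_end (((crv G y).flip v).flip w)
  simp only [ContinuousLinearMap.flip_apply] at h
  rw [← h]
  clear h
  revert v
  refine isLinearMap_eq ⟨by simp, by simp⟩ ⟨?_, ?_⟩ (fun i => ?_)
  · intro a b; simp [Finset.sum_add_distrib]
  · intro a b; simp [Finset.mul_sum]
  revert w
  refine isLinearMap_eq ⟨by simp, by simp⟩ ⟨?_, ?_⟩ (fun j => ?_)
  · intro a b; simp [Finset.sum_add_distrib]
  · intro a b; simp [Finset.mul_sum]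
  simp [ricciC]

theorem PatchMetric.ricciC_symm (hG : PatchMetric V G) {y : Coord n} (hy : y ∈ V)
    (v w : Coord n) : m2 (ricciC G y) v w = m2 (ricciC G y) w v := by
  obtain ⟨b, hb⟩ := hG.exists_frame hy
  rw [hG.m2_ricciC hy hb, hG.m2_ricciC hy hb, ← sub_eq_zero, ← Finset.sum_sub_distrib]
  refine Finset.sum_eq_zero fun a _ => ?_
  have h1 := hG.first_bianchi hy (b a) v w
  have h2 : m2 (G y) (b a) (crv G y v w (b a)) = 0 := by
    have := hG.crv_skew hy v w (b a) (b a)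
    rw [hG.m2_symm hy (b a)]
    linarith
  have h3 := congrArg (m2 (G y) (b a)) h1
  simp only [map_add, map_zero, h2] at h3
  rw [crv_antisymm G y w (b a) v, map_neg] at h3
  linarith

/-- Covariant differentiation commutes with metric contraction. -/
theorem PatchMetric.fderiv_traceC (hG : PatchMetric V G) {T : Coord n → Fin n → Fin n → ℝ}
    {y : Coord n} (hT : ∀ i j, DifferentiableAt ℝ (fun z => T z i j) y) (hy : y ∈ V)
    {b : Fin n → Coord n} (hb : IsFrame (G y) b) (w : Coord n) :
    fderiv ℝ (fun z => traceC G z (T z)) y w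
      = ∑ a, (d2 T y w (b a) (b a) - m2 (T y) (chr G y w (b a)) (b a)
          - m2 (T y) (b a) (chr G y w (b a))) := by
  have hline : ∀ {f : Coord n → ℝ}, DifferentiableAt ℝ f y →
      HasDerivAt (fun t : ℝ => f (y + t • w)) (fderiv ℝ f y w) 0 := by
    intro f hf
    have h1 : HasDerivAt (fun t : ℝ => y + t • w) w 0 := by
      simpa using ((hasDerivAt_id (0 : ℝ)).smul_const w).const_add y
    exact hf.hasFDerivAt.comp_hasDerivAt_of_eq (0 : ℝ) h1 (by simp)
  have hGd : ∀ i j, DifferentiableAt ℝ (fun z => G z i j) y := fun i j =>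
    hG.diffAt (hG.smooth i j) hy
  have hid : ∀ i j, DifferentiableAt ℝ (fun z => invG G z i j) y := fun i j =>
    hG.diffAt (hG.contDiffOn_invG i j) hy
  have htd : DifferentiableAt ℝ (fun z => traceC G z (T z)) y := by
    unfold SolitonVariation.traceC
    fun_prop
  have hb0 : IsFrame (G (y + (0 : ℝ) • w)) b := by simpa using hb
  have h1 := hasDerivAt_trace (fun i j => hline (hGd i j)) (fun i j => hline (hT i j)) hb0
  have h2 := (hline htd).unique h1
  rw [h2]
  have eD : ∀ (h : Coord n → Fin n → Fin n → ℝ), (∀ i j, DifferentiableAt ℝ (fun z => h z i j) y) →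
      ∀ u v, m2 (fun i j => fderiv ℝ (fun z => h z i j) y w) u v = d2 h y w u v := by
    intro h hh u v
    revert u
    refine isLinearMap_eq ⟨by simp, by simp⟩ ⟨by simp, by simp⟩ (fun i => ?_)
    revert v
    refine isLinearMap_eq ⟨by simp, by simp⟩ ⟨by simp, by simp⟩ (fun j => ?_)
    rw [m2_bv, ← fderiv_m2_const hh]
    simp
  simp only [eD T hT, eD G hGd, zero_smul, add_zero]
  simp only [hG.d2_self hy, add_mul, Finset.sum_add_distrib, Finset.sum_sub_distrib]
  have e1 : ∀ u v : Coord n, ∑ c, m2 (G y) u (b c) * m2 (T y) v (b c) = m2 (T y) v u := by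
    intro u v
    conv_rhs => rw [← hb.symm_of (hG.m2_symm hy) u]
    simp
  have e2 : ∀ u v : Coord n, ∑ c, m2 (G y) (b c) u * m2 (T y) (b c) v = m2 (T y) u v := by
    intro u v
    conv_rhs => rw [← hb.expand u]
    simp [ContinuousLinearMap.sum_apply]
  have e3 : ∑ a, ∑ c, m2 (G y) (b a) (chr G y w (b c)) * m2 (T y) (b a) (b c)
      = ∑ a, m2 (T y) (chr G y w (b a)) (b a) := by
    rw [Finset.sum_comm]
    exact Finset.sum_congr rfl fun c _ => e2 _ _
  rw [e3]
  simp only [e1]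
  ring

theorem PatchMetric.contDiffOn_traceC (hG : PatchMetric V G) {k : ℕ∞}
    {T : Coord n → Fin n → Fin n → ℝ} (hT : ∀ i j, ContDiffOn ℝ k (fun z => T z i j) V) :
    ContDiffOn ℝ k (fun z => traceC G z (T z)) V := by
  have h1 := fun i j => (hG.contDiffOn_invG i j).of_le (m := k) (by simp)
  unfold SolitonVariation.traceC
  fun_prop

theorem PatchMetric.fderiv_trace_eq (hG : PatchMetric V G) {h : Coord n → Fin n → Fin n → ℝ}
    {y : Coord n} (hh : ∀ i j, DifferentiableAt ℝ (fun z => h z i j) y) (hy : y ∈ V)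
    {b : Fin n → Coord n} (hb : IsFrame (G y) b) (w : Coord n) :
    fderiv ℝ (fun z => traceC G z (h z)) y w = ∑ a, m3 (nabla2 G h y) w (b a) (b a) := by
  rw [hG.fderiv_traceC hh hy hb]
  simp only [m3_nabla2]

theorem m3_apply_eq3 (c : Fin n → Fin n → Fin n → ℝ) (u v w : Coord n) :
    m3 c u v w = m2 (fun i j => ∑ k, w k * c i j k) u v := by
  revert u
  refine isLinearMap_eq ⟨by simp, by simp⟩ ⟨by simp, by simp⟩ (fun i => ?_)
  revert v
  refine isLinearMap_eq ⟨by simp, by simp⟩ ⟨by simp, by simp⟩ (fun j => ?_)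
  simp [m3, m2, m1_apply]

/-- The covariant derivative of a contraction in the last two slots. -/
theorem PatchMetric.nabla1_contract_last (hG : PatchMetric V G)
    {T : Coord n → Fin n → Fin n → Fin n → ℝ} {y : Coord n}
    (hT : ∀ p i j, DifferentiableAt ℝ (fun z => T z p i j) y) (hy : y ∈ V)
    {b : Fin n → Coord n} (hb : IsFrame (G y) b) (u v : Coord n) :
    m2 (nabla1 G (fun z p => traceC G z (T z p)) y) u v
      = ∑ a, m4 (nabla3 G T y) u v (b a) (b a) := by
  have hm : ∀ z, z ∈ V → ∀ v, m1 (fun p => traceC G z (T z p)) v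
      = traceC G z (fun i j => ∑ p, v p * T z p i j) := by
    intro z hz v
    simp only [SolitonVariation.traceC, m1_apply, Finset.mul_sum]
    rw [Finset.sum_comm]
    refine Finset.sum_congr rfl fun i _ => ?_
    rw [Finset.sum_comm]
    exact Finset.sum_congr rfl fun j _ => Finset.sum_congr rfl fun p _ => by ring
  have hθ : ∀ p, DifferentiableAt ℝ (fun z => traceC G z (T z p)) y := by
    intro p
    have hid : ∀ i j, DifferentiableAt ℝ (fun z => invG G z i j) y := fun i j =>
      hG.diffAt (hG.contDiffOn_invG i j) hy
    unfold SolitonVariation.traceC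
    fun_prop
  have hTv : ∀ i j, DifferentiableAt ℝ (fun z => ∑ p, v p * T z p i j) y := fun i j => by fun_prop
  rw [m2_nabla1, ← fderiv_m1_const hθ, fderiv_congr_on hG.isOpen (fun z hz => hm z hz v) hy,
    hG.fderiv_traceC (T := fun z i j => ∑ p, v p * T z p i j) hTv hy hb, hm y hy, hb.traceC,
    ← Finset.sum_sub_distrib]
  refine Finset.sum_congr rfl fun a _ => ?_
  simp only [← m3_apply_eq]
  rw [m4_nabla3, ← fderiv_m2_const hTv]
  simp only [← m3_apply_eq]
  rw [fderiv_m3_const hT]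
  ring

/-- The covariant derivative of a contraction in the first two slots. -/
theorem PatchMetric.nabla1_contract_first (hG : PatchMetric V G)
    {T : Coord n → Fin n → Fin n → Fin n → ℝ} {y : Coord n}
    (hT : ∀ p i j, DifferentiableAt ℝ (fun z => T z p i j) y) (hy : y ∈ V)
    {b : Fin n → Coord n} (hb : IsFrame (G y) b) (u v : Coord n) :
    m2 (nabla1 G (fun z j => traceC G z (fun p i => T z p i j)) y) u v
      = ∑ a, m4 (nabla3 G T y) u (b a) (b a) v := by
  have hm : ∀ z, z ∈ V → ∀ v, m1 (fun j => traceC G z (fun p i => T z p i j)) v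
      = traceC G z (fun p i => ∑ j, v j * T z p i j) := by
    intro z hz v
    simp only [SolitonVariation.traceC, m1_apply, Finset.mul_sum]
    rw [Finset.sum_comm]
    refine Finset.sum_congr rfl fun i _ => ?_
    rw [Finset.sum_comm]
    exact Finset.sum_congr rfl fun j _ => Finset.sum_congr rfl fun p _ => by ring
  have hθ : ∀ j, DifferentiableAt ℝ (fun z => traceC G z (fun p i => T z p i j)) y := by
    intro j
    have hid : ∀ i j, DifferentiableAt ℝ (fun z => invG G z i j) y := fun i j =>
      hG.diffAt (hG.contDiffOn_invG i j) hy
    unfold SolitonVariation.traceC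
    fun_prop
  have hTv : ∀ p i, DifferentiableAt ℝ (fun z => ∑ j, v j * T z p i j) y := fun i j => by fun_prop
  rw [m2_nabla1, ← fderiv_m1_const hθ, fderiv_congr_on hG.isOpen (fun z hz => hm z hz v) hy,
    hG.fderiv_traceC (T := fun z p i => ∑ j, v j * T z p i j) hTv hy hb, hm y hy, hb.traceC,
    ← Finset.sum_sub_distrib]
  refine Finset.sum_congr rfl fun a _ => ?_
  simp only [← m3_apply_eq3]
  rw [m4_nabla3, ← fderiv_m2_const hTv]
  simp only [← m3_apply_eq3]
  rw [fderiv_m3_const hT]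

end LeviCivita

/-! ### The contracted Bianchi identity and the Bochner formula -/

section Bianchi

variable {n : ℕ} {V : Set (Coord n)} {G : LocalMetric n}

/-- The covariant derivative `(∇_w R)(u, v) z` of the curvature. -/
def covCrv (G : LocalMetric n) (y w u v z : Coord n) : Coord n :=
  fderiv ℝ (fun x => crv G x u v z) y w - crv G y (chr G y w u) v z
    - crv G y u (chr G y w v) z - crv G y u v (chr G y w z) + chr G y w (crv G y u v z)

theorem PatchMetric.differentiableAt_crv (hG : PatchMetric V G) {y : Coord n} (hy : y ∈ V) :
    DifferentiableAt ℝ (fun z => crv G z) y :=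
  differentiableAt_ofBasis fun i => differentiableAt_ofBasis fun j => differentiableAt_ofBasis fun k =>
      (differentiableAt_euclidean).2 fun l => hG.diffAt (hG.contDiffOn_riem i j k l) hy

theorem PatchMetric.differentiableAt_crv_apply (hG : PatchMetric V G) {y : Coord n} (hy : y ∈ V)
    (u v w : Coord n) : DifferentiableAt ℝ (fun z => crv G z u v w) y :=
  (((hG.differentiableAt_crv hy).clm_apply (differentiableAt_const u)).clm_apply
    (differentiableAt_const v)).clm_apply (differentiableAt_const w)

theorem PatchMetric.fderiv_crv (hG : PatchMetric V G) {y : Coord n} (hy : y ∈ V)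
    (w u v z : Coord n) :
    fderiv ℝ (fun x => crv G x u v z) y w = ddchr G y w u v z - ddchr G y w v u z
      + (dchr G y w u (chr G y v z) + chr G y u (dchr G y w v z))
      - (dchr G y w v (chr G y u z) + chr G y v (dchr G y w u z)) := by
  have hd : ∀ m k i j, DifferentiableAt ℝ (fun z => pd m (fun z => christoffel G z k i j) z) y :=
    fun m k i j => hG.diffAt (contDiffOn_pd_top hG.isOpen (hG.contDiffOn_christoffel k i j) m) hy
  have hdd : ∀ u v, DifferentiableAt ℝ (fun x => dchr G x u v z) y := by
    intro u v
    have : DifferentiableAt ℝ (fun z => dchr G z) y :=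
      differentiableAt_ofBasis fun m => differentiableAt_ofBasis fun i => differentiableAt_ofBasis fun j =>
        (differentiableAt_euclidean).2 fun k => hd m k i j
    exact ((this.clm_apply (differentiableAt_const u)).clm_apply
      (differentiableAt_const v)).clm_apply (differentiableAt_const z)
  have e1 : ∀ u v, fderiv ℝ (fun x => dchr G x u v z) y w = ddchr G y w u v z := by
    intro u v
    have hdm : ∀ m, DifferentiableAt ℝ (fun x => (gam fun k i j =>
        pd m (fun z => christoffel G z k i j) x : Coord n →L[ℝ] Coord n →L[ℝ] Coord n)) y :=
      fun m => differentiableAt_ofBasis fun i => differentiableAt_ofBasis fun j =>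
        (differentiableAt_euclidean).2 fun k => hd m k i j
    have hs : ∀ x, dchr G x u v z = ∑ m, u m • (gam fun k i j =>
        pd m (fun z => christoffel G z k i j) x : Coord n →L[ℝ] Coord n →L[ℝ] Coord n) v z := by
      intro x; simp [dchr, ofBasis_apply, ContinuousLinearMap.sum_apply]
    have hdm' : ∀ m, DifferentiableAt ℝ (fun x => (gam fun k i j =>
        pd m (fun z => christoffel G z k i j) x : Coord n →L[ℝ] Coord n →L[ℝ] Coord n) v z) y :=
      fun m => ((hdm m).clm_apply (differentiableAt_const v)).clm_apply (differentiableAt_const z)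
    simp only [hs]
    rw [fderiv_fun_sum (fun m _ => (hdm' m).fun_const_smul _)]
    simp only [ContinuousLinearMap.sum_apply]
    have : ∀ m, fderiv ℝ (fun x => u m • (gam fun k i j =>
        pd m (fun z => christoffel G z k i j) x : Coord n →L[ℝ] Coord n →L[ℝ] Coord n) v z) y w
        = u m • ddchr G y w (bv m) v z := by
      intro m
      rw [fderiv_fun_const_smul (hdm' m), ContinuousLinearMap.smul_apply,
        fderiv_gam (fun k i j => hd m k i j) (differentiableAt_const z)]
      have e : (ofBasis fun p => gam fun k i j => pd p (fun z => pd m (fun z =>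
          christoffel G z k i j) z) y : Coord n →L[ℝ] Coord n →L[ℝ] Coord n →L[ℝ] Coord n) w v z
          = ddchr G y w (bv m) v z := by
        revert w
        refine isLinearMap_eq ⟨by simp, by simp⟩ ⟨by simp, by simp⟩ (fun a => ?_)
        simp [ddchr]
      rw [e]
      simp
    simp only [this]
    conv_rhs => rw [← sum_bv u]
    simp [ContinuousLinearMap.sum_apply]
  have hc := fun v => differentiableAt_chr hG hy v z
  have h1 : fderiv ℝ (fun x => crv G x u v z) y w
      = fderiv ℝ (fun x => dchr G x u v z - dchr G x v u z + chr G x u (chr G x v z)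
      - chr G x v (chr G x u z)) y w := by simp only [crv_apply]
  rw [h1, fderiv_fun_sub (((hdd u v).fun_sub (hdd v u)).fun_add
    (hG.differentiableAt_chr_apply hy u (hc v))) (hG.differentiableAt_chr_apply hy v (hc u)),
    fderiv_fun_add ((hdd u v).fun_sub (hdd v u)) (hG.differentiableAt_chr_apply hy u (hc v)),
    fderiv_fun_sub (hdd u v) (hdd v u)]
  simp only [ContinuousLinearMap.sub_apply, ContinuousLinearMap.add_apply, e1]
  rw [hG.fderiv_chr hy u w (hc v), hG.fderiv_chr hy v w (hc u), hG.fderiv_chr_const hy,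
    hG.fderiv_chr_const hy]

/-- The second Bianchi identity. The second derivatives of the Christoffel symbols cancel by their
symmetry, and the remaining terms by torsion freeness. -/
theorem PatchMetric.second_bianchi (hG : PatchMetric V G) {y : Coord n} (hy : y ∈ V)
    (w u v z : Coord n) :
    covCrv G y w u v z + covCrv G y u v w z + covCrv G y v w u z = 0 := by
  have hc : ∀ k i j, ContDiffOn ℝ 2 (fun z => christoffel G z k i j) V := fun k i j =>
    (hG.contDiffOn_christoffel k i j).of_le two_le_infty
  simp only [covCrv, hG.fderiv_crv hy]
  rw [hG.chr_symm hy v u, hG.chr_symm hy v w, hG.chr_symm hy u w,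
    ddchr_comm hG.isOpen hc hy w u, ddchr_comm hG.isOpen hc hy v u,
    ddchr_comm hG.isOpen hc hy w v]
  rw [crv_antisymm G y v (chr G y w u), crv_antisymm G y w (chr G y u v),
    crv_antisymm G y (chr G y w v) u]
  simp only [crv_apply G y _ _ (chr G y _ _), map_sub, map_add]
  simp only [crv_apply, map_sub, map_add]
  abel

theorem PatchMetric.covCrv_skew (hG : PatchMetric V G) {y : Coord n} (hy : y ∈ V)
    (w u v z t : Coord n) :
    m2 (G y) (covCrv G y w u v z) t = - m2 (G y) (covCrv G y w u v t) z := by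
  have hGd : ∀ i j, DifferentiableAt ℝ (fun z => G z i j) y := fun i j =>
    hG.diffAt (hG.smooth i j) hy
  have h1 : ∀ z t, fderiv ℝ (fun x => m2 (G x) (crv G x u v z) t) y w
      = d2 G y w (crv G y u v z) t + m2 (G y) (fderiv ℝ (fun x => crv G x u v z) y w) t := by
    intro z t
    rw [fderiv_m2 hGd (hG.differentiableAt_crv_apply hy u v z) (differentiableAt_const t)]
    simp
  have h2 : fderiv ℝ (fun x => m2 (G x) (crv G x u v z) t) y w
      = - fderiv ℝ (fun x => m2 (G x) (crv G x u v t) z) y w := by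
    rw [fderiv_congr_on hG.isOpen (fun x hx => hG.crv_skew hx u v z t) hy, fderiv_fun_neg]
    simp
  rw [h1, h1, hG.d2_self hy, hG.d2_self hy] at h2
  simp only [covCrv, map_add, map_sub, ContinuousLinearMap.add_apply,
    ContinuousLinearMap.sub_apply]
  have k1 := hG.crv_skew hy (chr G y w u) v z t
  have k2 := hG.crv_skew hy u (chr G y w v) z t
  have k3 := hG.crv_skew hy u v (chr G y w z) t
  have k4 := hG.crv_skew hy u v (chr G y w t) z
  linarith

theorem covCrv_antisymm (hG : PatchMetric V G) {y : Coord n} (hy : y ∈ V) (w u v z : Coord n) :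
    covCrv G y w u v z = - covCrv G y w v u z := by
  have : fderiv ℝ (fun x => crv G x u v z) y w = - fderiv ℝ (fun x => crv G x v u z) y w := by
    rw [fderiv_congr_on hG.isOpen (fun x _ => crv_antisymm G x u v z) hy, fderiv_fun_neg]
    simp
  unfold covCrv
  rw [this, crv_antisymm G y (chr G y w u), crv_antisymm G y u (chr G y w v),
    crv_antisymm G y u v (chr G y w z), crv_antisymm G y u v z, map_neg]
  abel

theorem trace_comp_comm (A B : Coord n →L[ℝ] Coord n) :
    ∑ l, A (B (bv l)) l = ∑ l, B (A (bv l)) l := by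
  have h : ∀ (A B : Coord n →L[ℝ] Coord n) l, A (B (bv l)) l = ∑ m, B (bv l) m * A (bv m) l := by
    intro A B l
    conv_lhs => rw [← sum_bv (B (bv l))]
    simp
  simp only [h A B, h B A]
  rw [Finset.sum_comm]
  exact Finset.sum_congr rfl fun l _ => Finset.sum_congr rfl fun m _ => mul_comm _ _

/-- Covariant differentiation commutes with the trace that defines the Ricci tensor. -/
theorem PatchMetric.nabla2_ricciC (hG : PatchMetric V G) {y : Coord n} (hy : y ∈ V)
    {b : Fin n → Coord n} (hb : IsFrame (G y) b) (w v z : Coord n) :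
    m3 (nabla2 G (ricciC G) y) w v z = ∑ a, m2 (G y) (b a) (covCrv G y w (b a) v z) := by
  have hr : ∀ x, m2 (ricciC G x) v z = ∑ l, crv G x (bv l) v z l := by
    intro x
    revert v
    refine isLinearMap_eq ⟨by simp, by simp⟩ ⟨?_, ?_⟩ (fun i => ?_)
    · intro a b; simp [Finset.sum_add_distrib]
    · intro a b; simp [Finset.mul_sum]
    revert z
    refine isLinearMap_eq ⟨by simp, by simp⟩ ⟨?_, ?_⟩ (fun j => ?_)
    · intro a b; simp [Finset.sum_add_distrib]
    · intro a b; simp [Finset.mul_sum]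
    simp [ricciC]
  have hrd : ∀ i j, DifferentiableAt ℝ (fun z => ricciC G z i j) y := fun i j =>
    hG.diffAt (hG.contDiffOn_ricciC i j) hy
  have hcd := fun u => hG.differentiableAt_crv_apply hy u v z
  have hcl : ∀ l, DifferentiableAt ℝ (fun x => crv G x (bv l) v z l) y := fun l =>
    (differentiableAt_euclidean.1 (hcd (bv l))) l
  have h1 : d2 (ricciC G) y w v z = ∑ l, fderiv ℝ (fun x => crv G x (bv l) v z) y w l := by
    rw [← fderiv_m2_const hrd]
    simp only [hr]
    rw [fderiv_fun_sum (fun l _ => hcl l)]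
    simp only [ContinuousLinearMap.sum_apply]
    refine Finset.sum_congr rfl fun l _ => ?_
    have := ((EuclideanSpace.proj l : Coord n →L[ℝ] ℝ).hasFDerivAt.comp y
      (hcd (bv l)).hasFDerivAt).fderiv
    have h5 := congrArg (fun A : Coord n →L[ℝ] ℝ => A w) this
    simpa [Function.comp_def] using h5
  have h2 : ∀ u, fderiv ℝ (fun x => crv G x u v z) y w
      = (((((fderiv ℝ (fun x => crv G x) y w)).flip v).flip z) : Coord n →L[ℝ] Coord n) u := by
    intro u
    have := ((((hG.differentiableAt_crv hy).hasFDerivAt.clm_apply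
      (hasFDerivAt_const u y)).clm_apply (hasFDerivAt_const v y)).clm_apply
        (hasFDerivAt_const z y)).fderiv
    rw [this]
    simp
  set D : Coord n →L[ℝ] Coord n := ((fderiv ℝ (fun x => crv G x) y w).flip v).flip z with hD
  have h3 := hb.trace_end D
  set A : Coord n →L[ℝ] Coord n := ((crv G y).flip v).flip z with hA
  have h4 := trace_comp_comm A (chr G y w)
  have h5 := hb.trace_end (A.comp (chr G y w))
  have h6 := hb.trace_end ((chr G y w).comp A)
  simp only [ContinuousLinearMap.comp_apply] at h5 h6
  rw [m3_nabla2, h1]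
  simp only [h2]
  rw [h3, hG.m2_ricciC hy hb, hG.m2_ricciC hy hb]
  simp only [covCrv, map_add, map_sub, Finset.sum_add_distrib, Finset.sum_sub_distrib, h2]
  have e1 : ∀ u, crv G y u v z = A u := fun u => by simp [hA]
  simp only [e1]
  rw [← h5, ← h6, h4]
  ring

/-- The contracted second Bianchi identity `dR = 2 δ Ric`. -/
theorem PatchMetric.contracted_bianchi (hG : PatchMetric V G) {y : Coord n} (hy : y ∈ V)
    {b : Fin n → Coord n} (hb : IsFrame (G y) b) (w : Coord n) :
    fderiv ℝ (fun z => traceC G z (ricciC G z)) y w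
      = 2 * ∑ a, m3 (nabla2 G (ricciC G) y) (b a) (b a) w := by
  have hrd : ∀ i j, DifferentiableAt ℝ (fun z => ricciC G z i j) y := fun i j =>
    hG.diffAt (hG.contDiffOn_ricciC i j) hy
  rw [hG.fderiv_trace_eq hrd hy hb]
  have hsym : ∀ a, m3 (nabla2 G (ricciC G) y) (b a) (b a) w
      = m3 (nabla2 G (ricciC G) y) (b a) w (b a) := by
    intro a
    rw [m3_nabla2, m3_nabla2, hG.ricciC_symm hy (chr G y (b a) (b a)),
      hG.ricciC_symm hy (b a) (chr G y (b a) w),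
      SolitonVariation.d2_symm hG.isOpen (fun z hz i j => by
        have := hG.ricciC_symm hz (bv i) (bv j); simpa using this) hy]
    ring
  simp only [hsym, hG.nabla2_ricciC hy hb]
  -- each of the two other terms of the second Bianchi identity contributes one divergence of `Ric`
  have h1 : ∀ a c, m2 (G y) (b a) (covCrv G y w (b a) (b c) (b c))
      = m2 (G y) (b c) (covCrv G y (b a) (b c) w (b a))
        + m2 (G y) (b a) (covCrv G y (b c) (b a) w (b c)) := by
    intro a c
    have hB := congrArg (m2 (G y) (b a)) (hG.second_bianchi hy w (b a) (b c) (b c))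
    simp only [map_add, map_zero] at hB
    have k1 := hG.covCrv_skew hy (b a) (b c) w (b c) (b a)
    rw [hG.m2_symm hy _ (b a), hG.m2_symm hy _ (b c)] at k1
    rw [covCrv_antisymm hG hy (b c) w (b a), map_neg] at hB
    linarith
  simp only [h1, Finset.sum_add_distrib]
  rw [Finset.sum_comm, two_mul]

/-- The curvature endomorphism traced over a frame gives `-Ric`. -/
theorem PatchMetric.sum_crv (hG : PatchMetric V G) {y : Coord n} (hy : y ∈ V)
    {b : Fin n → Coord n} (hb : IsFrame (G y) b) (w : Coord n) :
    ∑ a, crv G y (b a) w (b a) = - ∑ c, m2 (ricciC G y) w (b c) • b c := by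
  refine hb.nondeg fun t => ?_
  rw [map_sum, map_neg, map_sum]
  simp only [map_smul]
  have e1 : ∑ c, m2 (ricciC G y) w (b c) • m2 (G y) t (b c) = m2 (ricciC G y) w t := by
    conv_rhs => rw [← hb.symm_of (hG.m2_symm hy) t]
    simp [mul_comm]
  rw [e1, hG.m2_ricciC hy hb, ← Finset.sum_neg_distrib]
  refine Finset.sum_congr rfl fun a _ => ?_
  have := hG.crv_skew hy (b a) w (b a) t
  rw [hG.m2_symm hy t, hG.m2_symm hy (b a)]
  exact this

theorem PatchMetric.m2_hessC_symm (hG : PatchMetric V G) {u : Coord n → ℝ}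
    (hu : ContDiffOn ℝ 2 u V) {y : Coord n} (hy : y ∈ V) (v w : Coord n) :
    m2 (hessC G u y) v w = m2 (hessC G u y) w v := by
  have hess : hessC G u y = nabla1 G (fun z a => pd a u z) y := rfl
  rw [hess, m2_nabla1, m2_nabla1, hG.chr_symm hy v w]
  congr 1
  revert v
  refine isLinearMap_eq ⟨by simp, by simp⟩ ⟨by simp, by simp⟩ (fun a => ?_)
  revert w
  refine isLinearMap_eq ⟨by simp, by simp⟩ ⟨by simp, by simp⟩ (fun c => ?_)
  simp only [d1, m2_bv]
  exact pd_comm hG.isOpen hu hy a c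

/-- The Bochner formula `δ ∇² u = d Δ u + Ric(∇ u)`. -/
theorem PatchMetric.bochner (hG : PatchMetric V G) {y : Coord n} (hy : y ∈ V)
    {b : Fin n → Coord n} (hb : IsFrame (G y) b) {u : Coord n → ℝ} (hu : ContDiffOn ℝ 3 u V)
    (w : Coord n) :
    ∑ a, m3 (nabla2 G (hessC G u) y) (b a) (b a) w
      = fderiv ℝ (fun z => traceC G z (hessC G u z)) y w
        + ∑ a, m2 (ricciC G y) w (b a) * m1 (fun i => pd i u y) (b a) := by
  have hα : ∀ i, ContDiffOn ℝ 2 (pd i u) V := fun i => contDiffOn_pd hG.isOpen (by norm_num) hu i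
  have hess : ∀ z, hessC G u z = nabla1 G (fun z a => pd a u z) z := fun z => rfl
  have hhd : ∀ i j, DifferentiableAt ℝ (fun z => hessC G u z i j) y := fun i j =>
    hG.diffAt (hG.contDiffOn_nabla1 (k := 1) (l := 2) (by norm_num) hα i j) hy
  have hsym : ∀ z ∈ V, ∀ v w, m2 (hessC G u z) v w = m2 (hessC G u z) w v := fun z hz =>
    hG.m2_hessC_symm (hu.of_le (by norm_num)) hz
  rw [hG.fderiv_trace_eq hhd hy hb]
  have h1 : ∀ a, m3 (nabla2 G (hessC G u) y) (b a) (b a) w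
      = m3 (nabla2 G (hessC G u) y) (b a) w (b a) := by
    intro a
    rw [m3_nabla2, m3_nabla2, hsym y hy (chr G y (b a) (b a)), hsym y hy (b a) (chr G y (b a) w),
      SolitonVariation.d2_symm hG.isOpen (fun z hz i j => by
        have := hsym z hz (bv i) (bv j); simpa using this) hy]
    ring
  have h2 : ∀ a, m3 (nabla2 G (hessC G u) y) (b a) w (b a)
      = m3 (nabla2 G (hessC G u) y) w (b a) (b a)
        - m1 (fun i => pd i u y) (crv G y (b a) w (b a)) := by
    intro a
    have := hG.ricci_identity1 (α := fun z i => pd i u z) hα hy (b a) w (b a)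
    change m3 (nabla2 G (hessC G u) y) _ _ _ - m3 (nabla2 G (hessC G u) y) _ _ _ = _ at this
    linarith
  simp only [h1, h2, Finset.sum_sub_distrib]
  rw [sub_eq_add_neg]
  congr 1
  rw [← map_sum, hG.sum_crv hy hb, map_neg, map_sum, neg_neg]
  simp

end Bianchi

/-! ### Naturality under changes of coordinates -/

section Naturality

variable {n : ℕ}

/-- `φ` is an isometric change of coordinates from `(V, G')` into `(W, G)`. -/
structure IsometricChange (V W : Set (Coord n)) (φ : Coord n → Coord n) (G' G : LocalMetric n) :
    Prop where
  source : PatchMetric V G'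
  target : PatchMetric W G
  mapsTo : ∀ z ∈ V, φ z ∈ W
  smooth : ContDiffOn ℝ ∞ φ V
  pull : ∀ z ∈ V, ∀ u v, m2 (G' z) u v = m2 (G (φ z)) (fderiv ℝ φ z u) (fderiv ℝ φ z v)

variable {V W : Set (Coord n)} {φ : Coord n → Coord n} {G' G : LocalMetric n} {y : Coord n}

namespace IsometricChange

theorem differentiableAt (H : IsometricChange V W φ G' G) (hy : y ∈ V) :
    DifferentiableAt ℝ φ y :=
  differentiableAt_of_contDiffOn H.source.isOpen (by norm_num) H.smooth hy

theorem contDiffOn_fderiv (H : IsometricChange V W φ G' G) :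
    ContDiffOn ℝ ∞ (fderiv ℝ φ) V :=
  H.smooth.fderiv_of_isOpen H.source.isOpen (by simp)

theorem differentiableAt_fderiv (H : IsometricChange V W φ G' G) (hy : y ∈ V) :
    DifferentiableAt ℝ (fderiv ℝ φ) y :=
  differentiableAt_of_contDiffOn H.source.isOpen (by norm_num) H.contDiffOn_fderiv hy

theorem differentiableAt_fderiv_apply (H : IsometricChange V W φ G' G) (hy : y ∈ V)
    (v : Coord n) : DifferentiableAt ℝ (fun z => fderiv ℝ φ z v) y :=
  (H.differentiableAt_fderiv hy).clm_apply (differentiableAt_const v)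

theorem fderiv_apply (H : IsometricChange V W φ G' G) (hy : y ∈ V) (u v : Coord n) :
    fderiv ℝ (fun z => fderiv ℝ φ z v) y u = fderiv ℝ (fderiv ℝ φ) y u v :=
  fderiv_apply_const (H.differentiableAt_fderiv hy) u v

theorem second_comm (H : IsometricChange V W φ G' G) (hy : y ∈ V) (u v : Coord n) :
    fderiv ℝ (fderiv ℝ φ) y u v = fderiv ℝ (fderiv ℝ φ) y v u :=
  fderiv_fderiv_comm H.source.isOpen (H.smooth.of_le two_le_infty) hy u v

theorem injective (H : IsometricChange V W φ G' G) (hy : y ∈ V) :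
    Function.Injective (fderiv ℝ φ y) := by
  intro u v huv
  obtain ⟨b, hb⟩ := H.source.exists_frame hy
  refine hb.nondeg fun w => ?_
  rw [H.pull y hy, H.pull y hy, huv]

theorem surjective (H : IsometricChange V W φ G' G) (hy : y ∈ V) :
    Function.Surjective (fderiv ℝ φ y) :=
  (LinearMap.injective_iff_surjective (f := (fderiv ℝ φ y : Coord n →ₗ[ℝ] Coord n))).1
    (H.injective hy)

theorem isFrame (H : IsometricChange V W φ G' G) (hy : y ∈ V) {b : Fin n → Coord n}
    (hb : IsFrame (G' y) b) : IsFrame (G (φ y)) fun a => fderiv ℝ φ y (b a) := by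
  intro a c
  rw [← H.pull y hy]
  exact hb a c

theorem differentiableAt_comp (H : IsometricChange V W φ G' G) (hy : y ∈ V) {f : Coord n → ℝ}
    (hf : DifferentiableAt ℝ f (φ y)) : DifferentiableAt ℝ (fun z => f (φ z)) y :=
  hf.comp y (H.differentiableAt hy)

theorem fderiv_comp (H : IsometricChange V W φ G' G) (hy : y ∈ V) {f : Coord n → ℝ}
    (hf : DifferentiableAt ℝ f (φ y)) (w : Coord n) :
    fderiv ℝ (fun z => f (φ z)) y w = fderiv ℝ f (φ y) (fderiv ℝ φ y w) := by
  have := _root_.fderiv_comp y hf (H.differentiableAt hy)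
  simp only [Function.comp_def] at this
  rw [this]
  rfl

theorem d1_comp (H : IsometricChange V W φ G' G) (hy : y ∈ V) {α : Coord n → Fin n → ℝ}
    (hα : ∀ i, DifferentiableAt ℝ (fun z => α z i) (φ y)) (w v : Coord n) :
    d1 (fun z => α (φ z)) y w v = d1 α (φ y) (fderiv ℝ φ y w) v := by
  rw [← fderiv_m1_const (fun i => H.differentiableAt_comp hy (hα i)), ← fderiv_m1_const hα]
  exact H.fderiv_comp hy (f := fun z => m1 (α z) v)
    ((differentiableAt_ofBasis hα).clm_apply (differentiableAt_const v)) w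

theorem d2_comp (H : IsometricChange V W φ G' G) (hy : y ∈ V) {h : Coord n → Fin n → Fin n → ℝ}
    (hh : ∀ i j, DifferentiableAt ℝ (fun z => h z i j) (φ y)) (w u v : Coord n) :
    d2 (fun z => h (φ z)) y w u v = d2 h (φ y) (fderiv ℝ φ y w) u v := by
  rw [← fderiv_m2_const (fun i j => H.differentiableAt_comp hy (hh i j)), ← fderiv_m2_const hh]
  exact H.fderiv_comp hy (f := fun z => m2 (h z) u v)
    (((differentiableAt_ofBasis fun i => differentiableAt_ofBasis fun j => hh i j).clm_apply
      (differentiableAt_const u)).clm_apply (differentiableAt_const v)) w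

theorem d1_pull (H : IsometricChange V W φ G' G) (hy : y ∈ V) {α' α : Coord n → Fin n → ℝ}
    (hα : ∀ i, DifferentiableAt ℝ (fun z => α z i) (φ y))
    (hα' : ∀ i, DifferentiableAt ℝ (fun z => α' z i) y)
    (e : ∀ z ∈ V, ∀ u, m1 (α' z) u = m1 (α (φ z)) (fderiv ℝ φ z u)) (w v : Coord n) :
    d1 α' y w v = d1 α (φ y) (fderiv ℝ φ y w) (fderiv ℝ φ y v)
      + m1 (α (φ y)) (fderiv ℝ (fderiv ℝ φ) y w v) := by
  rw [← fderiv_m1_const hα', fderiv_congr_on H.source.isOpen (fun z hz => e z hz v) hy,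
    fderiv_m1 (α := fun z => α (φ z)) (fun i => H.differentiableAt_comp hy (hα i))
      (H.differentiableAt_fderiv_apply hy v), H.d1_comp hy hα, H.fderiv_apply hy]

theorem d2_pull (H : IsometricChange V W φ G' G) (hy : y ∈ V)
    {h' h : Coord n → Fin n → Fin n → ℝ}
    (hh : ∀ i j, DifferentiableAt ℝ (fun z => h z i j) (φ y))
    (hh' : ∀ i j, DifferentiableAt ℝ (fun z => h' z i j) y)
    (e : ∀ z ∈ V, ∀ u v, m2 (h' z) u v = m2 (h (φ z)) (fderiv ℝ φ z u) (fderiv ℝ φ z v))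
    (w u v : Coord n) :
    d2 h' y w u v = d2 h (φ y) (fderiv ℝ φ y w) (fderiv ℝ φ y u) (fderiv ℝ φ y v)
      + m2 (h (φ y)) (fderiv ℝ (fderiv ℝ φ) y w u) (fderiv ℝ φ y v)
      + m2 (h (φ y)) (fderiv ℝ φ y u) (fderiv ℝ (fderiv ℝ φ) y w v) := by
  rw [← fderiv_m2_const hh', fderiv_congr_on H.source.isOpen (fun z hz => e z hz u v) hy,
    fderiv_m2 (h := fun z => h (φ z)) (fun i j => H.differentiableAt_comp hy (hh i j))
      (H.differentiableAt_fderiv_apply hy u) (H.differentiableAt_fderiv_apply hy v),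
    H.d2_comp hy hh, H.fderiv_apply hy, H.fderiv_apply hy]

/-- The transformation law of the Christoffel symbols. -/
theorem chr_pull (H : IsometricChange V W φ G' G) (hy : y ∈ V) (u v : Coord n) :
    fderiv ℝ φ y (chr G' y u v) = chr G (φ y) (fderiv ℝ φ y u) (fderiv ℝ φ y v)
      + fderiv ℝ (fderiv ℝ φ) y u v := by
  have hy' := H.mapsTo y hy
  obtain ⟨b, hb⟩ := H.target.exists_frame hy'
  refine hb.nondeg fun w => ?_
  obtain ⟨w, rfl⟩ := H.surjective hy w
  have hd := fun i j => H.target.diffAt (H.target.smooth i j) hy'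
  have hd' := fun i j => H.source.diffAt (H.source.smooth i j) hy
  have e := fun a b c => H.d2_pull hy hd hd' H.pull a b c
  have k1 := H.source.koszul hy u v w
  have k2 := H.target.koszul hy' (fderiv ℝ φ y u) (fderiv ℝ φ y v) (fderiv ℝ φ y w)
  rw [H.pull y hy, e u v w, e v u w, e w u v, H.second_comm hy v u, H.second_comm hy w u,
    H.second_comm hy w v] at k1
  rw [map_add]
  rw [H.target.m2_symm hy' (fderiv ℝ (fderiv ℝ φ) y u v),
    H.target.m2_symm hy' (fderiv ℝ (fderiv ℝ φ) y u w)] at k1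
  linarith

theorem nabla1_pull (H : IsometricChange V W φ G' G) (hy : y ∈ V) {α' α : Coord n → Fin n → ℝ}
    (hα : ∀ i, DifferentiableAt ℝ (fun z => α z i) (φ y))
    (hα' : ∀ i, DifferentiableAt ℝ (fun z => α' z i) y)
    (e : ∀ z ∈ V, ∀ u, m1 (α' z) u = m1 (α (φ z)) (fderiv ℝ φ z u)) (u v : Coord n) :
    m2 (nabla1 G' α' y) u v
      = m2 (nabla1 G α (φ y)) (fderiv ℝ φ y u) (fderiv ℝ φ y v) := by
  rw [m2_nabla1, m2_nabla1, H.d1_pull hy hα hα' e, e y hy, H.chr_pull hy, map_add]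
  ring

theorem nabla2_pull (H : IsometricChange V W φ G' G) (hy : y ∈ V)
    {h' h : Coord n → Fin n → Fin n → ℝ}
    (hh : ∀ i j, DifferentiableAt ℝ (fun z => h z i j) (φ y))
    (hh' : ∀ i j, DifferentiableAt ℝ (fun z => h' z i j) y)
    (e : ∀ z ∈ V, ∀ u v, m2 (h' z) u v = m2 (h (φ z)) (fderiv ℝ φ z u) (fderiv ℝ φ z v))
    (w u v : Coord n) :
    m3 (nabla2 G' h' y) w u v
      = m3 (nabla2 G h (φ y)) (fderiv ℝ φ y w) (fderiv ℝ φ y u) (fderiv ℝ φ y v) := by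
  rw [m3_nabla2, m3_nabla2, H.d2_pull hy hh hh' e, e y hy, e y hy, H.chr_pull hy, H.chr_pull hy]
  simp only [map_add, ContinuousLinearMap.add_apply]
  ring

theorem dchr_pull (H : IsometricChange V W φ G' G) (hy : y ∈ V) (w u v : Coord n) :
    fderiv ℝ (fderiv ℝ φ) y w (chr G' y u v) + fderiv ℝ φ y (dchr G' y w u v)
      = dchr G (φ y) (fderiv ℝ φ y w) (fderiv ℝ φ y u) (fderiv ℝ φ y v)
        + chr G (φ y) (fderiv ℝ (fderiv ℝ φ) y w u) (fderiv ℝ φ y v)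
        + chr G (φ y) (fderiv ℝ φ y u) (fderiv ℝ (fderiv ℝ φ) y w v)
        + fderiv ℝ (fun z => fderiv ℝ (fderiv ℝ φ) z u v) y w := by
  have hy' := H.mapsTo y hy
  have h1 : fderiv ℝ (fun z => fderiv ℝ φ z (chr G' z u v)) y w
      = fderiv ℝ (fderiv ℝ φ) y w (chr G' y u v) + fderiv ℝ φ y (dchr G' y w u v) := by
    rw [← H.source.fderiv_chr_const hy]
    have := ((H.differentiableAt_fderiv hy).hasFDerivAt.clm_apply
      (differentiableAt_chr H.source hy u v).hasFDerivAt).fderiv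
    rw [this]
    simp [add_comm]
  have hchr : DifferentiableAt ℝ (fun z => chr G z) (φ y) :=
    differentiableAt_ofBasis fun i => differentiableAt_ofBasis fun j =>
      (differentiableAt_euclidean).2 fun k =>
        H.target.diffAt (H.target.contDiffOn_christoffel k i j) hy'
  have hc2 : DifferentiableAt ℝ (fun z => fderiv ℝ (fderiv ℝ φ) z u v) y := by
    have : ContDiffOn ℝ ∞ (fderiv ℝ (fderiv ℝ φ)) V :=
      H.contDiffOn_fderiv.fderiv_of_isOpen H.source.isOpen (by simp)
    exact ((differentiableAt_of_contDiffOn H.source.isOpen (by norm_num) this hy).clm_apply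
      (differentiableAt_const u)).clm_apply (differentiableAt_const v)
  have hcc := hchr.hasFDerivAt.comp y (H.differentiableAt hy).hasFDerivAt
  have hcu := (H.differentiableAt_fderiv_apply hy u).hasFDerivAt
  have hcv := (H.differentiableAt_fderiv_apply hy v).hasFDerivAt
  have h2 := ((hcc.clm_apply hcu).clm_apply hcv).fun_add hc2.hasFDerivAt
  have h3 := h2.fderiv
  have h4 : fderiv ℝ (fun z => fderiv ℝ φ z (chr G' z u v)) y = fderiv ℝ (fun z =>
      chr G (φ z) (fderiv ℝ φ z u) (fderiv ℝ φ z v) + fderiv ℝ (fderiv ℝ φ) z u v) y :=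
    fderiv_congr_on H.source.isOpen (fun z hz => H.chr_pull hz u v) hy
  rw [← h1, h4]
  simp only [Function.comp_def] at h3
  rw [h3]
  have h5 : ∀ a b c, fderiv ℝ (fun z => chr G z) (φ y) a b c = dchr G (φ y) a b c := by
    intro a b c
    rw [← H.target.fderiv_chr_const hy']
    have := ((hchr.hasFDerivAt.clm_apply (hasFDerivAt_const b (φ y))).clm_apply
      (hasFDerivAt_const c (φ y))).fderiv
    rw [this]
    simp
  simp only [ContinuousLinearMap.add_apply, ContinuousLinearMap.comp_apply,
    ContinuousLinearMap.flip_apply, h5, H.fderiv_apply hy]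
  abel

theorem third_comm (H : IsometricChange V W φ G' G) (hy : y ∈ V) (w u v : Coord n) :
    fderiv ℝ (fun z => fderiv ℝ (fderiv ℝ φ) z u v) y w
      = fderiv ℝ (fun z => fderiv ℝ (fderiv ℝ φ) z w v) y u := by
  have hV := H.source.isOpen
  have h1 : ∀ u, ∀ z ∈ V, fderiv ℝ (fderiv ℝ φ) z u v
      = fderiv ℝ (fun x => fderiv ℝ φ x v) z u := fun u z hz => (H.fderiv_apply hz u v).symm
  have hc : ContDiffOn ℝ ∞ (fun x => fderiv ℝ φ x v) V :=
    H.contDiffOn_fderiv.clm_apply contDiffOn_const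
  have hd : DifferentiableAt ℝ (fderiv ℝ (fun x => fderiv ℝ φ x v)) y :=
    differentiableAt_of_contDiffOn hV (by norm_num) (hc.fderiv_of_isOpen hV (m := ∞) (by simp)) hy
  rw [fderiv_congr_on hV (h1 u) hy, fderiv_congr_on hV (h1 w) hy, fderiv_apply_const hd,
    fderiv_apply_const hd, fderiv_fderiv_comm hV (hc.of_le two_le_infty) hy]

/-- The curvature is natural: the third derivatives of `φ` cancel by their symmetry. -/
theorem crv_pull (H : IsometricChange V W φ G' G) (hy : y ∈ V) (u v w : Coord n) :
    fderiv ℝ φ y (crv G' y u v w)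
      = crv G (φ y) (fderiv ℝ φ y u) (fderiv ℝ φ y v) (fderiv ℝ φ y w) := by
  have h1 := H.dchr_pull hy u v w
  have h2 := H.dchr_pull hy v u w
  rw [← H.third_comm hy u v w, H.second_comm hy v u] at h2
  rw [crv_apply, crv_apply]
  simp only [map_add, map_sub, H.chr_pull hy] at h1 h2 ⊢
  have h3 := congrArg₂ (fun a b => a - b) h1 h2
  rw [sub_eq_iff_eq_add] at h3
  rw [← sub_eq_zero] at h3 ⊢
  refine Eq.trans ?_ h3
  abel

theorem ricciC_pull (H : IsometricChange V W φ G' G) (hy : y ∈ V) (v w : Coord n) :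
    m2 (ricciC G' y) v w = m2 (ricciC G (φ y)) (fderiv ℝ φ y v) (fderiv ℝ φ y w) := by
  obtain ⟨b, hb⟩ := H.source.exists_frame hy
  rw [H.source.m2_ricciC hy hb, H.target.m2_ricciC (H.mapsTo y hy) (H.isFrame hy hb)]
  simp only [← H.crv_pull hy, ← H.pull y hy]

theorem traceC_pull (H : IsometricChange V W φ G' G) (hy : y ∈ V) {T' T : Fin n → Fin n → ℝ}
    (e : ∀ u v, m2 T' u v = m2 T (fderiv ℝ φ y u) (fderiv ℝ φ y v)) :
    traceC G' y T' = traceC G (φ y) T := by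
  obtain ⟨b, hb⟩ := H.source.exists_frame hy
  rw [hb.traceC, (H.isFrame hy hb).traceC]
  simp only [e]

theorem pd_pull (H : IsometricChange V W φ G' G) (hy : y ∈ V) {u' u : Coord n → ℝ}
    (hu : DifferentiableAt ℝ u (φ y)) (e : ∀ z ∈ V, u' z = u (φ z)) (v : Coord n) :
    m1 (fun i => pd i u' y) v = m1 (fun i => pd i u (φ y)) (fderiv ℝ φ y v) := by
  rw [← fderiv_eq_m1, ← fderiv_eq_m1, fderiv_congr_on H.source.isOpen e hy, H.fderiv_comp hy hu]

theorem hessC_pull (H : IsometricChange V W φ G' G) (hy : y ∈ V) {u' u : Coord n → ℝ}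
    (hu : ContDiffOn ℝ 2 u W) (e : ∀ z ∈ V, u' z = u (φ z)) (v w : Coord n) :
    m2 (hessC G' u' y) v w = m2 (hessC G u (φ y)) (fderiv ℝ φ y v) (fderiv ℝ φ y w) := by
  have hu' : ContDiffOn ℝ 2 u' V :=
    (hu.comp (H.smooth.of_le two_le_infty) H.mapsTo).congr e
  exact H.nabla1_pull (α' := fun z a => pd a u' z) (α := fun z a => pd a u z) hy
    (fun i => H.target.diffAt (contDiffOn_pd H.target.isOpen (k := 1) (by norm_num) hu i)
      (H.mapsTo y hy))
    (fun i => H.source.diffAt (contDiffOn_pd H.source.isOpen (k := 1) (by norm_num) hu' i) hy)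
    (fun z hz u => H.pd_pull hz (H.target.diffAt hu (H.mapsTo z hz) (by norm_num)) e u) v w

end IsometricChange

theorem IsFrame.m1_divC {b : Fin n → Coord n}
    (hb : IsFrame (G y) b) (h : Coord n → Fin n → Fin n → ℝ) (v : Coord n) :
    m1 (divC G h y) v = ∑ a, m3 (nabla2 G h y) (b a) (b a) v := by
  revert v
  refine isLinearMap_eq ⟨by simp, by simp⟩ ⟨?_, ?_⟩ (fun j => ?_)
  · intro a b; simp [Finset.sum_add_distrib]
  · intro a b; simp [Finset.mul_sum]
  simp only [m1_bv, divC, m3_apply_eq3]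
  rw [hb.sum_invG (fun i k => nabla2 G h y i k j)]
  simp [Pi.single_apply]

theorem IsometricChange.divC_pull (H : IsometricChange V W φ G' G) (hy : y ∈ V)
    {h' h : Coord n → Fin n → Fin n → ℝ}
    (hh : ∀ i j, DifferentiableAt ℝ (fun z => h z i j) (φ y))
    (hh' : ∀ i j, DifferentiableAt ℝ (fun z => h' z i j) y)
    (e : ∀ z ∈ V, ∀ u v, m2 (h' z) u v = m2 (h (φ z)) (fderiv ℝ φ z u) (fderiv ℝ φ z v))
    (v : Coord n) :
    m1 (divC G' h' y) v = m1 (divC G h (φ y)) (fderiv ℝ φ y v) := by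
  obtain ⟨b, hb⟩ := H.source.exists_frame hy
  rw [hb.m1_divC, (H.isFrame hy hb).m1_divC]
  simp only [H.nabla2_pull hy hh hh' e]

end Naturality

/-! ### Linearization along a path of metrics -/

section Linearization

variable {n : ℕ}

variable {V : Set (Coord n)} {G : LocalMetric n}

/-- The pair symmetry of the curvature, by the octahedron of first Bianchi identities. -/
theorem PatchMetric.crv_pair (H : PatchMetric V G) {y : Coord n} (hy : y ∈ V)
    (u v w t : Coord n) : m2 (G y) (crv G y u v w) t = m2 (G y) (crv G y w t u) v := by
  have B := fun a b c d => congrArg (fun X => m2 (G y) X d) (H.first_bianchi hy a b c)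
  simp only [map_add, ContinuousLinearMap.add_apply, map_zero,
    ContinuousLinearMap.zero_apply] at B
  have S := fun a b c d => H.crv_skew hy a b c d
  have A : ∀ a b c d, m2 (G y) (crv G y a b c) d = - m2 (G y) (crv G y b a c) d := by
    intro a b c d
    rw [crv_antisymm G y a b]; simp
  have b1 := B u v w t
  have b2 := B v w t u
  have b3 := B w t u v
  have b4 := B t u v w
  have s1 := S u v w t
  have s2 := S v w u t
  have s3 := S w u v t
  have s4 := S w t v u
  have s5 := S t v w u
  have s6 := S u w t v
  have s7 := S t u w v
  have a1 := A v w t u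
  have a2 := A w u v t
  have a3 := A t u w v
  have a4 := A t v w u
  have a5 := A u w t v
  have a6 := A v t u w
  have a7 := A w u t v
  have a8 := A t u v w
  have s8 := S v t u w
  have s9 := S w u t v
  have s10 := S t u v w
  have s11 := S v w t u
  have s12 := S u v t w
  linarith

/-! #### Functions depending smoothly on a parameter -/

/-- `f s y` is smooth jointly in `(s, y)`, for `|s| < ε` and `y ∈ V`. -/
def JointSmooth (ε : ℝ) (V : Set (Coord n)) (f : ℝ → Coord n → ℝ) : Prop :=
  ContDiffOn ℝ ∞ (fun p : ℝ × Coord n => f p.1 p.2) (Ioo (-ε) ε ×ˢ V)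

variable {ε : ℝ} {f : ℝ → Coord n → ℝ} {y : Coord n}

theorem JointSmooth.differentiableAt (hf : JointSmooth ε V f) (hV : IsOpen V) {s : ℝ}
    (hs : s ∈ Ioo (-ε) ε) (hy : y ∈ V) :
    DifferentiableAt ℝ (fun p : ℝ × Coord n => f p.1 p.2) (s, y) :=
  differentiableAt_of_contDiffOn (isOpen_Ioo.prod hV) (by norm_num) hf ⟨hs, hy⟩

theorem JointSmooth.pd_eq (hf : JointSmooth ε V f) (hV : IsOpen V) {s : ℝ}
    (hs : s ∈ Ioo (-ε) ε) (hy : y ∈ V) (i : Fin n) :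
    pd i (f s) y = fderiv ℝ (fun p : ℝ × Coord n => f p.1 p.2) (s, y) (0, bv i) := by
  have h1 := (hf.differentiableAt hV hs hy).hasFDerivAt
  have h2 : HasFDerivAt (fun z : Coord n => (s, z)) (ContinuousLinearMap.inr ℝ ℝ (Coord n)) y :=
    hasFDerivAt_prodMk_right s y
  have h3 := (h1.comp y h2).fderiv
  simp only [Function.comp_def] at h3
  unfold pd
  rw [h3]
  simp

theorem JointSmooth.hasDerivAt (hf : JointSmooth ε V f) (hV : IsOpen V) {s : ℝ}
    (hs : s ∈ Ioo (-ε) ε) (hy : y ∈ V) :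
    HasDerivAt (fun s => f s y)
      (fderiv ℝ (fun p : ℝ × Coord n => f p.1 p.2) (s, y) (1, 0)) s := by
  have h1 := (hf.differentiableAt hV hs hy).hasFDerivAt
  have h2 : HasDerivAt (fun s : ℝ => (s, y)) (1, 0) s :=
    (hasDerivAt_id s).prodMk (hasDerivAt_const s y)
  exact h1.comp_hasDerivAt s h2

theorem JointSmooth.pd (hf : JointSmooth ε V f) (hV : IsOpen V) (i : Fin n) :
    JointSmooth ε V (fun s => pd i (f s)) := by
  have hO := (isOpen_Ioo (a := -ε) (b := ε)).prod hV
  have h1 : ContDiffOn ℝ ∞ (fun p => fderiv ℝ (fun p : ℝ × Coord n => f p.1 p.2) p (0, bv i))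
      (Ioo (-ε) ε ×ˢ V) :=
    (hf.fderiv_of_isOpen hO (by simp)).clm_apply contDiffOn_const
  exact h1.congr fun p hp => hf.pd_eq hV hp.1 hp.2 i

theorem JointSmooth.slice (hf : JointSmooth ε V f) {s : ℝ} (hs : s ∈ Ioo (-ε) ε) :
    ContDiffOn ℝ ∞ (f s) V :=
  ContDiffOn.comp (g := fun p : ℝ × Coord n => f p.1 p.2) (f := fun z => (s, z)) hf
    (contDiff_prodMk_right s).contDiffOn fun _ hz => ⟨hs, hz⟩

theorem JointSmooth.contDiffOn_deriv (hf : JointSmooth ε V f) (hV : IsOpen V) {s : ℝ}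
    (hs : s ∈ Ioo (-ε) ε) : ContDiffOn ℝ ∞ (fun z => deriv (fun s => f s z) s) V := by
  have hO := (isOpen_Ioo (a := -ε) (b := ε)).prod hV
  have h1 : ContDiffOn ℝ ∞ (fun p => fderiv ℝ (fun p : ℝ × Coord n => f p.1 p.2) p (1, 0))
      (Ioo (-ε) ε ×ˢ V) :=
    (hf.fderiv_of_isOpen hO (by simp)).clm_apply contDiffOn_const
  have h2 : ContDiffOn ℝ ∞ (fun z => fderiv ℝ (fun p : ℝ × Coord n => f p.1 p.2) (s, z) (1, 0)) V :=
    ContDiffOn.comp (g := fun p => fderiv ℝ (fun p : ℝ × Coord n => f p.1 p.2) p (1, 0))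
      (f := fun z => (s, z)) h1 (contDiff_prodMk_right s).contDiffOn fun _ hz => ⟨hs, hz⟩
  exact h2.congr fun z hz => (hf.hasDerivAt hV hs hz).deriv

/-- Differentiation in the parameter commutes with partial derivatives. -/
theorem JointSmooth.hasDerivAt_pd (hf : JointSmooth ε V f) (hV : IsOpen V) {s : ℝ}
    (hs : s ∈ Ioo (-ε) ε) (hy : y ∈ V) {f' : Coord n → ℝ}
    (hf' : ∀ z ∈ V, HasDerivAt (fun s => f s z) (f' z) s) (i : Fin n) :
    HasDerivAt (fun s => SolitonVariation.pd i (f s) y) (SolitonVariation.pd i f' y) s := by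
  have hO := (isOpen_Ioo (a := -ε) (b := ε)).prod hV
  set F : ℝ × Coord n → ℝ := fun p => f p.1 p.2 with hF
  have hF2 : ContDiffAt ℝ 2 F (s, y) :=
    (hf.of_le two_le_infty).contDiffAt (hO.mem_nhds ⟨hs, hy⟩)
  have hdF : DifferentiableAt ℝ (fderiv ℝ F) (s, y) :=
    differentiableAt_of_contDiffOn hO (k := 1) le_rfl
      ((hf.of_le two_le_infty).fderiv_of_isOpen hO (by norm_num)) ⟨hs, hy⟩
  have h1 : HasDerivAt (fun s => fderiv ℝ F (s, y) (0, bv i))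
      (fderiv ℝ (fderiv ℝ F) (s, y) (1, 0) (0, bv i)) s := by
    have h2 : HasDerivAt (fun s : ℝ => (s, y)) (1, 0) s :=
      (hasDerivAt_id s).prodMk (hasDerivAt_const s y)
    have h3 := hdF.hasFDerivAt.comp_hasDerivAt s h2
    have h4 := h3.clm_apply (hasDerivAt_const s ((0 : ℝ), (bv i : Coord n)))
    simpa using h4
  have h5 : SolitonVariation.pd i f' y = fderiv ℝ (fderiv ℝ F) (s, y) (1, 0) (0, bv i) := by
    have e : ∀ z ∈ V, f' z = fderiv ℝ F (s, z) (1, 0) := fun z hz =>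
      (hf' z hz).unique (hf.hasDerivAt hV hs hz)
    rw [pd_congr_on hV e hy]
    have h2 : HasFDerivAt (fun z : Coord n => (s, z)) (ContinuousLinearMap.inr ℝ ℝ (Coord n)) y :=
      hasFDerivAt_prodMk_right s y
    have h6 := ((hdF.hasFDerivAt.comp y h2).clm_apply
      (hasFDerivAt_const ((1 : ℝ), (0 : Coord n)) y)).fderiv
    simp only [Function.comp_def] at h6
    unfold SolitonVariation.pd
    rw [h6]
    have := (hF2.isSymmSndFDerivAt (by simp)) (0, bv i) (1, 0)
    simpa using this
  rw [h5]
  refine h1.congr_of_eventuallyEq ?_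
  filter_upwards [isOpen_Ioo.mem_nhds hs] with t ht
  exact hf.pd_eq hV ht hy i

/-! #### Paths of metrics on a patch -/

/-- `Γ s` is a smooth family of metrics on `V`, for `|s| < ε`, with velocity `h` at `0`. -/
structure PatchPath (ε : ℝ) (V : Set (Coord n)) (Γ : ℝ → LocalMetric n)
    (h : Coord n → Fin n → Fin n → ℝ) : Prop where
  pos : 0 < ε
  metric : ∀ s ∈ Ioo (-ε) ε, PatchMetric V (Γ s)
  smooth : ∀ i j, JointSmooth ε V (fun s z => Γ s z i j)
  velocity : ∀ z ∈ V, ∀ i j, HasDerivAt (fun s => Γ s z i j) (h z i j) 0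

theorem hasDerivAt_m2 {A : ℝ → Fin n → Fin n → ℝ} {A' : Fin n → Fin n → ℝ} {s : ℝ}
    (hA : ∀ i j, HasDerivAt (fun t => A t i j) (A' i j) s) (u v : Coord n) :
    HasDerivAt (fun t => m2 (A t) u v) (m2 A' u v) s := by
  simp only [m2_apply]
  exact HasDerivAt.fun_sum fun i _ => HasDerivAt.fun_sum fun j _ =>
    ((hA i j).const_mul _).const_mul _

theorem hasDerivAt_m2_vec {A : ℝ → Fin n → Fin n → ℝ} {A' : Fin n → Fin n → ℝ} {s : ℝ}
    (hA : ∀ i j, HasDerivAt (fun t => A t i j) (A' i j) s) (u : Coord n) {q : ℝ → Coord n}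
    {q' : Coord n} (hq : ∀ i, HasDerivAt (fun t => q t i) (q' i) s) :
    HasDerivAt (fun t => m2 (A t) u (q t)) (m2 A' u (q s) + m2 (A s) u q') s := by
  simp only [m2_apply, ← Finset.sum_add_distrib]
  refine HasDerivAt.fun_sum fun i _ => HasDerivAt.fun_sum fun j _ => ?_
  have := (((hq j).mul (hA i j)).const_mul (u i))
  refine this.congr_deriv ?_
  ring

theorem gam_apply (c : Fin n → Fin n → Fin n → ℝ) (u v : Coord n) :
    gam c u v = vec fun k => m2 (c k) u v := by
  revert u
  refine isLinearMap_eq ⟨by simp, by simp⟩ ⟨?_, ?_⟩ (fun i => ?_)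
  · intro a b; ext k; simp
  · intro a b; ext k; simp
  revert v
  refine isLinearMap_eq ⟨by simp, by simp⟩ ⟨?_, ?_⟩ (fun j => ?_)
  · intro a b; ext k; simp
  · intro a b; ext k; simp
  · simp

namespace PatchPath

variable {Γ : ℝ → LocalMetric n} {h : Coord n → Fin n → Fin n → ℝ}

theorem zero_mem (H : PatchPath ε V Γ h) : (0 : ℝ) ∈ Ioo (-ε) ε := ⟨by linarith [H.pos], H.pos⟩

theorem base (H : PatchPath ε V Γ h) : PatchMetric V (Γ 0) := H.metric 0 H.zero_mem

theorem isOpen (H : PatchPath ε V Γ h) : IsOpen V := H.base.isOpen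

theorem contDiffOn_h (H : PatchPath ε V Γ h) (i j : Fin n) :
    ContDiffOn ℝ ∞ (fun z => h z i j) V :=
  ((H.smooth i j).contDiffOn_deriv H.isOpen H.zero_mem).congr fun z hz =>
    (H.velocity z hz i j).deriv.symm

theorem h_symm (H : PatchPath ε V Γ h) {z : Coord n} (hz : z ∈ V) (i j : Fin n) :
    h z i j = h z j i := by
  refine (H.velocity z hz i j).unique ((H.velocity z hz j i).congr_of_eventuallyEq ?_)
  filter_upwards [isOpen_Ioo.mem_nhds H.zero_mem] with t ht
  exact (H.metric t ht).symm hz i j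

theorem m2_h_symm (H : PatchPath ε V Γ h) {z : Coord n} (hz : z ∈ V) (u v : Coord n) :
    m2 (h z) u v = m2 (h z) v u := m2_symm (H.h_symm hz) u v

theorem jointSmooth_invG (H : PatchPath ε V Γ h) (i j : Fin n) :
    JointSmooth ε V (fun s z => invG (Γ s) z i j) := by
  exact contDiffOn_inv (A := fun (p : ℝ × Coord n) i j => Γ p.1 p.2 i j) (fun i j => H.smooth i j)
    (fun p hp => ((H.metric p.1 hp.1).posDef p.2 hp.2).det_pos.ne') i j

theorem jointSmooth_christoffel (H : PatchPath ε V Γ h) (k i j : Fin n) :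
    JointSmooth ε V (fun s z => christoffel (Γ s) z k i j) := by
  have h1 := H.jointSmooth_invG
  have h2 := fun i j l => (H.smooth i j).pd H.isOpen l
  unfold JointSmooth at *
  unfold christoffel
  fun_prop

theorem jointSmooth_riem (H : PatchPath ε V Γ h) (i j k l : Fin n) :
    JointSmooth ε V (fun s z => riem (Γ s) z i j k l) := by
  have h1 := H.jointSmooth_christoffel
  have h2 := fun i j k l => (h1 i j k).pd H.isOpen l
  unfold JointSmooth at *
  unfold riem
  fun_prop

theorem jointSmooth_ricciC (H : PatchPath ε V Γ h) (j k : Fin n) :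
    JointSmooth ε V (fun s z => ricciC (Γ s) z j k) := by
  have h1 := H.jointSmooth_riem
  unfold JointSmooth at *
  unfold ricciC
  fun_prop

/-- The components of the derivative of the Christoffel symbols at `s = 0`. -/
def chrVar (Γ : ℝ → LocalMetric n) (y : Coord n) (k i j : Fin n) : ℝ :=
  deriv (fun s => christoffel (Γ s) y k i j) 0

theorem hasDerivAt_christoffel (H : PatchPath ε V Γ h) {z : Coord n} (hz : z ∈ V)
    (k i j : Fin n) : HasDerivAt (fun s => christoffel (Γ s) z k i j) (chrVar Γ z k i j) 0 := by
  have := (H.jointSmooth_christoffel k i j).hasDerivAt H.isOpen H.zero_mem hz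
  exact this.differentiableAt.hasDerivAt

theorem contDiffOn_chrVar (H : PatchPath ε V Γ h) (k i j : Fin n) :
    ContDiffOn ℝ ∞ (fun z => chrVar Γ z k i j) V :=
  (H.jointSmooth_christoffel k i j).contDiffOn_deriv H.isOpen H.zero_mem

/-- The derivative of the Christoffel symbols is the tensor
`½ g^{kl} (∇ᵢ h_{jl} + ∇ⱼ h_{il} - ∇_l h_{ij})`. -/
theorem koszul (H : PatchPath ε V Γ h) (hy : y ∈ V) (u v w : Coord n) :
    2 * m2 (Γ 0 y) w (gam (chrVar Γ y) u v)
      = m3 (nabla2 (Γ 0) h y) u v w + m3 (nabla2 (Γ 0) h y) v u w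
        - m3 (nabla2 (Γ 0) h y) w u v := by
  have hd2 : ∀ u v w, HasDerivAt (fun s => d2 (Γ s) y u v w) (d2 h y u v w) 0 := by
    intro u v w
    simp only [d2, m3_apply_eq]
    refine hasDerivAt_m2 (fun i j => HasDerivAt.fun_sum fun k _ => HasDerivAt.const_mul _ ?_) v w
    exact (H.smooth i j).hasDerivAt_pd H.isOpen H.zero_mem hy
      (fun z hz => H.velocity z hz i j) k
  have hq : ∀ k, HasDerivAt (fun s => chr (Γ s) y u v k) (gam (chrVar Γ y) u v k) 0 := by
    intro k
    simp only [chr, gam_apply, vec_apply]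
    exact hasDerivAt_m2 (fun i j => H.hasDerivAt_christoffel hy k i j) u v
  have h1 := (hasDerivAt_m2_vec (H.velocity y hy) w hq).const_mul 2
  have h2 := ((hd2 u v w).add (hd2 v u w)).sub (hd2 w u v)
  have h3 := h1.unique (h2.congr_of_eventuallyEq (by
    filter_upwards [isOpen_Ioo.mem_nhds H.zero_mem] with t ht
    exact (H.metric t ht).koszul hy u v w))
  simp only [m3_nabla2]
  have e1 := H.base.chr_symm hy v u
  have e2 := H.base.chr_symm hy w u
  have e3 := H.base.chr_symm hy w v
  rw [e1, e2, e3, H.m2_h_symm hy (chr (Γ 0) y u v) w, H.m2_h_symm hy v,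
    H.m2_h_symm hy (chr (Γ 0) y u w) v]
  rw [H.m2_h_symm hy v] at *
  linarith

theorem differentiableAt_chrVar (H : PatchPath ε V Γ h) (hy : y ∈ V) (u v : Coord n) :
    DifferentiableAt ℝ (fun z => gam (chrVar Γ z) u v) y := by
  have : DifferentiableAt ℝ (fun z => gam (chrVar Γ z)) y :=
    differentiableAt_ofBasis fun i => differentiableAt_ofBasis fun j =>
      (differentiableAt_euclidean).2 fun k => H.base.diffAt (H.contDiffOn_chrVar k i j) hy
  exact (this.clm_apply (differentiableAt_const u)).clm_apply (differentiableAt_const v)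

/-- The directional derivatives of the variation of the Christoffel symbols. -/
def dchrVar (Γ : ℝ → LocalMetric n) (y : Coord n) :
    Coord n →L[ℝ] Coord n →L[ℝ] Coord n →L[ℝ] Coord n :=
  ofBasis fun m => gam fun k i j => pd m (fun z => chrVar Γ z k i j) y

/-- The covariant derivative of the variation of the Christoffel symbols. -/
def covVar (Γ : ℝ → LocalMetric n) (y u v w : Coord n) : Coord n :=
  dchrVar Γ y u v w + chr (Γ 0) y u (gam (chrVar Γ y) v w)
    - gam (chrVar Γ y) (chr (Γ 0) y u v) w - gam (chrVar Γ y) v (chr (Γ 0) y u w)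

theorem contDiffOn_nabla2 (H : PatchPath ε V Γ h) (a i j : Fin n) :
    ContDiffOn ℝ ∞ (fun z => nabla2 (Γ 0) h z a i j) V :=
  H.base.contDiffOn_nabla2 (k := ⊤) (l := ⊤) (by simp) (fun i j => H.contDiffOn_h i j) a i j

/-- The covariant derivative of the Koszul formula for the varied Christoffel symbols. -/
theorem m2_covVar (H : PatchPath ε V Γ h) (hy : y ∈ V) (u v w z : Coord n) :
    2 * m2 (Γ 0 y) z (covVar Γ y u v w)
      = m4 (nabla3 (Γ 0) (nabla2 (Γ 0) h) y) u v w z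
        + m4 (nabla3 (Γ 0) (nabla2 (Γ 0) h) y) u w v z
        - m4 (nabla3 (Γ 0) (nabla2 (Γ 0) h) y) u z v w := by
  have hn : ∀ a i j, DifferentiableAt ℝ (fun z => nabla2 (Γ 0) h z a i j) y := fun a i j =>
    H.base.diffAt (H.contDiffOn_nabla2 a i j) hy
  have hGd : ∀ i j, DifferentiableAt ℝ (fun z => Γ 0 z i j) y := fun i j =>
    H.base.diffAt (H.base.smooth i j) hy
  have hm3 : ∀ a b c, DifferentiableAt ℝ (fun x => m3 (nabla2 (Γ 0) h x) a b c) y := by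
    intro a b c
    have : DifferentiableAt ℝ (fun x => m3 (nabla2 (Γ 0) h x)) y :=
      differentiableAt_ofBasis fun a => differentiableAt_ofBasis fun i => differentiableAt_ofBasis fun j => hn a i j
    exact ((this.clm_apply (differentiableAt_const a)).clm_apply
      (differentiableAt_const b)).clm_apply (differentiableAt_const c)
  have h1 : fderiv ℝ (fun x => 2 * m2 (Γ 0 x) z (gam (chrVar Γ x) v w)) y u
      = d3 (nabla2 (Γ 0) h) y u v w z + d3 (nabla2 (Γ 0) h) y u w v z
        - d3 (nabla2 (Γ 0) h) y u z v w := by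
    rw [fderiv_congr_on H.isOpen (fun x hx => H.koszul hx v w z) hy,
      fderiv_fun_sub ((hm3 v w z).fun_add (hm3 w v z)) (hm3 z v w),
      fderiv_fun_add (hm3 v w z) (hm3 w v z)]
    simp only [ContinuousLinearMap.sub_apply, ContinuousLinearMap.add_apply, fderiv_m3_const hn]
  have h2 : fderiv ℝ (fun x => gam (chrVar Γ x) v w) y u = dchrVar Γ y u v w := by
    rw [fderiv_gam (fun k i j => H.base.diffAt (H.contDiffOn_chrVar k i j) hy)
      (differentiableAt_const w)]
    simp [dchrVar]
  have h3 : DifferentiableAt ℝ (fun x => m2 (Γ 0 x) z (gam (chrVar Γ x) v w)) y :=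
    ((differentiableAt_ofBasis fun i => differentiableAt_ofBasis fun j => hGd i j).clm_apply
      (differentiableAt_const z)).clm_apply (H.differentiableAt_chrVar hy v w)
  rw [fderiv_const_mul h3, ContinuousLinearMap.smul_apply,
    fderiv_m2 hGd (differentiableAt_const z) (H.differentiableAt_chrVar hy v w), h2,
    H.base.d2_self hy] at h1
  simp only [fderiv_fun_const, Pi.zero_apply, ContinuousLinearMap.zero_apply, map_zero,
    add_zero, smul_eq_mul] at h1
  have k1 := H.koszul hy (chr (Γ 0) y u v) w z
  have k2 := H.koszul hy v (chr (Γ 0) y u w) z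
  have k3 := H.koszul hy v w (chr (Γ 0) y u z)
  simp only [covVar, map_add, map_sub, m4_nabla3]
  linarith

/-- The Palatini formula for the variation of the Ricci tensor. -/
theorem hasDerivAt_m2_ricciC (H : PatchPath ε V Γ h) (hy : y ∈ V) {b : Fin n → Coord n}
    (hb : IsFrame (Γ 0 y) b) (v w : Coord n) :
    HasDerivAt (fun s => m2 (ricciC (Γ s) y) v w)
      (∑ a, m2 (Γ 0 y) (b a) (covVar Γ y (b a) v w - covVar Γ y v (b a) w)) 0 := by
  set R' : Fin n → Fin n → Fin n → Fin n → ℝ := fun i j k l =>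
    pd i (fun z => chrVar Γ z l j k) y - pd j (fun z => chrVar Γ z l i k) y
      + ∑ m, ((chrVar Γ y m j k * christoffel (Γ 0) y l i m
          + christoffel (Γ 0) y m j k * chrVar Γ y l i m)
        - (chrVar Γ y m i k * christoffel (Γ 0) y l j m
          + christoffel (Γ 0) y m i k * chrVar Γ y l j m)) with hR'
  have h1 : ∀ i j k l, HasDerivAt (fun s => riem (Γ s) y i j k l) (R' i j k l) 0 := by
    intro i j k l
    have hp : ∀ m k i j, HasDerivAt (fun s => pd m (fun z => christoffel (Γ s) z k i j) y)
        (pd m (fun z => chrVar Γ z k i j) y) 0 := fun m k i j =>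
      (H.jointSmooth_christoffel k i j).hasDerivAt_pd H.isOpen H.zero_mem hy
        (fun z hz => H.hasDerivAt_christoffel hz k i j) m
    have hc := fun k i j => H.hasDerivAt_christoffel hy k i j
    exact ((hp i l j k).sub (hp j l i k)).add (HasDerivAt.fun_sum fun m _ =>
      ((hc m j k).mul (hc l i m)).sub ((hc m i k).mul (hc l j m)))
  have h2 := hasDerivAt_m2 (fun j k => HasDerivAt.fun_sum (u := Finset.univ)
    (fun l _ => h1 l j k l)) v w
  refine h2.congr_deriv ?_
  have h3 : ∀ u v w : Coord n, (ofBasis fun i => ofBasis fun j => ofBasis fun k => vec fun l =>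
      R' i j k l : Coord n →L[ℝ] Coord n →L[ℝ] Coord n →L[ℝ] Coord n) u v w
      = covVar Γ y u v w - covVar Γ y v u w := by
    intro u v w
    have e : covVar Γ y u v w - covVar Γ y v u w = dchrVar Γ y u v w - dchrVar Γ y v u w
        + (chr (Γ 0) y u (gam (chrVar Γ y) v w) + gam (chrVar Γ y) u (chr (Γ 0) y v w))
        - (chr (Γ 0) y v (gam (chrVar Γ y) u w) + gam (chrVar Γ y) v (chr (Γ 0) y u w)) := by
      simp only [covVar, H.base.chr_symm hy v u]
      abel
    rw [e]
    clear e
    revert u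
    refine isLinearMap_eq ⟨by simp, by simp⟩ ⟨?_, ?_⟩ (fun i => ?_)
    · intro a b; simp; abel
    · intro a b; simp [smul_sub, smul_add]
    revert v
    refine isLinearMap_eq ⟨by simp, by simp⟩ ⟨?_, ?_⟩ (fun j => ?_)
    · intro a b; simp; abel
    · intro a b; simp [smul_sub, smul_add]
    revert w
    refine isLinearMap_eq ⟨by simp, by simp⟩ ⟨?_, ?_⟩ (fun k => ?_)
    · intro a b; simp; abel
    · intro a b; simp [smul_sub, smul_add]
    have e1 : ∀ (c : Fin n → Fin n → Fin n → ℝ) (i : Fin n) (q : Coord n) (l : Fin n),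
        gam c (bv i) q l = ∑ m, q m * c l i m := by
      intro c i q l
      conv_lhs => rw [← sum_bv q]
      simp
    ext l
    simp only [PiLp.sub_apply, PiLp.add_apply, chr, e1]
    have e2 : ∀ (k : Fin n) (c : Fin n → ℝ), ∑ m, (bv k : Coord n) m * c m = c k := by
      intro k c
      simp [bv, Pi.single_apply]
    have e3 : ∀ i j k l, dchrVar Γ y (bv i) (bv j) (bv k) l
        = pd i (fun z => chrVar Γ z l j k) y := by
      intro i j k l
      simp [dchrVar]
    simp only [ofBasis_bv, vec_apply, hR', e2, e3]
    rw [add_sub_assoc, ← Finset.sum_add_distrib, ← Finset.sum_add_distrib,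
      ← Finset.sum_sub_distrib]
  have h4 := hb.trace_end ((((ofBasis fun i => ofBasis fun j => ofBasis fun k => vec fun l =>
      R' i j k l : Coord n →L[ℝ] Coord n →L[ℝ] Coord n →L[ℝ] Coord n)).flip v).flip w)
  simp only [ContinuousLinearMap.flip_apply] at h4
  simp only [← h3]
  rw [← h4]
  clear h4 h2
  revert v
  refine isLinearMap_eq ⟨by simp, by simp⟩ ⟨?_, ?_⟩ (fun i => ?_)
  · intro a b; simp [Finset.sum_add_distrib]
  · intro a b; simp [Finset.mul_sum]
  revert w
  refine isLinearMap_eq ⟨by simp, by simp⟩ ⟨?_, ?_⟩ (fun j => ?_)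
  · intro a b; simp [Finset.sum_add_distrib]
  · intro a b; simp [Finset.mul_sum]
  simp

theorem m4_symm (H : PatchPath ε V Γ h) (hy : y ∈ V) (t u v w : Coord n) :
    m4 (nabla3 (Γ 0) (nabla2 (Γ 0) h) y) t u v w
      = m4 (nabla3 (Γ 0) (nabla2 (Γ 0) h) y) t u w v := by
  have hn : ∀ a i j, DifferentiableAt ℝ (fun z => nabla2 (Γ 0) h z a i j) y := fun a i j =>
    H.base.diffAt (H.contDiffOn_nabla2 a i j) hy
  have h3 : ∀ z ∈ V, ∀ a b c, m3 (nabla2 (Γ 0) h z) a b c = m3 (nabla2 (Γ 0) h z) a c b := by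
    intro z hz a b c
    rw [m3_nabla2, m3_nabla2, d2_symm H.isOpen (fun z hz i j => H.h_symm hz i j) hz,
      H.m2_h_symm hz b, H.m2_h_symm hz _ c]
    ring
  rw [m4_nabla3, m4_nabla3, ← fderiv_m3_const hn, ← fderiv_m3_const hn,
    fderiv_congr_on H.isOpen (fun z hz => h3 z hz u v w) hy, h3 y hy (chr (Γ 0) y t u) v w,
    h3 y hy u (chr (Γ 0) y t v) w, h3 y hy u v (chr (Γ 0) y t w)]
  ring

/-- The variation of the Ricci tensor in terms of second covariant derivatives of the variation of
the metric. -/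
theorem hasDerivAt_ricciC_frame (H : PatchPath ε V Γ h) (hy : y ∈ V) {b : Fin n → Coord n}
    (hb : IsFrame (Γ 0 y) b) (v w : Coord n) :
    HasDerivAt (fun s => m2 (ricciC (Γ s) y) v w)
      ((1 / 2) * ∑ a, (m4 (nabla3 (Γ 0) (nabla2 (Γ 0) h) y) (b a) v w (b a)
        + m4 (nabla3 (Γ 0) (nabla2 (Γ 0) h) y) (b a) w v (b a)
        - m4 (nabla3 (Γ 0) (nabla2 (Γ 0) h) y) (b a) (b a) v w
        - m4 (nabla3 (Γ 0) (nabla2 (Γ 0) h) y) v w (b a) (b a))) 0 := by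
  refine (H.hasDerivAt_m2_ricciC hy hb v w).congr_deriv ?_
  rw [Finset.mul_sum]
  refine Finset.sum_congr rfl fun a _ => ?_
  have k1 := H.m2_covVar hy (b a) v w (b a)
  have k2 := H.m2_covVar hy v (b a) w (b a)
  have k3 := H.m4_symm hy v (b a) (b a) w
  rw [map_sub]
  linarith

end PatchPath

end Linearization

/-! ### Variation of the Ricci tensor, of the Hessian and of the scalar quantities -/

section Variation

variable {n : ℕ} {V : Set (Coord n)} {G : LocalMetric n} {y : Coord n}

theorem nabla1_congr_on (hV : IsOpen V) {α β : Coord n → Fin n → ℝ} (e : ∀ z ∈ V, α z = β z)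
    (hy : y ∈ V) : nabla1 G α y = nabla1 G β y := by
  ext k i
  unfold nabla1
  rw [pd_congr_on hV (fun z hz => congrFun (e z hz) i) hy, e y hy]

theorem m3_bv_left (c : Fin n → Fin n → Fin n → ℝ) (i : Fin n) : m3 c (bv i) = m2 (c i) := by
  simp [m3]

theorem PatchMetric.pd_traceC (hG : PatchMetric V G) {h : Coord n → Fin n → Fin n → ℝ}
    (hh : ∀ i j, DifferentiableAt ℝ (fun z => h z i j) y) (hy : y ∈ V) (a : Fin n) :
    pd a (fun z => traceC G z (h z)) y = traceC G y (nabla2 G h y a) := by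
  obtain ⟨b, hb⟩ := hG.exists_frame hy
  rw [pd, hG.fderiv_trace_eq hh hy hb, hb.traceC]
  exact Finset.sum_congr rfl fun c _ => by rw [← m3_bv_left]

section Second

variable {h : Coord n → Fin n → Fin n → ℝ}

theorem PatchMetric.diffAt_nabla2 (hG : PatchMetric V G)
    (hh : ∀ i j, ContDiffOn ℝ 2 (fun z => h z i j) V) (hy : y ∈ V) (a i j : Fin n) :
    DifferentiableAt ℝ (fun z => nabla2 G h z a i j) y :=
  hG.diffAt (hG.contDiffOn_nabla2 (k := 1) (l := 2) (by norm_num) hh a i j) hy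

theorem PatchMetric.nabla1_divC (hG : PatchMetric V G)
    (hh : ∀ i j, ContDiffOn ℝ 2 (fun z => h z i j) V) (hy : y ∈ V) {b : Fin n → Coord n}
    (hb : IsFrame (G y) b) (u v : Coord n) :
    m2 (nabla1 G (divC G h) y) u v
      = ∑ a, m4 (nabla3 G (nabla2 G h) y) u (b a) (b a) v :=
  hG.nabla1_contract_first (hG.diffAt_nabla2 hh hy) hy hb u v

theorem PatchMetric.hessC_traceC (hG : PatchMetric V G)
    (hh : ∀ i j, ContDiffOn ℝ 2 (fun z => h z i j) V) (hy : y ∈ V) {b : Fin n → Coord n}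
    (hb : IsFrame (G y) b) (u v : Coord n) :
    m2 (hessC G (fun z => traceC G z (h z)) y) u v
      = ∑ a, m4 (nabla3 G (nabla2 G h) y) u v (b a) (b a) := by
  rw [← hG.nabla1_contract_last (hG.diffAt_nabla2 hh hy) hy hb u v]
  have : hessC G (fun z => traceC G z (h z)) y
      = nabla1 G (fun z a => pd a (fun z => traceC G z (h z)) z) y := rfl
  rw [this, nabla1_congr_on hG.isOpen (β := fun z p => traceC G z (nabla2 G h z p)) _ hy]
  intro z hz
  ext a
  exact hG.pd_traceC (fun i j => hG.diffAt (hh i j) hz) hz a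

end Second

/-- The Lichnerowicz Laplacian in an orthonormal frame. -/
theorem IsFrame.m2_lichC {b : Fin n → Coord n} (hb : IsFrame (G y) b)
    (h : Coord n → Fin n → Fin n → ℝ) (v w : Coord n) :
    m2 (lichC G h y) v w = ∑ a, m4 (nabla3 G (nabla2 G h) y) (b a) (b a) v w
      + 2 * ∑ a, m2 (h y) (b a) (crv G y (b a) v w)
      - ∑ c, m2 (ricciC G y) v (b c) * m2 (h y) (b c) w
      - ∑ c, m2 (ricciC G y) w (b c) * m2 (h y) v (b c) := by
  revert v
  refine isLinearMap_eq ⟨by simp, by simp⟩ ⟨?_, ?_⟩ (fun i => ?_)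
  · intro a b; simp [Finset.sum_add_distrib, mul_add, add_mul]; ring
  · intro a b; simp [← Finset.mul_sum, mul_assoc, mul_left_comm]; ring
  revert w
  refine isLinearMap_eq ⟨by simp, by simp⟩ ⟨?_, ?_⟩ (fun j => ?_)
  · intro a b; simp [Finset.sum_add_distrib, mul_add, add_mul]; ring
  · intro a b; simp [← Finset.mul_sum, mul_assoc, mul_left_comm]; ring
  have e1 : ∑ a, m4 (nabla3 G (nabla2 G h) y) (b a) (b a) (bv i) (bv j)
      = roughLapC G h y i j := by
    unfold roughLapC
    rw [hb.sum_invG (fun p q => nabla3 G (nabla2 G h) y p q i j)]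
    refine Finset.sum_congr rfl fun a _ => ?_
    have : ∀ u v : Coord n, m4 (nabla3 G (nabla2 G h) y) u v (bv i) (bv j)
        = m2 (fun p q => nabla3 G (nabla2 G h) y p q i j) u v := by
      intro u v
      revert u
      refine isLinearMap_eq ⟨by simp, by simp⟩ ⟨by simp, by simp⟩ (fun p => ?_)
      revert v
      refine isLinearMap_eq ⟨by simp, by simp⟩ ⟨by simp, by simp⟩ (fun q => ?_)
      simp
    exact this _ _
  have e2 : ∑ a, m2 (h y) (b a) (crv G y (b a) (bv i) (bv j))
      = ∑ p, ∑ q, ∑ r, riem G y p i j q * SolitonVariation.invG G y p r * h y r q := by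
    have k1 : ∀ p r : Fin n, m2 (h y) (bv r) (crv G y (bv p) (bv i) (bv j))
        = ∑ q, riem G y p i j q * h y r q := by
      intro p r
      rw [crv_bv, vec_eq_sum]
      simp
    have k2 : ∀ u u' : Coord n, m2 (h y) u' (crv G y u (bv i) (bv j))
        = m2 (fun p r => ∑ q, riem G y p i j q * h y r q) u u' := by
      intro u u'
      revert u
      refine isLinearMap_eq ⟨by simp, by simp⟩ ⟨by simp, by simp⟩ (fun p => ?_)
      revert u'
      refine isLinearMap_eq ⟨by simp, by simp⟩ ⟨by simp, by simp⟩ (fun q => ?_)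
      rw [k1, m2_bv]
    simp only [k2]
    rw [← hb.sum_invG]
    refine Finset.sum_congr rfl fun p _ => ?_
    rw [Finset.sum_comm]
    refine Finset.sum_congr rfl fun r _ => ?_
    rw [Finset.mul_sum]
    exact Finset.sum_congr rfl fun q _ => by ring
  have k3 : ∀ (T S : Fin n → Fin n → ℝ) (i j : Fin n),
      ∑ c, m2 T (bv i) (b c) * m2 S (b c) (bv j)
        = ∑ p, ∑ q, T i p * SolitonVariation.invG G y p q * S q j := by
    intro T S i j
    have k4 : ∀ u u' : Coord n, m2 T (bv i) u * m2 S u' (bv j)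
        = m2 (fun p q => T i p * S q j) u u' := by
      intro u u'
      revert u
      refine isLinearMap_eq ⟨by simp [add_mul], by simp [mul_assoc]⟩ ⟨by simp, by simp⟩ (fun p => ?_)
      revert u'
      refine isLinearMap_eq ⟨by simp [mul_add], by simp [mul_left_comm]⟩ ⟨by simp, by simp⟩
        (fun q => ?_)
      simp
    simp only [k4]
    rw [← hb.sum_invG]
    exact Finset.sum_congr rfl fun p _ => Finset.sum_congr rfl fun q _ => by ring
  have e3 := k3 (ricciC G y) (h y) i j
  have e4 := k3 (ricciC G y) (fun a b => h y b a) j i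
  have e5 : ∀ c, m2 (h y) (bv i) (b c) = m2 (fun a b => h y b a) (b c) (bv i) := fun c =>
    m2_swap _ _ _
  simp only [e5]
  rw [e1, e2, e3, e4, m2_bv, lichC]

namespace PatchPath

variable {ε : ℝ} {Γ : ℝ → LocalMetric n} {h : Coord n → Fin n → Fin n → ℝ}

/-- The curvature term `R_{pijq} h^{pq}` of the Lichnerowicz Laplacian is symmetric. -/
theorem sum_curvature_symm (H : PatchPath ε V Γ h) (hy : y ∈ V) {b : Fin n → Coord n}
    (hb : IsFrame (Γ 0 y) b) (v w : Coord n) :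
    ∑ a, m2 (h y) (b a) (crv (Γ 0) y (b a) v w)
      = ∑ a, m2 (h y) (b a) (crv (Γ 0) y (b a) w v) := by
  have e : ∀ v w, ∑ a, m2 (h y) (b a) (crv (Γ 0) y (b a) v w)
      = ∑ a, ∑ c, m2 (Γ 0 y) (crv (Γ 0) y (b a) v w) (b c) * m2 (h y) (b a) (b c) := by
    intro v w
    refine Finset.sum_congr rfl fun a _ => ?_
    conv_lhs => rw [← hb.symm_of (H.base.m2_symm hy) (crv (Γ 0) y (b a) v w)]
    simp
  rw [e, e, Finset.sum_comm]
  refine Finset.sum_congr rfl fun a _ => Finset.sum_congr rfl fun c _ => ?_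
  rw [H.m2_h_symm hy (b c), H.base.crv_pair hy, crv_antisymm, map_neg,
    ContinuousLinearMap.neg_apply, ← H.base.crv_skew hy]

/-- The linearization of the Ricci tensor. -/
theorem hasDerivAt_ricciC (H : PatchPath ε V Γ h) (hy : y ∈ V) (v w : Coord n) :
    HasDerivAt (fun s => m2 (ricciC (Γ s) y) v w)
      (-(1 / 2) * m2 (lichC (Γ 0) h y) v w
        + (1 / 2) * (m2 (nabla1 (Γ 0) (divC (Γ 0) h) y) v w
            + m2 (nabla1 (Γ 0) (divC (Γ 0) h) y) w v)
        - (1 / 2) * m2 (hessC (Γ 0) (fun z => traceC (Γ 0) z (h z)) y) v w) 0 := by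
  obtain ⟨b, hb⟩ := H.base.exists_frame hy
  have hh : ∀ i j, ContDiffOn ℝ 2 (fun z => h z i j) V := fun i j =>
    (H.contDiffOn_h i j).of_le two_le_infty
  refine (H.hasDerivAt_ricciC_frame hy hb v w).congr_deriv ?_
  rw [hb.m2_lichC, H.base.nabla1_divC hh hy hb, H.base.nabla1_divC hh hy hb,
    H.base.hessC_traceC hh hy hb]
  -- commuting derivatives produces the curvature terms of the Lichnerowicz Laplacian
  have key : ∀ v w, ∑ a, m4 (nabla3 (Γ 0) (nabla2 (Γ 0) h) y) (b a) v w (b a)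
      = ∑ a, m4 (nabla3 (Γ 0) (nabla2 (Γ 0) h) y) v (b a) (b a) w
        + ∑ c, m2 (ricciC (Γ 0) y) v (b c) * m2 (h y) (b c) w
        - ∑ a, m2 (h y) (b a) (crv (Γ 0) y (b a) v w) := by
    intro v w
    have k1 : ∀ a, m4 (nabla3 (Γ 0) (nabla2 (Γ 0) h) y) (b a) v w (b a)
        = m4 (nabla3 (Γ 0) (nabla2 (Γ 0) h) y) v (b a) (b a) w
          - m2 (h y) (crv (Γ 0) y (b a) v (b a)) w
          - m2 (h y) (b a) (crv (Γ 0) y (b a) v w) := by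
      intro a
      rw [H.m4_symm hy]
      linarith [H.base.ricci_identity2 hh hy (b a) v (b a) w]
    have k2 : ∑ a, m2 (h y) (crv (Γ 0) y (b a) v (b a)) w
        = - ∑ c, m2 (ricciC (Γ 0) y) v (b c) * m2 (h y) (b c) w := by
      have := congrArg (fun X => m2 (h y) X w) (H.base.sum_crv hy hb v)
      simpa using this
    simp only [k1, Finset.sum_sub_distrib, k2]
    ring
  simp only [Finset.sum_sub_distrib, Finset.sum_add_distrib]
  rw [key v w, key w v, H.sum_curvature_symm hy hb w v]
  simp only [H.m2_h_symm hy v]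
  ring

/-- The linearization of the Hessian of a varying function. -/
theorem hasDerivAt_hessC (H : PatchPath ε V Γ h) (hy : y ∈ V) {F : ℝ → Coord n → ℝ}
    {p : Coord n → ℝ} (h1 : ∀ i, HasDerivAt (fun s => pd i (F s) y) (pd i p y) 0)
    (h2 : ∀ i j, HasDerivAt (fun s => pd i (pd j (F s)) y) (pd i (pd j p) y) 0) (i j : Fin n) :
    HasDerivAt (fun s => hessC (Γ s) (F s) y i j)
      (hessC (Γ 0) p y i j + psiC (Γ 0) (F 0) h y i j) 0 := by
  have k1 := (h2 i j).sub (HasDerivAt.fun_sum (u := Finset.univ) fun l _ =>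
    (H.hasDerivAt_christoffel hy l i j).mul (h1 l))
  refine k1.congr_deriv ?_
  unfold hessC nabla1 psiC
  rw [Finset.sum_add_distrib]
  have e : ∑ l, chrVar Γ y l i j * pd l (F 0) y = (1 / 2) * ∑ k, ∑ l, invG (Γ 0) y k l *
      (nabla2 (Γ 0) h y i j l + nabla2 (Γ 0) h y j i l - nabla2 (Γ 0) h y l i j)
        * pd k (F 0) y := by
    have k2 : ∀ l, m2 (Γ 0 y) (bv l) (gam (chrVar Γ y) (bv i) (bv j)) = (1 / 2) *
        (nabla2 (Γ 0) h y i j l + nabla2 (Γ 0) h y j i l - nabla2 (Γ 0) h y l i j) := by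
      intro l
      have := H.koszul hy (bv i) (bv j) (bv l)
      simp only [m3_bv] at this
      linarith
    have k3 : ∀ k, chrVar Γ y k i j = ∑ l, invG (Γ 0) y k l *
        m2 (Γ 0 y) (bv l) (gam (chrVar Γ y) (bv i) (bv j)) := by
      intro k
      have hd : (Matrix.of (Γ 0 y)).det ≠ 0 := (H.base.posDef y hy).det_pos.ne'
      have k4 := Matrix.nonsing_inv_mul (Matrix.of (Γ 0 y)) hd.isUnit
      have k5 : ∀ m, ∑ l, invG (Γ 0) y k l * Γ 0 y l m = if k = m then 1 else 0 := by
        intro m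
        have := congrFun (congrFun k4 k) m
        rw [Matrix.mul_apply, Matrix.one_apply] at this
        exact this
      have k6 : ∀ l, m2 (Γ 0 y) (bv l) (gam (chrVar Γ y) (bv i) (bv j))
          = ∑ m, Γ 0 y l m * chrVar Γ y m i j := by
        intro l
        rw [gam_bv, vec_eq_sum]
        simp [mul_comm]
      simp only [k6, Finset.mul_sum]
      rw [Finset.sum_comm]
      simp only [← mul_assoc, ← Finset.sum_mul, k5]
      simp
    simp only [k3, k2, Finset.mul_sum, Finset.sum_mul]
    exact Finset.sum_congr rfl fun k _ => Finset.sum_congr rfl fun l _ => by ring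
  rw [e]
  ring

end PatchPath

end Variation

/-! ### Divergences and the Euler–Lagrange density in a patch -/

section Divergence

variable {n : ℕ} {V : Set (Coord n)} {G : LocalMetric n} {y : Coord n}

/-- The inner product of one-forms in coordinates. -/
def innerC1 (G : LocalMetric n) (y : Coord n) (α η : Fin n → ℝ) : ℝ :=
  ∑ i, ∑ j, invG G y i j * α i * η j

/-- The inner product of `(0,2)` tensors in coordinates. -/
def innerC2 (G : LocalMetric n) (y : Coord n) (A B : Fin n → Fin n → ℝ) : ℝ :=
  ∑ i, ∑ j, ∑ k, ∑ l, invG G y i k * invG G y j l * A i j * B k l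

/-- The contraction `θ ↦ g^{ik} θ_i h_{kj}` of a one-form with a `(0,2)` tensor. -/
def contractC (G : LocalMetric n) (θ : Coord n → Fin n → ℝ) (h : Coord n → Fin n → Fin n → ℝ)
    (y : Coord n) (j : Fin n) : ℝ :=
  ∑ i, ∑ k, invG G y i k * θ y i * h y k j

/-- The weighted divergence of a `(0,2)` tensor in coordinates. -/
def driftDivC (G : LocalMetric n) (F : Coord n → ℝ) (h : Coord n → Fin n → Fin n → ℝ)
    (y : Coord n) (j : Fin n) : ℝ :=
  divC G h y j - contractC G (fun z i => pd i F z) h y j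

theorem m1_mul_m1 (α η : Fin n → ℝ) (u v : Coord n) :
    m2 (fun i j => α i * η j) u v = m1 α u * m1 η v := by
  simp only [m1_apply, m2_apply, Finset.sum_mul_sum]
  exact Finset.sum_congr rfl fun i _ => Finset.sum_congr rfl fun j _ => by ring

theorem IsFrame.innerC1 {b : Fin n → Coord n} (hb : IsFrame (G y) b) (α η : Fin n → ℝ) :
    innerC1 G y α η = ∑ a, m1 α (b a) * m1 η (b a) := by
  simp only [← m1_mul_m1, SolitonVariation.innerC1, mul_assoc]
  exact hb.sum_invG _

theorem IsFrame.innerC2 {b : Fin n → Coord n} (hb : IsFrame (G y) b) (A B : Fin n → Fin n → ℝ) :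
    innerC2 G y A B = ∑ a, ∑ c, m2 A (b a) (b c) * m2 B (b a) (b c) := by
  have e1 : SolitonVariation.innerC2 G y A B = ∑ i, ∑ k, SolitonVariation.invG G y i k *
      ∑ j, ∑ l, SolitonVariation.invG G y j l * (A i j * B k l) := by
    unfold SolitonVariation.innerC2
    refine Finset.sum_congr rfl fun i _ => ?_
    rw [Finset.sum_comm]
    refine Finset.sum_congr rfl fun k _ => ?_
    simp only [Finset.mul_sum]
    exact Finset.sum_congr rfl fun j _ => Finset.sum_congr rfl fun l _ => by ring
  rw [e1, hb.sum_invG, Finset.sum_congr rfl fun a _ => ?_]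
  have e2 : ∀ u u' : Coord n, m2 (fun i k => ∑ j, ∑ l, SolitonVariation.invG G y j l *
      (A i j * B k l)) u u' = ∑ c, m2 A u (b c) * m2 B u' (b c) := by
    intro u u'
    revert u
    refine isLinearMap_eq ⟨by simp, by simp⟩ ⟨?_, ?_⟩ (fun i => ?_)
    · intro a b; simp [add_mul, Finset.sum_add_distrib]
    · intro a b; simp [mul_assoc, Finset.mul_sum]
    revert u'
    refine isLinearMap_eq ⟨by simp, by simp⟩ ⟨?_, ?_⟩ (fun k => ?_)
    · intro a b; simp [mul_add, Finset.sum_add_distrib]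
    · intro a b; simp [mul_left_comm, Finset.mul_sum]
    rw [m2_bv, hb.sum_invG]
    refine Finset.sum_congr rfl fun c _ => ?_
    rw [m1_mul_m1]
    congr 1 <;> simp [m1_apply, m2_apply, Pi.single_apply]
  exact e2 _ _

theorem nabla1_add {α β : Coord n → Fin n → ℝ} (hα : ∀ i, DifferentiableAt ℝ (fun z => α z i) y)
    (hβ : ∀ i, DifferentiableAt ℝ (fun z => β z i) y) (k i : Fin n) :
    nabla1 G (fun z i => α z i + β z i) y k i = nabla1 G α y k i + nabla1 G β y k i := by
  unfold nabla1 pd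
  rw [fderiv_fun_add (hα i) (hβ i)]
  simp only [ContinuousLinearMap.add_apply, mul_add, Finset.sum_add_distrib]
  ring

theorem nabla1_mul {u : Coord n → ℝ} {α : Coord n → Fin n → ℝ} (hu : DifferentiableAt ℝ u y)
    (hα : ∀ i, DifferentiableAt ℝ (fun z => α z i) y) (k i : Fin n) :
    nabla1 G (fun z i => u z * α z i) y k i = pd k u y * α y i + u y * nabla1 G α y k i := by
  unfold nabla1 pd
  rw [fderiv_fun_mul hu (hα i)]
  simp only [ContinuousLinearMap.add_apply, ContinuousLinearMap.smul_apply, smul_eq_mul, mul_sub,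
    Finset.mul_sum]
  rw [Finset.sum_congr rfl fun l _ => mul_left_comm (christoffel G y l k i) (u y) (α y l)]
  ring

theorem nabla1_sub {α β : Coord n → Fin n → ℝ} (hα : ∀ i, DifferentiableAt ℝ (fun z => α z i) y)
    (hβ : ∀ i, DifferentiableAt ℝ (fun z => β z i) y) (k i : Fin n) :
    nabla1 G (fun z i => α z i - β z i) y k i = nabla1 G α y k i - nabla1 G β y k i := by
  unfold nabla1 pd
  rw [fderiv_fun_sub (hα i) (hβ i)]
  simp only [ContinuousLinearMap.sub_apply, mul_sub, Finset.sum_sub_distrib]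
  ring

theorem nabla2_add {h k : Coord n → Fin n → Fin n → ℝ}
    (hh : ∀ i j, DifferentiableAt ℝ (fun z => h z i j) y)
    (hk : ∀ i j, DifferentiableAt ℝ (fun z => k z i j) y) (a i j : Fin n) :
    nabla2 G (fun z i j => h z i j + k z i j) y a i j
      = nabla2 G h y a i j + nabla2 G k y a i j := by
  unfold nabla2 pd
  rw [fderiv_fun_add (hh i j) (hk i j)]
  simp only [ContinuousLinearMap.add_apply, mul_add, Finset.sum_add_distrib]
  ring

theorem nabla2_mul {u : Coord n → ℝ} {h : Coord n → Fin n → Fin n → ℝ}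
    (hu : DifferentiableAt ℝ u y)
    (hh : ∀ i j, DifferentiableAt ℝ (fun z => h z i j) y) (a i j : Fin n) :
    nabla2 G (fun z i j => u z * h z i j) y a i j
      = pd a u y * h y i j + u y * nabla2 G h y a i j := by
  unfold nabla2 pd
  rw [fderiv_fun_mul hu (hh i j)]
  simp only [ContinuousLinearMap.add_apply, ContinuousLinearMap.smul_apply, smul_eq_mul, mul_sub,
    Finset.mul_sum]
  rw [Finset.sum_congr rfl fun l _ => mul_left_comm (christoffel G y l a i) (u y) (h y l j),
    Finset.sum_congr rfl fun l _ => mul_left_comm (christoffel G y l a j) (u y) (h y i l)]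
  ring

/-- The product rule for the tensor product of one-forms. -/
theorem m3_nabla2_tensor {α β : Coord n → Fin n → ℝ}
    (hα : ∀ i, DifferentiableAt ℝ (fun z => α z i) y)
    (hβ : ∀ i, DifferentiableAt ℝ (fun z => β z i) y) (w u v : Coord n) :
    m3 (nabla2 G (fun z i j => α z i * β z j) y) w u v
      = m2 (nabla1 G α y) w u * m1 (β y) v + m1 (α y) u * m2 (nabla1 G β y) w v := by
  revert w
  refine isLinearMap_eq ⟨by simp, by simp⟩ ⟨?_, ?_⟩ (fun i => ?_)
  · intro a b; simp; ring
  · intro a b; simp; ring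
  revert u
  refine isLinearMap_eq ⟨by simp, by simp⟩ ⟨?_, ?_⟩ (fun j => ?_)
  · intro a b; simp; ring
  · intro a b; simp; ring
  revert v
  refine isLinearMap_eq ⟨by simp, by simp⟩ ⟨?_, ?_⟩ (fun k => ?_)
  · intro a b; simp; ring
  · intro a b; simp; ring
  simp only [m3_bv, m2_bv, m1_bv, nabla2, nabla1, pd]
  rw [fderiv_fun_mul (hα j) (hβ k)]
  simp only [ContinuousLinearMap.add_apply, ContinuousLinearMap.smul_apply, smul_eq_mul, mul_sub,
    Finset.mul_sum, sub_mul, Finset.sum_mul]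
  rw [Finset.sum_congr rfl fun l _ => (mul_assoc (christoffel G y l i j) (α y l) (β y k)).symm,
    Finset.sum_congr rfl fun l _ => mul_left_comm (christoffel G y l i k) (α y j) (β y l)]
  ring

/-- The product rule for the tensor product of a one-form and a `(0,2)` tensor. -/
theorem m4_nabla3_tensor {θ : Coord n → Fin n → ℝ} {h : Coord n → Fin n → Fin n → ℝ}
    (hθ : ∀ i, DifferentiableAt ℝ (fun z => θ z i) y)
    (hh : ∀ i j, DifferentiableAt ℝ (fun z => h z i j) y) (w p u v : Coord n) :
    m4 (nabla3 G (fun z p i j => θ z p * h z i j) y) w p u v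
      = m2 (nabla1 G θ y) w p * m2 (h y) u v + m1 (θ y) p * m3 (nabla2 G h y) w u v := by
  revert w
  refine isLinearMap_eq ⟨by simp, by simp⟩ ⟨?_, ?_⟩ (fun i => ?_)
  · intro a b; simp; ring
  · intro a b; simp; ring
  revert p
  refine isLinearMap_eq ⟨by simp, by simp⟩ ⟨?_, ?_⟩ (fun q => ?_)
  · intro a b; simp; ring
  · intro a b; simp; ring
  revert u
  refine isLinearMap_eq ⟨by simp, by simp⟩ ⟨?_, ?_⟩ (fun j => ?_)
  · intro a b; simp; ring
  · intro a b; simp; ring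
  revert v
  refine isLinearMap_eq ⟨by simp, by simp⟩ ⟨?_, ?_⟩ (fun k => ?_)
  · intro a b; simp; ring
  · intro a b; simp; ring
  simp only [m4_bv, m3_bv, m2_bv, m1_bv, nabla3, nabla2, nabla1, pd]
  rw [fderiv_fun_mul (hθ q) (hh j k)]
  simp only [ContinuousLinearMap.add_apply, ContinuousLinearMap.smul_apply, smul_eq_mul, mul_sub,
    Finset.mul_sum, sub_mul, Finset.sum_mul]
  rw [Finset.sum_congr rfl fun l _ => (mul_assoc (christoffel G y l i q) (θ y l) (h y j k)).symm,
    Finset.sum_congr rfl fun l _ => mul_left_comm (christoffel G y l i j) (θ y q) (h y l k),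
    Finset.sum_congr rfl fun l _ => mul_left_comm (christoffel G y l i k) (θ y q) (h y j l)]
  ring

theorem IsFrame.m1_contractC {b : Fin n → Coord n} (hb : IsFrame (G y) b)
    (θ : Coord n → Fin n → ℝ) (h : Coord n → Fin n → Fin n → ℝ) (v : Coord n) :
    m1 (contractC G θ h y) v = ∑ a, m1 (θ y) (b a) * m2 (h y) (b a) v := by
  revert v
  refine isLinearMap_eq ⟨by simp, by simp⟩ ⟨?_, ?_⟩ (fun j => ?_)
  · intro a b; simp [mul_add, Finset.sum_add_distrib]
  · intro a b; simp [mul_left_comm, Finset.mul_sum]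
  simp only [m1_bv, contractC, mul_assoc]
  rw [hb.sum_invG]
  refine Finset.sum_congr rfl fun a _ => ?_
  rw [m1_mul_m1]
  congr 1
  simp [m1_apply, m2_apply, Pi.single_apply]

/-- The divergence of the contraction of a one-form with a symmetric tensor. -/
theorem PatchMetric.traceC_nabla1_contractC (hG : PatchMetric V G) (hy : y ∈ V)
    {θ : Coord n → Fin n → ℝ} {h : Coord n → Fin n → Fin n → ℝ}
    (hθ : ∀ i, DifferentiableAt ℝ (fun z => θ z i) y)
    (hh : ∀ i j, DifferentiableAt ℝ (fun z => h z i j) y)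
    (hs : ∀ z ∈ V, ∀ i j, h z i j = h z j i) :
    traceC G y (nabla1 G (contractC G θ h) y)
      = innerC1 G y (θ y) (divC G h y) + innerC2 G y (nabla1 G θ y) (h y) := by
  obtain ⟨b, hb⟩ := hG.exists_frame hy
  have e1 : contractC G θ h
      = fun z j => SolitonVariation.traceC G z (fun p i => θ z p * h z i j) := by
    ext z j
    simp only [contractC, SolitonVariation.traceC, mul_assoc]
  have hT : ∀ p i j, DifferentiableAt ℝ (fun z => θ z p * h z i j) y := fun p i j =>
    (hθ p).fun_mul (hh i j)
  rw [hb.traceC, hb.innerC1, hb.innerC2, e1]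
  simp only [hG.nabla1_contract_first (T := fun z p i j => θ z p * h z i j) hT hy hb,
    m4_nabla3_tensor hθ hh, hb.m1_divC]
  have hs3 : ∀ u v w, m3 (nabla2 G h y) u v w = m3 (nabla2 G h y) u w v := by
    intro u v w
    rw [m3_nabla2, m3_nabla2, SolitonVariation.d2_symm hG.isOpen hs hy,
      SolitonVariation.m2_symm (hs y hy) v, SolitonVariation.m2_symm (hs y hy) _ w]
    ring
  simp only [Finset.sum_add_distrib, Finset.mul_sum]
  rw [add_comm]
  congr 1
  · rw [Finset.sum_comm]
    exact Finset.sum_congr rfl fun a _ => Finset.sum_congr rfl fun c _ => by rw [hs3]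
  · exact Finset.sum_congr rfl fun a _ => Finset.sum_congr rfl fun c _ => by
      rw [SolitonVariation.m2_symm (hs y hy) (b c)]

/-- The divergence as a coordinate divergence: `√g div α = ∂ᵢ (√g g^{ij} α_j)`. -/
theorem PatchMetric.traceC_nabla1_mul_sqrt_det (hG : PatchMetric V G) (hy : y ∈ V)
    {α : Coord n → Fin n → ℝ} (hα : ∀ i, DifferentiableAt ℝ (fun z => α z i) y) :
    traceC G y (nabla1 G α y) * Real.sqrt (Matrix.of (G y)).det
      = ∑ i, pd i (fun z => Real.sqrt (Matrix.of (G z)).det * ∑ j, invG G z i j * α z j) y := by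
  obtain ⟨b, hb⟩ := hG.exists_frame hy
  have hid : ∀ i j, DifferentiableAt ℝ (fun z => invG G z i j) y := fun i j =>
    hG.diffAt (hG.contDiffOn_invG i j) hy
  have hGd : ∀ i j, DifferentiableAt ℝ (fun z => G z i j) y := fun i j =>
    hG.diffAt (hG.smooth i j) hy
  have hpos := (hG.posDef y hy).det_pos
  set X : Coord n → Coord n := fun z => vec fun i => ∑ j, invG G z i j * α z j with hX
  have hXi : ∀ i, DifferentiableAt ℝ (fun z => X z i) y := by
    intro i
    simp only [hX, vec_apply]
    fun_prop
  have hXd : DifferentiableAt ℝ X y := (differentiableAt_euclidean).2 hXi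
  have hαX : ∀ z ∈ V, ∀ v, m1 (α z) v = m2 (G z) (X z) v := by
    intro z hz v
    revert v
    refine isLinearMap_eq ⟨by simp, by simp⟩ ⟨by simp, by simp⟩ (fun m => ?_)
    rw [hG.m2_symm hz, m1_bv]
    simp only [hX]
    rw [vec_eq_sum]
    have k1 : ∀ j, ∑ i, G z m i * invG G z i j = if m = j then 1 else 0 := by
      intro j
      have hd : (Matrix.of (G z)).det ≠ 0 := (hG.posDef z hz).det_pos.ne'
      have := congrFun (congrFun (Matrix.mul_nonsing_inv (Matrix.of (G z)) hd.isUnit) m) j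
      rw [Matrix.mul_apply, Matrix.one_apply] at this
      exact this
    simp only [map_sum, map_smul, m2_bv, smul_eq_mul, Finset.sum_mul]
    rw [Finset.sum_comm]
    have k2 : ∀ j, ∑ i, invG G z i j * α z j * G z m i = (if m = j then 1 else 0) * α z j := by
      intro j
      rw [← k1, Finset.sum_mul]
      exact Finset.sum_congr rfl fun i _ => by ring
    simp only [k2]
    simp
  have hdα : ∀ u v, m2 (nabla1 G α y) u v = m2 (G y) (chr G y u (X y)) v
      + m2 (G y) (fderiv ℝ X y u) v := by
    intro u v
    rw [m2_nabla1, ← fderiv_m1_const hα, fderiv_congr_on hG.isOpen (fun z hz => hαX z hz v) hy,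
      fderiv_m2 hGd hXd (differentiableAt_const v), hG.d2_self hy, hαX y hy]
    simp
    ring
  have htr : traceC G y (nabla1 G α y) = (∑ a, m2 (G y) (b a) (chr G y (X y) (b a)))
      + ∑ i, fderiv ℝ X y (bv i) i := by
    rw [hb.trace_end (fderiv ℝ X y), hb.traceC, ← Finset.sum_add_distrib]
    refine Finset.sum_congr rfl fun a _ => ?_
    rw [hdα, hG.m2_symm hy (b a), hG.m2_symm hy (b a), hG.chr_symm hy]
  set D : Coord n → ℝ := fun z => (Matrix.of (G z)).det with hD
  have hDd : DifferentiableAt ℝ D y := by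
    have h1 : ContDiffOn ℝ ∞ D V :=
      contDiff_det.comp_contDiffOn (contDiffOn_pi.2 fun i => contDiffOn_pi.2 fun j => hG.smooth i j)
    exact hG.diffAt h1 hy
  have hdet : fderiv ℝ D y (X y) = D y * (2 * ∑ a, m2 (G y) (b a) (chr G y (X y) (b a))) := by
    have hline : ∀ {f : Coord n → ℝ}, DifferentiableAt ℝ f y →
        HasDerivAt (fun t : ℝ => f (y + t • X y)) (fderiv ℝ f y (X y)) 0 := by
      intro f hf
      have h1 : HasDerivAt (fun t : ℝ => y + t • X y) (X y) 0 := by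
        simpa using ((hasDerivAt_id (0 : ℝ)).smul_const (X y)).const_add y
      exact hf.hasFDerivAt.comp_hasDerivAt_of_eq (0 : ℝ) h1 (by simp)
    have hb0 : IsFrame (G (y + (0 : ℝ) • X y)) b := by simpa using hb
    have h1 := hasDerivAt_det (fun i j => hline (hGd i j)) hb0
    have h2 := (hline hDd).unique h1
    rw [h2]
    simp only [zero_smul, add_zero]
    congr 1
    rw [Finset.mul_sum]
    refine Finset.sum_congr rfl fun a _ => ?_
    have eD : ∀ u v, m2 (fun i j => fderiv ℝ (fun z => G z i j) y (X y)) u v = d2 G y (X y) u v := by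
      intro u v
      revert u
      refine isLinearMap_eq ⟨by simp, by simp⟩ ⟨by simp, by simp⟩ (fun i => ?_)
      revert v
      refine isLinearMap_eq ⟨by simp, by simp⟩ ⟨by simp, by simp⟩ (fun j => ?_)
      rw [m2_bv, ← fderiv_m2_const hGd]
      simp
    rw [eD, hG.d2_self hy, hG.m2_symm hy _ (b a)]
    ring
  have hsq : HasFDerivAt (fun z => Real.sqrt (D z)) ((1 / (2 * Real.sqrt (D y))) • fderiv ℝ D y) y :=
    hDd.hasFDerivAt.sqrt hpos.ne'
  have e1 : ∀ i, pd i (fun z => Real.sqrt (D z) * ∑ j, invG G z i j * α z j) y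
      = Real.sqrt (D y) * fderiv ℝ X y (bv i) i
        + X y i * ((1 / (2 * Real.sqrt (D y))) * pd i D y) := by
    intro i
    have h1 := (hsq.mul (hXi i).hasFDerivAt).fderiv
    have h2 : fderiv ℝ (fun z => X z i) y (bv i) = fderiv ℝ X y (bv i) i := by
      have := ((EuclideanSpace.proj i : Coord n →L[ℝ] ℝ).hasFDerivAt.comp y
        hXd.hasFDerivAt).fderiv
      simp only [Function.comp_def] at this
      exact congrArg (fun T : Coord n →L[ℝ] ℝ => T (bv i)) this
    have h3 : pd i (fun z => Real.sqrt (D z) * ∑ j, invG G z i j * α z j) y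
        = fderiv ℝ ((fun z => Real.sqrt (D z)) * fun z => X z i) y (bv i) := rfl
    rw [h3, h1]
    simp only [ContinuousLinearMap.add_apply, ContinuousLinearMap.smul_apply, smul_eq_mul, h2]
    rfl
  change _ = ∑ i, pd i (fun z => Real.sqrt (D z) * ∑ j, invG G z i j * α z j) y
  simp only [e1, Finset.sum_add_distrib, ← Finset.mul_sum]
  have e2 : ∑ i, X y i * (1 / (2 * Real.sqrt (D y)) * pd i D y)
      = 1 / (2 * Real.sqrt (D y)) * fderiv ℝ D y (X y) := by
    rw [fderiv_eq_m1 D, m1_apply, Finset.mul_sum]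
    exact Finset.sum_congr rfl fun i _ => by ring
  rw [e2, hdet, htr]
  have hs0 : Real.sqrt (D y) ≠ 0 := (Real.sqrt_pos.2 hpos).ne'
  have hss : Real.sqrt (D y) * Real.sqrt (D y) = D y := Real.mul_self_sqrt hpos.le
  change _ * Real.sqrt (D y) = _
  field_simp
  rw [sq, hss]
  ring

end Divergence

section EulerDensity

variable {n : ℕ} {V : Set (Coord n)} {G : LocalMetric n} {y : Coord n}

/-- The Euler–Lagrange density `τ (2 Δf - |df|² + R) + f - n` of the entropy, in coordinates. -/
def eulerC (τ : ℝ) (G : LocalMetric n) (F : Coord n → ℝ) (y : Coord n) : ℝ :=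
  τ * (2 * traceC G y (hessC G F y) - innerC1 G y (fun i => pd i F y) (fun i => pd i F y)
    + traceC G y (ricciC G y)) + (F y - n)

theorem innerC1_eq_traceC (α η : Fin n → ℝ) :
    innerC1 G y α η = traceC G y (fun i j => α i * η j) := by
  simp only [innerC1, traceC, mul_assoc]

/-- The differential of the Euler–Lagrange density is the weighted divergence of
`Ric + ∇²f - g / (2τ)`, up to the factor `2τ`. -/
theorem PatchMetric.fderiv_eulerC (hG : PatchMetric V G) (hy : y ∈ V) {F : Coord n → ℝ}
    (hF : ContDiffOn ℝ 3 F V) {τ : ℝ} (hτ : τ ≠ 0) (w : Coord n) :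
    fderiv ℝ (eulerC τ G F) y w
      = 2 * τ * m1 (driftDivC G F
          (fun z i j => ricciC G z i j + hessC G F z i j + (-(1 / (2 * τ))) * G z i j) y) w := by
  obtain ⟨b, hb⟩ := hG.exists_frame hy
  have hpd : ∀ i, ContDiffOn ℝ 2 (fun z => pd i F z) V := fun i =>
    contDiffOn_pd hG.isOpen (by norm_num) hF i
  have hpdd : ∀ i, DifferentiableAt ℝ (fun z => pd i F z) y := fun i => hG.diffAt (hpd i) hy
  have hFd : DifferentiableAt ℝ F y := hG.diffAt hF hy
  have hhd : ∀ i j, DifferentiableAt ℝ (fun z => hessC G F z i j) y := fun i j =>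
    hG.diffAt (hG.contDiffOn_nabla1 (k := 1) (l := 2) (by norm_num) hpd i j) hy
  have hrd : ∀ i j, DifferentiableAt ℝ (fun z => ricciC G z i j) y := fun i j =>
    hG.diffAt (hG.contDiffOn_ricciC i j) hy
  have hGd : ∀ i j, DifferentiableAt ℝ (fun z => G z i j) y := fun i j =>
    hG.diffAt (hG.smooth i j) hy
  have hid : ∀ i j, DifferentiableAt ℝ (fun z => invG G z i j) y := fun i j =>
    hG.diffAt (hG.contDiffOn_invG i j) hy
  have htd : ∀ {T : Coord n → Fin n → Fin n → ℝ}, (∀ i j, DifferentiableAt ℝ (fun z => T z i j) y) →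
      DifferentiableAt ℝ (fun z => traceC G z (T z)) y := by
    intro T hT
    unfold traceC
    fun_prop
  have e1 : eulerC τ G F = fun z => τ * (2 * traceC G z (hessC G F z)
      - traceC G z (fun i j => pd i F z * pd j F z) + traceC G z (ricciC G z)) + (F z - n) := by
    ext z
    rw [eulerC, innerC1_eq_traceC]
  have hTT : ∀ i j, DifferentiableAt ℝ (fun z => pd i F z * pd j F z) y := fun i j =>
    (hpdd i).fun_mul (hpdd j)
  have e2 : fderiv ℝ (eulerC τ G F) y w = τ * (2 * fderiv ℝ (fun z => traceC G z (hessC G F z)) y w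
      - fderiv ℝ (fun z => traceC G z (fun i j => pd i F z * pd j F z)) y w
      + fderiv ℝ (fun z => traceC G z (ricciC G z)) y w) + fderiv ℝ F y w := by
    have a1 := (htd hhd).hasFDerivAt
    have a2 := (htd hTT).hasFDerivAt
    have a3 := (htd hrd).hasFDerivAt
    have a4 := ((((a1.const_mul 2).sub a2).add a3).const_mul τ).add (hFd.hasFDerivAt.sub_const (n : ℝ))
    rw [e1]
    have := a4.fderiv
    rw [show (fun z => τ * (2 * traceC G z (hessC G F z)
      - traceC G z (fun i j => pd i F z * pd j F z) + traceC G z (ricciC G z)) + (F z - n)) = _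
        from rfl]
    refine (congrArg (fun T : Coord n →L[ℝ] ℝ => T w) this).trans ?_
    simp
    ring
  have hS : ∀ u v, m2 (fun i j => ricciC G y i j + hessC G F y i j + (-(1 / (2 * τ))) * G y i j) u v
      = m2 (ricciC G y) u v + m2 (hessC G F y) u v + (-(1 / (2 * τ))) * m2 (G y) u v := by
    intro u v
    rw [m2_add, m2_add, m2_smul]
  have hN : ∀ u v w, m3 (nabla2 G (fun z i j => ricciC G z i j + hessC G F z i j
        + (-(1 / (2 * τ))) * G z i j) y) u v w
      = m3 (nabla2 G (ricciC G) y) u v w + m3 (nabla2 G (hessC G F) y) u v w := by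
    intro u v w
    revert u
    refine isLinearMap_eq ⟨by simp, by simp⟩ ⟨?_, ?_⟩ (fun i => ?_)
    · intro a b; simp; ring
    · intro a b; simp; ring
    revert v
    refine isLinearMap_eq ⟨by simp, by simp⟩ ⟨?_, ?_⟩ (fun j => ?_)
    · intro a b; simp; ring
    · intro a b; simp; ring
    revert w
    refine isLinearMap_eq ⟨by simp, by simp⟩ ⟨?_, ?_⟩ (fun k => ?_)
    · intro a b; simp; ring
    · intro a b; simp; ring
    simp only [m3_bv]
    rw [nabla2_add (h := fun z i j => ricciC G z i j + hessC G F z i j)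
        (k := fun z i j => (-(1 / (2 * τ))) * G z i j) (fun i j => (hrd i j).fun_add (hhd i j))
        (fun i j => (hGd i j).const_mul _),
      nabla2_add hrd hhd, nabla2_mul (u := fun _ => (-(1 / (2 * τ)))) (differentiableAt_const _) hGd,
      hG.nabla2_self hy]
    simp [pd]
  have e3 : m1 (driftDivC G F
        (fun z i j => ricciC G z i j + hessC G F z i j + (-(1 / (2 * τ))) * G z i j) y) w
      = ∑ a, m3 (nabla2 G (ricciC G) y) (b a) (b a) w + ∑ a, m3 (nabla2 G (hessC G F) y) (b a) (b a) w
        - ∑ a, m1 (fun i => pd i F y) (b a) * m2 (ricciC G y) w (b a)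
        - ∑ a, m1 (fun i => pd i F y) (b a) * m2 (hessC G F y) w (b a)
        + 1 / (2 * τ) * fderiv ℝ F y w := by
    have k1 : m1 (fun i => pd i F y) w = ∑ a, m1 (fun i => pd i F y) (b a) * m2 (G y) w (b a) := by
      conv_lhs => rw [← hb.symm_of (hG.m2_symm hy) w]
      simp [mul_comm]
    have k2 : driftDivC G F
        (fun z i j => ricciC G z i j + hessC G F z i j + (-(1 / (2 * τ))) * G z i j) y
        = fun j => divC G (fun z i j => ricciC G z i j + hessC G F z i j
            + (-(1 / (2 * τ))) * G z i j) y j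
          - contractC G (fun z i => pd i F z) (fun z i j => ricciC G z i j + hessC G F z i j
            + (-(1 / (2 * τ))) * G z i j) y j := rfl
    rw [k2, m1_sub, hb.m1_divC, hb.m1_contractC]
    simp only [hN, hS, Finset.sum_add_distrib, mul_add]
    rw [fderiv_eq_m1 F, k1]
    simp only [hG.ricciC_symm hy w, hG.m2_hessC_symm (hF.of_le (by norm_num)) hy w,
      hG.m2_symm hy w]
    simp only [Finset.mul_sum, mul_left_comm _ (-(1 / (2 * τ)))]
    simp only [neg_mul, Finset.sum_neg_distrib]
    ring
  -- `2 δ Ric = dR` and `δ ∇²f = d Δf + Ric(∇f)`; the terms `Ric(∇f)` and `∇²f(∇f)` then match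
  rw [e2, e3, hG.contracted_bianchi hy hb, hG.bochner hy hb hF, hG.fderiv_trace_eq hTT hy hb]
  simp only [m3_nabla2_tensor hpdd hpdd]
  have hess : ∀ u v, m2 (nabla1 G (fun z i => pd i F z) y) u v = m2 (hessC G F y) u v :=
    fun u v => rfl
  simp only [hess]
  have e4 : ∑ a, (m2 (hessC G F y) w (b a) * m1 (fun i => pd i F y) (b a)
      + m1 (fun i => pd i F y) (b a) * m2 (hessC G F y) w (b a))
      = 2 * ∑ a, m1 (fun i => pd i F y) (b a) * m2 (hessC G F y) w (b a) := by
    rw [Finset.mul_sum]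
    exact Finset.sum_congr rfl fun a _ => by ring
  rw [e4]
  have e5 : ∑ a, m2 (ricciC G y) w (b a) * m1 (fun i => pd i F y) (b a)
      = ∑ a, m1 (fun i => pd i F y) (b a) * m2 (ricciC G y) w (b a) :=
    Finset.sum_congr rfl fun a _ => mul_comm _ _
  rw [e5]
  field_simp
  ring

/-- The linearization of the Euler–Lagrange density along a path of metrics with velocity `h` and
a path of functions with velocity `p`, in terms of `v = p - ½ tr h`. -/
theorem PatchPath.hasDerivAt_eulerC {ε : ℝ} {Γ : ℝ → LocalMetric n}
    {h : Coord n → Fin n → Fin n → ℝ} (H : PatchPath ε V Γ h) (hy : y ∈ V) (τ : ℝ)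
    {F : ℝ → Coord n → ℝ} {p : Coord n → ℝ} (hF : ContDiffOn ℝ 2 (F 0) V) (hp : ContDiffOn ℝ 2 p V)
    (h0 : HasDerivAt (fun s => F s y) (p y) 0)
    (h1 : ∀ i, HasDerivAt (fun s => pd i (F s) y) (pd i p y) 0)
    (h2 : ∀ i j, HasDerivAt (fun s => pd i (pd j (F s)) y) (pd i (pd j p) y) 0) :
    HasDerivAt (fun s => eulerC τ (Γ s) (F s) y)
      (τ * (2 * (traceC (Γ 0) y (hessC (Γ 0) (fun z => p z - (1 / 2) * traceC (Γ 0) z (h z)) y)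
            - innerC1 (Γ 0) y (fun i => pd i (fun z => p z - (1 / 2) * traceC (Γ 0) z (h z)) y)
                (fun i => pd i (F 0) y))
          + (traceC (Γ 0) y (nabla1 (Γ 0) (driftDivC (Γ 0) (F 0) h) y)
            - innerC1 (Γ 0) y (fun i => pd i (F 0) y) (driftDivC (Γ 0) (F 0) h y))
          - innerC2 (Γ 0) y (fun i j => ricciC (Γ 0) y i j + hessC (Γ 0) (F 0) y i j) (h y))
        + p y) 0 := by
  have hG := H.base
  obtain ⟨b, hb⟩ := hG.exists_frame hy
  have hh : ∀ i j, ContDiffOn ℝ 2 (fun z => h z i j) V := fun i j =>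
    (H.contDiffOn_h i j).of_le two_le_infty
  have hhd : ∀ i j, DifferentiableAt ℝ (fun z => h z i j) y := fun i j => hG.diffAt (hh i j) hy
  -- the scalar curvature, the Laplacian and the squared gradient, each traced with `g_s`
  have hR : ∀ i j, HasDerivAt (fun s => ricciC (Γ s) y i j)
      (-(1 / 2) * lichC (Γ 0) h y i j
        + (1 / 2) * (nabla1 (Γ 0) (divC (Γ 0) h) y i j + nabla1 (Γ 0) (divC (Γ 0) h) y j i)
        - (1 / 2) * hessC (Γ 0) (fun z => traceC (Γ 0) z (h z)) y i j) 0 := by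
    intro i j
    have := H.hasDerivAt_ricciC hy (bv i) (bv j)
    simpa only [m2_bv] using this
  have hRtr : HasDerivAt (fun s => traceC (Γ s) y (ricciC (Γ s) y))
      (∑ a, m2 (nabla1 (Γ 0) (divC (Γ 0) h) y) (b a) (b a)
        - ∑ a, m2 (hessC (Γ 0) (fun z => traceC (Γ 0) z (h z)) y) (b a) (b a)
        - ∑ a, ∑ c, m2 (h y) (b a) (b c) * m2 (ricciC (Γ 0) y) (b a) (b c)) 0 := by
    refine (hasDerivAt_trace (H.velocity y hy) hR hb).congr_deriv ?_
    congr 1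
    have k0 : ∀ a, m2 (fun i j => -(1 / 2) * lichC (Γ 0) h y i j
        + (1 / 2) * (nabla1 (Γ 0) (divC (Γ 0) h) y i j + nabla1 (Γ 0) (divC (Γ 0) h) y j i)
        - (1 / 2) * hessC (Γ 0) (fun z => traceC (Γ 0) z (h z)) y i j) (b a) (b a)
        = (1 / 2) * ∑ c, (m4 (nabla3 (Γ 0) (nabla2 (Γ 0) h) y) (b c) (b a) (b a) (b c)
        + m4 (nabla3 (Γ 0) (nabla2 (Γ 0) h) y) (b c) (b a) (b a) (b c)
        - m4 (nabla3 (Γ 0) (nabla2 (Γ 0) h) y) (b c) (b c) (b a) (b a)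
        - m4 (nabla3 (Γ 0) (nabla2 (Γ 0) h) y) (b a) (b a) (b c) (b c)) := by
      intro a
      exact (hasDerivAt_m2 hR (b a) (b a)).unique (H.hasDerivAt_ricciC_frame hy hb (b a) (b a))
    simp only [k0, hG.nabla1_divC hh hy hb, hG.hessC_traceC hh hy hb, ← Finset.mul_sum,
      Finset.sum_add_distrib, Finset.sum_sub_distrib]
    have k1 : ∑ a, ∑ c, m4 (nabla3 (Γ 0) (nabla2 (Γ 0) h) y) (b c) (b a) (b a) (b c)
        = ∑ a, ∑ c, m4 (nabla3 (Γ 0) (nabla2 (Γ 0) h) y) (b a) (b c) (b c) (b a) :=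
      Finset.sum_comm
    have k2 : ∑ a, ∑ c, m4 (nabla3 (Γ 0) (nabla2 (Γ 0) h) y) (b c) (b c) (b a) (b a)
        = ∑ a, ∑ c, m4 (nabla3 (Γ 0) (nabla2 (Γ 0) h) y) (b a) (b a) (b c) (b c) :=
      Finset.sum_comm
    rw [k1, k2]
    ring
  have hHtr := hasDerivAt_trace (H.velocity y hy) (H.hasDerivAt_hessC hy h1 h2) hb
  have hdF : HasDerivAt (fun s => innerC1 (Γ s) y (fun i => pd i (F s) y) (fun i => pd i (F s) y))
      (2 * ∑ a, m1 (fun i => pd i p y) (b a) * m1 (fun i => pd i (F 0) y) (b a)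
        - ∑ a, ∑ c, m2 (h y) (b a) (b c)
          * (m1 (fun i => pd i (F 0) y) (b a) * m1 (fun i => pd i (F 0) y) (b c))) 0 := by
    have := hasDerivAt_trace (H.velocity y hy) (fun i j => (h1 i).fun_mul (h1 j)) hb
    simp only [innerC1_eq_traceC]
    refine this.congr_deriv ?_
    simp only [m2_add, m1_mul_m1]
    congr 1
    rw [Finset.mul_sum]
    exact Finset.sum_congr rfl fun a _ => by ring
  have htot := (((hHtr.const_mul 2).sub hdF).add hRtr).const_mul τ |>.add (h0.sub_const (n : ℝ))
  refine htot.congr_deriv ?_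
  clear htot hdF hHtr hRtr hR
  -- the individual terms in an orthonormal frame
  have hpi : ∀ i, ContDiffOn ℝ 1 (fun z => pd i p z) V := fun i =>
    contDiffOn_pd hG.isOpen (by norm_num) hp i
  have htr : ContDiffOn ℝ 2 (fun z => traceC (Γ 0) z (h z)) V :=
    hG.contDiffOn_traceC (k := 2) hh
  have hti : ∀ i, ContDiffOn ℝ 1 (fun z => pd i (fun z => traceC (Γ 0) z (h z)) z) V := fun i =>
    contDiffOn_pd hG.isOpen (by norm_num) htr i
  have hFi : ∀ i, DifferentiableAt ℝ (fun z => pd i (F 0) z) y := fun i =>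
    hG.diffAt (contDiffOn_pd hG.isOpen (k := 1) (by norm_num) hF i) hy
  have hpdv : ∀ z ∈ V, ∀ i, pd i (fun z => p z - (1 / 2) * traceC (Γ 0) z (h z)) z
      = pd i p z + (-(1 / 2)) * pd i (fun z => traceC (Γ 0) z (h z)) z := by
    intro z hz i
    unfold pd
    rw [fderiv_fun_sub (hG.diffAt hp hz) ((hG.diffAt htr hz).const_mul _),
      fderiv_const_mul (hG.diffAt htr hz)]
    simp
    ring
  have t1 : ∀ u v, m2 (hessC (Γ 0) (fun z => p z - (1 / 2) * traceC (Γ 0) z (h z)) y) u v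
      = m2 (hessC (Γ 0) p y) u v
        - (1 / 2) * m2 (hessC (Γ 0) (fun z => traceC (Γ 0) z (h z)) y) u v := by
    intro u v
    have : hessC (Γ 0) (fun z => p z - (1 / 2) * traceC (Γ 0) z (h z)) y
        = fun i j => hessC (Γ 0) p y i j
          - (1 / 2) * hessC (Γ 0) (fun z => traceC (Γ 0) z (h z)) y i j := by
      have k1 : hessC (Γ 0) (fun z => p z - (1 / 2) * traceC (Γ 0) z (h z)) y
        = nabla1 (Γ 0) (fun z a => pd a (fun z => p z - (1 / 2) * traceC (Γ 0) z (h z)) z) y := rfl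
      rw [k1, nabla1_congr_on hG.isOpen (β := fun z i =>
        pd i p z + (-(1 / 2)) * pd i (fun z => traceC (Γ 0) z (h z)) z)
        (fun z hz => funext (hpdv z hz)) hy]
      ext i j
      rw [nabla1_add (β := fun z i => (-(1 / 2)) * pd i (fun z => traceC (Γ 0) z (h z)) z)
        (fun i => hG.diffAt (hpi i) hy) (fun i => (hG.diffAt (hti i) hy).const_mul _),
        nabla1_mul (u := fun _ => (-(1 / 2) : ℝ)) (differentiableAt_const _)
          (fun i => hG.diffAt (hti i) hy)]
      simp only [hessC, pd, fderiv_fun_const, Pi.zero_apply, ContinuousLinearMap.zero_apply]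
      ring
    rw [this, m2_sub, m2_smul]
  have t2 : ∀ u, m1 (fun i => pd i (fun z => p z - (1 / 2) * traceC (Γ 0) z (h z)) y) u
      = m1 (fun i => pd i p y) u - (1 / 2) * ∑ c, m3 (nabla2 (Γ 0) h y) u (b c) (b c) := by
    intro u
    rw [← hG.fderiv_trace_eq hhd hy hb u, fderiv_eq_m1 (fun z => traceC (Γ 0) z (h z)), ← m1_smul,
      ← m1_sub]
    congr 2
    ext i
    rw [hpdv y hy]
    ring
  have t3 : traceC (Γ 0) y (nabla1 (Γ 0) (driftDivC (Γ 0) (F 0) h) y)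
      = ∑ a, m2 (nabla1 (Γ 0) (divC (Γ 0) h) y) (b a) (b a)
        - ∑ a, m1 (fun i => pd i (F 0) y) (b a) * m1 (divC (Γ 0) h y) (b a)
        - ∑ a, ∑ c, m2 (hessC (Γ 0) (F 0) y) (b a) (b c) * m2 (h y) (b a) (b c) := by
    have k1 : ∀ j, DifferentiableAt ℝ (fun z => divC (Γ 0) h z j) y := by
      have a1 := hG.diffAt_nabla2 hh hy
      have a2 : ∀ i j, DifferentiableAt ℝ (fun z => invG (Γ 0) z i j) y := fun i j =>
        hG.diffAt (hG.contDiffOn_invG i j) hy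
      intro j
      unfold divC
      fun_prop
    have k2 : ∀ j, DifferentiableAt ℝ (fun z => contractC (Γ 0) (fun z i => pd i (F 0) z) h z j) y := by
      have a2 : ∀ i j, DifferentiableAt ℝ (fun z => invG (Γ 0) z i j) y := fun i j =>
        hG.diffAt (hG.contDiffOn_invG i j) hy
      intro j
      unfold contractC
      fun_prop
    have k3 := hG.traceC_nabla1_contractC hy hFi hhd (fun z hz => H.h_symm hz)
    rw [hb.traceC, hb.innerC1, hb.innerC2] at k3
    have k4 : nabla1 (Γ 0) (driftDivC (Γ 0) (F 0) h) y = fun i j => nabla1 (Γ 0) (divC (Γ 0) h) y i j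
        - nabla1 (Γ 0) (contractC (Γ 0) (fun z i => pd i (F 0) z) h) y i j := by
      ext i j
      exact nabla1_sub k1 k2 i j
    rw [k4, hb.traceC]
    simp only [m2_sub, Finset.sum_sub_distrib]
    rw [k3, sub_add_eq_sub_sub]
    rfl
  have t4 : ∀ u, m1 (driftDivC (Γ 0) (F 0) h y) u = m1 (divC (Γ 0) h y) u
      - ∑ a, m1 (fun i => pd i (F 0) y) (b a) * m2 (h y) (b a) u := by
    intro u
    rw [← hb.m1_contractC (fun z i => pd i (F 0) z) h u, ← m1_sub]
    rfl
  have t5 : ∀ u v, m2 (psiC (Γ 0) (F 0) h y) u v = -(1 / 2) * ∑ c, m1 (fun i => pd i (F 0) y) (b c)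
      * (m3 (nabla2 (Γ 0) h y) u v (b c) + m3 (nabla2 (Γ 0) h y) v u (b c)
        - m3 (nabla2 (Γ 0) h y) (b c) u v) := by
    intro u v
    revert u
    refine isLinearMap_eq ⟨by simp, by simp⟩ ⟨?_, ?_⟩ (fun i => ?_)
    · intro a b; simp only [Finset.mul_sum, ← Finset.sum_add_distrib]
      refine Finset.sum_congr rfl fun c _ => ?_
      simp; ring
    · intro a b; simp only [smul_eq_mul, Finset.mul_sum]
      refine Finset.sum_congr rfl fun c _ => ?_
      simp; ring
    revert v
    refine isLinearMap_eq ⟨by simp, by simp⟩ ⟨?_, ?_⟩ (fun j => ?_)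
    · intro a b; simp only [Finset.mul_sum, ← Finset.sum_add_distrib]
      refine Finset.sum_congr rfl fun c _ => ?_
      simp; ring
    · intro a b; simp only [smul_eq_mul, Finset.mul_sum]
      refine Finset.sum_congr rfl fun c _ => ?_
      simp; ring
    rw [m2_bv, psiC]
    congr 1
    have k1 : ∀ u : Coord n, m3 (nabla2 (Γ 0) h y) (bv i) (bv j) u + m3 (nabla2 (Γ 0) h y) (bv j) (bv i) u
        - m3 (nabla2 (Γ 0) h y) u (bv i) (bv j) = m1 (fun l => nabla2 (Γ 0) h y i j l
          + nabla2 (Γ 0) h y j i l - nabla2 (Γ 0) h y l i j) u := by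
      intro u
      revert u
      refine isLinearMap_eq ⟨?_, ?_⟩ ⟨by simp, by simp⟩ (fun l => ?_)
      · intro a b; simp; ring
      · intro a b; simp; ring
      simp
    simp only [k1]
    rw [← hb.innerC1, SolitonVariation.innerC1]
    exact Finset.sum_congr rfl fun k _ => Finset.sum_congr rfl fun l _ => by ring
  have hs3 : ∀ u v w, m3 (nabla2 (Γ 0) h y) u v w = m3 (nabla2 (Γ 0) h y) u w v := by
    intro u v w
    rw [m3_nabla2, m3_nabla2, d2_symm hG.isOpen (fun z hz => H.h_symm hz) hy,
      H.m2_h_symm hy v, H.m2_h_symm hy _ w]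
    ring
  have t6 : ∑ a, m2 (psiC (Γ 0) (F 0) h y) (b a) (b a)
      = - ∑ c, m1 (fun i => pd i (F 0) y) (b c) * m1 (divC (Γ 0) h y) (b c)
        + (1 / 2) * ∑ c, m1 (fun i => pd i (F 0) y) (b c)
          * ∑ a, m3 (nabla2 (Γ 0) h y) (b c) (b a) (b a) := by
    simp only [t5, hb.m1_divC, ← Finset.mul_sum]
    rw [Finset.sum_comm]
    simp only [← Finset.mul_sum, Finset.sum_sub_distrib, Finset.sum_add_distrib, mul_sub, mul_add]
    ring
  rw [hb.traceC, hb.innerC1, t3, hb.innerC1, hb.innerC2]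
  simp only [t1, t2, t4, m2_add, Finset.sum_sub_distrib, Finset.sum_add_distrib, ← Finset.mul_sum,
    mul_sub, add_mul, sub_mul, t6]
  have s1 : ∑ a, ∑ c, m2 (ricciC (Γ 0) y) (b a) (b c) * m2 (h y) (b a) (b c)
      = ∑ a, ∑ c, m2 (h y) (b a) (b c) * m2 (ricciC (Γ 0) y) (b a) (b c) :=
    Finset.sum_congr rfl fun a _ => Finset.sum_congr rfl fun c _ => mul_comm _ _
  have s2 : ∑ a, ∑ c, m2 (hessC (Γ 0) (F 0) y) (b a) (b c) * m2 (h y) (b a) (b c)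
      = ∑ a, ∑ c, m2 (h y) (b a) (b c) * m2 (hessC (Γ 0) (F 0) y) (b a) (b c) :=
    Finset.sum_congr rfl fun a _ => Finset.sum_congr rfl fun c _ => mul_comm _ _
  have s3 : ∑ a, m1 (fun i => pd i (F 0) y) (b a)
      * ∑ c, m1 (fun i => pd i (F 0) y) (b c) * m2 (h y) (b c) (b a)
      = ∑ a, ∑ c, m2 (h y) (b a) (b c)
          * (m1 (fun i => pd i (F 0) y) (b a) * m1 (fun i => pd i (F 0) y) (b c)) := by
    refine Finset.sum_congr rfl fun a _ => ?_
    rw [Finset.mul_sum]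
    exact Finset.sum_congr rfl fun c _ => by rw [H.m2_h_symm hy (b c)]; ring
  have s4 : ∑ a, (1 / 2) * (∑ c, m3 (nabla2 (Γ 0) h y) (b a) (b c) (b c))
        * m1 (fun i => pd i (F 0) y) (b a)
      = (1 / 2) * ∑ a, m1 (fun i => pd i (F 0) y) (b a)
        * ∑ c, m3 (nabla2 (Γ 0) h y) (b a) (b c) (b c) := by
    rw [Finset.mul_sum]
    exact Finset.sum_congr rfl fun a _ => by ring
  rw [s1, s2, s3, s4]
  ring

end EulerDensity

/-! ### Tensor fields on a manifold and their components -/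

section Components

variable {n : ℕ} {M : Type*} [TopologicalSpace M] [ChartedSpace (Coord n) M]

/-- The derivative of the inverse of the chart around `a`. The tangent space of `M` at any point
is `ℝⁿ` by definition, so that this is an endomorphism of `ℝⁿ`. -/
def coordVec (a : M) (y : Coord n) : Coord n →L[ℝ] Coord n :=
  mfderiv 𝓘(ℝ, Coord n) (𝓡 n) (crd n a).symm y

/-- The derivative of the chart around `a` at the point `x`. -/
def coordDiff (a x : M) : Coord n →L[ℝ] Coord n :=
  mfderiv (𝓡 n) 𝓘(ℝ, Coord n) (crd n a) x

variable [IsManifold (𝓡 n) ∞ M]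

theorem isOpen_target (a : M) : IsOpen (crd n a).target := isOpen_extChartAt_target a

theorem coordDiff_coordVec {a : M} {y : Coord n} (hy : y ∈ (crd n a).target) (u : Coord n) :
    coordDiff a ((crd n a).symm y) (coordVec a y u) = u := by
  have h := mfderiv_extChartAt_comp_mfderivWithin_extChartAt_symm (I := 𝓡 n) hy
  rw [ModelWithCorners.range_eq_univ, mfderivWithin_univ] at h
  exact congrArg (fun T : Coord n →L[ℝ] Coord n => T u) h

theorem coordVec_coordDiff {a x : M} (hx : x ∈ (crd n a).source) (v : Coord n) :
    coordVec a (crd n a x) (coordDiff a x v) = v := by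
  have h := mfderivWithin_extChartAt_symm_comp_mfderiv_extChartAt' (I := 𝓡 n) hx
  rw [ModelWithCorners.range_eq_univ, mfderivWithin_univ] at h
  exact congrArg (fun T : Coord n →L[ℝ] Coord n => T v) h

theorem coordDiff_self (x : M) (v : Coord n) : coordDiff x x v = v := by
  have h := mfderiv_extChartAt_self (I := 𝓡 n) (x := x)
  exact congrArg (fun T : Coord n →L[ℝ] Coord n => T v) h

theorem vcoord_eq (x : M) (v : Coord n) (i : Fin n) : vcoord x (v : TM n x) i = v i := by
  have := coordDiff_self x v
  exact congrArg (fun w : Coord n => w i) this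

/-- The coordinate change from the chart around `a` to the chart around `b`. -/
def chartChange (a b : M) (y : Coord n) : Coord n := crd n b ((crd n a).symm y)

/-- The domain of the coordinate change from the chart around `a` to the chart around `b`. -/
def overlap (n : ℕ) {M : Type*} [TopologicalSpace M] [ChartedSpace (Coord n) M] (a b : M) :
    Set (Coord n) :=
  (crd n a).target ∩ (crd n a).symm ⁻¹' (crd n b).source

theorem isOpen_overlap (a b : M) : IsOpen (overlap n a b) :=
  (continuousOn_extChartAt_symm a).isOpen_inter_preimage (isOpen_target a)
    (isOpen_extChartAt_source b)

theorem chartChange_mem {a b : M} {y : Coord n} (hy : y ∈ overlap n a b) :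
    chartChange a b y ∈ overlap n b a := by
  refine ⟨(crd n b).map_source hy.2, ?_⟩
  change (crd n b).symm (crd n b ((crd n a).symm y)) ∈ (crd n a).source
  rw [(crd n b).left_inv hy.2]
  exact (crd n a).map_target hy.1

theorem symm_chartChange {a b : M} {y : Coord n} (hy : y ∈ overlap n a b) :
    (crd n b).symm (chartChange a b y) = (crd n a).symm y := (crd n b).left_inv hy.2

theorem chartChange_chartChange {a b : M} {y : Coord n} (hy : y ∈ overlap n a b) :
    chartChange b a (chartChange a b y) = y := by
  rw [chartChange, symm_chartChange hy, (crd n a).right_inv hy.1]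

theorem contDiffOn_chartChange (a b : M) :
    ContDiffOn ℝ ∞ (chartChange a b) (overlap n a b) := by
  rw [← contMDiffOn_iff_contDiffOn]
  exact (contMDiffOn_extChartAt (I := 𝓡 n) (x := b)).comp
    ((contMDiffOn_extChartAt_symm a).mono fun y hy => hy.1) fun y hy => by
      simpa using hy.2

theorem fderiv_chartChange {a b : M} {y : Coord n} (hy : y ∈ overlap n a b) (u : Coord n) :
    fderiv ℝ (chartChange a b) y u = coordDiff b ((crd n a).symm y) (coordVec a y u) := by
  have h1 : MDifferentiableAt (𝓡 n) 𝓘(ℝ, Coord n) (crd n b) ((crd n a).symm y) :=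
    mdifferentiableAt_extChartAt (by simpa using hy.2)
  have h2 : MDifferentiableAt 𝓘(ℝ, Coord n) (𝓡 n) (crd n a).symm y := by
    have := mdifferentiableWithinAt_extChartAt_symm (I := 𝓡 n) hy.1
    rwa [ModelWithCorners.range_eq_univ, mdifferentiableWithinAt_univ] at this
  have h3 := mfderiv_comp y h1 h2
  rw [mfderiv_eq_fderiv] at h3
  exact congrArg (fun T : Coord n →L[ℝ] Coord n => T u) h3

theorem coordVec_chartChange {a b : M} {y : Coord n} (hy : y ∈ overlap n a b) (u : Coord n) :
    coordVec b (chartChange a b y) (fderiv ℝ (chartChange a b) y u) = coordVec a y u := by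
  rw [fderiv_chartChange hy]
  exact coordVec_coordDiff hy.2 _

theorem mem_overlap_self {a : M} {y : Coord n} (hy : y ∈ (crd n a).target) :
    y ∈ overlap n a ((crd n a).symm y) := ⟨hy, mem_extChartAt_source _⟩

/-- Pointwise linearity of a field of one-forms. -/
def IsLin1 (α : Field1 n M) : Prop := ∀ x, ∃ A : Coord n →L[ℝ] ℝ, ∀ v : Coord n, α x v = A v

/-- Pointwise bilinearity of a field of `(0,2)` tensors. -/
def IsLin2 (h : Field2 n M) : Prop :=
  ∀ x, ∃ A : Coord n →L[ℝ] Coord n →L[ℝ] ℝ, ∀ v w : Coord n, h x v w = A v w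

theorem m1_comp1 {α : Field1 n M} (hα : IsLin1 α) (a : M) (y u : Coord n) :
    m1 (comp1 a α y) u = α ((crd n a).symm y) (coordVec a y u) := by
  obtain ⟨A, hA⟩ := hα ((crd n a).symm y)
  rw [hA]
  have : comp1 a α y = fun i => (A.comp (coordVec a y)) (bv i) := funext fun i => hA _
  rw [this, m1_clm]
  rfl

theorem m2_comp2 {h : Field2 n M} (hh : IsLin2 h) (a : M) (y u v : Coord n) :
    m2 (comp2 a h y) u v = h ((crd n a).symm y) (coordVec a y u) (coordVec a y v) := by
  obtain ⟨A, hA⟩ := hh ((crd n a).symm y)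
  rw [hA]
  have : comp2 a h y = fun i j => (A.bilinearComp (coordVec a y) (coordVec a y)) (bv i) (bv j) :=
    funext fun i => funext fun j => hA _ _
  rw [this, m2_clm]
  rfl

theorem comp0_chartChange (u : M → ℝ) {a b : M} {y : Coord n} (hy : y ∈ overlap n a b) :
    comp0 b u (chartChange a b y) = comp0 a u y := by
  rw [comp0, symm_chartChange hy]; rfl

theorem m1_comp1_chartChange {α : Field1 n M} (hα : IsLin1 α) {a b : M} {y : Coord n}
    (hy : y ∈ overlap n a b) (u : Coord n) :
    m1 (comp1 a α y) u = m1 (comp1 b α (chartChange a b y)) (fderiv ℝ (chartChange a b) y u) := by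
  rw [m1_comp1 hα, m1_comp1 hα, coordVec_chartChange hy]
  have : ∀ x x' : M, x = x' → ∀ v : Coord n, α x v = α x' v := by rintro x _ rfl v; rfl
  exact this _ _ (symm_chartChange hy).symm _

theorem m2_comp2_chartChange {h : Field2 n M} (hh : IsLin2 h) {a b : M} {y : Coord n}
    (hy : y ∈ overlap n a b) (u v : Coord n) :
    m2 (comp2 a h y) u v = m2 (comp2 b h (chartChange a b y))
      (fderiv ℝ (chartChange a b) y u) (fderiv ℝ (chartChange a b) y v) := by
  rw [m2_comp2 hh, m2_comp2 hh, coordVec_chartChange hy, coordVec_chartChange hy]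
  have : ∀ x x' : M, x = x' → ∀ v w : Coord n, h x v w = h x' v w := by rintro x _ rfl v w; rfl
  exact this _ _ (symm_chartChange hy).symm _ _

theorem of1_eq (x : M) (c : Fin n → ℝ) (v : Coord n) : of1 x c (v : TM n x) = m1 c v := by
  rw [m1_apply]
  exact Finset.sum_congr rfl fun i _ => by rw [vcoord_eq, mul_comm]

theorem of2_eq (x : M) (c : Fin n → Fin n → ℝ) (v w : Coord n) :
    of2 x c (v : TM n x) (w : TM n x) = m2 c v w := by
  rw [m2_apply]
  exact Finset.sum_congr rfl fun i _ => Finset.sum_congr rfl fun j _ => by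
    rw [vcoord_eq, vcoord_eq]; ring

theorem isLin1_of1 (K : M → Fin n → ℝ) : IsLin1 (fun x => of1 x (K x) : Field1 n M) :=
  fun x => ⟨m1 (K x), of1_eq x (K x)⟩

theorem isLin2_of2 (K : M → Fin n → Fin n → ℝ) : IsLin2 (fun x => of2 x (K x) : Field2 n M) :=
  fun x => ⟨m2 (K x), of2_eq x (K x)⟩

/-- The components, in any chart, of a field which is given at each point by components in the
preferred chart at that point. -/
theorem comp1_of1 {K : M → Fin n → ℝ} {a : M} {y : Coord n} (hy : y ∈ (crd n a).target)
    {k : Fin n → ℝ}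
    (h : ∀ u, m1 k u = m1 (K ((crd n a).symm y))
      (fderiv ℝ (chartChange a ((crd n a).symm y)) y u)) (i : Fin n) :
    comp1 a (fun x => of1 x (K x)) y i = k i := by
  have h1 := m1_comp1 (isLin1_of1 K) a y (bv i)
  rw [m1_bv] at h1
  rw [h1, ← m1_bv k i, h, fderiv_chartChange (mem_overlap_self hy), coordDiff_self]
  exact of1_eq _ _ _

theorem comp2_of2 {K : M → Fin n → Fin n → ℝ} {a : M} {y : Coord n} (hy : y ∈ (crd n a).target)
    {k : Fin n → Fin n → ℝ}
    (h : ∀ u v, m2 k u v = m2 (K ((crd n a).symm y))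
      (fderiv ℝ (chartChange a ((crd n a).symm y)) y u)
      (fderiv ℝ (chartChange a ((crd n a).symm y)) y v)) (i j : Fin n) :
    comp2 a (fun x => of2 x (K x)) y i j = k i j := by
  have h1 := m2_comp2 (isLin2_of2 K) a y (bv i) (bv j)
  rw [m2_bv] at h1
  rw [h1, ← m2_bv k i j, h, fderiv_chartChange (mem_overlap_self hy),
    fderiv_chartChange (mem_overlap_self hy), coordDiff_self, coordDiff_self]
  exact of2_eq _ _ _ _

/-- The components of a field at the centre of the chart. -/
theorem comp1_self {α : Field1 n M} (hα : IsLin1 α) (x : M) (v : Coord n) :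
    m1 (comp1 x α (crd n x x)) v = α x v := by
  rw [m1_comp1 hα]
  have e : (crd n x).symm (crd n x x) = x := extChartAt_to_inv x
  have h1 : coordVec x (crd n x x) v = v := by
    have := coordVec_coordDiff (n := n) (a := x) (x := x) (mem_extChartAt_source x) v
    rwa [coordDiff_self] at this
  rw [h1]
  have : ∀ x' : M, x' = x → α x' (v : Coord n) = α x (v : Coord n) := by rintro _ rfl; rfl
  exact this _ e

theorem comp2_self {h : Field2 n M} (hh : IsLin2 h) (x : M) (v w : Coord n) :
    m2 (comp2 x h (crd n x x)) v w = h x v w := by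
  rw [m2_comp2 hh]
  have e : (crd n x).symm (crd n x x) = x := extChartAt_to_inv x
  have h1 : ∀ v, coordVec x (crd n x x) v = v := by
    intro v
    have := coordVec_coordDiff (n := n) (a := x) (x := x) (mem_extChartAt_source x) v
    rwa [coordDiff_self] at this
  rw [h1, h1]
  have : ∀ x' : M, x' = x → h x' (v : Coord n) (w : Coord n) = h x (v : Coord n) (w : Coord n) := by
    rintro _ rfl; rfl
  exact this _ e

end Components

/-! ### Smooth sections and smooth components -/

section Sections

variable {n : ℕ} {M : Type*} [TopologicalSpace M] [ChartedSpace (Coord n) M]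
  [IsManifold (𝓡 n) ∞ M]

theorem trivializationAt_symm {x x' : M} (hx : x' ∈ (crd n x).source) (v : Coord n) :
    (trivializationAt (Coord n) (TangentSpace (𝓡 n)) x).symm x' v = coordVec x (crd n x x') v := by
  have h1 := TangentBundle.symmL_trivializationAt (I := 𝓡 n) (x₀ := x) (x := x') (by simpa using hx)
  rw [ModelWithCorners.range_eq_univ, mfderivWithin_univ] at h1
  rw [← Trivialization.symmL_apply (R := ℝ)]
  · exact congrArg (fun T : Coord n →L[ℝ] Coord n => T v) h1
  · simpa using hx

variable (A : ℝ → ∀ x : M, TangentSpace (𝓡 n) x →L[ℝ] TangentSpace (𝓡 n) x →L[ℝ] ℝ)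

/-- The field underlying a family of bilinear forms, at the parameter `s`. -/
def familyField (s : ℝ) : Field2 n M := fun x u v => A s x u v

theorem isLin2_familyField (s : ℝ) : IsLin2 (familyField A s) := fun x => ⟨A s x, fun _ _ => rfl⟩

/-- In the trivialization of the bundle of bilinear forms that the chart around `x` induces, a form
is read off in the components with respect to the coordinate frame. -/
theorem inCoordinates_eq_m2 {s : ℝ} {x x' : M} (hx : x' ∈ (crd n x).source) :
    ContinuousLinearMap.inCoordinates (Coord n) (TangentSpace (𝓡 n) : M → Type _)
        (Coord n →L[ℝ] ℝ) (fun x : M => TangentSpace (𝓡 n) x →L[ℝ] ℝ) x x' x x' (A s x')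
      = m2 (comp2 x (familyField A s) (crd n x x')) := by
  ext v w
  have hb : x' ∈ (trivializationAt (Coord n) (TangentSpace (𝓡 n) : M → Type _) x).baseSet := by
    simpa using hx
  have := inCoordinates_apply_eq₂ (𝕜 := ℝ) (F₁ := Coord n) (F₂ := Coord n) (F₃ := ℝ)
    (E₁ := (TangentSpace (𝓡 n) : M → Type _)) (E₂ := (TangentSpace (𝓡 n) : M → Type _))
    (E₃ := fun _ : M => ℝ) (x₀ := x) (x := x') (ϕ := A s x') (v := v) (w := w) hb hb
    (Set.mem_univ _)
  refine this.trans ?_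
  rw [m2_comp2 (isLin2_familyField A s), trivializationAt_symm hx, trivializationAt_symm hx]
  have e : ∀ y y' : M, y = y' → ∀ v w : Coord n, familyField A s y v w = familyField A s y' v w := by
    rintro y _ rfl v w; rfl
  refine Eq.trans ?_ (e _ _ ((crd n x).left_inv hx).symm _ _)
  simp [familyField]

theorem contMDiffAt_section_iff (s : ℝ) (x : M) :
    ContMDiffAt (𝓘(ℝ, ℝ).prod (𝓡 n)) ((𝓡 n).prod 𝓘(ℝ, Coord n →L[ℝ] Coord n →L[ℝ] ℝ)) ∞
      (fun p : ℝ × M => TotalSpace.mk' (Coord n →L[ℝ] Coord n →L[ℝ] ℝ)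
        (E := fun x : M => TangentSpace (𝓡 n) x →L[ℝ] TangentSpace (𝓡 n) x →L[ℝ] ℝ)
        p.2 (A p.1 p.2)) (s, x)
      ↔ ∀ i j, ContDiffAt ℝ ∞ (fun q : ℝ × Coord n => comp2 x (familyField A q.1) q.2 i j)
          (s, crd n x x) := by
  have h1 : ∀ i j, ContDiffAt ℝ ∞ (fun q : ℝ × Coord n => comp2 x (familyField A q.1) q.2 i j)
          (s, crd n x x) ↔ ContMDiffAt (𝓘(ℝ, ℝ).prod (𝓡 n)) 𝓘(ℝ, ℝ) ∞
        (fun p : ℝ × M => comp2 x (familyField A p.1) (crd n x p.2) i j) (s, x) := by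
    intro i j
    constructor
    · intro h
      have h2 : ContMDiffAt (𝓘(ℝ, ℝ).prod (𝓡 n)) 𝓘(ℝ, ℝ × Coord n) ∞
          (fun p : ℝ × M => (p.1, crd n x p.2)) (s, x) :=
        contMDiffAt_fst.prodMk_space (contMDiffAt_extChartAt.comp (s, x) contMDiffAt_snd)
      exact ContDiffAt.comp_contMDiffAt (g := fun q : ℝ × Coord n =>
        comp2 x (familyField A q.1) q.2 i j) (f := fun p : ℝ × M => (p.1, crd n x p.2)) h h2
    · intro h
      rw [← contMDiffAt_iff_contDiffAt]
      have h3 : ContMDiffAt 𝓘(ℝ, Coord n) (𝓡 n) ∞ (crd n x).symm (crd n x x) :=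
        (contMDiffOn_extChartAt_symm x).contMDiffAt (extChartAt_target_mem_nhds x)
      have h2 : ContMDiffAt 𝓘(ℝ, ℝ × Coord n) (𝓘(ℝ, ℝ).prod (𝓡 n)) ∞
          (fun q : ℝ × Coord n => (q.1, (crd n x).symm q.2)) (s, crd n x x) :=
        contDiff_fst.contMDiff.contMDiffAt.prodMk
          (ContMDiffAt.comp (s, crd n x x) h3 contDiff_snd.contMDiff.contMDiffAt)
      have h4 := ContMDiffAt.comp_of_eq (x := (s, crd n x x)) (y := (s, x))
        (g := fun p : ℝ × M => comp2 x (familyField A p.1) (crd n x p.2) i j)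
        (f := fun q : ℝ × Coord n => (q.1, (crd n x).symm q.2)) h h2
        (by simp)
      refine h4.congr_of_eventuallyEq ?_
      have : ∀ᶠ q : ℝ × Coord n in 𝓝 (s, crd n x x), q.2 ∈ (crd n x).target :=
        (continuous_snd.tendsto (s, crd n x x)).eventually
          (extChartAt_target_mem_nhds (I := 𝓡 n) x)
      filter_upwards [this] with q hq
      simp only [Function.comp_apply, (crd n x).right_inv hq]
  rw [contMDiffAt_hom_bundle]
  simp only [h1]
  have hev : (fun p : ℝ × M => ContinuousLinearMap.inCoordinates (Coord n)
        (TangentSpace (𝓡 n) : M → Type _)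
        (Coord n →L[ℝ] ℝ) (fun x : M => TangentSpace (𝓡 n) x →L[ℝ] ℝ) x p.2 x p.2 (A p.1 p.2))
      =ᶠ[𝓝 (s, x)] fun p => m2 (comp2 x (familyField A p.1) (crd n x p.2)) := by
    have : ∀ᶠ p : ℝ × M in 𝓝 (s, x), p.2 ∈ (crd n x).source :=
      (continuous_snd.tendsto (s, x)).eventually (extChartAt_source_mem_nhds (I := 𝓡 n) x)
    filter_upwards [this] with p hp
    exact inCoordinates_eq_m2 A hp
  constructor
  · rintro ⟨-, h⟩ i j
    have h2 := h.congr_of_eventuallyEq hev.symm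
    have h3 := (h2.clm_apply (contMDiffAt_const (c := (bv i : Coord n)))).clm_apply
      (contMDiffAt_const (c := (bv j : Coord n)))
    simpa using h3
  · intro h
    refine ⟨contMDiffAt_snd, ?_⟩
    refine ContMDiffAt.congr_of_eventuallyEq ?_ hev
    have h2 : ContMDiffAt (𝓘(ℝ, ℝ).prod (𝓡 n)) 𝓘(ℝ, Fin n → Fin n → ℝ) ∞
        (fun p : ℝ × M => comp2 x (familyField A p.1) (crd n x p.2)) (s, x) :=
      contMDiffAt_pi_space.2 fun i => contMDiffAt_pi_space.2 fun j => h i j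
    have h3 : ContDiff ℝ ∞ (fun c : Fin n → Fin n → ℝ => m2 c) := by
      rw [← contDiffOn_univ]
      exact contDiffOn_ofBasis fun i => contDiffOn_ofBasis fun j =>
        (contDiff_apply_apply ℝ ℝ i j).contDiffOn
    exact h3.contMDiff.contMDiffAt.comp (s, x) h2

/-- A family of bilinear forms is a smooth section, jointly in the parameter and the point, if and
only if its components are smooth. -/
theorem contMDiffOn_section_iff (ε : ℝ) :
    ContMDiffOn (𝓘(ℝ, ℝ).prod (𝓡 n)) ((𝓡 n).prod 𝓘(ℝ, Coord n →L[ℝ] Coord n →L[ℝ] ℝ)) ∞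
      (fun p : ℝ × M => TotalSpace.mk' (Coord n →L[ℝ] Coord n →L[ℝ] ℝ)
        (E := fun x : M => TangentSpace (𝓡 n) x →L[ℝ] TangentSpace (𝓡 n) x →L[ℝ] ℝ)
        p.2 (A p.1 p.2)) (Ioo (-ε) ε ×ˢ univ)
      ↔ ∀ (a : M) (i j : Fin n),
          JointSmooth ε (crd n a).target (fun s z => comp2 a (familyField A s) z i j) := by
  have hO : IsOpen (Ioo (-ε) ε ×ˢ (univ : Set M)) := isOpen_Ioo.prod isOpen_univ
  constructor
  · intro h a i j
    rintro ⟨s, z⟩ ⟨hs, hz⟩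
    have hx := mem_overlap_self hz
    set x := (crd n a).symm z with hxd
    have h1 := (contMDiffAt_section_iff A s x).1 (h.contMDiffAt (hO.mem_nhds ⟨hs, mem_univ _⟩))
    have e0 : chartChange a x z = crd n x x := rfl
    have hφ : ContDiffAt ℝ ∞ (chartChange a x) z :=
      (contDiffOn_chartChange a x).contDiffAt ((isOpen_overlap a x).mem_nhds hx)
    have hdφ : ContDiffAt ℝ ∞ (fderiv ℝ (chartChange a x)) z :=
      ((contDiffOn_chartChange a x).fderiv_of_isOpen (isOpen_overlap a x) (by simp)).contDiffAt
        ((isOpen_overlap a x).mem_nhds hx)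
    have hq : ContDiffAt ℝ ∞ (fun q : ℝ × Coord n => (q.1, chartChange a x q.2)) (s, z) :=
      contDiffAt_fst.prodMk (ContDiffAt.comp (g := chartChange a x) (f := Prod.snd) (s, z)
        hφ contDiffAt_snd)
    have hd : ∀ i k, ContDiffAt ℝ ∞
        (fun q : ℝ × Coord n => (fderiv ℝ (chartChange a x) q.2 (bv i)) k) (s, z) := by
      intro i
      have : ContDiffAt ℝ ∞ (fun q : ℝ × Coord n => fderiv ℝ (chartChange a x) q.2 (bv i)) (s, z) :=
        (ContDiffAt.comp (g := fderiv ℝ (chartChange a x)) (f := Prod.snd) (s, z)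
        hdφ contDiffAt_snd).clm_apply contDiffAt_const
      exact contDiffAt_euclidean.1 this
    have hc : ∀ k l, ContDiffAt ℝ ∞ (fun q : ℝ × Coord n =>
        comp2 x (familyField A q.1) (chartChange a x q.2) k l) (s, z) := by
      intro k l
      exact ContDiffAt.comp (s, z) (g := fun q : ℝ × Coord n =>
        comp2 x (familyField A q.1) q.2 k l) (f := fun q => (q.1, chartChange a x q.2))
        (h1 k l) hq
    refine ContDiffAt.contDiffWithinAt ?_
    have h5 : ContDiffAt ℝ ∞ (fun q : ℝ × Coord n => ∑ k, ∑ l,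
        (fderiv ℝ (chartChange a x) q.2 (bv i)) k * ((fderiv ℝ (chartChange a x) q.2 (bv j)) l *
          comp2 x (familyField A q.1) (chartChange a x q.2) k l)) (s, z) :=
      ContDiffAt.sum fun k _ => ContDiffAt.sum fun l _ => (hd i k).mul ((hd j l).mul (hc k l))
    refine h5.congr_of_eventuallyEq ?_
    have : ∀ᶠ q : ℝ × Coord n in 𝓝 (s, z), q.2 ∈ overlap n a x :=
      (continuous_snd.tendsto (s, z)).eventually ((isOpen_overlap a x).mem_nhds hx)
    filter_upwards [this] with q hq
    rw [← m2_apply, ← m2_comp2_chartChange (isLin2_familyField A q.1) hq, m2_bv]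
  · intro h
    rintro ⟨s, x⟩ ⟨hs, -⟩
    refine ContMDiffAt.contMDiffWithinAt ?_
    rw [contMDiffAt_section_iff]
    intro i j
    exact (h x i j).contDiffAt ((isOpen_Ioo.prod (isOpen_target x)).mem_nhds
      ⟨hs, mem_extChartAt_target x⟩)

theorem contMDiff_section_iff (h : ∀ x : M, TangentSpace (𝓡 n) x →L[ℝ] TangentSpace (𝓡 n) x →L[ℝ] ℝ) :
    ContMDiff (𝓡 n) ((𝓡 n).prod 𝓘(ℝ, Coord n →L[ℝ] Coord n →L[ℝ] ℝ)) ∞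
      (fun x : M => TotalSpace.mk' (Coord n →L[ℝ] Coord n →L[ℝ] ℝ)
        (E := fun x : M => TangentSpace (𝓡 n) x →L[ℝ] TangentSpace (𝓡 n) x →L[ℝ] ℝ) x (h x))
      ↔ ∀ (a : M) (i j : Fin n),
          ContDiffOn ℝ ∞ (fun z => comp2 a (fun x u v => h x u v) z i j) (crd n a).target := by
  have h1 := contMDiffOn_section_iff (fun _ : ℝ => h) 1
  constructor
  · intro hh a i j
    have h2 := h1.1 (ContMDiff.contMDiffOn (hh.comp contMDiff_snd)) a i j
    exact h2.slice (s := 0) (by norm_num)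
  · intro hh
    have h2 := h1.2 fun a i j => (hh a i j).comp contDiffOn_snd fun p hp => hp.2
    have h3 : ContMDiff (𝓡 n) (𝓘(ℝ, ℝ).prod (𝓡 n)) ∞ (fun x : M => ((0 : ℝ), x)) :=
      contMDiff_const.prodMk contMDiff_id
    exact contMDiffOn_univ.1 (ContMDiffOn.comp h2 h3.contMDiffOn fun x _ => ⟨by norm_num, mem_univ _⟩)

theorem contDiffOn_comp1 (α : OneForm n M) (a : M) (i : Fin n) :
    ContDiffOn ℝ ∞ (fun z => comp1 a α.field z i) (crd n a).target := by
  have hlin : IsLin1 α.field := fun x => ⟨α.val x, fun _ => rfl⟩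
  intro z hz
  have hx := mem_overlap_self hz
  set x := (crd n a).symm z with hxd
  have hsec := (contMDiffAt_hom_bundle _).1 (α.smooth x)
  have h0 := hsec.2
  have hev : (fun x' : M => ContinuousLinearMap.inCoordinates (Coord n)
        (TangentSpace (𝓡 n) : M → Type _) ℝ (fun _ : M => ℝ) x x' x x' (α.val x'))
      =ᶠ[𝓝 x] fun x' => m1 (comp1 x α.field (crd n x x')) := by
    filter_upwards [extChartAt_source_mem_nhds (I := 𝓡 n) x] with x' hx'
    ext v
    have hb : x' ∈ (trivializationAt (Coord n) (TangentSpace (𝓡 n) : M → Type _) x).baseSet := by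
      simpa using hx'
    rw [ContinuousLinearMap.inCoordinates_eq hb (Set.mem_univ _), m1_comp1 hlin]
    have e : ∀ y y' : M, y = y' → ∀ v : Coord n, α.field y v = α.field y' v := by
      rintro y _ rfl v; rfl
    refine Eq.trans ?_ (e _ _ ((crd n x).left_inv hx').symm _)
    rw [← trivializationAt_symm hx']
    simp [OneForm.field]
  have h1 := h0.congr_of_eventuallyEq hev.symm
  have h3 : ContMDiffAt 𝓘(ℝ, Coord n) (𝓡 n) ∞ (crd n a).symm z :=
    (contMDiffOn_extChartAt_symm a).contMDiffAt ((isOpen_target a).mem_nhds hz)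
  have h4 := (ContMDiffAt.comp z h1 h3).contDiffAt
  have hdφ : ContDiffAt ℝ ∞ (fderiv ℝ (chartChange a x)) z :=
    ((contDiffOn_chartChange a x).fderiv_of_isOpen (isOpen_overlap a x) (by simp)).contDiffAt
      ((isOpen_overlap a x).mem_nhds hx)
  have h5 := h4.clm_apply (hdφ.clm_apply (contDiffAt_const (c := (bv i : Coord n))))
  refine (h5.congr_of_eventuallyEq ?_).contDiffWithinAt
  filter_upwards [(isOpen_overlap a x).mem_nhds hx] with q hq
  have := m1_comp1_chartChange hlin hq (bv i)
  rw [m1_bv] at this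
  exact this

end Sections

/-! ### Operators on fields in arbitrary charts -/

section Charts

variable {n : ℕ} {M : Type*} [TopologicalSpace M] [ChartedSpace (Coord n) M]

theorem posDef_of_m2 {A : Fin n → Fin n → ℝ} (hs : ∀ i j, A i j = A j i)
    (hp : ∀ v : Coord n, v ≠ 0 → 0 < m2 A v v) : (Matrix.of A).PosDef := by
  refine Matrix.PosDef.of_dotProduct_mulVec_pos ?_ ?_
  · ext i j
    simpa using hs j i
  · intro x hx
    have h := hp (vec x) fun h => hx (by
      ext i
      have := congrArg (fun w : Coord n => w i) h
      simpa using this)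
    refine h.trans_eq ?_
    rw [m2_apply]
    simp only [dotProduct, Matrix.mulVec, vec_apply, Finset.mul_sum]
    exact Finset.sum_congr rfl fun i _ => Finset.sum_congr rfl fun j _ => by
      rw [show star x i = x i from rfl]; simp only [Matrix.of_apply]; ring

theorem PatchMetric.mono {V W : Set (Coord n)} {G : LocalMetric n} (hG : PatchMetric W G)
    (hV : IsOpen V) (h : V ⊆ W) : PatchMetric V G :=
  ⟨hV, fun i j => (hG.smooth i j).mono h, fun z hz => hG.posDef z (h hz)⟩

theorem IsometricChange.innerC1_pull {V W : Set (Coord n)} {φ : Coord n → Coord n}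
    {G' G : LocalMetric n} (H : IsometricChange V W φ G' G) {y : Coord n} (hy : y ∈ V)
    {α' η' α η : Fin n → ℝ} (e : ∀ u, m1 α' u = m1 α (fderiv ℝ φ y u))
    (e' : ∀ u, m1 η' u = m1 η (fderiv ℝ φ y u)) :
    innerC1 G' y α' η' = innerC1 G (φ y) α η := by
  obtain ⟨b, hb⟩ := H.source.exists_frame hy
  rw [hb.innerC1, (H.isFrame hy hb).innerC1]
  simp only [e, e']

theorem IsometricChange.innerC2_pull {V W : Set (Coord n)} {φ : Coord n → Coord n}
    {G' G : LocalMetric n} (H : IsometricChange V W φ G' G) {y : Coord n} (hy : y ∈ V)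
    {S' T' S T : Fin n → Fin n → ℝ}
    (e : ∀ u v, m2 S' u v = m2 S (fderiv ℝ φ y u) (fderiv ℝ φ y v))
    (e' : ∀ u v, m2 T' u v = m2 T (fderiv ℝ φ y u) (fderiv ℝ φ y v)) :
    innerC2 G' y S' T' = innerC2 G (φ y) S T := by
  obtain ⟨b, hb⟩ := H.source.exists_frame hy
  rw [hb.innerC2, (H.isFrame hy hb).innerC2]
  simp only [e, e']

/-- `u` is of class `C^k` in all charts. -/
def Reg0 (k : ℕ∞ω) (u : M → ℝ) : Prop :=
  ∀ a : M, ContDiffOn ℝ k (comp0 a u) (crd n a).target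

/-- `α` is a field of linear forms, of class `C^k` in all charts. -/
structure Reg1 (k : ℕ∞ω) (α : Field1 n M) : Prop where
  lin : IsLin1 α
  comp (a : M) (i : Fin n) : ContDiffOn ℝ k (fun z => comp1 a α z i) (crd n a).target

/-- `h` is a field of bilinear forms, of class `C^k` in all charts. -/
structure Reg2 (k : ℕ∞ω) (h : Field2 n M) : Prop where
  lin : IsLin2 h
  comp (a : M) (i j : Fin n) : ContDiffOn ℝ k (fun z => comp2 a h z i j) (crd n a).target

theorem Reg0.of_le {k l : ℕ∞ω} {u : M → ℝ} (hu : Reg0 (n := n) l u) (h : k ≤ l) :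
    Reg0 (n := n) k u := fun a => (hu a).of_le h

theorem Reg1.of_le {k l : ℕ∞ω} {α : Field1 n M} (hα : Reg1 l α) (h : k ≤ l) : Reg1 k α :=
  ⟨hα.lin, fun a i => (hα.comp a i).of_le h⟩

theorem Reg2.of_le {k l : ℕ∞ω} {α : Field2 n M} (hα : Reg2 l α) (h : k ≤ l) : Reg2 k α :=
  ⟨hα.lin, fun a i j => (hα.comp a i j).of_le h⟩

variable [IsManifold (𝓡 n) ∞ M]

theorem reg0_of_contMDiff {k : ℕ∞} {u : M → ℝ} (hu : ContMDiff (𝓡 n) 𝓘(ℝ, ℝ) k u) :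
    Reg0 (n := n) k u := by
  intro a
  rw [← contMDiffOn_iff_contDiffOn]
  exact hu.comp_contMDiffOn ((contMDiffOn_extChartAt_symm (n := ∞) a).of_le (by simp))

theorem Reg0.contMDiff {k : ℕ∞} {u : M → ℝ} (hu : Reg0 (n := n) k u) :
    ContMDiff (𝓡 n) 𝓘(ℝ, ℝ) k u := by
  intro x
  have h1 : ContDiffAt ℝ k (comp0 x u) (crd n x x) :=
    (hu x).contDiffAt (extChartAt_target_mem_nhds x)
  have h2 : ContMDiffAt (𝓡 n) 𝓘(ℝ, Coord n) k (crd n x) x :=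
    (contMDiffAt_extChartAt (n := ∞)).of_le (by simp)
  have h3 := h1.comp_contMDiffAt h2
  refine h3.congr_of_eventuallyEq ?_
  filter_upwards [extChartAt_source_mem_nhds (I := 𝓡 n) x] with x' hx'
  simp only [Function.comp_apply, comp0, (crd n x).left_inv hx']

theorem Reg0.continuous {k : ℕ∞} {u : M → ℝ} (hu : Reg0 (n := n) k u) : Continuous u :=
  hu.contMDiff.continuous

theorem SmoothFun.reg0 (f : SmoothFun n M) : Reg0 (n := n) ∞ (f : M → ℝ) :=
  reg0_of_contMDiff (k := ⊤) f.contMDiff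

theorem OneForm.reg1 (α : OneForm n M) : Reg1 ∞ α.field :=
  ⟨fun x => ⟨α.val x, fun _ => rfl⟩, fun a i => contDiffOn_comp1 α a i⟩

theorem SymTensor.reg2 (h : SymTensor n M) : Reg2 ∞ h.field :=
  ⟨fun x => ⟨h.val x, fun _ _ => rfl⟩, (contMDiff_section_iff h.val).1 h.smooth⟩

theorem RMetric.reg2 (g : RMetric n M) : Reg2 ∞ (RMetric.field g) :=
  ⟨fun x => ⟨g.inner x, fun _ _ => rfl⟩, (contMDiff_section_iff g.inner).1 g.contMDiff⟩

theorem comp2_symm {h : Field2 n M} (hs : ∀ x v w, h x v w = h x w v) (a : M) (y : Coord n)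
    (i j : Fin n) : comp2 a h y i j = comp2 a h y j i := hs _ _ _

theorem patchMetric (g : RMetric n M) (a : M) : PatchMetric (crd n a).target (locG g a) := by
  refine ⟨isOpen_target a, (RMetric.reg2 g).comp a, fun z hz => ?_⟩
  refine posDef_of_m2 (comp2_symm (fun x v w => g.symm x v w) a z) fun v hv => ?_
  have h1 := m2_comp2 (RMetric.reg2 g).lin a z v v
  refine lt_of_lt_of_eq ?_ h1.symm
  refine g.pos _ _ fun h => hv ?_
  have h2 := coordDiff_coordVec hz v
  have h3 : coordVec a z v = 0 := h
  rw [h3, map_zero] at h2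
  exact h2.symm

/-- Changes of charts are isometric for the coordinate expressions of `g`. By naturality, the
components of a curvature or derivative tensor in any chart are therefore given by the coordinate
formula in that chart, although the tensor is defined with the preferred chart at each point. -/
theorem isometricChange (g : RMetric n M) (a b : M) :
    IsometricChange (overlap n a b) (crd n b).target (chartChange a b) (locG g a) (locG g b) where
  source := (patchMetric g a).mono (isOpen_overlap a b) fun _ hz => hz.1
  target := patchMetric g b
  mapsTo := fun z hz => (chartChange_mem hz).1
  smooth := contDiffOn_chartChange a b
  pull := fun z hz u v => m2_comp2_chartChange (RMetric.reg2 g).lin hz u v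

section Evaluation

variable (g : RMetric n M) {a : M} {y : Coord n} (hy : y ∈ (crd n a).target)

theorem isLin2_ricci : IsLin2 (ricci g) := isLin2_of2 _

theorem isLin2_hess (u : M → ℝ) : IsLin2 (hess g u) := isLin2_of2 _

theorem isLin1_diff (u : M → ℝ) : IsLin1 (diff (n := n) u) := isLin1_of1 _

theorem isLin1_div2 (h : Field2 n M) : IsLin1 (div2 g h) := isLin1_of1 _

theorem comp2_ricci (hy : y ∈ (crd n a).target) : comp2 a (ricci g) y = ricciC (locG g a) y := by
  ext i j
  exact comp2_of2 (K := fun x => ricciC (locG g x) (crd n x x)) hy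
    (fun u v => (isometricChange g a _).ricciC_pull (mem_overlap_self hy) u v) i j

theorem comp2_hess (hy : y ∈ (crd n a).target) {u : M → ℝ} (hu : Reg0 (n := n) 2 u) :
    comp2 a (hess g u) y = hessC (locG g a) (comp0 a u) y := by
  ext i j
  refine comp2_of2 (K := fun x => hessC (locG g x) (comp0 x u) (crd n x x)) hy (fun v w => ?_) i j
  exact (isometricChange g a _).hessC_pull (mem_overlap_self hy) (hu _)
    (fun z hz => (comp0_chartChange u hz).symm) v w

theorem diffAt_target {f : Coord n → ℝ} {k : ℕ∞ω} (hf : ContDiffOn ℝ k f (crd n a).target)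
    (hy : y ∈ (crd n a).target) (hk : 1 ≤ k := by norm_num) : DifferentiableAt ℝ f y :=
  differentiableAt_of_contDiffOn (isOpen_target a) hk hf hy

variable (n) in
theorem fderiv_chartChange_diff {u : M → ℝ} (hu : Reg0 (n := n) 1 u) {a b : M} {y : Coord n}
    (hy : y ∈ overlap n a b) (v : Coord n) :
    m1 (fun i => pd i (comp0 a u) y) v
      = m1 (fun i => pd i (comp0 b u) (chartChange a b y)) (fderiv ℝ (chartChange a b) y v) := by
  rw [← fderiv_eq_m1, ← fderiv_eq_m1]
  have h1 : fderiv ℝ (comp0 a u) y = fderiv ℝ (fun z => comp0 b u (chartChange a b z)) y :=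
    fderiv_congr_on (isOpen_overlap a b) (fun z hz => (comp0_chartChange u hz).symm) hy
  have h2 : DifferentiableAt ℝ (comp0 b u) (chartChange a b y) :=
    diffAt_target (hu b) (chartChange_mem hy).1
  have h3 : DifferentiableAt ℝ (chartChange a b) y :=
    differentiableAt_of_contDiffOn (isOpen_overlap a b) (by norm_num)
      (contDiffOn_chartChange a b) hy
  have h4 := fderiv_comp y h2 h3
  simp only [Function.comp_def] at h4
  rw [h1, h4]
  rfl

theorem comp1_diff (hy : y ∈ (crd n a).target) {u : M → ℝ} (hu : Reg0 (n := n) 1 u) :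
    comp1 a (diff (n := n) u) y = fun i => pd i (comp0 a u) y := by
  ext i
  exact comp1_of1 (K := fun x i => pd i (comp0 x u) (crd n x x)) hy
    (fun v => fderiv_chartChange_diff n hu (mem_overlap_self hy) v) i

theorem comp1_div2 (hy : y ∈ (crd n a).target) {h : Field2 n M} (hh : Reg2 1 h) :
    comp1 a (div2 g h) y = divC (locG g a) (comp2 a h) y := by
  ext i
  refine comp1_of1 (K := fun x => divC (locG g x) (comp2 x h) (crd n x x)) hy (fun v => ?_) i
  have hm := mem_overlap_self hy
  exact (isometricChange g a _).divC_pull hm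
    (fun i j => diffAt_target (hh.comp _ i j) (chartChange_mem hm).1)
    (fun i j => diffAt_target (hh.comp _ i j) hy)
    (fun z hz => m2_comp2_chartChange hh.lin hz) v

theorem comp0_tr (hy : y ∈ (crd n a).target) {h : Field2 n M} (hh : IsLin2 h) :
    comp0 a (tr g h) y = traceC (locG g a) y (comp2 a h y) :=
  ((isometricChange g a _).traceC_pull (mem_overlap_self hy)
    (m2_comp2_chartChange hh (mem_overlap_self hy))).symm

theorem comp0_inner1 (hy : y ∈ (crd n a).target) {α η : Field1 n M} (hα : IsLin1 α)
    (hη : IsLin1 η) :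
    comp0 a (inner1 g α η) y = innerC1 (locG g a) y (comp1 a α y) (comp1 a η y) :=
  ((isometricChange g a _).innerC1_pull (mem_overlap_self hy)
    (m1_comp1_chartChange hα (mem_overlap_self hy))
    (m1_comp1_chartChange hη (mem_overlap_self hy))).symm

theorem comp0_inner2 (hy : y ∈ (crd n a).target) {S T : Field2 n M} (hS : IsLin2 S)
    (hT : IsLin2 T) :
    comp0 a (inner2 g S T) y = innerC2 (locG g a) y (comp2 a S y) (comp2 a T y) :=
  ((isometricChange g a _).innerC2_pull (mem_overlap_self hy)
    (m2_comp2_chartChange hS (mem_overlap_self hy))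
    (m2_comp2_chartChange hT (mem_overlap_self hy))).symm

theorem comp0_div1 (hy : y ∈ (crd n a).target) {α : Field1 n M} (hα : Reg1 1 α) :
    comp0 a (div1 g α) y = traceC (locG g a) y (nabla1 (locG g a) (comp1 a α) y) := by
  have hm := mem_overlap_self hy
  refine ((isometricChange g a _).traceC_pull hm fun u v => ?_).symm
  exact (isometricChange g a _).nabla1_pull hm
    (fun i => diffAt_target (hα.comp _ i) (chartChange_mem hm).1)
    (fun i => diffAt_target (hα.comp _ i) hy)
    (fun z hz => m1_comp1_chartChange hα.lin hz) u v

/-- The contraction of a one-form with a `(0,2)` tensor. -/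
def contract (g : RMetric n M) (α : Field1 n M) (h : Field2 n M) : Field1 n M := fun x =>
  of1 x (contractC (locG g x) (comp1 x α) (comp2 x h) (crd n x x))

theorem isLin1_contract (α : Field1 n M) (h : Field2 n M) : IsLin1 (contract g α h) :=
  isLin1_of1 _

theorem comp1_contract (hy : y ∈ (crd n a).target) {α : Field1 n M} {h : Field2 n M}
    (hα : IsLin1 α) (hh : IsLin2 h) :
    comp1 a (contract g α h) y = contractC (locG g a) (comp1 a α) (comp2 a h) y := by
  ext i
  refine comp1_of1 (K := fun x => contractC (locG g x) (comp1 x α) (comp2 x h) (crd n x x)) hy (fun v => ?_) i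
  have hm := mem_overlap_self hy
  have H := isometricChange g a ((crd n a).symm y)
  obtain ⟨b, hb⟩ := H.source.exists_frame hm
  have e : crd n ((crd n a).symm y) ((crd n a).symm y) = chartChange a ((crd n a).symm y) y := rfl
  rw [e, hb.m1_contractC, (H.isFrame hm hb).m1_contractC]
  simp only [m1_comp1_chartChange hα hm, m2_comp2_chartChange hh hm]

end Evaluation

end Charts

/-! ### Regularity and pointwise identities on the manifold -/

section Identities

variable {n : ℕ} {M : Type*} [TopologicalSpace M] [ChartedSpace (Coord n) M]

theorem comp0_self (x : M) (u : M → ℝ) : comp0 x u (crd n x x) = u x := by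
  simp [comp0]

theorem comp0_eq {a x : M} (hx : x ∈ (crd n a).source) (u : M → ℝ) :
    comp0 a u (crd n a x) = u x := by
  rw [comp0, (crd n a).left_inv hx]

theorem IsLin1.mul {α : Field1 n M} (hα : IsLin1 α) (u : M → ℝ) :
    IsLin1 (fun x v => u x * α x v : Field1 n M) := fun x => by
  obtain ⟨A, hA⟩ := hα x
  exact ⟨u x • A, fun v => congrArg (u x * ·) (hA v)⟩

theorem IsLin1.sub {α η : Field1 n M} (hα : IsLin1 α) (hη : IsLin1 η) :
    IsLin1 (fun x v => α x v - η x v : Field1 n M) := fun x => by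
  obtain ⟨A, hA⟩ := hα x
  obtain ⟨B, hB⟩ := hη x
  exact ⟨A - B, fun v => congrArg₂ (· - ·) (hA v) (hB v)⟩

theorem IsLin1.add {α η : Field1 n M} (hα : IsLin1 α) (hη : IsLin1 η) :
    IsLin1 (fun x v => α x v + η x v : Field1 n M) := fun x => by
  obtain ⟨A, hA⟩ := hα x
  obtain ⟨B, hB⟩ := hη x
  exact ⟨A + B, fun v => congrArg₂ (· + ·) (hA v) (hB v)⟩

theorem IsLin2.mul {h : Field2 n M} (hh : IsLin2 h) (u : M → ℝ) :
    IsLin2 (fun x v w => u x * h x v w : Field2 n M) := fun x => by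
  obtain ⟨A, hA⟩ := hh x
  exact ⟨u x • A, fun v w => congrArg (u x * ·) (hA v w)⟩

theorem IsLin2.add {h k : Field2 n M} (hh : IsLin2 h) (hk : IsLin2 k) :
    IsLin2 (fun x v w => h x v w + k x v w : Field2 n M) := fun x => by
  obtain ⟨A, hA⟩ := hh x
  obtain ⟨B, hB⟩ := hk x
  exact ⟨A + B, fun v w => congrArg₂ (· + ·) (hA v w) (hB v w)⟩

theorem Reg0.mul {k : ℕ∞ω} {u w : M → ℝ} (hu : Reg0 (n := n) k u) (hw : Reg0 (n := n) k w) :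
    Reg0 (n := n) k (fun x => u x * w x) := fun a => (hu a).mul (hw a)

theorem Reg0.add {k : ℕ∞ω} {u w : M → ℝ} (hu : Reg0 (n := n) k u) (hw : Reg0 (n := n) k w) :
    Reg0 (n := n) k (fun x => u x + w x) := fun a => (hu a).add (hw a)

theorem Reg0.sub {k : ℕ∞ω} {u w : M → ℝ} (hu : Reg0 (n := n) k u) (hw : Reg0 (n := n) k w) :
    Reg0 (n := n) k (fun x => u x - w x) := fun a => (hu a).sub (hw a)

theorem Reg0.exp {k : ℕ∞ω} {u : M → ℝ} (hu : Reg0 (n := n) k u) :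
    Reg0 (n := n) k (fun x => Real.exp (u x)) := fun a => (hu a).exp

theorem reg0_const {k : ℕ∞ω} (c : ℝ) : Reg0 (n := n) k (fun _ : M => c) :=
  fun _ => contDiffOn_const

theorem Reg1.mul {k : ℕ∞ω} {α : Field1 n M} (hα : Reg1 k α) {u : M → ℝ}
    (hu : Reg0 (n := n) k u) : Reg1 k (fun x v => u x * α x v : Field1 n M) :=
  ⟨hα.lin.mul u, fun a i => (hu a).mul (hα.comp a i)⟩

theorem Reg1.sub {k : ℕ∞ω} {α η : Field1 n M} (hα : Reg1 k α) (hη : Reg1 k η) :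
    Reg1 k (fun x v => α x v - η x v : Field1 n M) :=
  ⟨hα.lin.sub hη.lin, fun a i => (hα.comp a i).sub (hη.comp a i)⟩

theorem Reg1.add {k : ℕ∞ω} {α η : Field1 n M} (hα : Reg1 k α) (hη : Reg1 k η) :
    Reg1 k (fun x v => α x v + η x v : Field1 n M) :=
  ⟨hα.lin.add hη.lin, fun a i => (hα.comp a i).add (hη.comp a i)⟩

theorem Reg2.mul {k : ℕ∞ω} {h : Field2 n M} (hh : Reg2 k h) {u : M → ℝ}
    (hu : Reg0 (n := n) k u) : Reg2 k (fun x v w => u x * h x v w : Field2 n M) :=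
  ⟨hh.lin.mul u, fun a i j => (hu a).mul (hh.comp a i j)⟩

theorem Reg2.add {k : ℕ∞ω} {h m : Field2 n M} (hh : Reg2 k h) (hm : Reg2 k m) :
    Reg2 k (fun x v w => h x v w + m x v w : Field2 n M) :=
  ⟨hh.lin.add hm.lin, fun a i j => (hh.comp a i j).add (hm.comp a i j)⟩

variable [IsManifold (𝓡 n) ∞ M] (g : RMetric n M)

theorem Reg0.diff {k l : ℕ∞} (hkl : k + 1 ≤ l) {u : M → ℝ} (hu : Reg0 (n := n) l u) :
    Reg1 k (diff (n := n) u) := by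
  refine ⟨isLin1_diff u, fun a i => ?_⟩
  have hl : (1 : ℕ∞ω) ≤ l := by
    have : (1 : ℕ∞) ≤ l := le_trans le_add_self hkl
    exact_mod_cast this
  refine (contDiffOn_pd (isOpen_target a) (by exact_mod_cast hkl) (hu a) i).congr fun z hz => ?_
  rw [comp1_diff hz (hu.of_le hl)]

theorem reg2_ricci : Reg2 ∞ (ricci g) :=
  ⟨isLin2_ricci g, fun a i j => ((patchMetric g a).contDiffOn_ricciC i j).congr fun z hz => by
    rw [comp2_ricci g hz]⟩

theorem Reg0.hess {k l : ℕ∞} (hkl : k + 2 ≤ l) {u : M → ℝ} (hu : Reg0 (n := n) l u) :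
    Reg2 k (hess g u) := by
  refine ⟨isLin2_hess g u, fun a i j => ?_⟩
  have hl : (2 : ℕ∞ω) ≤ l := by
    have : (2 : ℕ∞) ≤ l := le_trans le_add_self hkl
    exact WithTop.coe_le_coe.2 this
  have h1 : ∀ i, ContDiffOn ℝ (k + 1 : ℕ∞) (fun z => pd i (comp0 a u) z) (crd n a).target :=
    fun i => contDiffOn_pd (isOpen_target a) (by
      have : k + 1 + 1 ≤ l := by rwa [add_assoc, one_add_one_eq_two]
      exact_mod_cast this) (hu a) i
  refine ((patchMetric g a).contDiffOn_nabla1 (α := fun z a' => pd a' (comp0 a u) z)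
    (k := k) (l := k + 1) le_rfl h1 i j).congr fun z hz => ?_
  rw [comp2_hess g hz (hu.of_le hl)]
  rfl

theorem Reg2.tr {k : ℕ∞} {h : Field2 n M} (hh : Reg2 k h) : Reg0 (n := n) k (tr g h) := fun a =>
  ((patchMetric g a).contDiffOn_traceC (hh.comp a)).congr fun z hz => comp0_tr g hz hh.lin

theorem Reg1.inner1 {k : ℕ∞} {α η : Field1 n M} (hα : Reg1 k α) (hη : Reg1 k η) :
    Reg0 (n := n) k (inner1 g α η) := fun a => by
  have h1 := fun i j => ((patchMetric g a).contDiffOn_invG i j).of_le (m := k) (by simp)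
  have h2 := hα.comp a
  have h3 := hη.comp a
  refine ContDiffOn.congr (f := fun z => innerC1 (locG g a) z (comp1 a α z) (comp1 a η z)) ?_
    fun z hz => comp0_inner1 g hz hα.lin hη.lin
  unfold innerC1
  fun_prop

theorem Reg2.inner2 {k : ℕ∞} {S T : Field2 n M} (hS : Reg2 k S) (hT : Reg2 k T) :
    Reg0 (n := n) k (inner2 g S T) := fun a => by
  have h1 := fun i j => ((patchMetric g a).contDiffOn_invG i j).of_le (m := k) (by simp)
  have h2 := hS.comp a
  have h3 := hT.comp a
  refine ContDiffOn.congr (f := fun z => innerC2 (locG g a) z (comp2 a S z) (comp2 a T z)) ?_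
    fun z hz => comp0_inner2 g hz hS.lin hT.lin
  unfold innerC2
  fun_prop

theorem Reg1.div1 {k l : ℕ∞} (hkl : k + 1 ≤ l) {α : Field1 n M} (hα : Reg1 l α) :
    Reg0 (n := n) k (div1 g α) := fun a => by
  have hl : (1 : ℕ∞ω) ≤ l := by
    have : (1 : ℕ∞) ≤ l := le_trans le_add_self hkl
    exact_mod_cast this
  exact ((patchMetric g a).contDiffOn_traceC (k := k)
    (fun i j => (patchMetric g a).contDiffOn_nabla1 hkl (hα.comp a) i j)).congr
      fun z hz => comp0_div1 g hz (hα.of_le hl)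

theorem Reg2.div2 {k l : ℕ∞} (hkl : k + 1 ≤ l) {h : Field2 n M} (hh : Reg2 l h) :
    Reg1 k (div2 g h) := by
  refine ⟨isLin1_div2 g h, fun a j => ?_⟩
  have hl : (1 : ℕ∞ω) ≤ l := by
    have : (1 : ℕ∞) ≤ l := le_trans le_add_self hkl
    exact_mod_cast this
  have h1 := fun i j => ((patchMetric g a).contDiffOn_invG i j).of_le (m := k) (by simp)
  have h2 := (patchMetric g a).contDiffOn_nabla2 hkl (hh.comp a)
  refine ContDiffOn.congr (f := fun z => divC (locG g a) (comp2 a h) z j) ?_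
    fun z hz => by rw [comp1_div2 g hz (hh.of_le hl)]
  unfold divC
  fun_prop

theorem Reg1.contract {k : ℕ∞} {α : Field1 n M} (hα : Reg1 k α) {h : Field2 n M}
    (hh : Reg2 k h) : Reg1 k (contract g α h) := by
  refine ⟨isLin1_contract g α h, fun a j => ?_⟩
  have h1 := fun i j => ((patchMetric g a).contDiffOn_invG i j).of_le (m := k) (by simp)
  have h2 := hα.comp a
  have h3 := hh.comp a
  refine ContDiffOn.congr (f := fun z => contractC (locG g a) (comp1 a α) (comp2 a h) z j) ?_
    fun z hz => by rw [comp1_contract g hz hα.lin hh.lin]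
  unfold contractC
  fun_prop

/-! #### Pointwise algebra -/

/-- An orthonormal frame at a point. -/
theorem exists_frame_at (x : M) : ∃ b : Fin n → Coord n, IsFrame (locG g x (crd n x x)) b :=
  (patchMetric g x).exists_frame (mem_extChartAt_target x)

variable {g}

theorem inner1_frame {x : M} {b : Fin n → Coord n} (hb : IsFrame (locG g x (crd n x x)) b)
    {α η : Field1 n M} (hα : IsLin1 α) (hη : IsLin1 η) :
    inner1 g α η x = ∑ a, α x (b a) * η x (b a) := by
  have h1 : inner1 g α η x
    = innerC1 (locG g x) (crd n x x) (comp1 x α (crd n x x)) (comp1 x η (crd n x x)) := rfl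
  rw [h1, hb.innerC1]
  simp only [comp1_self hα, comp1_self hη]

theorem inner2_frame {x : M} {b : Fin n → Coord n} (hb : IsFrame (locG g x (crd n x x)) b)
    {S T : Field2 n M} (hS : IsLin2 S) (hT : IsLin2 T) :
    inner2 g S T x = ∑ a, ∑ c, S x (b a) (b c) * T x (b a) (b c) := by
  have h1 : inner2 g S T x
    = innerC2 (locG g x) (crd n x x) (comp2 x S (crd n x x)) (comp2 x T (crd n x x)) := rfl
  rw [h1, hb.innerC2]
  simp only [comp2_self hS, comp2_self hT]

theorem tr_frame {x : M} {b : Fin n → Coord n} (hb : IsFrame (locG g x (crd n x x)) b)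
    {S : Field2 n M} (hS : IsLin2 S) : tr g S x = ∑ a, S x (b a) (b a) := by
  have h1 : tr g S x = traceC (locG g x) (crd n x x) (comp2 x S (crd n x x)) := rfl
  rw [h1, hb.traceC]
  simp only [comp2_self hS]

theorem frame_orthonormal {x : M} {b : Fin n → Coord n} (hb : IsFrame (locG g x (crd n x x)) b)
    (a c : Fin n) : RMetric.field g x (b a) (b c) = if a = c then 1 else 0 := by
  rw [← comp2_self (RMetric.reg2 g).lin]
  exact hb a c

variable (g)

theorem inner1_comm {α η : Field1 n M} (hα : IsLin1 α) (hη : IsLin1 η) (x : M) :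
    inner1 g α η x = inner1 g η α x := by
  obtain ⟨b, hb⟩ := exists_frame_at g x
  rw [inner1_frame hb hα hη, inner1_frame hb hη hα]
  exact Finset.sum_congr rfl fun a _ => mul_comm _ _

theorem contract_frame {x : M} {b : Fin n → Coord n} (hb : IsFrame (locG g x (crd n x x)) b)
    {α : Field1 n M} {h : Field2 n M} (hα : IsLin1 α) (hh : IsLin2 h) (v : Coord n) :
    contract g α h x v = ∑ a, α x (b a) * h x (b a) v := by
  have h1 : contract g α h x v
    = m1 (contractC (locG g x) (comp1 x α) (comp2 x h) (crd n x x)) v := of1_eq _ _ _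
  rw [h1, hb.m1_contractC]
  simp only [comp1_self hα, comp2_self hh]

theorem driftDiv2_eq {f : M → ℝ} (hf : Reg0 (n := n) 1 f) (h : Field2 n M) (x : M) (v : TM n x) :
    driftDiv2 g f h x v = div2 g h x v - contract g (diff (n := n) f) h x v := by
  unfold driftDiv2 contract contractC
  rw [comp1_diff (mem_extChartAt_target x) hf]

theorem isLin1_driftDiv2 (f : M → ℝ) (h : Field2 n M) : IsLin1 (driftDiv2 g f h) :=
  (isLin1_div2 g h).sub (isLin1_of1 _)

/-- The weighted divergence of `w α`. -/
theorem div1_mul {w : M → ℝ} (hw : Reg0 (n := n) 1 w) {α : Field1 n M} (hα : Reg1 1 α) (x : M) :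
    div1 g (fun x v => w x * α x v) x = w x * div1 g α x + inner1 g (diff (n := n) w) α x := by
  have hy := mem_extChartAt_target (I := 𝓡 n) x
  have e1 : nabla1 (locG g x) (comp1 x (fun x v => w x * α x v : Field1 n M)) (crd n x x)
      = fun k i => pd k (comp0 x w) (crd n x x) * comp1 x α (crd n x x) i
        + comp0 x w (crd n x x) * nabla1 (locG g x) (comp1 x α) (crd n x x) k i := by
    ext k i
    exact nabla1_mul (diffAt_target (hw x) hy) (fun i => diffAt_target (hα.comp x i) hy) k i
  have e2 : inner1 g (diff (n := n) w) α x = innerC1 (locG g x) (crd n x x)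
      (comp1 x (diff (n := n) w) (crd n x x)) (comp1 x α (crd n x x)) := rfl
  rw [e2, comp1_diff hy hw]
  unfold div1
  rw [e1, comp0_self]
  unfold innerC1 traceC
  simp only [mul_add, Finset.sum_add_distrib, Finset.mul_sum]
  rw [add_comm]
  congr 1
  · exact Finset.sum_congr rfl fun i _ => Finset.sum_congr rfl fun j _ => by ring
  · exact Finset.sum_congr rfl fun i _ => Finset.sum_congr rfl fun j _ => by ring

theorem div1_diff {u : M → ℝ} (hu : Reg0 (n := n) 2 u) (x : M) :
    div1 g (diff (n := n) u) x = tr g (hess g u) x := by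
  have hy := mem_extChartAt_target (I := 𝓡 n) x
  unfold div1 tr
  rw [comp2_hess g hy hu, nabla1_congr_on (isOpen_target x)
    (fun z hz => comp1_diff hz (hu.of_le (by norm_num))) hy]
  rfl

theorem driftLap_eq {f u : M → ℝ} (hu : Reg0 (n := n) 2 u) (x : M) :
    driftLap g f u x = driftDiv1 g f (diff (n := n) u) x := by
  rw [driftLap, driftDiv1, div1_diff g hu, inner1_comm g (isLin1_diff u) (isLin1_diff f)]

/-- The pairing of a symmetric tensor with the covariant derivative of a one-form. -/
theorem div1_contract {α : Field1 n M} (hα : Reg1 1 α) {h : Field2 n M} (hh : Reg2 1 h)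
    (hs : ∀ x v w, h x v w = h x w v) (x : M) :
    div1 g (contract g α h) x = inner1 g α (div2 g h) x
      + innerC2 (locG g x) (crd n x x) (nabla1 (locG g x) (comp1 x α) (crd n x x))
          (comp2 x h (crd n x x)) := by
  have hy := mem_extChartAt_target (I := 𝓡 n) x
  have e1 : inner1 g α (div2 g h) x = innerC1 (locG g x) (crd n x x)
      (comp1 x α (crd n x x)) (comp1 x (div2 g h) (crd n x x)) := rfl
  rw [e1, comp1_div2 g hy hh, ← (patchMetric g x).traceC_nabla1_contractC hy
    (fun i => diffAt_target (hα.comp x i) hy) (fun i j => diffAt_target (hh.comp x i j) hy)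
    (fun z _ => comp2_symm hs x z)]
  unfold div1
  rw [nabla1_congr_on (isOpen_target x) (fun z hz => comp1_contract g hz hα.lin hh.lin) hy]

theorem driftDiv1_contract_diff {f u : M → ℝ} (hf : Reg0 (n := n) 1 f) (hu : Reg0 (n := n) 2 u)
    {h : Field2 n M} (hh : Reg2 1 h) (hs : ∀ x v w, h x v w = h x w v) (x : M) :
    driftDiv1 g f (contract g (diff (n := n) u) h) x
      = inner1 g (diff (n := n) u) (driftDiv2 g f h) x + inner2 g (hess g u) h x := by
  have hy := mem_extChartAt_target (I := 𝓡 n) x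
  have hu1 : Reg1 1 (diff (n := n) u) := hu.diff (k := 1) (l := 2) (by norm_num)
  rw [driftDiv1, div1_contract g hu1 hh hs]
  have e1 : innerC2 (locG g x) (crd n x x)
      (nabla1 (locG g x) (comp1 x (diff (n := n) u)) (crd n x x)) (comp2 x h (crd n x x))
      = inner2 g (hess g u) h x := by
    have e2 : inner2 g (hess g u) h x = innerC2 (locG g x) (crd n x x)
      (comp2 x (hess g u) (crd n x x)) (comp2 x h (crd n x x)) := rfl
    rw [e2, comp2_hess g hy hu, nabla1_congr_on (isOpen_target x)
      (fun z hz => comp1_diff hz (hu.of_le (by norm_num))) hy]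
    rfl
  rw [e1]
  obtain ⟨b, hb⟩ := exists_frame_at g x
  rw [inner1_frame hb (isLin1_diff u) (isLin1_div2 g h),
    inner1_frame hb (isLin1_diff f) (isLin1_contract g _ _),
    inner1_frame hb (isLin1_diff u) (isLin1_driftDiv2 g f h)]
  have e4 : ∑ a, diff (n := n) u x (b a) * driftDiv2 g f h x (b a)
      = ∑ a, diff (n := n) u x (b a) * div2 g h x (b a)
        - ∑ a, ∑ c, diff (n := n) u x (b a) * (diff (n := n) f x (b c) * h x (b c) (b a)) := by
    rw [← Finset.sum_sub_distrib]
    refine Finset.sum_congr rfl fun a _ => ?_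
    rw [← Finset.mul_sum, ← contract_frame g hb (isLin1_diff _) hh.lin (b a), ← mul_sub]
    exact congrArg _ (driftDiv2_eq g hf h x (b a))
  have e5 : ∑ a, diff (n := n) f x (b a) * contract g (diff (n := n) u) h x (b a)
      = ∑ a, ∑ c, diff (n := n) f x (b a) * (diff (n := n) u x (b c) * h x (b c) (b a)) := by
    refine Finset.sum_congr rfl fun a _ => ?_
    rw [← Finset.mul_sum]
    exact congrArg _ (contract_frame g hb (isLin1_diff _) hh.lin (b a))
  rw [e4, e5]
  have e3 : ∑ a, ∑ c, diff (n := n) f x (b a) * (diff (n := n) u x (b c) * h x (b c) (b a))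
      = ∑ a, ∑ c, diff (n := n) u x (b a) * (diff (n := n) f x (b c) * h x (b c) (b a)) := by
    rw [Finset.sum_comm]
    refine Finset.sum_congr rfl fun a _ => Finset.sum_congr rfl fun c _ => ?_
    rw [hs x (b a) (b c)]
    ring
  rw [e3]
  ring

/-- `δ*` is, up to sign, the symmetrized covariant derivative. -/
theorem inner2_deltaStar {α : Field1 n M} {h : Field2 n M}
    (hh : IsLin2 h) (hs : ∀ x v w, h x v w = h x w v) (x : M) :
    inner2 g (deltaStar g α) h x = - innerC2 (locG g x) (crd n x x)
      (nabla1 (locG g x) (comp1 x α) (crd n x x)) (comp2 x h (crd n x x)) := by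
  obtain ⟨b, hb⟩ := exists_frame_at g x
  have hlin : IsLin2 (deltaStar g α) := isLin2_of2 _
  rw [inner2_frame hb hlin hh, hb.innerC2]
  simp only [comp2_self hh]
  set N := nabla1 (locG g x) (comp1 x α) (crd n x x) with hN
  have e1 : ∀ v w : Coord n, deltaStar g α x v w = -(1 / 2) * (m2 N v w + m2 N w v) := by
    intro v w
    have : deltaStar g α x v w = m2 (fun i j => -(1 / 2) * (N i j + N j i)) v w := of2_eq _ _ _ _
    rw [this, m2_smul (-(1 / 2)) (fun i j => N i j + N j i), m2_add N (fun i j => N j i)]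
    exact congrArg (fun r => -(1 / 2) * (m2 N v w + r)) (m2_swap N v w)
  simp only [e1]
  have e2 : ∑ a, ∑ c, m2 N (b c) (b a) * h x (b a) (b c)
      = ∑ a, ∑ c, m2 N (b a) (b c) * h x (b a) (b c) := by
    rw [Finset.sum_comm]
    exact Finset.sum_congr rfl fun a _ => Finset.sum_congr rfl fun c _ => by rw [hs x (b a) (b c)]
  have e3 : ∑ a, ∑ c, -(1 / 2) * (m2 N (b a) (b c) + m2 N (b c) (b a)) * h x (b a) (b c)
      = -(1 / 2) * (∑ a, ∑ c, m2 N (b a) (b c) * h x (b a) (b c)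
        + ∑ a, ∑ c, m2 N (b c) (b a) * h x (b a) (b c)) := by
    simp only [Finset.mul_sum, ← Finset.sum_add_distrib]
    exact Finset.sum_congr rfl fun a _ => Finset.sum_congr rfl fun c _ => by ring
  rw [e3, e2]
  ring

end Identities

/-! ### The Riemannian measure in a chart -/

section Measure

variable {n : ℕ}

theorem IsometricChange.det_pull {V W : Set (Coord n)} {φ : Coord n → Coord n}
    {G' G : LocalMetric n} (H : IsometricChange V W φ G' G) {y : Coord n} (hy : y ∈ V) :
    (Matrix.of (G' y)).det = (fderiv ℝ φ y).det ^ 2 * (Matrix.of (G (φ y))).det := by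
  set B : Matrix (Fin n) (Fin n) ℝ := Matrix.of fun k i => fderiv ℝ φ y (bv i) k with hB
  have h1 : Matrix.of (G' y) = B.transpose * Matrix.of (G (φ y)) * B := by
    ext i j
    have := H.pull y hy (bv i) (bv j)
    rw [m2_bv, m2_apply] at this
    rw [Matrix.of_apply, this, Matrix.mul_apply]
    simp only [Matrix.mul_apply, Matrix.transpose_apply, hB, Matrix.of_apply, Finset.sum_mul]
    rw [Finset.sum_comm]
    exact Finset.sum_congr rfl fun i _ => Finset.sum_congr rfl fun j _ => by ring
  have h2 : B.det = (fderiv ℝ φ y).det := by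
    have : B = LinearMap.toMatrix (EuclideanSpace.basisFun (Fin n) ℝ).toBasis
        (EuclideanSpace.basisFun (Fin n) ℝ).toBasis (fderiv ℝ φ y : Coord n →ₗ[ℝ] Coord n) := by
      ext k i
      rw [LinearMap.toMatrix_apply]
      simp [hB, bv]
    rw [this, LinearMap.det_toMatrix]
  rw [h1, Matrix.det_mul, Matrix.det_mul, Matrix.det_transpose, h2]
  ring

variable {M : Type*} [TopologicalSpace M] [ChartedSpace (Coord n) M] [IsManifold (𝓡 n) ∞ M]

/-- The density `√(det g_{ij})` in the chart around `a`. -/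
def dens (g : RMetric n M) (a : M) (y : Coord n) : ℝ := Real.sqrt (Matrix.of (locG g a y)).det

theorem dens_pos (g : RMetric n M) {a : M} {y : Coord n} (hy : y ∈ (crd n a).target) :
    0 < dens g a y := Real.sqrt_pos.2 ((patchMetric g a).posDef y hy).det_pos

theorem contDiffOn_dens (g : RMetric n M) (a : M) :
    ContDiffOn ℝ ∞ (dens g a) (crd n a).target := by
  have h1 : ContDiffOn ℝ ∞ (locG g a) (crd n a).target :=
    contDiffOn_pi.2 fun i => contDiffOn_pi.2 fun j => (patchMetric g a).smooth i j
  exact (contDiff_det.comp_contDiffOn h1).sqrt fun y hy =>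
    ((patchMetric g a).posDef y hy).det_pos.ne'

theorem dens_chartChange (g : RMetric n M) {a b : M} {y : Coord n} (hy : y ∈ overlap n a b) :
    dens g a y = |(fderiv ℝ (chartChange a b) y).det| * dens g b (chartChange a b y) := by
  unfold dens
  rw [(isometricChange g a b).det_pull hy, Real.sqrt_mul (sq_nonneg _), Real.sqrt_sq_eq_abs]

variable [CompactSpace M] [T2Space M]

variable (n M) in
theorem finite_chartPartition : {a : M | ∃ x, chartPartition n M a x ≠ 0}.Finite := by
  have h := (chartPartition n M).locallyFinite.finite_nonempty_of_compact
  refine h.subset fun a ⟨x, hx⟩ => ⟨x, hx⟩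

variable (n M) in
/-- The finitely many charts that carry the partition of unity. -/
def chartIndex : Finset M := (finite_chartPartition n M).toFinset

theorem chartPartition_eq_zero {a : M} (ha : a ∉ chartIndex n M) (x : M) :
    chartPartition n M a x = 0 := by
  by_contra h
  exact ha ((finite_chartPartition n M).mem_toFinset.2 ⟨x, h⟩)

theorem sum_chartPartition (x : M) : ∑ a ∈ chartIndex n M, chartPartition n M a x = 1 := by
  rw [← (chartPartition n M).sum_eq_one (mem_univ x)]
  refine (finsum_eq_sum_of_support_subset _ fun a ha => ?_).symm
  by_contra h
  exact ha (chartPartition_eq_zero h x)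

theorem tsupport_chartPartition (a : M) : tsupport (chartPartition n M a) ⊆ (crd n a).source := by
  have h := (SmoothPartitionOfUnity.exists_isSubordinate_chartAt_source (𝓡 n) M).choose_spec a
  rwa [extChartAt_source]

theorem chartPartition_of_notMem {a x : M} (hx : x ∉ (crd n a).source) :
    chartPartition n M a x = 0 := by
  by_contra h
  exact hx (tsupport_chartPartition a (subset_tsupport _ h))

variable [MeasurableSpace M] [BorelSpace M] (g : RMetric n M)

theorem aemeasurable_symm (a : M) :
    AEMeasurable (crd n a).symm (volume.restrict (crd n a).target) :=
  (continuousOn_extChartAt_symm a).aemeasurable (isOpen_target a).measurableSet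

theorem aemeasurable_comp0 {β : Type*} [TopologicalSpace β] [MeasurableSpace β] [BorelSpace β]
    [TopologicalSpace.PseudoMetrizableSpace β] {u : M → β} (hu : Continuous u) (a : M) :
    AEMeasurable (fun y => u ((crd n a).symm y)) (volume.restrict (crd n a).target) :=
  (hu.comp_continuousOn (continuousOn_extChartAt_symm a)).aemeasurable
    (isOpen_target a).measurableSet

theorem aemeasurable_dens (a : M) :
    AEMeasurable (dens g a) (volume.restrict (crd n a).target) :=
  (contDiffOn_dens g a).continuousOn.aemeasurable (isOpen_target a).measurableSet

theorem lintegral_vol {F : M → ENNReal} (hF : Measurable F) :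
    ∫⁻ x, F x ∂(vol g) = ∑' a : M, ∫⁻ y in (crd n a).target,
      ENNReal.ofReal (chartPartition n M a ((crd n a).symm y) * dens g a y)
        * F ((crd n a).symm y) := by
  unfold vol
  rw [lintegral_sum_measure]
  refine tsum_congr fun a => ?_
  have h1 := aemeasurable_symm (n := n) a
  have h2 : AEMeasurable (fun y => ENNReal.ofReal
      (chartPartition n M a ((crd n a).symm y) * dens g a y))
      (volume.restrict (crd n a).target) :=
    ((aemeasurable_comp0 (chartPartition n M a).contMDiff.continuous a).mul
      (aemeasurable_dens g a)).ennreal_ofReal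
  rw [lintegral_map' hF.aemeasurable (h1.mono_ac (withDensity_absolutelyContinuous _ _))]
  exact lintegral_withDensity_eq_lintegral_mul₀ h2 (hF.comp_aemeasurable h1)

theorem setLIntegral_restrict_of_zero {s t : Set (Coord n)} (hs : MeasurableSet s)
    (ht : MeasurableSet t) (hst : s ⊆ t) {F : Coord n → ENNReal} (hF : ∀ y ∈ t, y ∉ s → F y = 0) :
    ∫⁻ y in t, F y = ∫⁻ y in s, F y := by
  rw [← lintegral_indicator hs, ← lintegral_indicator ht]
  congr 1
  ext y
  by_cases h1 : y ∈ s
  · simp [h1, hst h1]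
  · by_cases h2 : y ∈ t
    · simp [h1, h2, hF y h2 h1]
    · simp [h1, h2]

/-- The part of the measure that comes from the chart around `b`, moved to the chart around `a`
by the change of variables. -/
theorem lintegral_partition_chart (a b : M) {F : M → ENNReal}
    (h0 : ∀ x, x ∉ (crd n a).source → F x = 0) :
    ∫⁻ y in (crd n b).target, ENNReal.ofReal
        (chartPartition n M b ((crd n b).symm y) * dens g b y) * F ((crd n b).symm y)
      = ∫⁻ y in (crd n a).target, ENNReal.ofReal (chartPartition n M b ((crd n a).symm y))
          * (ENNReal.ofReal (dens g a y) * F ((crd n a).symm y)) := by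
  have him : chartChange a b '' overlap n a b = overlap n b a := by
    ext z
    constructor
    · rintro ⟨y, hy, rfl⟩
      exact chartChange_mem hy
    · intro hz
      exact ⟨chartChange b a z, chartChange_mem hz, chartChange_chartChange hz⟩
  have hinj : InjOn (chartChange a b) (overlap n a b) := fun y hy z hz h => by
    rw [← chartChange_chartChange hy, h, chartChange_chartChange hz]
  have hd : ∀ y ∈ overlap n a b,
      HasFDerivWithinAt (chartChange a b) (fderiv ℝ (chartChange a b) y) (overlap n a b) y :=
    fun y hy => (differentiableAt_of_contDiffOn (isOpen_overlap a b) (by norm_num)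
      (contDiffOn_chartChange a b) hy).hasFDerivAt.hasFDerivWithinAt
  rw [setLIntegral_restrict_of_zero (isOpen_overlap b a).measurableSet
      (isOpen_target b).measurableSet (fun y hy => hy.1)
      (fun y hy hn => by rw [h0 _ (fun h => hn ⟨hy, h⟩), mul_zero]),
    setLIntegral_restrict_of_zero (isOpen_overlap a b).measurableSet
      (isOpen_target a).measurableSet (fun y hy => hy.1)
      (fun y hy hn => by
        rw [chartPartition_of_notMem (fun h => hn ⟨hy, h⟩), ENNReal.ofReal_zero, zero_mul]),
    ← him, lintegral_image_eq_lintegral_abs_det_fderiv_mul _ (isOpen_overlap a b).measurableSet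
      hd hinj]
  refine setLIntegral_congr_fun (isOpen_overlap a b).measurableSet fun y hy => ?_
  simp only [symm_chartChange hy]
  rw [dens_chartChange g hy, ENNReal.ofReal_mul ((chartPartition n M).nonneg b _),
    ENNReal.ofReal_mul (abs_nonneg _)]
  ring

/-- The Riemannian measure has density `√(det g_{ij})` in every chart. -/
theorem lintegral_vol_chart (a : M) {F : M → ENNReal} (hF : Measurable F)
    (h0 : ∀ x, x ∉ (crd n a).source → F x = 0) :
    ∫⁻ x, F x ∂(vol g)
      = ∫⁻ y in (crd n a).target, ENNReal.ofReal (dens g a y) * F ((crd n a).symm y) := by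
  rw [lintegral_vol g hF]
  simp only [lintegral_partition_chart g a _ h0]
  rw [tsum_eq_sum (s := chartIndex n M) fun b hb => by simp [chartPartition_eq_zero hb],
    ← lintegral_finset_sum' _ fun b _ => ?_]
  · refine lintegral_congr fun y => ?_
    rw [← Finset.sum_mul, ← ENNReal.ofReal_sum_of_nonneg fun b _ =>
      (chartPartition n M).nonneg b _, sum_chartPartition, ENNReal.ofReal_one, one_mul]
  · exact (aemeasurable_comp0 (chartPartition n M b).contMDiff.continuous a).ennreal_ofReal.mul
      ((aemeasurable_dens g a).ennreal_ofReal.mul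
        (hF.comp_aemeasurable (aemeasurable_symm a)))

theorem vol_restrict (a : M) : (vol g).restrict (crd n a).source
    = Measure.map (crd n a).symm ((volume.restrict (crd n a).target).withDensity
        fun y => ENNReal.ofReal (dens g a y)) := by
  have ho : MeasurableSet (crd n a).source := (isOpen_extChartAt_source a).measurableSet
  refine Measure.ext_of_lintegral _ fun F hF => ?_
  have h1 := aemeasurable_symm (n := n) a
  rw [lintegral_map' hF.aemeasurable (h1.mono_ac (withDensity_absolutelyContinuous _ _)),
    lintegral_withDensity_eq_lintegral_mul₀ (g := fun y => F ((crd n a).symm y))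
      (aemeasurable_dens g a).ennreal_ofReal (hF.comp_aemeasurable h1), ← lintegral_indicator ho,
    lintegral_vol_chart g a (hF.indicator ho) fun x hx => indicator_of_notMem hx _]
  refine setLIntegral_congr_fun (isOpen_target a).measurableSet fun y hy => ?_
  rw [indicator_of_mem ((crd n a).map_target hy)]
  rfl

/-- Integration of a function supported in a chart. -/
theorem integral_vol_chart (a : M) {u : M → ℝ} (hu : Continuous u)
    (h0 : ∀ x, x ∉ (crd n a).source → u x = 0) :
    ∫ x, u x ∂(vol g) = ∫ y in (crd n a).target, comp0 a u y * dens g a y := by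
  have ho : MeasurableSet (crd n a).source := (isOpen_extChartAt_source a).measurableSet
  have h1 := aemeasurable_symm (n := n) a
  rw [← setIntegral_eq_integral_of_forall_compl_eq_zero h0, vol_restrict,
    integral_map (h1.mono_ac (withDensity_absolutelyContinuous _ _)) hu.aestronglyMeasurable,
    integral_withDensity_eq_integral_toReal_smul₀ (aemeasurable_dens g a).ennreal_ofReal
      (Eventually.of_forall fun _ => ENNReal.ofReal_lt_top)]
  refine setIntegral_congr_fun (isOpen_target a).measurableSet fun y hy => ?_
  simp only [ENNReal.toReal_ofReal (dens_pos g hy).le, smul_eq_mul, comp0]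
  ring

end Measure

/-! ### The divergence theorem -/

section Divergence

variable {n : ℕ}

/-- A partial derivative of a compactly supported function has integral zero. -/
theorem integral_pd_eq_zero {V K : Set (Coord n)} (hV : IsOpen V) (hK : IsCompact K) (hKV : K ⊆ V)
    {w : Coord n → ℝ} (hw : ContDiffOn ℝ 1 w V) (h0 : ∀ y ∈ V, y ∉ K → w y = 0) (i : Fin n) :
    IntegrableOn (pd i w) V ∧ ∫ y in V, pd i w y = 0 := by
  set w' : Coord n → ℝ := V.indicator w with hw'
  have h1 : ∀ y, y ∉ K → w' y = 0 := fun y hy => by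
    by_cases hyV : y ∈ V
    · rw [hw', indicator_of_mem hyV, h0 y hyV hy]
    · rw [hw', indicator_of_notMem hyV]
  have hcs : HasCompactSupport w' := HasCompactSupport.intro hK h1
  have h2 : ContDiff ℝ 1 w' := by
    rw [contDiff_iff_contDiffAt]
    intro y
    by_cases hy : y ∈ V
    · refine (hw.contDiffAt (hV.mem_nhds hy)).congr_of_eventuallyEq ?_
      filter_upwards [hV.mem_nhds hy] with z hz
      exact indicator_of_mem hz _
    · refine (contDiffAt_const (c := (0 : ℝ))).congr_of_eventuallyEq ?_
      filter_upwards [hK.isClosed.isOpen_compl.mem_nhds fun h => hy (hKV h)] with z hz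
      exact h1 z hz
  have h3 : Continuous fun y => fderiv ℝ w' y (EuclideanSpace.single i 1) :=
    (h2.continuous_fderiv (by norm_num)).clm_apply continuous_const
  have h4 : HasCompactSupport fun y => fderiv ℝ w' y (EuclideanSpace.single i 1) :=
    hcs.fderiv_apply ℝ _
  have h5 : Integrable fun y => fderiv ℝ w' y (EuclideanSpace.single i 1) :=
    h3.integrable_of_hasCompactSupport h4
  have h6 : (fun y => fderiv ℝ w' y (EuclideanSpace.single i 1)) = V.indicator (pd i w) := by
    ext y
    by_cases hy : y ∈ V
    · rw [indicator_of_mem hy]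
      exact pd_congr_on hV (u := w') (v := w) (fun z hz => indicator_of_mem hz _) hy i
    · rw [indicator_of_notMem hy]
      have : w' =ᶠ[𝓝 y] fun _ => (0 : ℝ) := by
        filter_upwards [hK.isClosed.isOpen_compl.mem_nhds fun h => hy (hKV h)] with z hz
        exact h1 z hz
      rw [this.fderiv_eq]
      simp
  rw [h6, integrable_indicator_iff hV.measurableSet] at h5
  refine ⟨h5, ?_⟩
  rw [← integral_indicator hV.measurableSet, ← h6]
  have h7 := integral_mul_fderiv_eq_neg_fderiv_mul_of_integrable (μ := volume)
    (f := fun _ : Coord n => (1 : ℝ)) (g := w') (v := EuclideanSpace.single i 1)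
    (by simp) (by simpa [h6] using (integrable_indicator_iff hV.measurableSet).2 h5)
    (by simpa using h2.continuous.integrable_of_hasCompactSupport hcs) (fun _ _ => by fun_prop)
    (fun x _ => h2.differentiable (by norm_num) x)
  simpa using h7

variable {M : Type*} [TopologicalSpace M] [ChartedSpace (Coord n) M] [IsManifold (𝓡 n) ∞ M]
  [CompactSpace M] [T2Space M] [MeasurableSpace M] [BorelSpace M] (g : RMetric n M)

theorem vol_nhds_lt_top (x : M) : ∃ s ∈ 𝓝 x, vol g s < ⊤ := by
  have hx := mem_extChartAt_target (I := 𝓡 n) x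
  obtain ⟨r, hr, hB⟩ := Metric.isOpen_iff.1 (isOpen_target (n := n) x) _ hx
  have hcB : Metric.closedBall (crd n x x) (r / 2) ⊆ (crd n x).target :=
    (Metric.closedBall_subset_ball (by linarith)).trans hB
  obtain ⟨C, hC⟩ := (isCompact_closedBall (crd n x x) (r / 2)).bddAbove_image
    ((contDiffOn_dens g x).continuousOn.mono hcB)
  have hO : IsOpen ((crd n x).source ∩ crd n x ⁻¹' Metric.ball (crd n x x) (r / 2)) :=
    isOpen_extChartAt_preimage' x Metric.isOpen_ball
  refine ⟨_, hO.mem_nhds ⟨mem_extChartAt_source x, Metric.mem_ball_self (by linarith)⟩, ?_⟩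
  rw [← lintegral_indicator_one hO.measurableSet, lintegral_vol_chart g x
    (measurable_one.indicator hO.measurableSet)
    (fun z hz => indicator_of_notMem (fun h => hz h.1) _)]
  calc _ ≤ ∫⁻ y in Metric.closedBall (crd n x x) (r / 2), ENNReal.ofReal C := by
        rw [← lintegral_indicator (isOpen_target x).measurableSet,
          ← lintegral_indicator Metric.isClosed_closedBall.measurableSet]
        refine lintegral_mono fun y => ?_
        by_cases hy : y ∈ (crd n x).target
        · rw [indicator_of_mem hy]
          by_cases hy' : y ∈ Metric.ball (crd n x x) (r / 2)
          · have hy2 := Metric.ball_subset_closedBall hy'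
            rw [indicator_of_mem hy2]
            refine (mul_le_of_le_one_right' ?_).trans
              (ENNReal.ofReal_le_ofReal (hC (mem_image_of_mem _ hy2)))
            exact indicator_le_self' (fun _ _ => zero_le) _ |>.trans le_rfl
          · rw [indicator_of_notMem (s := (crd n x).source ∩ _), mul_zero]
            · exact zero_le
            · rintro ⟨-, h⟩
              rw [mem_preimage, (crd n x).right_inv hy] at h
              exact hy' h
        · rw [indicator_of_notMem hy]
          exact zero_le
    _ < ⊤ := by
        rw [setLIntegral_const]
        exact ENNReal.mul_lt_top ENNReal.ofReal_lt_top measure_closedBall_lt_top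

instance : IsFiniteMeasure (vol g) := by
  refine ⟨isCompact_univ.measure_lt_top_of_nhdsWithin fun x _ => ?_⟩
  obtain ⟨s, hs, h⟩ := vol_nhds_lt_top g x
  exact ⟨s, mem_nhdsWithin_of_mem_nhds hs, h⟩

instance : (vol g).IsOpenPosMeasure := by
  refine ⟨fun O hO ⟨x, hx⟩ h => ?_⟩
  have hO' : IsOpen ((crd n x).source ∩ O) := (isOpen_extChartAt_source x).inter hO
  have h1 : ∫⁻ z, ((crd n x).source ∩ O).indicator 1 z ∂(vol g) = 0 := by
    rw [lintegral_indicator_one hO'.measurableSet]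
    exact measure_mono_null inter_subset_right h
  rw [lintegral_vol_chart g x (measurable_one.indicator hO'.measurableSet)
    (fun z hz => indicator_of_notMem (fun h => hz h.1) _),
    lintegral_eq_zero_iff'] at h1
  · set W := (crd n x).target ∩ (crd n x).symm ⁻¹' O with hW
    have hWo : IsOpen W := (continuousOn_extChartAt_symm x).isOpen_inter_preimage
      (isOpen_target x) hO
    have hWx : crd n x x ∈ W := ⟨mem_extChartAt_target x, by simpa using hx⟩
    refine (hWo.measure_pos volume ⟨_, hWx⟩).ne' ?_
    rw [EventuallyEq, ae_restrict_iff' (isOpen_target x).measurableSet] at h1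
    refine measure_mono_null (fun y hy => ?_) h1
    intro hh
    have := hh hy.1
    rw [indicator_of_mem (show (crd n x).symm y ∈ (crd n x).source ∩ O from
      ⟨(crd n x).map_target hy.1, hy.2⟩)] at this
    simp only [Pi.one_apply, mul_one, Pi.zero_apply, ENNReal.ofReal_eq_zero] at this
    exact absurd (dens_pos g hy.1) this.not_gt
  · exact (aemeasurable_dens g x).ennreal_ofReal.mul
      ((measurable_one.indicator hO'.measurableSet).comp_aemeasurable (aemeasurable_symm x))

theorem integrable_vol {u : M → ℝ} (hu : Continuous u) : Integrable u (vol g) :=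
  hu.integrable_of_hasCompactSupport (HasCompactSupport.of_compactSpace u)

theorem eq_zero_of_integral_eq_zero {u : M → ℝ} (hu : Continuous u) (h0 : ∀ x, 0 ≤ u x)
    (h : ∫ x, u x ∂(vol g) = 0) (x : M) : u x = 0 := by
  rw [integral_eq_zero_iff_of_nonneg h0 (integrable_vol g hu)] at h
  exact congrFun (Measure.eq_of_ae_eq h hu continuous_const) x

/-- The divergence theorem for a field supported in one chart. -/
theorem integral_div1_of_support {a : M} {α : Field1 n M} (hα : Reg1 1 α) {K : Set M}
    (hK : IsCompact K) (hKs : K ⊆ (crd n a).source) (h0 : ∀ x, x ∉ K → ∀ v, α x v = 0) :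
    ∫ x, div1 g α x ∂(vol g) = 0 := by
  have hdiv : Reg0 (n := n) 0 (div1 g α) := hα.div1 g (k := 0) (l := 1) (by norm_num)
  have hK' : IsCompact (crd n a '' K) := hK.image_of_continuousOn
    ((continuousOn_extChartAt a).mono hKs)
  have hKt : crd n a '' K ⊆ (crd n a).target := by
    rintro _ ⟨x, hx, rfl⟩
    exact (crd n a).map_source (hKs hx)
  have hs : ∀ (b : M) (y : Coord n), y ∈ (crd n b).target → (crd n b).symm y ∉ K →
      traceC (locG g b) y (nabla1 (locG g b) (comp1 b α) y) = 0 := by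
    intro b y hy hyK
    have hO : IsOpen ((crd n b).target ∩ (crd n b).symm ⁻¹' Kᶜ) :=
      (continuousOn_extChartAt_symm b).isOpen_inter_preimage (isOpen_target b)
        hK.isClosed.isOpen_compl
    have h1 : nabla1 (locG g b) (comp1 b α) y = nabla1 (locG g b) (fun _ _ => 0) y :=
      nabla1_congr_on hO (fun z hz => funext fun i => h0 _ hz.2 _) ⟨hy, hyK⟩
    rw [h1]
    simp [nabla1, traceC, pd]
  have hz : ∀ x, x ∉ (crd n a).source → div1 g α x = 0 := fun x hx =>
    hs x (crd n x x) (mem_extChartAt_target x)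
      (by simpa using fun h => hx (hKs h))
  rw [integral_vol_chart g a hdiv.continuous hz]
  set w : Fin n → Coord n → ℝ := fun i z => Real.sqrt (Matrix.of (locG g a z)).det
    * ∑ j, invG (locG g a) z i j * comp1 a α z j with hw
  have hwr : ∀ i, ContDiffOn ℝ 1 (w i) (crd n a).target := fun i => by
    have h1 := fun j => ((patchMetric g a).contDiffOn_invG i j).of_le (m := 1) (by simp)
    have h2 : ContDiffOn ℝ 1 (dens g a) (crd n a).target := (contDiffOn_dens g a).of_le (by simp)
    have h3 := hα.comp a
    exact h2.mul (ContDiffOn.sum fun j _ => (h1 j).mul (h3 j))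
  have hw0 : ∀ i, ∀ y ∈ (crd n a).target, y ∉ crd n a '' K → w i y = 0 := by
    intro i y hy hyK
    have : (crd n a).symm y ∉ K := fun h => hyK ⟨_, h, (crd n a).right_inv hy⟩
    have h1 : ∀ j, comp1 a α y j = 0 := fun j => h0 _ this _
    simp [hw, h1]
  have key := fun i => integral_pd_eq_zero (isOpen_target a) hK' hKt (hwr i) (hw0 i) i
  rw [setIntegral_congr_fun (g := fun y => ∑ i, pd i (w i) y) (isOpen_target a).measurableSet,
    integral_finset_sum _ fun i _ => (key i).1]
  · exact Finset.sum_eq_zero fun i _ => (key i).2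
  · intro y hy
    simp only
    rw [comp0_div1 g hy hα]
    exact (patchMetric g a).traceC_nabla1_mul_sqrt_det hy fun i => diffAt_target (hα.comp a i) hy

theorem div1_add {α η : Field1 n M} (hα : Reg1 1 α) (hη : Reg1 1 η) (x : M) :
    div1 g (fun x v => α x v + η x v) x = div1 g α x + div1 g η x := by
  have hy := mem_extChartAt_target (I := 𝓡 n) x
  have e1 : nabla1 (locG g x) (comp1 x (fun x v => α x v + η x v : Field1 n M)) (crd n x x)
      = fun k i => nabla1 (locG g x) (comp1 x α) (crd n x x) k i
        + nabla1 (locG g x) (comp1 x η) (crd n x x) k i := by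
    ext k i
    exact nabla1_add (fun i => diffAt_target (hα.comp x i) hy)
      (fun i => diffAt_target (hη.comp x i) hy) k i
  unfold div1
  rw [e1]
  simp only [traceC, mul_add, Finset.sum_add_distrib]

theorem chartPartition_reg0 (a : M) : Reg0 (n := n) ∞ (chartPartition n M a) :=
  reg0_of_contMDiff (k := ⊤) (chartPartition n M a).contMDiff

/-- The divergence theorem for finitely many localizations of a field. The regularity of the
localized field is carried along in the induction. -/
theorem integral_div1_partition {α : Field1 n M} (hα : Reg1 1 α) (s : Finset M) :
    ∫ x, div1 g (fun x v => (∑ a ∈ s, chartPartition n M a x) * α x v) x ∂(vol g) = 0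
      ∧ Reg1 1 (fun x v => (∑ a ∈ s, chartPartition n M a x) * α x v : Field1 n M) := by
  classical
  have hr : ∀ a, Reg1 1 (fun x v => chartPartition n M a x * α x v : Field1 n M) := fun a =>
    hα.mul ((chartPartition_reg0 a).of_le (by simp))
  induction s using Finset.induction_on with
  | empty =>
    have hz : Reg1 1 (fun x v => (∑ a ∈ (∅ : Finset M), chartPartition n M a x) * α x v
        : Field1 n M) := by
      have := hα.mul (reg0_const (M := M) (k := 1) 0)
      simpa using this
    refine ⟨?_, hz⟩
    by_cases hM : Nonempty M
    · obtain ⟨a⟩ := hM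
      exact integral_div1_of_support g (a := a) hz (K := ∅) isCompact_empty (by simp) (by simp)
    · rw [not_nonempty_iff] at hM
      rw [Measure.eq_zero_of_isEmpty (vol g), integral_zero_measure]
  | insert a s ha ih =>
    have e : (fun x v => (∑ b ∈ insert a s, chartPartition n M b x) * α x v : Field1 n M)
        = fun x v => chartPartition n M a x * α x v
          + (∑ b ∈ s, chartPartition n M b x) * α x v := by
      ext x v
      rw [Finset.sum_insert ha, add_mul]
    rw [e]
    have hreg := (hr a).add ih.2
    refine ⟨?_, hreg⟩
    simp only [div1_add g (hr a) ih.2]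
    rw [integral_add, ih.1, add_zero]
    · refine integral_div1_of_support g (hr a) (isClosed_tsupport _).isCompact
        (tsupport_chartPartition a) fun x hx v => ?_
      rw [image_eq_zero_of_notMem_tsupport hx, zero_mul]
    · exact integrable_vol g ((hr a).div1 g (k := 0) (l := 1) (by norm_num)).continuous
    · exact integrable_vol g (ih.2.div1 g (k := 0) (l := 1) (by norm_num)).continuous

/-- The divergence theorem. -/
theorem integral_div1 {α : Field1 n M} (hα : Reg1 1 α) : ∫ x, div1 g α x ∂(vol g) = 0 := by
  have h := (integral_div1_partition g hα (chartIndex n M)).1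
  simpa only [sum_chartPartition, one_mul] using h

end Divergence

/-! ### Weighted integration by parts -/

section Weighted

variable {n : ℕ} {M : Type*} [TopologicalSpace M] [ChartedSpace (Coord n) M]

variable (n) in
/-- The density of `dν` with respect to `dV_g`. -/
def weight (τ : ℝ) (f : M → ℝ) (x : M) : ℝ :=
  (4 * Real.pi * τ) ^ (-(n : ℝ) / 2) * Real.exp (-f x)

theorem weight_pos {τ : ℝ} (hτ : 0 < τ) (f : M → ℝ) (x : M) : 0 < weight n τ f x :=
  mul_pos (Real.rpow_pos_of_pos (by positivity) _) (Real.exp_pos _)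

theorem Reg0.neg {k : ℕ∞ω} {u : M → ℝ} (hu : Reg0 (n := n) k u) :
    Reg0 (n := n) k (fun x => -u x) := fun a => (hu a).neg

theorem weight_reg0 {k : ℕ∞ω} (τ : ℝ) {f : M → ℝ} (hf : Reg0 (n := n) k f) :
    Reg0 (n := n) k (weight n τ f) :=
  (reg0_const (n := n) ((4 * Real.pi * τ) ^ (-(n : ℝ) / 2))).mul hf.neg.exp

theorem pd_weight (τ : ℝ) {f : M → ℝ} {a : M} {y : Coord n}
    (hf : DifferentiableAt ℝ (comp0 (n := n) a f) y) (i : Fin n) :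
    pd i (comp0 a (weight n τ f)) y = -(comp0 a (weight n τ f) y * pd i (comp0 a f) y) := by
  have h1 := ((hf.hasFDerivAt.fun_neg.exp).const_mul ((4 * Real.pi * τ) ^ (-(n : ℝ) / 2)))
  unfold pd
  have e : comp0 a (weight n τ f)
    = fun z : Coord n => (4 * Real.pi * τ) ^ (-(n : ℝ) / 2) * Real.exp (-comp0 (n := n) a f z) := rfl
  rw [e, h1.fderiv]
  simp only [ContinuousLinearMap.smul_apply, ContinuousLinearMap.neg_apply, smul_eq_mul]
  ring

variable [IsManifold (𝓡 n) ∞ M] (g : RMetric n M)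

theorem inner1_diff_weight (τ : ℝ) {f : M → ℝ} (hf : Reg0 (n := n) 1 f) (α : Field1 n M) (x : M) :
    inner1 g (diff (n := n) (weight n τ f)) α x
      = -(weight n τ f x * inner1 g (diff (n := n) f) α x) := by
  have hy := mem_extChartAt_target (I := 𝓡 n) x
  have e : ∀ w : M → ℝ, Reg0 (n := n) 1 w → inner1 g (diff (n := n) w) α x
      = innerC1 (locG g x) (crd n x x) (fun i => pd i (comp0 x w) (crd n x x))
        (comp1 x α (crd n x x)) := by
    intro w hw
    rw [← comp1_diff hy hw]
    rfl
  rw [e _ (weight_reg0 τ hf), e _ hf]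
  simp only [pd_weight τ (diffAt_target (hf x) hy), comp0_self, innerC1, Finset.mul_sum,
    ← Finset.sum_neg_distrib]
  exact Finset.sum_congr rfl fun i _ => Finset.sum_congr rfl fun j _ => by ring

theorem inner1_mul_right (α η : Field1 n M) (w : M → ℝ) (x : M) :
    inner1 g α (fun x v => w x * η x v) x = w x * inner1 g α η x := by
  have h : ∀ i, comp1 x (fun x v => w x * η x v : Field1 n M) (crd n x x) i
      = w x * comp1 x η (crd n x x) i := fun i => by
    exact congrArg (fun x' => w x' * comp1 x η (crd n x x) i) (extChartAt_to_inv (I := 𝓡 n) x)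
  unfold inner1
  simp only [h, Finset.mul_sum]
  exact Finset.sum_congr rfl fun i _ => Finset.sum_congr rfl fun j _ => by ring

theorem driftDiv1_mul {f w : M → ℝ} (hw : Reg0 (n := n) 1 w) {α : Field1 n M} (hα : Reg1 1 α)
    (x : M) : driftDiv1 g f (fun x v => w x * α x v) x
      = w x * driftDiv1 g f α x + inner1 g (diff (n := n) w) α x := by
  unfold driftDiv1
  rw [div1_mul g hw hα, inner1_mul_right]
  ring

/-- `dν` turns the weighted divergence into a divergence. -/
theorem driftDiv1_mul_weight (τ : ℝ) {f : M → ℝ} (hf : Reg0 (n := n) 1 f) {α : Field1 n M}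
    (hα : Reg1 1 α) (x : M) :
    driftDiv1 g f α x * weight n τ f x = div1 g (fun x v => weight n τ f x * α x v) x := by
  rw [div1_mul g (weight_reg0 τ hf) hα, inner1_diff_weight g τ hf, driftDiv1]
  ring

theorem Reg1.driftDiv1 {k l : ℕ∞} (hkl : k + 1 ≤ l) {f : M → ℝ} (hf : Reg0 (n := n) l f)
    {α : Field1 n M} (hα : Reg1 l α) : Reg0 (n := n) k (driftDiv1 g f α) :=
  (hα.div1 g hkl).sub ((hf.diff hkl).inner1 g (hα.of_le (by
    have : k ≤ l := le_trans le_self_add hkl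
    exact_mod_cast this)))

theorem Reg2.driftDiv2 {k l : ℕ∞} (hkl : k + 1 ≤ l) {f : M → ℝ} (hf : Reg0 (n := n) l f)
    {h : Field2 n M} (hh : Reg2 l h) : Reg1 k (driftDiv2 g f h) := by
  have hl : (1 : ℕ∞ω) ≤ l := by
    have : (1 : ℕ∞) ≤ l := le_trans le_add_self hkl
    exact_mod_cast this
  have hk : (k : ℕ∞ω) ≤ l := by
    have : k ≤ l := le_trans le_self_add hkl
    exact_mod_cast this
  have := (hh.div2 g hkl).sub ((hf.diff hkl).contract g (hh.of_le hk))
  exact ⟨isLin1_driftDiv2 g f h, fun a i => (this.comp a i).congr fun z _ =>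
    driftDiv2_eq g (hf.of_le hl) h _ _⟩

variable [CompactSpace M] [T2Space M] [MeasurableSpace M] [BorelSpace M] {τ : ℝ}

theorem nuIntegral_eq (τ : ℝ) (f u : M → ℝ) :
    nuIntegral τ g f u = ∫ x, u x * weight n τ f x ∂(vol g) := rfl

theorem integrable_nu {f u : M → ℝ} (hf : Reg0 (n := n) 1 f) (hu : Continuous u) :
    Integrable (fun x => u x * weight n τ f x) (vol g) :=
  integrable_vol g (hu.mul (weight_reg0 τ hf).continuous)

theorem nuIntegral_add {f u v : M → ℝ} (hf : Reg0 (n := n) 1 f) (hu : Continuous u)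
    (hv : Continuous v) : nuIntegral τ g f (fun x => u x + v x)
      = nuIntegral τ g f u + nuIntegral τ g f v := by
  simp only [nuIntegral_eq, add_mul]
  exact integral_add (integrable_nu g hf hu) (integrable_nu g hf hv)

theorem nuIntegral_const_mul (f u : M → ℝ) (c : ℝ) :
    nuIntegral τ g f (fun x => c * u x) = c * nuIntegral τ g f u := by
  simp only [nuIntegral_eq, mul_assoc]
  exact integral_const_mul _ _

theorem nuIntegral_neg (f u : M → ℝ) :
    nuIntegral τ g f (fun x => -u x) = -nuIntegral τ g f u := by
  simp only [nuIntegral_eq, neg_mul]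
  exact integral_neg _

theorem nuIntegral_sub {f u v : M → ℝ} (hf : Reg0 (n := n) 1 f) (hu : Continuous u)
    (hv : Continuous v) : nuIntegral τ g f (fun x => u x - v x)
      = nuIntegral τ g f u - nuIntegral τ g f v := by
  simp only [nuIntegral_eq, sub_mul]
  exact integral_sub (integrable_nu g hf hu) (integrable_nu g hf hv)

/-- The divergence theorem for `dν`. -/
theorem nuIntegral_driftDiv1 {f : M → ℝ} (hf : Reg0 (n := n) 1 f) {α : Field1 n M}
    (hα : Reg1 1 α) : nuIntegral τ g f (driftDiv1 g f α) = 0 := by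
  rw [nuIntegral_eq]
  simp only [driftDiv1_mul_weight g τ hf hα]
  exact integral_div1 g (hα.mul (weight_reg0 τ hf))

theorem nuIntegral_mul_driftDiv1 {f w : M → ℝ} (hf : Reg0 (n := n) 1 f)
    (hw : Reg0 (n := n) 1 w) {α : Field1 n M} (hα : Reg1 1 α) :
    nuIntegral τ g f (fun x => w x * driftDiv1 g f α x)
      = -nuIntegral τ g f (inner1 g (diff (n := n) w) α) := by
  have h := nuIntegral_driftDiv1 (τ := τ) g hf (hα.mul hw)
  have h1 : Continuous (driftDiv1 g f α) :=
    (Reg1.driftDiv1 g (k := 0) (l := 1) (by norm_num) hf hα).continuous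
  have h2 : Continuous (inner1 g (diff (n := n) w) α) :=
    ((hw.diff (k := 0) (l := 1) (by norm_num)).inner1 g (hα.of_le (by norm_num))).continuous
  have e : driftDiv1 g f (fun x v => w x * α x v : Field1 n M)
      = fun x => w x * driftDiv1 g f α x + inner1 g (diff (n := n) w) α x :=
    funext fun x => driftDiv1_mul g hw hα x
  rw [e, nuIntegral_add (u := fun x => w x * driftDiv1 g f α x) g hf (hw.continuous.mul h1) h2] at h
  linarith

theorem eq_zero_of_nuIntegral_eq_zero (hτ : 0 < τ) {f u : M → ℝ} (hf : Reg0 (n := n) 1 f)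
    (hu : Continuous u) (h0 : ∀ x, 0 ≤ u x) (h : nuIntegral τ g f u = 0) (x : M) : u x = 0 := by
  have := eq_zero_of_integral_eq_zero g (hu.mul (weight_reg0 τ hf).continuous)
    (fun x => mul_nonneg (h0 x) (weight_pos hτ f x).le) h x
  exact (mul_eq_zero.1 this).resolve_right (weight_pos hτ f x).ne'

/-- The fundamental lemma of the calculus of variations. -/
theorem eq_zero_of_forall_nuIntegral_mul (hτ : 0 < τ) {f u : M → ℝ} (hf : Reg0 (n := n) 1 f)
    (hu : Continuous u) (h : ∀ w : SmoothFun n M, nuIntegral τ g f (fun x => w x * u x) = 0)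
    (x : M) : u x = 0 := by
  have hc : Continuous fun x => u x * weight n τ f x := hu.mul (weight_reg0 τ hf).continuous
  have h1 := ae_eq_zero_of_integral_contMDiff_smul_eq_zero (𝓡 n) (μ := vol g)
    (integrable_vol g hc).locallyIntegrable (fun w hw _ => by
      have := h ⟨w, hw⟩
      rw [nuIntegral_eq] at this
      rw [← this]
      exact integral_congr_ae (Eventually.of_forall fun x => by
        show w x * (u x * weight n τ f x) = w x * u x * weight n τ f x
        ring))
  have h2 := congrFun (Measure.eq_of_ae_eq h1 hc continuous_const) x
  exact (mul_eq_zero.1 h2).resolve_right (weight_pos hτ f x).ne'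

/-! #### Positivity and harmonic functions -/

theorem inner1_self_nonneg {α : Field1 n M} (hα : IsLin1 α) (x : M) : 0 ≤ inner1 g α α x := by
  obtain ⟨b, hb⟩ := exists_frame_at g x
  rw [inner1_frame hb hα hα]
  exact Finset.sum_nonneg fun a _ => mul_self_nonneg _

theorem eq_zero_of_inner1_self {α : Field1 n M} (hα : IsLin1 α) {x : M}
    (h : inner1 g α α x = 0) (v : TM n x) : α x v = 0 := by
  obtain ⟨b, hb⟩ := exists_frame_at g x
  rw [inner1_frame hb hα hα, Finset.sum_eq_zero_iff_of_nonneg fun a _ => mul_self_nonneg _] at h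
  have h1 : ∀ a, α x (b a) = 0 := fun a => mul_self_eq_zero.1 (h a (Finset.mem_univ a))
  obtain ⟨A, hA⟩ := hα x
  have h2 : A v = 0 := by
    rw [← hb.expand (v : Coord n), map_sum]
    refine Finset.sum_eq_zero fun a _ => ?_
    rw [map_smul, ← hA, h1, smul_zero]
  exact (hA v).trans h2

theorem inner2_self_nonneg {h : Field2 n M} (hh : IsLin2 h) (x : M) : 0 ≤ inner2 g h h x := by
  obtain ⟨b, hb⟩ := exists_frame_at g x
  rw [inner2_frame hb hh hh]
  exact Finset.sum_nonneg fun a _ => Finset.sum_nonneg fun c _ => mul_self_nonneg _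

theorem eq_zero_of_inner2_self {h : Field2 n M} (hh : IsLin2 h) {x : M}
    (h0 : inner2 g h h x = 0) (v w : TM n x) : h x v w = 0 := by
  obtain ⟨b, hb⟩ := exists_frame_at g x
  rw [inner2_frame hb hh hh, Finset.sum_eq_zero_iff_of_nonneg fun a _ =>
    Finset.sum_nonneg fun c _ => mul_self_nonneg _] at h0
  have h1 : ∀ a c, h x (b a) (b c) = 0 := fun a c => mul_self_eq_zero.1
    ((Finset.sum_eq_zero_iff_of_nonneg fun c _ => mul_self_nonneg _).1
      (h0 a (Finset.mem_univ a)) c (Finset.mem_univ c))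
  obtain ⟨A, hA⟩ := hh x
  have h2 : A v w = 0 := by
    rw [← hb.expand (v : Coord n), ← hb.expand (w : Coord n)]
    simp only [map_sum, map_smul, ContinuousLinearMap.sum_apply, ContinuousLinearMap.smul_apply,
      ← hA, h1, smul_zero, Finset.sum_const_zero]
  exact (hA v w).trans h2

/-- A harmonic function on a closed manifold is locally constant. -/
theorem diff_eq_zero_of_harmonic {u : M → ℝ} (hu : Reg0 (n := n) 2 u)
    (h : ∀ x, tr g (hess g u) x = 0) (x : M) (v : TM n x) : diff (n := n) u x v = 0 := by
  have hα : Reg1 1 (diff (n := n) u) := hu.diff (k := 1) (l := 2) (by norm_num)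
  have hu1 := hu.of_le (k := 1) (by norm_num)
  have h1 := integral_div1 g (hα.mul hu1)
  simp only [div1_mul g hu1 hα, div1_diff g hu, h, mul_zero, zero_add] at h1
  have hc : Continuous (inner1 g (diff (n := n) u) (diff (n := n) u)) :=
    (hα.inner1 g (k := 1) hα).continuous
  exact eq_zero_of_inner1_self g hα.lin
    (eq_zero_of_integral_eq_zero g hc (inner1_self_nonneg g hα.lin) h1 x) v

end Weighted

/-! ### The Euler–Lagrange density and rigidity at a soliton -/

section Rigidity

variable {n : ℕ} {M : Type*} [TopologicalSpace M] [ChartedSpace (Coord n) M]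
  [IsManifold (𝓡 n) ∞ M] (g : RMetric n M)

/-- Perelman's density `τ (2 Δf - |∇f|² + R) + f - n`, which differs from the integrand of `W` by
a divergence, and is constant for a minimizer. -/
def euler (τ : ℝ) (g : RMetric n M) (f : M → ℝ) (x : M) : ℝ :=
  τ * (2 * tr g (hess g f) x - inner1 g (diff (n := n) f) (diff (n := n) f) x + scal g x)
    + (f x - n)

theorem comp0_euler (τ : ℝ) {f : M → ℝ} (hf : Reg0 (n := n) 2 f) {a : M} {y : Coord n}
    (hy : y ∈ (crd n a).target) :
    comp0 a (euler τ g f) y = eulerC τ (locG g a) (comp0 a f) y := by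
  have h1 := comp0_tr g hy (isLin2_hess g f)
  have h2 := comp0_tr g hy (isLin2_ricci g)
  have h3 := comp0_inner1 g hy (isLin1_diff f) (isLin1_diff f)
  rw [comp2_hess g hy hf] at h1
  rw [comp2_ricci g hy] at h2
  rw [comp1_diff hy (hf.of_le (by norm_num))] at h3
  unfold eulerC
  rw [← h1, ← h2, ← h3]
  rfl

theorem euler_reg0 (τ : ℝ) {k l : ℕ∞} (hkl : k + 2 ≤ l) {f : M → ℝ} (hf : Reg0 (n := n) l f) :
    Reg0 (n := n) k (euler τ g f) := by
  have hk : (k : ℕ∞ω) ≤ l := by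
    have : k ≤ l := le_trans le_self_add hkl
    exact_mod_cast this
  have hk1 : k + 1 ≤ l := le_trans (by gcongr; norm_num) hkl
  have h1 := (hf.hess g hkl).tr g
  have h2 := (hf.diff hk1).inner1 g (hf.diff hk1)
  have h3 : Reg0 (n := n) k (scal g) := ((reg2_ricci g).of_le (by simp)).tr g
  exact ((reg0_const τ).mul ((((reg0_const 2).mul h1).sub h2).add h3)).add
    ((hf.of_le hk).sub (reg0_const _))

theorem isLin2_gradMu (τ : ℝ) (f : M → ℝ) : IsLin2 (gradMu τ g f) := by
  have h1 := ((isLin2_ricci g).add (isLin2_hess g f)).add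
    ((RMetric.reg2 g).lin.mul fun _ => -(1 / (2 * τ)))
  intro x
  obtain ⟨A, hA⟩ := (h1.mul fun _ => -τ) x
  refine ⟨A, fun v w => ?_⟩
  rw [← hA]
  show -τ * (_ + _ - _ * _) = -τ * (_ + _ + -_ * _)
  rw [neg_mul (1 / (2 * τ)), ← sub_eq_add_neg]
  rfl

theorem comp2_gradMu (τ : ℝ) {f : M → ℝ} (hf : Reg0 (n := n) 2 f) {a : M} {y : Coord n}
    (hy : y ∈ (crd n a).target) (i j : Fin n) :
    comp2 a (gradMu τ g f) y i j = -τ * (ricciC (locG g a) y i j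
      + hessC (locG g a) (comp0 a f) y i j + (-(1 / (2 * τ))) * locG g a y i j) := by
  rw [← comp2_ricci g hy, ← comp2_hess g hy hf]
  show -τ * (_ + _ - _ * _) = -τ * (_ + _ + -_ * _)
  rw [neg_mul (1 / (2 * τ)), ← sub_eq_add_neg]
  rfl

theorem gradMu_reg2 (τ : ℝ) {k l : ℕ∞} (hkl : k + 2 ≤ l) {f : M → ℝ} (hf : Reg0 (n := n) l f) :
    Reg2 k (gradMu τ g f) := by
  refine ⟨isLin2_gradMu g τ f, fun a i j => ?_⟩
  have hl : (2 : ℕ∞ω) ≤ l := by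
    have : (2 : ℕ∞) ≤ l := le_trans le_add_self hkl
    exact WithTop.coe_le_coe.2 this
  have h1 := ((reg2_ricci g).comp a i j).of_le (m := k) (by simp)
  have h2 := (hf.hess g hkl).comp a i j
  have h3 := ((RMetric.reg2 g).comp a i j).of_le (m := k) (by simp)
  exact contDiffOn_const.mul ((h1.add h2).sub (contDiffOn_const.mul h3))

theorem ricci_symm (x : M) (v w : TM n x) : ricci g x v w = ricci g x w v := by
  have hy := mem_extChartAt_target (I := 𝓡 n) x
  obtain ⟨b, hb⟩ := exists_frame_at g x
  have e : ∀ v w : Coord n, ricci g x v w = m2 (ricciC (locG g x) (crd n x x)) v w :=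
    fun v w => of2_eq _ _ _ _
  exact (e v w).trans (((patchMetric g x).ricciC_symm hy v w).trans (e w v).symm)

theorem hess_symm {f : M → ℝ} (hf : Reg0 (n := n) 2 f) (x : M) (v w : TM n x) :
    hess g f x v w = hess g f x w v := by
  have hy := mem_extChartAt_target (I := 𝓡 n) x
  have e : ∀ v w : Coord n, hess g f x v w = m2 (hessC (locG g x) (comp0 x f) (crd n x x)) v w :=
    fun v w => of2_eq _ _ _ _
  exact (e v w).trans (((patchMetric g x).m2_hessC_symm (hf x) hy v w).trans (e w v).symm)

theorem gradMu_symm (τ : ℝ) {f : M → ℝ} (hf : Reg0 (n := n) 2 f) (x : M) (v w : TM n x) :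
    gradMu τ g f x v w = gradMu τ g f x w v := by
  unfold gradMu
  rw [ricci_symm g x v w, hess_symm g hf x v w, g.symm x v w]

theorem nabla2_congr_on {V : Set (Coord n)} (hV : IsOpen V) {G : LocalMetric n}
    {h k : Coord n → Fin n → Fin n → ℝ} (e : ∀ z ∈ V, h z = k z) {y : Coord n} (hy : y ∈ V) :
    nabla2 G h y = nabla2 G k y := by
  ext a i j
  unfold nabla2
  rw [e y hy, pd_congr_on hV (fun z hz => by rw [e z hz]) hy]

theorem diff_of_const {u : M → ℝ} {c : ℝ} (hu : ∀ x, u x = c) (x : M) (v : TM n x) :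
    diff (n := n) u x v = 0 := by
  have h2 : comp0 (n := n) x u = fun _ => c := funext fun z => hu _
  simp [diff, of1, h2, pd]

/-- The weighted Bianchi identity: `δ^f ∇μ = -½ d(τ (2 Δf - |∇f|² + R) + f)`. -/
theorem driftDiv2_gradMu {τ : ℝ} (hτ : τ ≠ 0) {f : M → ℝ} (hf : Reg0 (n := n) ∞ f) (x : M)
    (v : Coord n) :
    driftDiv2 g f (gradMu τ g f) x v = -(1 / 2) * diff (n := n) (euler τ g f) x v := by
  have hy := mem_extChartAt_target (I := 𝓡 n) x
  have hf2 := hf.of_le two_le_infty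
  have hf3 := hf.of_le three_le_infty
  have hT : Reg2 1 (fun x v w => ricci g x v w + hess g f x v w
      + (-(1 / (2 * τ))) * RMetric.field g x v w : Field2 n M) :=
    ((reg2_ricci g).of_le (by simp) |>.add (hf3.hess g (k := 1) (l := 3) (by norm_num))).add
      ((RMetric.reg2 g).of_le (by simp) |>.mul (reg0_const _))
  set T : Coord n → Fin n → Fin n → ℝ := fun z i j => ricciC (locG g x) z i j
    + hessC (locG g x) (comp0 x f) z i j + (-(1 / (2 * τ))) * locG g x z i j with hTd
  have hTdiff : ∀ i j, DifferentiableAt ℝ (fun z => T z i j) (crd n x x) := fun i j => by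
    refine diffAt_target (k := 1) ((hT.comp x i j).congr fun z hz => ?_) hy
    simp only [hTd, ← comp2_ricci g hz, ← comp2_hess g hz hf2]
    rfl
  have h1 : driftDiv2 g f (gradMu τ g f) x v
      = m1 (driftDivC (locG g x) (comp0 x f) (comp2 x (gradMu τ g f)) (crd n x x)) v := by
    have e1 := of1_eq x (divC (locG g x) (comp2 x (gradMu τ g f)) (crd n x x)) v
    have e2 := of1_eq x (contractC (locG g x) (fun z i => pd i (comp0 x f) z)
      (comp2 x (gradMu τ g f)) (crd n x x)) v
    have e3 : m1 (driftDivC (locG g x) (comp0 x f) (comp2 x (gradMu τ g f)) (crd n x x)) v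
        = m1 (divC (locG g x) (comp2 x (gradMu τ g f)) (crd n x x)) v
          - m1 (contractC (locG g x) (fun z i => pd i (comp0 x f) z)
            (comp2 x (gradMu τ g f)) (crd n x x)) v := by
      rw [← m1_sub]
      rfl
    rw [e3, ← e1, ← e2]
    rfl
  have h2 : driftDivC (locG g x) (comp0 x f) (comp2 x (gradMu τ g f)) (crd n x x)
      = fun j => -τ * driftDivC (locG g x) (comp0 x f) T (crd n x x) j := by
    have hon : ∀ z ∈ (crd n x).target, comp2 x (gradMu τ g f) z
        = fun i j => -τ * T z i j := fun z hz => by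
      ext i j
      exact comp2_gradMu g τ hf2 hz i j
    ext j
    unfold driftDivC
    have e1 : divC (locG g x) (comp2 x (gradMu τ g f)) (crd n x x) j
        = -τ * divC (locG g x) T (crd n x x) j := by
      have e2 : ∀ i k, nabla2 (locG g x) (comp2 x (gradMu τ g f)) (crd n x x) i k j
          = -τ * nabla2 (locG g x) T (crd n x x) i k j := by
        intro i k
        rw [nabla2_congr_on (isOpen_target x) hon hy]
        rw [nabla2_mul (u := fun _ => -τ) (differentiableAt_const _) hTdiff]
        simp [pd]
      unfold divC
      simp only [e2, Finset.mul_sum]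
      exact Finset.sum_congr rfl fun i _ => Finset.sum_congr rfl fun k _ => by ring
    rw [e1]
    unfold contractC
    rw [hon _ hy, mul_sub, Finset.mul_sum]
    simp only [Finset.mul_sum]
    congr 1
    exact Finset.sum_congr rfl fun i _ => Finset.sum_congr rfl fun k _ => by ring
  have h3 : diff (n := n) (euler τ g f) x v
      = m1 (fun i => pd i (comp0 x (euler τ g f)) (crd n x x)) v := of1_eq _ _ _
  have h4 := (patchMetric g x).fderiv_eulerC hy (hf3 x) hτ v
  rw [← fderiv_congr_on (isOpen_target x) (fun z hz => comp0_euler g τ hf2 hz) hy,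
    fderiv_eq_m1] at h4
  rw [h1, h2, h3, m1_smul (-τ), h4]
  ring

theorem hess_sub {u f : M → ℝ} (hu : Reg0 (n := n) 2 u) (hf : Reg0 (n := n) 2 f) (x : M)
    (v w : Coord n) :
    hess g (fun x => u x - f x) x v w = hess g u x v w - hess g f x v w := by
  have hy := mem_extChartAt_target (I := 𝓡 n) x
  have e : ∀ u : M → ℝ, ∀ v w : Coord n, hess g u x v w
      = m2 (hessC (locG g x) (comp0 x u) (crd n x x)) v w := fun u v w => of2_eq _ _ _ _
  have h1 : hessC (locG g x) (comp0 x (fun x => u x - f x)) (crd n x x)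
      = fun i j => hessC (locG g x) (comp0 x u) (crd n x x) i j
        - hessC (locG g x) (comp0 x f) (crd n x x) i j := by
    ext i j
    have hp : ∀ {u : M → ℝ}, Reg0 (n := n) 2 u → ∀ i, DifferentiableAt ℝ
        (fun z => pd i (comp0 x u) z) (crd n x x) := fun hu i =>
      diffAt_target (contDiffOn_pd (isOpen_target x) (k := 1) (by norm_num) (hu x) i) hy
    have h2 : nabla1 (locG g x) (fun z a => pd a (comp0 x (fun x => u x - f x)) z) (crd n x x) i j
        = nabla1 (locG g x) (fun z a => pd a (comp0 x u) z - pd a (comp0 x f) z)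
          (crd n x x) i j := by
      rw [nabla1_congr_on (isOpen_target x) (fun z hz => funext fun a => ?_) hy]
      exact congrArg (fun T : Coord n →L[ℝ] ℝ => T (EuclideanSpace.single a 1))
        (fderiv_fun_sub (diffAt_target (hu x) hz) (diffAt_target (hf x) hz))
    exact h2.trans (nabla1_sub (hp hu) (hp hf) i j)
  exact (e _ v w).trans (by rw [h1, m2_sub, ← e, ← e])

variable [CompactSpace M] [T2Space M] [MeasurableSpace M] [BorelSpace M] {τ : ℝ}

/-- A potential with constant Euler–Lagrange density, on a metric that is a soliton for the
potential `f₀`, differs from `f₀` by a function with vanishing Hessian. With `B = Ric + ∇²f - g / (2τ)` and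
`u = f - f₀`, the soliton equation gives `B = ∇²u`, and `δ^f B = 0` by the weighted Bianchi identity,
so that `∫ |∇²u|² dν = ∫ ⟨∇²u, B⟩ dν = -∫ ⟨du, δ^f B⟩ dν = 0`. -/
theorem hess_sub_eq_zero_of_euler_const (hτ : 0 < τ) {f₀ : SmoothFun n M} (hsol : IsShrinkingSoliton τ g f₀)
    {f : SmoothFun n M} {c : ℝ} (hf : ∀ x, euler τ g f x = c) (x : M) (v w : TM n x) :
    hess g (fun x => f x - f₀ x) x v w = 0 := by
  have hfs := f.reg0
  have hus : Reg0 (n := n) ∞ (fun x => f x - f₀ x) := hfs.sub f₀.reg0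
  have hu2 := hus.of_le two_le_infty
  have hf1 := hfs.of_le (k := 1) (by simp)
  have hB : ∀ x v w, gradMu τ g f x v w = -τ * hess g (fun x => f x - f₀ x) x v w := by
    intro x v w
    have h1 := hess_sub g (hfs.of_le two_le_infty) (f₀.reg0.of_le two_le_infty) x v w
    unfold gradMu
    linear_combination (-τ) * hsol x v w + τ * h1
  have hBr : Reg2 1 (gradMu τ g f) := gradMu_reg2 g τ (k := 1) (l := ⊤) (by simp) hfs
  have hd : ∀ x v, driftDiv2 g f (gradMu τ g f) x v = 0 := by
    intro x v
    refine (driftDiv2_gradMu g hτ.ne' hfs x v).trans ?_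
    rw [diff_of_const hf, mul_zero]
  -- integrate the weighted divergence of the one-form `∇μ(∇u, ·)`
  have h1 := nuIntegral_driftDiv1 (τ := τ) g hf1
    ((hus.diff (k := 1) (l := ⊤) (by simp)).contract g hBr)
  have e : driftDiv1 g f (contract g (diff (n := n) (fun x => f x - f₀ x)) (gradMu τ g f))
      = fun x => -τ * inner2 g (hess g (fun x => f x - f₀ x)) (hess g (fun x => f x - f₀ x)) x := by
    ext x
    rw [driftDiv1_contract_diff g hf1 hu2 hBr
      (gradMu_symm g τ (hfs.of_le two_le_infty))]
    obtain ⟨b, hb⟩ := exists_frame_at g x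
    rw [inner1_frame hb (isLin1_diff _) (isLin1_driftDiv2 g _ _),
      inner2_frame hb (isLin2_hess g _) hBr.lin,
      inner2_frame hb (isLin2_hess g _) (isLin2_hess g _), Finset.mul_sum]
    rw [Finset.sum_eq_zero fun a _ => by rw [show driftDiv2 g f (gradMu τ g f) x (b a) = 0 from
      hd x (b a), mul_zero], zero_add]
    refine Finset.sum_congr rfl fun a _ => ?_
    rw [Finset.mul_sum]
    refine Finset.sum_congr rfl fun c _ => ?_
    rw [show gradMu τ g f x (b a) (b c) = _ from hB x (b a) (b c)]
    ring
  rw [e, nuIntegral_const_mul] at h1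
  have hh : Reg2 0 (hess g (fun x => f x - f₀ x)) := hu2.hess g (k := 0) (l := 2) (by norm_num)
  exact eq_zero_of_inner2_self g hh.lin (eq_zero_of_nuIntegral_eq_zero g hτ hf1
    (hh.inner2 g (k := 0) hh).continuous (inner2_self_nonneg g hh.lin)
    ((mul_eq_zero.1 h1).resolve_left (neg_ne_zero.2 hτ.ne')) x) v w

end Rigidity

/-! ### The linearized equation and the duality of `δ` and `δ*` -/

section Kernel

variable {n : ℕ}

theorem PatchMetric.sum_invG_mul {V : Set (Coord n)} {G : LocalMetric n} (hG : PatchMetric V G)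
    {y : Coord n} (hy : y ∈ V) (c : Fin n → ℝ) (j : Fin n) :
    ∑ i, ∑ k, invG G y i k * c i * G y k j = c j := by
  have hd : (Matrix.of (G y)).det ≠ 0 := (hG.posDef y hy).det_pos.ne'
  have h1 := Matrix.nonsing_inv_mul (Matrix.of (G y)) hd.isUnit
  have h2 : ∀ i, ∑ k, invG G y i k * G y k j = if i = j then 1 else 0 := by
    intro i
    have := congrFun (congrFun h1 i) j
    rw [Matrix.mul_apply, Matrix.one_apply] at this
    exact this
  have h3 : ∀ i, ∑ k, invG G y i k * c i * G y k j = c i * ∑ k, invG G y i k * G y k j := by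
    intro i
    rw [Finset.mul_sum]
    exact Finset.sum_congr rfl fun k _ => by ring
  simp only [h3, h2]
  simp

variable {M : Type*} [TopologicalSpace M] [ChartedSpace (Coord n) M]
  [IsManifold (𝓡 n) ∞ M] (g : RMetric n M)

/-- The symmetric tensor `w g`. -/
def conformal (w : SmoothFun n M) : SymTensor n M where
  val x := w x • g.inner x
  symm x v u := congrArg (w x * ·) (g.symm x v u)
  smooth := (contMDiff_section_iff _).2 fun a i j =>
    (w.reg0 a).mul ((RMetric.reg2 g).comp a i j)

/-- The weighted divergence of `w g` is `dw - w df`. -/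
theorem driftDiv2_conformal {f : M → ℝ} (hf : Reg0 (n := n) 1 f) (w : SmoothFun n M) (x : M)
    (v : Coord n) : driftDiv2 g f (conformal g w).field x v
      = diff (n := n) w x v - w x * diff (n := n) f x v := by
  have hy := mem_extChartAt_target (I := 𝓡 n) x
  have hP := patchMetric g x
  have hw1 : DifferentiableAt ℝ (comp0 x w) (crd n x x) :=
    diffAt_target (w.reg0 x) hy (by simp)
  have e0 : comp2 x (conformal g w).field = fun z i j => comp0 x w z * locG g x z i j := rfl
  have e1 : divC (locG g x) (comp2 x (conformal g w).field) (crd n x x)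
      = fun j => pd j (comp0 x w) (crd n x x) := by
    ext j
    rw [e0]
    unfold divC
    simp only [nabla2_mul hw1 (fun i j => hP.diffAt (hP.smooth i j) hy), hP.nabla2_self hy,
      mul_zero, add_zero, ← mul_assoc]
    exact hP.sum_invG_mul hy (fun i => pd i (comp0 x w) (crd n x x)) j
  have e2 : contractC (locG g x) (comp1 x (diff (n := n) f)) (comp2 x (conformal g w).field)
      (crd n x x) = fun j => w x * pd j (comp0 x f) (crd n x x) := by
    ext j
    rw [e0]
    unfold contractC
    rw [comp1_diff hy hf, ← hP.sum_invG_mul hy (fun i => pd i (comp0 x f) (crd n x x)) j,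
      Finset.mul_sum]
    simp only [Finset.mul_sum, comp0_self]
    exact Finset.sum_congr rfl fun i _ => Finset.sum_congr rfl fun j _ => by ring
  refine (driftDiv2_eq g hf _ x v).trans ?_
  have e3 : div2 g (conformal g w).field x v = diff (n := n) w x v := by
    unfold div2
    rw [e1]
    rfl
  have e4 : contract g (diff (n := n) f) (conformal g w).field x v = w x * diff (n := n) f x v := by
    unfold contract
    rw [e2]
    simp only [diff, of1, Finset.mul_sum]
    exact Finset.sum_congr rfl fun i _ => by ring
  exact congrArg₂ (· - ·) e3 e4

theorem inner1_eq_zero_left {α η : Field1 n M} (hα : IsLin1 α) (hη : IsLin1 η) {x : M}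
    (h : ∀ v, α x v = 0) : inner1 g α η x = 0 := by
  obtain ⟨b, hb⟩ := exists_frame_at g x
  rw [inner1_frame hb hα hη]
  exact Finset.sum_eq_zero fun a _ => by rw [show α x (b a) = 0 from h (b a), zero_mul]

theorem inner1_sub_right {α η θ : Field1 n M} (hα : IsLin1 α) (hη : IsLin1 η) (hθ : IsLin1 θ)
    (x : M) : inner1 g α (fun x v => η x v - θ x v) x = inner1 g α η x - inner1 g α θ x := by
  obtain ⟨b, hb⟩ := exists_frame_at g x
  rw [inner1_frame hb hα (hη.sub hθ), inner1_frame hb hα hη, inner1_frame hb hα hθ,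
    ← Finset.sum_sub_distrib]
  exact Finset.sum_congr rfl fun a _ => mul_sub _ _ _

variable [CompactSpace M] [T2Space M] [MeasurableSpace M] [BorelSpace M] {τ : ℝ}

/-- The duality of `δ*` and `δ`. -/
theorem integral_deltaStar {α : Field1 n M} (hα : Reg1 1 α) {h : Field2 n M} (hh : Reg2 1 h)
    (hs : ∀ x v w, h x v w = h x w v) :
    ∫ x, inner2 g (deltaStar g α) h x ∂(vol g) = ∫ x, inner1 g α (div2 g h) x ∂(vol g) := by
  have h1 := integral_div1 g (hα.contract g (k := 1) hh)
  have e : ∀ x, inner2 g (deltaStar g α) h x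
      = inner1 g α (div2 g h) x - div1 g (contract g α h) x := by
    intro x
    rw [inner2_deltaStar g hh.lin hs, div1_contract g hα hh hs]
    ring
  simp only [e]
  rw [integral_sub, h1, sub_zero]
  · exact integrable_vol g ((hα.of_le (k := 0) (by norm_num)).inner1 g (k := 0)
      (hh.div2 g (k := 0) (l := 1) (by norm_num))).continuous
  · exact integrable_vol g ((hα.contract g (k := 1) hh).div1 g (k := 0) (l := 1)
      (by norm_num)).continuous

theorem driftLap_reg0 {f u : M → ℝ} (hf : Reg0 (n := n) 2 f) (hu : Reg0 (n := n) 2 u) :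
    Reg0 (n := n) 0 (driftLap g f u) :=
  ((hu.hess g (k := 0) (l := 2) (by norm_num)).tr g (k := 0)).sub
    ((hu.diff (k := 0) (l := 2) (by norm_num)).inner1 g (hf.diff (k := 0) (l := 2) (by norm_num)))

/-- The drift Laplacian is symmetric for `dν`. -/
theorem nuIntegral_mul_driftLap {f u w : M → ℝ} (hf : Reg0 (n := n) 1 f)
    (hu : Reg0 (n := n) 2 u) (hw : Reg0 (n := n) 1 w) :
    nuIntegral τ g f (fun x => w x * driftLap g f u x)
      = -nuIntegral τ g f (inner1 g (diff (n := n) w) (diff (n := n) u)) := by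
  simp only [driftLap_eq g hu]
  exact nuIntegral_mul_driftDiv1 g hf hw (hu.diff (k := 1) (l := 2) (by norm_num))

/-- If the linearized equation can be solved for all conformal variations, its kernel is
trivial. The operator `Δ^f + 1 / (2τ)` is symmetric for `dν`, so a kernel element `u` is orthogonal
to all right-hand sides `δ^f δ^f (w g) = Δ^f w - δ^f (w df)`. Integration by parts turns this into
`∫ w Δu dν = 0` for all `w`. Hence `u` is harmonic, its differential vanishes, and the kernel
equation reduces to `u / (2τ) = 0`. -/
theorem kernel_eq_zero (hτ : 0 < τ) {f : M → ℝ} (hf : Reg0 (n := n) 2 f)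
    (hex : ∀ w : SmoothFun n M, ∃ φ : M → ℝ, Reg0 (n := n) 2 φ ∧
      ∀ x, driftLap g f φ x + (1 / (2 * τ)) * φ x
        = -(1 / 2) * driftDiv1 g f (driftDiv2 g f (conformal g w).field) x)
    {u : M → ℝ} (hu : Reg0 (n := n) 2 u)
    (h0 : ∀ x, driftLap g f u x + (1 / (2 * τ)) * u x = 0) (x : M) : u x = 0 := by
  have hf1 := hf.of_le (k := 1) (by norm_num)
  have hu1 := hu.of_le (k := 1) (by norm_num)
  have hdf : Reg1 1 (diff (n := n) f) := hf.diff (k := 1) (l := 2) (by norm_num)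
  have hdu : Reg1 1 (diff (n := n) u) := hu.diff (k := 1) (l := 2) (by norm_num)
  have hlu : Continuous (driftLap g f u) := (driftLap_reg0 g hf hu).continuous
  have htr : Continuous (tr g (hess g u)) :=
    ((hu.hess g (k := 0) (l := 2) (by norm_num)).tr g (k := 0)).continuous
  have hflat : ∀ x, tr g (hess g u) x = 0 := by
    refine eq_zero_of_forall_nuIntegral_mul g hτ hf1 htr fun w => ?_
    obtain ⟨φ, hφ, heq⟩ := hex w
    have hφ1 := hφ.of_le (k := 1) (by norm_num)
    have hw2 : Reg0 (n := n) 2 w := w.reg0.of_le two_le_infty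
    have hw1 := hw2.of_le (k := 1) (by norm_num)
    have hdw : Reg1 1 (diff (n := n) w) := hw2.diff (k := 1) (l := 2) (by norm_num)
    have hlφ : Continuous (driftLap g f φ) := (driftLap_reg0 g hf hφ).continuous
    have s1 : nuIntegral τ g f (fun x => u x * driftLap g f φ x)
        = nuIntegral τ g f (fun x => φ x * driftLap g f u x) := by
      rw [nuIntegral_mul_driftLap g hf1 hφ hu1, nuIntegral_mul_driftLap g hf1 hu hφ1,
        show inner1 g (diff (n := n) u) (diff (n := n) φ) = inner1 g (diff (n := n) φ)
          (diff (n := n) u) from funext fun x => inner1_comm g (isLin1_diff u) (isLin1_diff φ) x]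
    have s2 : nuIntegral τ g f (fun x => u x * driftDiv1 g f (driftDiv2 g f (conformal g w).field) x)
        = 0 := by
      have e : (fun x => u x * driftDiv1 g f (driftDiv2 g f (conformal g w).field) x)
          = fun x => -2 * (u x * driftLap g f φ x - φ x * driftLap g f u x) := by
        ext x
        have h1 := heq x
        have h2 := h0 x
        linear_combination 2 * u x * h1 - 2 * φ x * h2
      rw [e, nuIntegral_const_mul, nuIntegral_sub (u := fun x => u x * driftLap g f φ x)
        (v := fun x => φ x * driftLap g f u x) g hf1 (hu.continuous.mul hlφ)
        (hφ.continuous.mul hlu), s1, sub_self, mul_zero]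
    have e1 : driftDiv2 g f (conformal g w).field
        = (fun x v => diff (n := n) w x v - w x * diff (n := n) f x v : Field1 n M) :=
      funext fun x => funext fun v => driftDiv2_conformal g hf1 w x v
    have hη : Reg1 1 (fun x v => w x * diff (n := n) f x v : Field1 n M) := hdf.mul hw1
    rw [e1, nuIntegral_mul_driftDiv1 g hf1 hu1 (hdw.sub hη), neg_eq_zero] at s2
    have e2 : inner1 g (diff (n := n) u) (fun x v => diff (n := n) w x v - w x * diff (n := n) f x v)
        = fun x => inner1 g (diff (n := n) w) (diff (n := n) u) x
          - w x * inner1 g (diff (n := n) u) (diff (n := n) f) x := by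
      ext x
      rw [inner1_sub_right g hdu.lin hdw.lin hη.lin, inner1_mul_right,
        inner1_comm g hdu.lin hdw.lin]
    have c1 : Continuous (inner1 g (diff (n := n) w) (diff (n := n) u)) :=
      (hdw.inner1 g (k := 1) hdu).continuous
    have c2 : Continuous (inner1 g (diff (n := n) u) (diff (n := n) f)) :=
      (hdu.inner1 g (k := 1) hdf).continuous
    have s3 := nuIntegral_mul_driftLap (τ := τ) g hf1 hu hw1
    rw [e2, nuIntegral_sub (v := fun x => w x * inner1 g (diff (n := n) u) (diff (n := n) f) x)
      g hf1 c1 (hw1.continuous.mul c2)] at s2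
    have e3 : (fun x => w x * tr g (hess g u) x) = fun x => w x * driftLap g f u x
        + w x * inner1 g (diff (n := n) u) (diff (n := n) f) x := by
      ext x
      unfold driftLap
      ring
    rw [e3, nuIntegral_add (u := fun x => w x * driftLap g f u x)
      (v := fun x => w x * inner1 g (diff (n := n) u) (diff (n := n) f) x)
      g hf1 (hw1.continuous.mul hlu) (hw1.continuous.mul c2), s3]
    linarith
  have h1 := h0 x
  unfold driftLap at h1
  rw [hflat, inner1_eq_zero_left g hdu.lin hdf.lin (diff_eq_zero_of_harmonic g hu hflat x),
    sub_zero, zero_add] at h1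
  exact (mul_eq_zero.1 h1).resolve_left (by positivity)

end Kernel

/-! ### Paths of metrics and of functions, pointwise -/

section Paths

variable {n : ℕ} {M : Type*} [TopologicalSpace M] [ChartedSpace (Coord n) M]

section C2

variable {F : ℝ → M → ℝ} {p : M → ℝ} {a : M} {y : Coord n}

theorem HasC2DerivAt.reg0 [IsManifold (𝓡 n) ∞ M] (H : HasC2DerivAt (n := n) F p) :
    Reg0 (n := n) 2 p := reg0_of_contMDiff (k := 2) H.1

theorem pd_pd_eq {u : Coord n → ℝ} (hu : ContDiffAt ℝ 2 u y) (i j : Fin n) :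
    pd i (pd j u) y
      = fderiv ℝ (fderiv ℝ u) y (EuclideanSpace.single i 1) (EuclideanSpace.single j 1) := by
  have h1 : DifferentiableAt ℝ (fderiv ℝ u) y :=
    (hu.fderiv_right (m := 1) (by norm_num)).differentiableAt (by norm_num)
  have h2 := (h1.hasFDerivAt.clm_apply
    (hasFDerivAt_const (EuclideanSpace.single j (1 : ℝ) : Coord n) y)).fderiv
  have h3 : pd j u = fun z => fderiv ℝ u z (EuclideanSpace.single j 1) := rfl
  rw [h3]
  unfold pd
  rw [h2]
  simp

/-- The difference quotients of order zero, one and two. -/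
theorem diffQuot_eq [IsManifold (𝓡 n) ∞ M] (hF : ∀ s, Reg0 (n := n) 2 (F s)) (hy : y ∈ (crd n a).target) (s : ℝ) :
    (iteratedFDeriv ℝ 0 (fun z => s⁻¹ * (comp0 a (F s) z - comp0 a (F 0) z)) y ![]
        = s⁻¹ * (comp0 a (F s) y - comp0 a (F 0) y)) ∧
      (∀ i, iteratedFDeriv ℝ 1 (fun z => s⁻¹ * (comp0 a (F s) z - comp0 a (F 0) z)) y
          ![EuclideanSpace.single i 1]
        = s⁻¹ * (pd i (comp0 a (F s)) y - pd i (comp0 a (F 0)) y)) ∧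
      ∀ i j, iteratedFDeriv ℝ 2 (fun z => s⁻¹ * (comp0 a (F s) z - comp0 a (F 0) z)) y
          ![EuclideanSpace.single i 1, EuclideanSpace.single j 1]
        = s⁻¹ * (pd i (pd j (comp0 a (F s))) y - pd i (pd j (comp0 a (F 0))) y) := by
  have hc : ∀ s, ∀ z ∈ (crd n a).target, ContDiffAt ℝ 2 (comp0 a (F s)) z := fun s z hz =>
    (hF s a).contDiffAt ((isOpen_target a).mem_nhds hz)
  have h1 : ∀ z ∈ (crd n a).target, ∀ i,
      pd i (fun z => s⁻¹ * (comp0 a (F s) z - comp0 a (F 0) z)) z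
        = s⁻¹ * (pd i (comp0 a (F s)) z - pd i (comp0 a (F 0)) z) := by
    intro z hz i
    have d1 := (hc s z hz).differentiableAt (by norm_num)
    have d2 := (hc 0 z hz).differentiableAt (by norm_num)
    unfold pd
    rw [fderiv_const_mul (d1.fun_sub d2), fderiv_fun_sub d1 d2]
    rfl
  refine ⟨rfl, fun i => ?_, fun i j => ?_⟩
  · rw [iteratedFDeriv_one_apply, ← h1 y hy]
    rfl
  · rw [iteratedFDeriv_two_apply]
    have h2 := pd_pd_eq (u := fun z => s⁻¹ * (comp0 a (F s) z - comp0 a (F 0) z))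
      (contDiffAt_const.mul ((hc s y hy).sub (hc 0 y hy))) i j
    refine h2.symm.trans ?_
    rw [pd_congr_on (isOpen_target a) (fun z hz => h1 z hz j) hy]
    have hp : ∀ s, DifferentiableAt ℝ (pd j (comp0 a (F s))) y := fun s =>
      diffAt_target (contDiffOn_pd (isOpen_target a) (k := 1) (by norm_num) (hF s a) j) hy
    unfold pd at hp ⊢
    rw [fderiv_const_mul ((hp s).fun_sub (hp 0)), fderiv_fun_sub (hp s) (hp 0)]
    rfl

theorem hasDerivAt_zero_iff {f : ℝ → ℝ} {f' : ℝ} :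
    HasDerivAt f f' 0 ↔ Tendsto (fun s : ℝ => s⁻¹ * (f s - f 0)) (𝓝[≠] 0) (𝓝 f') := by
  rw [hasDerivAt_iff_tendsto_slope_zero]
  simp


theorem HasC2DerivAt.hasDerivAt (H : HasC2DerivAt (n := n) F p)
    (hF : ∀ s, Reg0 (n := n) 2 (F s)) (hy : y ∈ (crd n a).target) :
    HasDerivAt (fun s => comp0 a (F s) y) (comp0 a p y) 0 := by
  rw [hasDerivAt_zero_iff]
  have h1 := ((H.2 a 0 (by norm_num)).tendsto_at hy)
  have h2 := ((ContinuousMultilinearMap.apply ℝ (fun _ : Fin 0 => Coord n) ℝ ![]).continuous.tendsto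
    _).comp h1
  exact h2

theorem HasC2DerivAt.hasDerivAt_pd [IsManifold (𝓡 n) ∞ M] (H : HasC2DerivAt (n := n) F p)
    (hF : ∀ s, Reg0 (n := n) 2 (F s)) (hy : y ∈ (crd n a).target) (i : Fin n) :
    HasDerivAt (fun s => pd i (comp0 a (F s)) y) (pd i (comp0 a p) y) 0 := by
  rw [hasDerivAt_zero_iff]
  have h1 := ((H.2 a 1 (by norm_num)).tendsto_at hy)
  have h2 := ((ContinuousMultilinearMap.apply ℝ (fun _ : Fin 1 => Coord n) ℝ
    ![EuclideanSpace.single i 1]).continuous.tendsto _).comp h1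
  have h3 : iteratedFDeriv ℝ 1 (comp0 a p) y ![EuclideanSpace.single i 1] = pd i (comp0 a p) y := by
    rw [iteratedFDeriv_one_apply]
    rfl
  rw [← h3]
  exact h2.congr fun s => (diffQuot_eq hF hy s).2.1 i

theorem HasC2DerivAt.hasDerivAt_pd_pd [IsManifold (𝓡 n) ∞ M] (H : HasC2DerivAt (n := n) F p)
    (hF : ∀ s, Reg0 (n := n) 2 (F s)) (hy : y ∈ (crd n a).target) (i j : Fin n) :
    HasDerivAt (fun s => pd i (pd j (comp0 a (F s))) y) (pd i (pd j (comp0 a p)) y) 0 := by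
  rw [hasDerivAt_zero_iff]
  have h1 := ((H.2 a 2 (by norm_num)).tendsto_at hy)
  have h2 := ((ContinuousMultilinearMap.apply ℝ (fun _ : Fin 2 => Coord n) ℝ
    ![EuclideanSpace.single i 1, EuclideanSpace.single j 1]).continuous.tendsto _).comp h1
  have h3 : iteratedFDeriv ℝ 2 (comp0 a p) y
      ![EuclideanSpace.single i 1, EuclideanSpace.single j 1] = pd i (pd j (comp0 a p)) y := by
    rw [iteratedFDeriv_two_apply, pd_pd_eq ((H.reg0 a).contDiffAt ((isOpen_target a).mem_nhds hy))]
    rfl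
  rw [← h3]
  exact h2.congr fun s => (diffQuot_eq hF hy s).2.2 i j

theorem HasC2DerivAt.hasDerivAt_apply (H : HasC2DerivAt (n := n) F p)
    (hF : ∀ s, Reg0 (n := n) 2 (F s)) (x : M) : HasDerivAt (fun s => F s x) (p x) 0 := by
  have := H.hasDerivAt hF (mem_extChartAt_target (I := 𝓡 n) x)
  simpa only [comp0_self] using this

end C2

variable [IsManifold (𝓡 n) ∞ M] {γ : ℝ → RMetric n M} {g : RMetric n M} {h : SymTensor n M}

theorem isSmoothPath_iff : IsSmoothPath γ ↔ ∃ ε : ℝ, 0 < ε ∧ ∀ (a : M) (i j : Fin n),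
    JointSmooth ε (crd n a).target (fun s z => locG (γ s) a z i j) := by
  unfold IsSmoothPath
  exact exists_congr fun ε => and_congr_right fun _ =>
    contMDiffOn_section_iff (fun s x => (γ s).inner x) ε

/-- A path of metrics, in the charts. -/
theorem IsPathThrough.exists_patchPath (H : IsPathThrough γ g h) : ∃ ε : ℝ, ∀ a : M,
    PatchPath ε (crd n a).target (fun s => locG (γ s) a) (comp2 a h.field) := by
  obtain ⟨ε, hε, hs⟩ := isSmoothPath_iff.1 H.smooth
  exact ⟨ε, fun a => ⟨hε, fun s _ => patchMetric (γ s) a, hs a,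
    fun z _ i j => H.velocity _ _ _⟩⟩

theorem comp1_driftDiv2 (g : RMetric n M) {f : M → ℝ} (hf : Reg0 (n := n) 1 f) {h : Field2 n M}
    (hh : Reg2 1 h) {a : M} {y : Coord n} (hy : y ∈ (crd n a).target) :
    comp1 a (driftDiv2 g f h) y = driftDivC (locG g a) (comp0 a f) (comp2 a h) y := by
  ext j
  have h1 : comp1 a (driftDiv2 g f h) y j
      = comp1 a (div2 g h) y j - comp1 a (contract g (diff (n := n) f) h) y j :=
    driftDiv2_eq g hf h _ _
  rw [h1, comp1_div2 g hy hh, comp1_contract g hy (isLin1_diff f) hh.lin]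
  unfold driftDivC contractC
  rw [comp1_diff hy hf]

variable {F : ℝ → M → ℝ} {p : M → ℝ}

/-- The first variation of the Euler–Lagrange density. -/
theorem IsPathThrough.hasDerivAt_euler (H : IsPathThrough γ g h) (τ : ℝ)
    (HF : HasC2DerivAt (n := n) F p) (hF : ∀ s, Reg0 (n := n) 2 (F s)) (x : M) :
    HasDerivAt (fun s => euler τ (γ s) (F s) x)
      (τ * (2 * driftLap g (F 0) (fun x => p x - (1 / 2) * tr g h.field x) x
          + driftDiv1 g (F 0) (driftDiv2 g (F 0) h.field) x
          - inner2 g (fun x v w => ricci g x v w + hess g (F 0) x v w) h.field x) + p x) 0 := by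
  obtain ⟨ε, hP⟩ := H.exists_patchPath
  have hy := mem_extChartAt_target (I := 𝓡 n) x
  have h1 := (hP x).hasDerivAt_eulerC hy τ (F := fun s => comp0 x (F s)) (p := comp0 x p) (hF 0 x)
    (HF.reg0 x) (HF.hasDerivAt hF hy) (HF.hasDerivAt_pd hF hy) (HF.hasDerivAt_pd_pd hF hy)
  have e : (fun s => euler τ (γ s) (F s) x)
      = fun s => eulerC τ (locG (γ s) x) (comp0 x (F s)) (crd n x x) := by
    ext s
    rw [← comp0_euler (γ s) τ (hF s) hy, comp0_self]
  rw [e]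
  refine h1.congr_deriv ?_
  simp only [H.start]
  have hF1 := (hF 0).of_le (k := 1) (by norm_num)
  have hh2 : Reg2 2 h.field := h.reg2.of_le two_le_infty
  have hh1 : Reg2 1 h.field := h.reg2.of_le (by simp)
  set v : M → ℝ := fun x => p x - (1 / 2) * tr g h.field x with hv
  have hv2 : Reg0 (n := n) 2 v := HF.reg0.sub ((reg0_const _).mul (hh2.tr g (k := 2)))
  have hvc : ∀ z ∈ (crd n x).target, comp0 x v z
      = comp0 x p z - (1 / 2) * traceC (locG g x) z (comp2 x h.field z) := fun z hz => by
    rw [← comp0_tr g hz hh2.lin]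
    rfl
  have k1 : hessC (locG g x) (fun z => comp0 x p z
      - (1 / 2) * traceC (locG g x) z (comp2 x h.field z)) (crd n x x)
      = comp2 x (hess g v) (crd n x x) := by
    rw [comp2_hess g hy hv2]
    exact nabla1_congr_on (isOpen_target x) (fun z hz => funext fun i =>
      pd_congr_on (isOpen_target x) (fun z hz => (hvc z hz).symm) hz i) hy
  have k2 : (fun i => pd i (fun z => comp0 x p z
      - (1 / 2) * traceC (locG g x) z (comp2 x h.field z)) (crd n x x))
      = comp1 x (diff (n := n) v) (crd n x x) := by
    rw [comp1_diff hy (hv2.of_le (by norm_num))]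
    exact funext fun i => pd_congr_on (isOpen_target x) (fun z hz => (hvc z hz).symm) hy i
  have k3 : (fun i => pd i (comp0 x (F 0)) (crd n x x))
      = comp1 x (diff (n := n) (F 0)) (crd n x x) := (comp1_diff hy hF1).symm
  have k4 : (fun i j => ricciC (locG g x) (crd n x x) i j
      + hessC (locG g x) (comp0 x (F 0)) (crd n x x) i j)
      = comp2 x (fun x v w => ricci g x v w + hess g (F 0) x v w : Field2 n M) (crd n x x) := by
    rw [← comp2_ricci g hy, ← comp2_hess g hy (hF 0)]
    rfl
  rw [k1, k2, k3, k4, comp0_self,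
    nabla1_congr_on (isOpen_target x) (fun z hz => (comp1_driftDiv2 g hF1 hh1 hz).symm) hy,
    ← comp1_driftDiv2 g hF1 hh1 hy]
  rfl

/-- The first variation of `∇μ`. -/
theorem IsPathThrough.hasDerivAt_gradMu (H : IsPathThrough γ g h) (τ : ℝ)
    (HF : HasC2DerivAt (n := n) F p) (hF : ∀ s, Reg0 (n := n) 2 (F s)) (x : M) (v w : Coord n) :
    HasDerivAt (fun s => gradMu τ (γ s) (F s) x v w)
      (opL τ g (F 0) h (fun x => p x - (1 / 2) * tr g h.field x) x v w) 0 := by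
  obtain ⟨ε, hP⟩ := H.exists_patchPath
  have hy := mem_extChartAt_target (I := 𝓡 n) x
  have hh2 : Reg2 2 h.field := h.reg2.of_le two_le_infty
  have hh1 : Reg2 1 h.field := h.reg2.of_le (by simp)
  have d1 := (hP x).hasDerivAt_ricciC hy v w
  have d2 := hasDerivAt_m2 ((hP x).hasDerivAt_hessC hy (F := fun s => comp0 x (F s))
    (HF.hasDerivAt_pd hF hy) (HF.hasDerivAt_pd_pd hF hy)) v w
  have d3 := H.velocity x v w
  have d4 := ((d1.fun_add d2).fun_sub (d3.const_mul (1 / (2 * τ)))).const_mul (-τ)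
  have e : (fun s => gradMu τ (γ s) (F s) x v w) = fun s => -τ * (m2 (ricciC (locG (γ s) x) (crd n x x)) v w
      + m2 (hessC (locG (γ s) x) (comp0 x (F s)) (crd n x x)) v w
      - 1 / (2 * τ) * (γ s).inner x v w) := by
    ext s
    have e1 := of2_eq x (ricciC (locG (γ s) x) (crd n x x)) v w
    have e2 := of2_eq x (hessC (locG (γ s) x) (comp0 x (F s)) (crd n x x)) v w
    rw [← e1, ← e2]
    rfl
  rw [e]
  refine d4.congr_deriv ?_
  simp only [H.start]
  have htr : Reg0 (n := n) 2 (fun x => (1 / 2) * tr g h.field x) :=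
    (reg0_const _).mul (hh2.tr g (k := 2))
  have k1 := hess_sub g HF.reg0 htr x v w
  have k2 : hess g (fun x => (1 / 2) * tr g h.field x) x v w = (1 / 2) *
      m2 (hessC (locG g x) (fun z => traceC (locG g x) z (comp2 x h.field z)) (crd n x x)) v w := by
    have e1 := of2_eq x (hessC (locG g x) (comp0 x (fun x => (1 / 2) * tr g h.field x))
      (crd n x x)) v w
    refine e1.trans ?_
    have e2 : hessC (locG g x) (comp0 x (fun x => (1 / 2) * tr g h.field x)) (crd n x x)
        = fun i j => (1 / 2) * hessC (locG g x) (fun z => traceC (locG g x) z (comp2 x h.field z))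
          (crd n x x) i j := by
      have ht : ContDiffOn ℝ 2 (fun z => traceC (locG g x) z (comp2 x h.field z))
          (crd n x).target := (patchMetric g x).contDiffOn_traceC (k := 2) (hh2.comp x)
      ext i j
      have e3 : ∀ z ∈ (crd n x).target, (fun i => pd i (comp0 x (fun x => (1 / 2) * tr g h.field x)) z)
          = fun i => (1 / 2) * pd i (fun z => traceC (locG g x) z (comp2 x h.field z)) z := by
        intro z hz
        ext i
        rw [pd_congr_on (isOpen_target x) (v := fun z => (1 / 2) *
          traceC (locG g x) z (comp2 x h.field z)) (fun z hz => by
            rw [← comp0_tr g hz hh2.lin]; rfl) hz]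
        unfold pd
        rw [fderiv_const_mul (diffAt_target ht hz)]
        rfl
      unfold hessC
      rw [nabla1_congr_on (isOpen_target x) e3 hy]
      have e4 := nabla1_mul (G := locG g x) (u := fun _ : Coord n => (1 / 2 : ℝ))
        (α := fun z a => pd a (fun z => traceC (locG g x) z (comp2 x h.field z)) z)
        (differentiableAt_const _) (fun i => diffAt_target
          (contDiffOn_pd (isOpen_target x) (k := 1) (by norm_num) ht i) hy) i j
      rw [e4]
      simp [pd]
    rw [e2, m2_smul (1 / 2)]
  have k3 : hess g p x v w = m2 (hessC (locG g x) (comp0 x p) (crd n x x)) v w := of2_eq _ _ _ _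
  have k4 : lichnerowicz g h.field x v w = m2 (lichC (locG g x) (comp2 x h.field) (crd n x x)) v w :=
    of2_eq _ _ _ _
  have k5 : psi g (F 0) h.field x v w
      = m2 (psiC (locG g x) (comp0 x (F 0)) (comp2 x h.field) (crd n x x)) v w := of2_eq _ _ _ _
  have k6 : deltaStar g (div2 g h.field) x v w = -(1 / 2) *
      (m2 (nabla1 (locG g x) (divC (locG g x) (comp2 x h.field)) (crd n x x)) v w
      + m2 (nabla1 (locG g x) (divC (locG g x) (comp2 x h.field)) (crd n x x)) w v) := by
    have e1 := of2_eq x (fun i j => -(1 / 2) * (nabla1 (locG g x) (comp1 x (div2 g h.field))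
      (crd n x x) i j + nabla1 (locG g x) (comp1 x (div2 g h.field)) (crd n x x) j i)) v w
    refine e1.trans ?_
    rw [nabla1_congr_on (isOpen_target x) (fun z hz => comp1_div2 g hz hh1) hy]
    set N := nabla1 (locG g x) (divC (locG g x) (comp2 x h.field)) (crd n x x)
    rw [m2_smul (-(1 / 2)) (fun i j => N i j + N j i), m2_add N (fun i j => N j i)]
    exact congrArg (fun r => -(1 / 2) * (m2 N v w + r)) (m2_swap N v w)
  rw [m2_add]
  unfold opL
  rw [k1, k2, k3, k4, k5, k6]
  ring

end Paths

/-! ### Differentiation under the integral sign -/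

section Tame

variable {X : Type*} [TopologicalSpace X]

/-- Near `x₀` and for small `s`, the function `H s` differs from `H 0` by `O(s)`, and `H 0` is
continuous at `x₀`. A curve that is `C²`-differentiable at the parameter `0` need not be
differentiable at any other parameter; this is the bound on difference quotients that dominated
convergence needs and that such curves provide. -/
def Tame (H : ℝ → X → ℝ) (x₀ : X) : Prop :=
  ContinuousAt (H 0) x₀ ∧
    (fun p : ℝ × X => H p.1 p.2 - H 0 p.2) =O[𝓝 (0, x₀)] fun p => p.1

variable {H K : ℝ → X → ℝ} {x₀ : X}

theorem Tame.tendsto_zero (hH : Tame H x₀) :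
    Tendsto (fun p : ℝ × X => H 0 p.2) (𝓝 (0, x₀)) (𝓝 (H 0 x₀)) :=
  hH.1.tendsto.comp (continuous_snd.tendsto _)

theorem Tame.tendsto (hH : Tame H x₀) :
    Tendsto (fun p : ℝ × X => H p.1 p.2) (𝓝 (0, x₀)) (𝓝 (H 0 x₀)) := by
  have h1 : Tendsto (fun p : ℝ × X => H p.1 p.2 - H 0 p.2) (𝓝 (0, x₀)) (𝓝 0) :=
    hH.2.trans_tendsto (continuous_fst.tendsto (0, x₀))
  simpa using h1.add hH.tendsto_zero

theorem tame_const {u : X → ℝ} (hu : ContinuousAt u x₀) : Tame (fun _ => u) x₀ :=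
  ⟨hu, by simpa using Asymptotics.isBigO_zero _ _⟩

theorem tame_id : Tame (fun s (_ : X) => s) x₀ :=
  ⟨continuousAt_const, by simpa using Asymptotics.isBigO_refl _ _⟩

theorem Tame.add (hH : Tame H x₀) (hK : Tame K x₀) : Tame (fun s x => H s x + K s x) x₀ := by
  refine ⟨hH.1.add hK.1, (hH.2.add hK.2).congr_left fun p => ?_⟩
  ring

theorem Tame.mul (hH : Tame H x₀) (hK : Tame K x₀) : Tame (fun s x => H s x * K s x) x₀ := by
  refine ⟨hH.1.mul hK.1, ?_⟩
  have h1 := hH.2.mul (hK.tendsto.isBigO_one ℝ)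
  have h2 := (hH.tendsto_zero.isBigO_one ℝ).mul hK.2
  simp only [mul_one, one_mul] at h1 h2
  refine (h1.add h2).congr_left fun p => ?_
  ring

theorem Tame.const_mul (c : ℝ) (hH : Tame H x₀) : Tame (fun s x => c * H s x) x₀ :=
  (tame_const continuousAt_const).mul hH

theorem Tame.sub (hH : Tame H x₀) (hK : Tame K x₀) : Tame (fun s x => H s x - K s x) x₀ := by
  refine ⟨hH.1.sub hK.1, (hH.2.sub hK.2).congr_left fun p => ?_⟩
  ring

theorem Tame.sum {ι : Type*} (s : Finset ι) {H : ι → ℝ → X → ℝ} (hH : ∀ i ∈ s, Tame (H i) x₀) :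
    Tame (fun t x => ∑ i ∈ s, H i t x) x₀ := by
  refine ⟨tendsto_finset_sum _ fun i hi => (hH i hi).1, ?_⟩
  refine (Asymptotics.IsBigO.sum fun i hi => (hH i hi).2).congr_left fun p => ?_
  simp only [Finset.sum_apply, Finset.sum_sub_distrib]

theorem Tame.comp {φ : ℝ → ℝ} (hH : Tame H x₀) (hφ : ContDiffAt ℝ 1 φ (H 0 x₀)) :
    Tame (fun s x => φ (H s x)) x₀ := by
  refine ⟨ContinuousAt.comp (g := φ) (f := H 0) hφ.continuousAt hH.1, ?_⟩
  obtain ⟨C, t, ht, hC⟩ := hφ.exists_lipschitzOnWith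
  refine Asymptotics.IsBigO.trans ?_ hH.2
  refine Asymptotics.IsBigO.of_bound C ?_
  filter_upwards [hH.tendsto.eventually ht, hH.tendsto_zero.eventually ht] with p h1 h2
  exact hC.norm_sub_le h1 h2

/-- A tame function is uniformly Lipschitz in the parameter at `0`. -/
theorem exists_uniform_bound [CompactSpace X] (hH : ∀ x, Tame H x) :
    ∃ C : ℝ, ∀ᶠ s in 𝓝 (0 : ℝ), ∀ x, |H s x - H 0 x| ≤ C * |s| := by
  have h1 : ∀ x₀ : X, ∃ C : ℝ, ∃ V ∈ 𝓝 x₀, ∀ᶠ s in 𝓝 (0 : ℝ), ∀ x ∈ V,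
      |H s x - H 0 x| ≤ C * |s| := by
    intro x₀
    obtain ⟨C, hC⟩ := (hH x₀).2.bound
    rw [nhds_prod_eq, Filter.eventually_prod_iff] at hC
    obtain ⟨pa, ha, pb, hb, hab⟩ := hC
    exact ⟨C, {x | pb x}, hb, ha.mono fun s hs x hx => hab hs hx⟩
  choose C V hV hb using h1
  obtain ⟨t, -, ht⟩ := isCompact_univ.elim_nhds_subcover V fun x _ => hV x
  refine ⟨∑ x ∈ t, |C x|, ?_⟩
  have h2 : ∀ᶠ s in 𝓝 (0 : ℝ), ∀ x₀ ∈ t, ∀ x ∈ V x₀, |H s x - H 0 x| ≤ C x₀ * |s| :=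
    (Filter.eventually_all_finset t).2 fun x₀ _ => hb x₀
  filter_upwards [h2] with s hs x
  obtain ⟨x₀, hx₀, hx⟩ := mem_iUnion₂.1 (ht (mem_univ x))
  refine (hs x₀ hx₀ x hx).trans ?_
  refine mul_le_mul_of_nonneg_right ((le_abs_self _).trans ?_) (abs_nonneg _)
  exact Finset.single_le_sum (f := fun x => |C x|) (fun x _ => abs_nonneg _) hx₀

/-- Differentiation under the integral sign at the parameter `0`. -/
theorem hasDerivAt_integral_of_tame [CompactSpace X] [MeasurableSpace X] [BorelSpace X]
    (μ : Measure X) [IsFiniteMeasure μ] {H' : X → ℝ} (hH : ∀ x, Tame H x)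
    (hc : ∀ᶠ s in 𝓝 (0 : ℝ), Continuous (H s)) (hd : ∀ x, HasDerivAt (fun s => H s x) (H' x) 0) :
    HasDerivAt (fun s => ∫ x, H s x ∂μ) (∫ x, H' x ∂μ) 0 := by
  have hi : ∀ {u : X → ℝ}, Continuous u → Integrable u μ := fun hu =>
    hu.integrable_of_hasCompactSupport (HasCompactSupport.of_compactSpace _)
  have hc0 : Continuous (H 0) := hc.self_of_nhds
  obtain ⟨C, hC⟩ := exists_uniform_bound hH
  rw [hasDerivAt_zero_iff]
  have h1 : Tendsto (fun s : ℝ => ∫ x, s⁻¹ * (H s x - H 0 x) ∂μ) (𝓝[≠] 0) (𝓝 (∫ x, H' x ∂μ)) := by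
    refine tendsto_integral_filter_of_dominated_convergence (fun _ => C) ?_ ?_
      (integrable_const C) ?_
    · filter_upwards [hc.filter_mono nhdsWithin_le_nhds] with s hs
      exact (continuous_const.mul (hs.sub hc0)).aestronglyMeasurable
    · filter_upwards [hC.filter_mono nhdsWithin_le_nhds, self_mem_nhdsWithin] with s hs hs0
      refine Eventually.of_forall fun x => ?_
      have hp : 0 < |s| := abs_pos.2 hs0
      rw [Real.norm_eq_abs, abs_mul, abs_inv, inv_mul_le_iff₀ hp, mul_comm]
      exact hs x
    · exact Eventually.of_forall fun x => hasDerivAt_zero_iff.1 (hd x)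
  refine h1.congr' ?_
  filter_upwards [hc.filter_mono nhdsWithin_le_nhds] with s hs
  rw [integral_const_mul, integral_sub (hi hs) (hi hc0)]

variable {n : ℕ}

theorem JointSmooth.tame {ε : ℝ} (hε : 0 < ε) {V : Set (Coord n)} (hV : IsOpen V)
    {f : ℝ → Coord n → ℝ} (hf : JointSmooth ε V f) {y : Coord n} (hy : y ∈ V) : Tame f y := by
  have h0 : (0 : ℝ) ∈ Ioo (-ε) ε := ⟨by linarith, hε⟩
  have h1 : ContDiffAt ℝ 1 (fun p : ℝ × Coord n => f p.1 p.2) (0, y) :=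
    (hf.of_le (by simp)).contDiffAt ((isOpen_Ioo.prod hV).mem_nhds ⟨h0, hy⟩)
  refine ⟨((hf.slice h0).continuousOn.continuousAt (hV.mem_nhds hy)), ?_⟩
  obtain ⟨C, t, ht, hC⟩ := h1.exists_lipschitzOnWith
  refine Asymptotics.IsBigO.of_bound C ?_
  have h2 : Tendsto (fun p : ℝ × Coord n => ((0 : ℝ), p.2)) (𝓝 (0, y)) (𝓝 (0, y)) :=
    (continuous_const.prodMk continuous_snd).tendsto' _ _ rfl
  filter_upwards [ht, h2.eventually ht] with p hp hp0
  have h3 := hC.norm_sub_le hp hp0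
  have h4 : p - (0, p.2) = (p.1, 0) := Prod.ext (by simp) (by simp)
  rw [h4] at h3
  simpa [Prod.norm_def] using h3

variable {M : Type*} [TopologicalSpace M] [ChartedSpace (Coord n) M]

/-- Tameness can be checked in the chart around the point. -/
theorem Tame.of_coord {H : ℝ → M → ℝ} {x₀ : M} {K : ℝ → Coord n → ℝ}
    (hK : Tame K (crd n x₀ x₀))
    (h : ∀ s, ∀ y ∈ (crd n x₀).target, comp0 x₀ (H s) y = K s y) : Tame H x₀ := by
  have hs := extChartAt_source_mem_nhds (I := 𝓡 n) x₀
  have h1 : ∀ s, ∀ x ∈ (crd n x₀).source, H s x = K s (crd n x₀ x) := fun s x hx => by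
    rw [← h s _ ((crd n x₀).map_source hx), comp0_eq hx]
  have hc := continuousAt_extChartAt (I := 𝓡 n) x₀
  refine ⟨?_, ?_⟩
  · refine (ContinuousAt.comp (g := K 0) hK.1 hc).congr ?_
    filter_upwards [hs] with x hx
    exact (h1 0 x hx).symm
  · have h2 : Tendsto (fun p : ℝ × M => (p.1, crd n x₀ p.2)) (𝓝 (0, x₀)) (𝓝 (0, crd n x₀ x₀)) := by
      rw [nhds_prod_eq, nhds_prod_eq]
      exact tendsto_id.prodMap hc
    refine (hK.2.comp_tendsto h2).congr' ?_ EventuallyEq.rfl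
    have h3 : ∀ᶠ p : ℝ × M in 𝓝 (0, x₀), p.2 ∈ (crd n x₀).source :=
      (continuous_snd.tendsto (0, x₀)).eventually hs
    filter_upwards [h3] with p hp
    simp only [Function.comp_apply, h1 _ _ hp]

variable [IsManifold (𝓡 n) ∞ M] {F : ℝ → M → ℝ} {p : M → ℝ} {a : M} {y : Coord n}

/-- A quantity `B s` whose difference quotients are those of a derivative of order at most two of
the curve is tame, since the quotients converge locally uniformly to a continuous limit. -/
theorem HasC2DerivAt.tame_aux (H : HasC2DerivAt (n := n) F p) (hy : y ∈ (crd n a).target) {j : ℕ}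
    (hj : j ≤ 2) (m : Fin j → Coord n) {B : ℝ → Coord n → ℝ} (hB : ContinuousAt (B 0) y)
    (hq : ∀ s, ∀ z ∈ (crd n a).target,
      iteratedFDeriv ℝ j (fun z => s⁻¹ * (comp0 a (F s) z - comp0 a (F 0) z)) z m
        = s⁻¹ * (B s z - B 0 z)) : Tame B y := by
  refine ⟨hB, ?_⟩
  have hO := isOpen_target (n := n) a
  have hcont : ContinuousAt (iteratedFDeriv ℝ j (comp0 a p)) y := by
    have h1 : ContDiffAt ℝ 2 (comp0 a p) y := (H.reg0 a).contDiffAt (hO.mem_nhds hy)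
    have h2 := h1.iteratedFDeriv_right (m := 0) (i := j) (by
      rw [zero_add]
      exact_mod_cast hj)
    exact h2.continuousAt
  obtain ⟨t, ht, hs⟩ := Metric.tendstoLocallyUniformlyOn_iff.1 (H.2 a j hj) 1 one_pos y hy
  rw [hO.nhdsWithin_eq hy] at ht
  set C := ‖iteratedFDeriv ℝ j (comp0 a p) y‖ + 1 with hC
  have hbd : ∀ᶠ z in 𝓝 y, ‖iteratedFDeriv ℝ j (comp0 a p) z‖ < C :=
    hcont.norm.eventually_lt_const (by linarith)
  rw [eventually_nhdsWithin_iff] at hs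
  refine Asymptotics.IsBigO.of_bound ((C + 1) * ∏ i, ‖m i‖) ?_
  have e1 : ∀ᶠ q : ℝ × Coord n in 𝓝 (0, y), q.1 ∈ ({0}ᶜ : Set ℝ) → ∀ z ∈ t,
      dist (iteratedFDeriv ℝ j (comp0 a p) z)
        (iteratedFDeriv ℝ j (fun z => q.1⁻¹ * (comp0 a (F q.1) z - comp0 a (F 0) z)) z) < 1 :=
    (continuous_fst.tendsto (0, y)).eventually hs
  have e2 : ∀ᶠ q : ℝ × Coord n in 𝓝 (0, y), ‖iteratedFDeriv ℝ j (comp0 a p) q.2‖ < C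
      ∧ q.2 ∈ t ∧ q.2 ∈ (crd n a).target :=
    (continuous_snd.tendsto (0, y)).eventually (hbd.and (Filter.inter_mem ht (hO.mem_nhds hy)))
  filter_upwards [e1, e2] with q h1 h2
  obtain ⟨s, z⟩ := q
  obtain ⟨h2, h3, h4⟩ := h2
  by_cases hs0 : s = 0
  · subst hs0
    simp
  have h5 := h1 hs0 z h3
  have h6 : ‖iteratedFDeriv ℝ j (fun z => s⁻¹ * (comp0 a (F s) z - comp0 a (F 0) z)) z‖ ≤ C + 1 := by
    rw [dist_eq_norm] at h5
    have := norm_sub_norm_le (iteratedFDeriv ℝ j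
      (fun z => s⁻¹ * (comp0 a (F s) z - comp0 a (F 0) z)) z) (iteratedFDeriv ℝ j (comp0 a p) z)
    rw [norm_sub_rev] at this
    simp only at h2 h5
    linarith
  have h7 := (iteratedFDeriv ℝ j (fun z => s⁻¹ * (comp0 a (F s) z - comp0 a (F 0) z)) z).le_opNorm m
  rw [hq s z h4] at h7
  have h8 : ‖B s z - B 0 z‖ = ‖s⁻¹ * (B s z - B 0 z)‖ * ‖s‖ := by
    rw [norm_mul, norm_inv]
    field_simp [norm_ne_zero_iff.2 hs0]
  rw [h8]
  refine mul_le_mul_of_nonneg_right (h7.trans ?_) (norm_nonneg _)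
  exact mul_le_mul_of_nonneg_right h6 (Finset.prod_nonneg fun i _ => norm_nonneg _)

theorem HasC2DerivAt.tame_comp0 (H : HasC2DerivAt (n := n) F p) (hF : ∀ s, Reg0 (n := n) 2 (F s))
    (hy : y ∈ (crd n a).target) : Tame (fun s => comp0 a (F s)) y :=
  H.tame_aux hy (j := 0) (by norm_num) ![]
    ((hF 0 a).continuousOn.continuousAt ((isOpen_target a).mem_nhds hy))
    fun s _ hz => (diffQuot_eq hF hz s).1

theorem HasC2DerivAt.tame_pd (H : HasC2DerivAt (n := n) F p) (hF : ∀ s, Reg0 (n := n) 2 (F s))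
    (hy : y ∈ (crd n a).target) (i : Fin n) : Tame (fun s => pd i (comp0 a (F s))) y :=
  H.tame_aux hy (j := 1) (by norm_num) _
    ((contDiffOn_pd (isOpen_target a) (k := 1) (by norm_num) (hF 0 a) i).continuousOn.continuousAt
      ((isOpen_target a).mem_nhds hy))
    fun s _ hz => (diffQuot_eq hF hz s).2.1 i

theorem HasC2DerivAt.tame_pd_pd (H : HasC2DerivAt (n := n) F p) (hF : ∀ s, Reg0 (n := n) 2 (F s))
    (hy : y ∈ (crd n a).target) (i j : Fin n) :
    Tame (fun s => pd i (pd j (comp0 a (F s)))) y :=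
  H.tame_aux hy (j := 2) le_rfl _
    ((contDiffOn_pd (isOpen_target a) (k := 0) (by norm_num)
      (contDiffOn_pd (isOpen_target a) (k := 1) (by norm_num) (hF 0 a) j) i).continuousOn.continuousAt
      ((isOpen_target a).mem_nhds hy))
    fun s _ hz => (diffQuot_eq hF hz s).2.2 i j

theorem HasC2DerivAt.tame (H : HasC2DerivAt (n := n) F p) (hF : ∀ s, Reg0 (n := n) 2 (F s))
    (x : M) : Tame F x :=
  Tame.of_coord (H.tame_comp0 hF (mem_extChartAt_target x)) fun _ _ _ => rfl

end Tame

/-! ### The first variation of weighted integrals -/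

section FirstVariation

variable {n : ℕ} {M : Type*} [TopologicalSpace M] [ChartedSpace (Coord n) M]
  [IsManifold (𝓡 n) ∞ M]

/-- The density of `dV_{g'}` with respect to `dV_g`. -/
def volRatio (g g' : RMetric n M) (x : M) : ℝ := dens g' x (crd n x x) / dens g x (crd n x x)

theorem comp0_volRatio (g g' : RMetric n M) {a : M} {y : Coord n} (hy : y ∈ (crd n a).target) :
    comp0 a (volRatio g g') y = dens g' a y / dens g a y := by
  have hm := mem_overlap_self hy
  have h1 := dens_chartChange g hm
  have h2 := dens_chartChange g' hm
  have h3 := dens_pos g hy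
  have h4 : |(fderiv ℝ (chartChange a ((crd n a).symm y)) y).det| ≠ 0 := fun h => by
    rw [h, zero_mul] at h1
    exact h3.ne' h1
  rw [h1, h2, mul_div_mul_left _ _ h4]
  rfl

theorem volRatio_reg0 (g g' : RMetric n M) : Reg0 (n := n) ∞ (volRatio g g') := fun a =>
  ((contDiffOn_dens g' a).div (contDiffOn_dens g a) fun _ hy => (dens_pos g hy).ne').congr
    fun _ hy => comp0_volRatio g g' hy

theorem volRatio_pos (g g' : RMetric n M) (x : M) : 0 < volRatio g g' x :=
  div_pos (dens_pos g' (mem_extChartAt_target x)) (dens_pos g (mem_extChartAt_target x))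

theorem volRatio_self (g : RMetric n M) (x : M) : volRatio g g x = 1 :=
  div_self (dens_pos g (mem_extChartAt_target x)).ne'

section Integral

variable [CompactSpace M] [T2Space M] [MeasurableSpace M] [BorelSpace M]

/-- Any two Riemannian measures have a smooth positive density with respect to each other, so that
integrals over a path of metrics become integrals against one fixed measure. -/
theorem vol_eq_withDensity (g g' : RMetric n M) :
    vol g' = (vol g).withDensity fun x => ENNReal.ofReal (volRatio g g' x) := by
  have hm : Measurable fun x => ENNReal.ofReal (volRatio g g' x) :=
    (volRatio_reg0 g g').continuous.measurable.ennreal_ofReal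
  refine Measure.ext_of_lintegral _ fun F hF => ?_
  rw [lintegral_withDensity_eq_lintegral_mul _ hm hF, lintegral_vol g' hF,
    lintegral_vol g (hm.mul hF)]
  refine tsum_congr fun a => setLIntegral_congr_fun (isOpen_target a).measurableSet fun y hy => ?_
  have h1 := comp0_volRatio g g' hy
  have h2 := dens_pos g hy
  simp only [Pi.mul_apply]
  rw [← mul_assoc, ← ENNReal.ofReal_mul (mul_nonneg ((chartPartition n M).nonneg a _) h2.le)]
  congr 2
  rw [show volRatio g g' ((crd n a).symm y) = _ from h1]
  field_simp

theorem nuIntegral_volRatio (τ : ℝ) (g g' : RMetric n M) (f u : M → ℝ) :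
    nuIntegral τ g' f u = ∫ x, u x * weight n τ f x * volRatio g g' x ∂(vol g) := by
  rw [nuIntegral_eq, vol_eq_withDensity g g', integral_withDensity_eq_integral_toReal_smul
    (volRatio_reg0 g g').continuous.measurable.ennreal_ofReal
    (Eventually.of_forall fun _ => ENNReal.ofReal_lt_top)]
  refine integral_congr_ae (Eventually.of_forall fun x => ?_)
  simp only [ENNReal.toReal_ofReal (volRatio_pos g g' x).le, smul_eq_mul]
  ring

end Integral

variable {γ : ℝ → RMetric n M} {g : RMetric n M} {h : SymTensor n M} {F : ℝ → M → ℝ} {p : M → ℝ}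

theorem IsPathThrough.hasDerivAt_volRatio (H : IsPathThrough γ g h) (x : M) :
    HasDerivAt (fun s => volRatio g (γ s) x) ((1 / 2) * tr g h.field x) 0 := by
  obtain ⟨ε, hP⟩ := H.exists_patchPath
  have hy := mem_extChartAt_target (I := 𝓡 n) x
  obtain ⟨b, hb⟩ := exists_frame_at g x
  have hb' : IsFrame (locG (γ 0) x (crd n x x)) b := by rwa [H.start]
  have hd := hasDerivAt_det ((hP x).velocity _ hy) hb'
  rw [H.start] at hd
  have hpos := ((patchMetric g x).posDef _ hy).det_pos
  have h1 := (hd.sqrt (by rw [H.start]; exact hpos.ne')).div_const (dens g x (crd n x x))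
  refine h1.congr_deriv ?_
  rw [H.start, tr_frame hb h.reg2.lin]
  simp only [comp2_self h.reg2.lin]
  have h2 : dens g x (crd n x x) = Real.sqrt (Matrix.of (locG g x (crd n x x))).det := rfl
  rw [h2]
  have h3 := Real.sqrt_pos.2 hpos
  have h4 := Real.mul_self_sqrt hpos.le
  rw [← h4]
  set r := Real.sqrt (Matrix.of (locG g x (crd n x x))).det
  rw [Real.sqrt_mul_self h3.le]
  field_simp

theorem IsPathThrough.tame_volRatio (H : IsPathThrough γ g h) (x : M) :
    Tame (fun s => volRatio g (γ s)) x := by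
  obtain ⟨ε, hP⟩ := H.exists_patchPath
  have hy := mem_extChartAt_target (I := 𝓡 n) x
  have h1 : JointSmooth ε (crd n x).target (fun s z => dens (γ s) x z / dens g x z) := by
    have h2 : ContDiffOn ℝ ∞ (fun q : ℝ × Coord n => locG (γ q.1) x q.2)
        (Ioo (-ε) ε ×ˢ (crd n x).target) :=
      contDiffOn_pi.2 fun i => contDiffOn_pi.2 fun j => (hP x).smooth i j
    have h3 : ContDiffOn ℝ ∞ (fun q : ℝ × Coord n => dens (γ q.1) x q.2)
        (Ioo (-ε) ε ×ˢ (crd n x).target) :=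
      (contDiff_det.comp_contDiffOn h2).sqrt fun q hq =>
        ((patchMetric (γ q.1) x).posDef _ hq.2).det_pos.ne'
    exact h3.div ((contDiffOn_dens g x).comp contDiffOn_snd fun q hq => hq.2)
      fun q hq => (dens_pos g hq.2).ne'
  exact Tame.of_coord (h1.tame (hP x).pos (isOpen_target x) hy)
    fun s z hz => comp0_volRatio g (γ s) hz

variable [CompactSpace M] [T2Space M] [MeasurableSpace M] [BorelSpace M]

/-- The first variation of an integral against `dν`. -/
theorem IsPathThrough.hasDerivAt_nuIntegral (H : IsPathThrough γ g h) (τ : ℝ)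
    (HF : HasC2DerivAt (n := n) F p) (hF : ∀ s, Reg0 (n := n) 2 (F s)) {A : ℝ → M → ℝ}
    {A' : M → ℝ} (hA : ∀ x, Tame A x) (hc : ∀ s, Continuous (A s))
    (hd : ∀ x, HasDerivAt (fun s => A s x) (A' x) 0) :
    HasDerivAt (fun s => nuIntegral τ (γ s) (F s) (A s))
      (nuIntegral τ g (F 0) (fun x => A' x + A 0 x * ((1 / 2) * tr g h.field x - p x))) 0 := by
  have hw : ∀ x, Tame (fun s => weight n τ (F s)) x := fun x =>
    (Tame.comp (φ := fun r => Real.exp (-r)) (HF.tame hF x) (by fun_prop)).const_mul _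
  have hwd : ∀ x, HasDerivAt (fun s => weight n τ (F s) x) (-(p x * weight n τ (F 0) x)) 0 := by
    intro x
    refine (((HF.hasDerivAt_apply hF x).fun_neg.exp).const_mul _).congr_deriv ?_
    unfold weight
    ring
  have key := hasDerivAt_integral_of_tame (vol g)
    (H := fun s x => A s x * weight n τ (F s) x * volRatio g (γ s) x)
    (fun x => ((hA x).mul (hw x)).mul (H.tame_volRatio x))
    (Eventually.of_forall fun s => ((hc s).mul
      (weight_reg0 (k := 0) τ ((hF s).of_le (by norm_num))).continuous).mul
      (volRatio_reg0 g (γ s)).continuous)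
    (fun x => ((hd x).fun_mul (hwd x)).fun_mul (H.hasDerivAt_volRatio x))
  simp only [← nuIntegral_volRatio] at key
  refine key.congr_deriv ?_
  rw [nuIntegral_eq]
  refine integral_congr_ae (Eventually.of_forall fun x => ?_)
  simp only [H.start, volRatio_self]
  ring

end FirstVariation

/-! ### The Euler–Lagrange equation and the gradient of `μ` -/

section Variational

variable {n : ℕ} {M : Type*} [TopologicalSpace M] [ChartedSpace (Coord n) M]
  [IsManifold (𝓡 n) ∞ M]

theorem hasC2DerivAt_affine {f η : M → ℝ} (hη : Reg0 (n := n) 2 η) :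
    HasC2DerivAt (n := n) (fun s x => f x + s * η x) η := by
  refine ⟨hη.contMDiff (k := 2), fun a j _ => ?_⟩
  rw [Metric.tendstoLocallyUniformlyOn_iff]
  intro ε hε y hy
  refine ⟨_, self_mem_nhdsWithin, ?_⟩
  filter_upwards [self_mem_nhdsWithin] with s hs z _
  have e : (fun z : Coord n => s⁻¹ * (comp0 (n := n) a (fun x => f x + s * η x) z
      - comp0 (n := n) a (fun x => f x + 0 * η x) z)) = comp0 a η := by
    ext z
    simp only [comp0]
    have : s ≠ 0 := hs
    field_simp
    ring
  rw [e, dist_self]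
  exact hε

theorem isPathThrough_const (g : RMetric n M) : IsPathThrough (fun _ => g) g (conformal g 0) := by
  refine ⟨isSmoothPath_iff.2 ⟨1, one_pos, fun a i j =>
    ((patchMetric g a).smooth i j).comp contDiffOn_snd fun q hq => hq.2⟩, rfl, fun x v w => ?_⟩
  refine (hasDerivAt_const _ _).congr_deriv ?_
  exact (zero_mul _).symm

theorem tr_conformal_zero (g : RMetric n M) (x : M) : tr g (conformal g 0).field x = 0 := by
  obtain ⟨b, hb⟩ := exists_frame_at g x
  rw [tr_frame hb (conformal g 0).reg2.lin]
  exact Finset.sum_eq_zero fun a _ => zero_mul _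

theorem diff_add_mul {f η : M → ℝ} (hf : Reg0 (n := n) 1 f) (hη : Reg0 (n := n) 1 η) (t : ℝ)
    (x : M) (v : Coord n) :
    diff (n := n) (fun x => f x + t * η x) x v = diff (n := n) f x v + t * diff (n := n) η x v := by
  have hy := mem_extChartAt_target (I := 𝓡 n) x
  have h1 : ∀ i, pd i (comp0 x (fun x => f x + t * η x)) (crd n x x)
      = pd i (comp0 x f) (crd n x x) + t * pd i (comp0 x η) (crd n x x) := by
    intro i
    have e : comp0 x (fun x => f x + t * η x) = fun z : Coord n => comp0 x f z + t * comp0 x η z := rfl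
    unfold pd
    rw [e, fderiv_fun_add (diffAt_target (hf x) hy) ((diffAt_target (hη x) hy).const_mul t),
      fderiv_const_mul (diffAt_target (hη x) hy)]
    rfl
  simp only [diff, of1, h1, add_mul, Finset.sum_add_distrib, Finset.mul_sum, mul_assoc]

theorem inner1_diff_add_mul (g : RMetric n M) {f η : M → ℝ} (hf : Reg0 (n := n) 1 f)
    (hη : Reg0 (n := n) 1 η) (t : ℝ) (x : M) :
    inner1 g (diff (n := n) (fun x => f x + t * η x)) (diff (n := n) (fun x => f x + t * η x)) x
      = inner1 g (diff (n := n) f) (diff (n := n) f) x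
        + t * (2 * inner1 g (diff (n := n) η) (diff (n := n) f) x)
        + t ^ 2 * inner1 g (diff (n := n) η) (diff (n := n) η) x := by
  obtain ⟨b, hb⟩ := exists_frame_at g x
  rw [inner1_frame hb (isLin1_diff _) (isLin1_diff _), inner1_frame hb (isLin1_diff _) (isLin1_diff _),
    inner1_frame hb (isLin1_diff _) (isLin1_diff _), inner1_frame hb (isLin1_diff _) (isLin1_diff _)]
  simp only [Finset.mul_sum, ← Finset.sum_add_distrib]
  refine Finset.sum_congr rfl fun a _ => ?_
  have h1 := diff_add_mul hf hη t x (b a)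
  refine (congrArg (fun r => r * r) h1).trans ?_
  ring

/-- The part of `∇μ` proportional to the metric contributes the trace of `h`. -/
theorem inner2_gradMu {τ : ℝ} (hτ : τ ≠ 0) (g : RMetric n M) (f : M → ℝ) {h : Field2 n M}
    (hh : IsLin2 h) (x : M) :
    inner2 g (gradMu τ g f) h x
      = -τ * inner2 g (fun x v w => ricci g x v w + hess g f x v w) h x + (1 / 2) * tr g h x := by
  obtain ⟨b, hb⟩ := exists_frame_at g x
  rw [inner2_frame hb (isLin2_gradMu g τ f) hh,
    inner2_frame hb ((isLin2_ricci g).add (isLin2_hess g f)) hh, tr_frame hb hh]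
  have h1 : ∀ a c, gradMu τ g f x (b a) (b c) * h x (b a) (b c)
      = -τ * ((ricci g x (b a) (b c) + hess g f x (b a) (b c)) * h x (b a) (b c))
        + (1 / 2) * (if a = c then h x (b a) (b c) else 0) := by
    intro a c
    have h2 : g.inner x (b a) (b c) = if a = c then (1 : ℝ) else 0 := frame_orthonormal hb a c
    unfold gradMu
    rw [show g.inner x (b a) (b c) = _ from h2]
    split_ifs
    · field_simp
      ring
    · ring
  simp only [h1, Finset.sum_add_distrib, ← Finset.mul_sum]
  simp

variable [CompactSpace M] [T2Space M] [MeasurableSpace M] [BorelSpace M] {τ : ℝ} {g : RMetric n M}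

/-- On the empty manifold no function is normalized. -/
theorem IsNormalized.nonempty {f : SmoothFun n M} (hf : IsNormalized τ g f) : Nonempty M := by
  by_contra hM
  rw [not_nonempty_iff] at hM
  unfold IsNormalized nuIntegral at hf
  rw [Measure.eq_zero_of_isEmpty (vol g), integral_zero_measure] at hf
  exact zero_ne_one hf

theorem weight_add_const (f : M → ℝ) (c : ℝ) (x : M) :
    weight n τ (fun x => f x + c) x = Real.exp (-c) * weight n τ f x := by
  unfold weight
  rw [neg_add, Real.exp_add]
  ring

theorem nuIntegral_add_const (f u : M → ℝ) (c : ℝ) :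
    nuIntegral τ g (fun x => f x + c) u = Real.exp (-c) * nuIntegral τ g f u := by
  rw [nuIntegral_eq, nuIntegral_eq, ← integral_const_mul]
  refine integral_congr_ae (Eventually.of_forall fun x => ?_)
  simp only [weight_add_const]
  ring

/-- The integrand of `W`. -/
def entropyDensity (τ : ℝ) (g : RMetric n M) (f : M → ℝ) (x : M) : ℝ :=
  τ * (inner1 g (diff (n := n) f) (diff (n := n) f) x + scal g x) + (f x - n)

theorem entropyDensity_affine {f η : M → ℝ} (hf : Reg0 (n := n) 1 f) (hη : Reg0 (n := n) 1 η)
    (t : ℝ) (x : M) :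
    entropyDensity τ g (fun x => f x + t * η x) x = entropyDensity τ g f x
      + t * (2 * τ * inner1 g (diff (n := n) η) (diff (n := n) f) x + η x)
      + t * (t * (τ * inner1 g (diff (n := n) η) (diff (n := n) η) x)) := by
  unfold entropyDensity
  rw [inner1_diff_add_mul g hf hη]
  ring

theorem entropyDensity_reg0 (τ : ℝ) (g : RMetric n M) {f : M → ℝ} (hf : Reg0 (n := n) 1 f) :
    Reg0 (n := n) 0 (entropyDensity τ g f) :=
  have h1 := hf.diff (k := 0) (l := 1) (by norm_num)
  have h2 : Reg0 (n := n) 0 (scal g) := ((reg2_ricci g).of_le (k := 0) (by simp)).tr g (k := 0)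
  ((reg0_const τ).mul ((h1.inner1 g h1).add h2)).add ((hf.of_le (by norm_num)).sub (reg0_const _))

theorem nuIntegral_one_pos (hτ : 0 < τ) [Nonempty M] {f : M → ℝ} (hf : Reg0 (n := n) 1 f) :
    0 < nuIntegral τ g f (fun _ => 1) := by
  obtain ⟨x⟩ := ‹Nonempty M›
  refine lt_of_le_of_ne (integral_nonneg fun x => ?_) fun h => ?_
  · have := (weight_pos (n := n) hτ f x).le
    simpa [weight] using this
  · exact one_ne_zero (eq_zero_of_nuIntegral_eq_zero g hτ hf (u := fun _ => (1 : ℝ))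
      continuous_const (fun _ => zero_le_one) h.symm x)

/-- Adding the logarithm of its total mass normalizes `f`, and this changes `W` to the quotient of
`W` by the mass, plus the logarithm of the mass. -/
theorem entropyW_normalize (hτ : 0 < τ) [Nonempty M] (f : SmoothFun n M) :
    ∃ f' : SmoothFun n M, IsNormalized τ g f' ∧
      entropyW τ g f' = nuIntegral τ g f (entropyDensity τ g f) / nuIntegral τ g f (fun _ => 1)
        + Real.log (nuIntegral τ g f (fun _ => 1)) := by
  have hf1 : Reg0 (n := n) 1 f := f.reg0.of_le (by simp)
  set Z := nuIntegral τ g f (fun _ => 1) with hZ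
  have hZpos : 0 < Z := nuIntegral_one_pos hτ hf1
  refine ⟨⟨fun x => f x + Real.log Z, f.contMDiff.add contMDiff_const⟩, ?_, ?_⟩
  · unfold IsNormalized
    have h1 := nuIntegral_add_const (τ := τ) (g := g) f (fun _ => 1) (Real.log Z)
    refine h1.trans ?_
    rw [Real.exp_neg, Real.exp_log hZpos]
    exact inv_mul_cancel₀ hZpos.ne'
  · have h1 := nuIntegral_add_const (τ := τ) (g := g) f
      (entropyDensity τ g (fun x => f x + Real.log Z)) (Real.log Z)
    refine Eq.trans (by rfl) (h1.trans ?_)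
    have h2 : entropyDensity τ g (fun x => f x + Real.log Z)
        = fun x => entropyDensity τ g f x + Real.log Z * 1 := by
      ext x
      have h3 := entropyDensity_affine (τ := τ) (g := g) hf1 (reg0_const (Real.log Z)) 1 x
      have h4 : ∀ η : Field1 n M, IsLin1 η → inner1 g (diff (n := n) (fun _ : M => Real.log Z)) η x = 0 :=
        fun η hη => inner1_eq_zero_left g (isLin1_diff _) hη
          fun v => diff_of_const (fun _ => rfl) x v
      rw [h4 _ (isLin1_diff _), h4 _ (isLin1_diff _)] at h3
      simpa using h3
    rw [h2, nuIntegral_add g hf1 (entropyDensity_reg0 τ g hf1).continuous continuous_const,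
      nuIntegral_const_mul, ← hZ, Real.exp_neg, Real.exp_log hZpos]
    field_simp

/-- The Euler–Lagrange equation: the density `euler` of a minimizer is constant. The functions
`f + s η` are normalized by additive constants, so that no constraint on `η` is needed. -/
theorem IsMinimizer.euler_eq (hτ : 0 < τ) {f : SmoothFun n M} (hf : IsMinimizer τ g f) (x : M) :
    euler τ g f x = entropyW τ g f := by
  have : Nonempty M := ⟨x⟩
  have hf2 : Reg0 (n := n) 2 f := f.reg0.of_le two_le_infty
  have hf1 : Reg0 (n := n) 1 f := f.reg0.of_le (by simp)
  set N := entropyW τ g f with hN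
  have hN' : N = nuIntegral τ g f (entropyDensity τ g f) := rfl
  have hce : Continuous (euler τ g f) := (euler_reg0 g τ (k := 0) (l := 2) (by norm_num) hf2).continuous
  have hu : Continuous fun x => N - euler τ g f x := continuous_const.sub hce
  -- test the difference `N - euler` against all smooth functions
  have key := eq_zero_of_forall_nuIntegral_mul g hτ hf1 hu (fun η => ?_) x
  · linarith
  have hη2 : Reg0 (n := n) 2 η := η.reg0.of_le two_le_infty
  have hη1 : Reg0 (n := n) 1 η := η.reg0.of_le (by simp)
  have hF := hasC2DerivAt_affine (f := (f : M → ℝ)) hη2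
  have hFr : ∀ s : ℝ, Reg0 (n := n) 2 (fun x => f x + s * η x) := fun s =>
    hf2.add ((reg0_const s).mul hη2)
  have hdη := hη1.diff (k := 0) (l := 1) (by norm_num)
  have hdf := hf1.diff (k := 0) (l := 1) (by norm_num)
  have c0 : Continuous (entropyDensity τ g f) := (entropyDensity_reg0 τ g hf1).continuous
  have c1 : Continuous (inner1 g (diff (n := n) η) (diff (n := n) f)) :=
    (hdη.inner1 g hdf).continuous
  have c2 : Continuous (inner1 g (diff (n := n) η) (diff (n := n) η)) :=
    (hdη.inner1 g hdη).continuous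
  have cη := hη1.continuous
  have dN := (isPathThrough_const g).hasDerivAt_nuIntegral τ hF hFr
    (A := fun s => entropyDensity τ g (fun x => f x + s * η x))
    (A' := fun x => 2 * τ * inner1 g (diff (n := n) η) (diff (n := n) f) x + η x)
    (fun x => by
      have e : (fun (s : ℝ) => entropyDensity τ g (fun x => f x + s * η x)) = fun s x => _ :=
        funext fun s => funext fun x => entropyDensity_affine (τ := τ) (g := g) hf1 hη1 s x
      rw [e]
      exact ((tame_const c0.continuousAt).add (tame_id.mul (tame_const
        (by fun_prop)))).add (tame_id.mul (tame_id.mul (tame_const (by fun_prop)))))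
    (fun s => (entropyDensity_reg0 τ g ((hFr s).of_le (by norm_num))).continuous)
    (fun x => by
      simp only [entropyDensity_affine (τ := τ) (g := g) hf1 hη1]
      have i0 := hasDerivAt_id (0 : ℝ)
      refine (((hasDerivAt_const (0 : ℝ) (entropyDensity τ g f x)).fun_add (i0.mul_const
        (2 * τ * inner1 g (diff (n := n) η) (diff (n := n) f) x + η x))).fun_add
        (i0.fun_mul (i0.mul_const (τ * inner1 g (diff (n := n) η) (diff (n := n) η) x)))).congr_deriv ?_
      simp)
  have dZ := (isPathThrough_const g).hasDerivAt_nuIntegral τ hF hFr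
    (A := fun _ _ => 1) (A' := fun _ => 0) (fun x => tame_const continuousAt_const)
    (fun s => continuous_const) (fun x => hasDerivAt_const _ _)
  have e0 : (fun x => f x + 0 * η x) = f := by
    ext x
    simp
  have hZ0 : nuIntegral τ g (fun x => f x + 0 * η x) (fun _ => 1) = 1 := by
    rw [e0]
    exact hf.1
  have dQ := (dN.fun_div dZ (by rw [hZ0]; exact one_ne_zero)).fun_add
    (dZ.log (by rw [hZ0]; exact one_ne_zero))
  -- the value of `W` at the normalization of `f + s η` is smallest at `s = 0`
  have hmin : IsLocalMin (fun s : ℝ => nuIntegral τ g (fun x => f x + s * η x)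
        (entropyDensity τ g (fun x => f x + s * η x))
        / nuIntegral τ g (fun x => f x + s * η x) (fun _ => 1)
      + Real.log (nuIntegral τ g (fun x => f x + s * η x) (fun _ => 1))) 0 := by
    refine Eventually.of_forall fun s => ?_
    obtain ⟨f', hf', hW⟩ := entropyW_normalize (g := g) hτ
      (⟨fun x => f x + s * η x, f.contMDiff.add (contMDiff_const.mul η.contMDiff)⟩ : SmoothFun n M)
    have h1 := hf.2 f' hf'
    rw [hW] at h1
    simp only [hZ0, Real.log_one, div_one, add_zero]
    rw [e0]
    exact h1
  have h0 := hmin.hasDerivAt_eq_zero dQ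
  have hZ1 : nuIntegral τ g f (fun _ => 1) = 1 := hf.1
  simp only [e0, hZ1, tr_conformal_zero, mul_zero, zero_sub, zero_add, one_mul, ← hN'] at h0
  have e1 : (fun x => 2 * τ * inner1 g (diff (n := n) η) (diff (n := n) f) x + η x
      + entropyDensity τ g f x * -η x)
      = fun x => 2 * τ * inner1 g (diff (n := n) η) (diff (n := n) f) x
        + (η x - entropyDensity τ g f x * η x) := by
    ext x
    ring
  have s1 := nuIntegral_mul_driftLap (τ := τ) g hf1 hf2 hη1
  have cl : Continuous (driftLap g f f) := (driftLap_reg0 g hf2 hf2).continuous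
  have e2 : (fun x => η x * (N - euler τ g f x))
      = fun x => N * η x - ((2 * τ) * (η x * driftLap g f f x) + entropyDensity τ g f x * η x) := by
    ext x
    unfold euler driftLap entropyDensity
    ring
  rw [e1, nuIntegral_add (u := fun x => 2 * τ * inner1 g (diff (n := n) η) (diff (n := n) f) x)
    (v := fun x => η x - entropyDensity τ g f x * η x) g hf1 (continuous_const.mul c1) (cη.sub (c0.mul cη)), nuIntegral_const_mul,
    nuIntegral_sub (v := fun x => entropyDensity τ g f x * η x) g hf1 cη (c0.mul cη),
    nuIntegral_neg] at h0
  rw [e2, nuIntegral_sub (u := fun x => N * η x)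
    (v := fun x => 2 * τ * (η x * driftLap g f f x) + entropyDensity τ g f x * η x) g hf1 (continuous_const.mul cη)
    ((continuous_const.mul (cη.mul cl)).add (c0.mul cη)), nuIntegral_const_mul,
    nuIntegral_add (u := fun x => 2 * τ * (η x * driftLap g f f x))
      (v := fun x => entropyDensity τ g f x * η x) g hf1
    (continuous_const.mul (cη.mul cl)) (c0.mul cη), nuIntegral_const_mul, s1]
  linarith

theorem IsMinimizer.mu_eq {f : SmoothFun n M} (hf : IsMinimizer τ g f) :
    mu τ g = entropyW τ g f := by
  refine IsLeast.csInf_eq ⟨⟨f, hf.1, rfl⟩, ?_⟩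
  rintro _ ⟨f', hf', rfl⟩
  exact hf.2 f' hf'

variable {U : Set (RMetric n M)} {P : RMetric n M → SmoothFun n M} {g₀ : RMetric n M}
  {γ : ℝ → RMetric n M} {h : SymTensor n M} {p : M → ℝ}

/-- In a regular neighborhood `μ` is the value of the density `euler` of the minimizer at any point,
so that it can be differentiated pointwise. -/
theorem IsRegularNeighborhood.mu_eq_euler (hτ : 0 < τ) (hU : IsRegularNeighborhood τ g₀ U P)
    (hg : g ∈ U) (x : M) : mu τ g = euler τ g (P g) x := by
  rw [(hU.minimizer g hg).mu_eq, (hU.minimizer g hg).euler_eq hτ]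

/-- The first variation of the normalization. -/
theorem IsRegularNeighborhood.nuIntegral_velocity (hU : IsRegularNeighborhood τ g₀ U P)
    (hg : g ∈ U) (H : IsPathThrough γ g h) (HF : HasC2DerivAt (n := n) (fun s => P (γ s)) p) :
    nuIntegral τ g (P g) (fun x => (1 / 2) * tr g h.field x - p x) = 0 := by
  have dZ := H.hasDerivAt_nuIntegral τ HF (fun s => (P (γ s)).reg0.of_le two_le_infty)
    (A := fun _ _ => 1) (A' := fun _ => 0) (fun x => tame_const continuousAt_const)
    (fun s => continuous_const) (fun x => hasDerivAt_const _ _)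
  have h1 : (fun s => nuIntegral τ (γ s) (P (γ s)) (fun _ => 1)) =ᶠ[𝓝 0] fun _ => 1 := by
    filter_upwards [hU.path_mem γ H.smooth (by rwa [H.start])] with s hs
    exact (hU.minimizer _ hs).1
  have h2 := dZ.unique ((hasDerivAt_const (0 : ℝ) (1 : ℝ)).congr_of_eventuallyEq h1)
  simpa [H.start] using h2

/-- The first variation of `μ`, together with its pointwise form. As `μ(g_s)` is the value of the
density `euler` at every point, its derivative is a constant given by the linearized density.
Integrating this constant against `dν` removes the divergence terms and leaves the pairing with `∇μ`,
because `p - ½ tr h` has integral zero by the normalization. -/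
theorem IsRegularNeighborhood.hasDerivAt_mu (hτ : 0 < τ) (hU : IsRegularNeighborhood τ g₀ U P)
    (hg : g ∈ U) (H : IsPathThrough γ g h) (HF : HasC2DerivAt (n := n) (fun s => P (γ s)) p) :
    HasDerivAt (fun s => mu τ (γ s))
        (nuIntegral τ g (P g) (inner2 g (gradMu τ g (P g)) h.field)) 0 ∧
      ∀ x, τ * (2 * driftLap g (P g) (fun x => p x - (1 / 2) * tr g h.field x) x
          + driftDiv1 g (P g) (driftDiv2 g (P g) h.field) x
          - inner2 g (fun x v w => ricci g x v w + hess g (P g) x v w) h.field x) + p x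
        = nuIntegral τ g (P g) (inner2 g (gradMu τ g (P g)) h.field) := by
  set f := P g with hf
  have hf1 : Reg0 (n := n) 1 f := f.reg0.of_le (by simp)
  have hf2 : Reg0 (n := n) 2 f := f.reg0.of_le two_le_infty
  have hh2 : Reg2 2 h.field := h.reg2.of_le two_le_infty
  have hh1 : Reg2 1 h.field := h.reg2.of_le (by simp)
  have hh0 : Reg2 0 h.field := h.reg2.of_le (by simp)
  have hmem := hU.path_mem γ H.smooth (by rwa [H.start])
  have hd : ∀ x, HasDerivAt (fun s => mu τ (γ s))
      (τ * (2 * driftLap g f (fun x => p x - (1 / 2) * tr g h.field x) x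
          + driftDiv1 g f (driftDiv2 g f h.field) x
          - inner2 g (fun x v w => ricci g x v w + hess g f x v w) h.field x) + p x) 0 := by
    intro x
    have h1 := H.hasDerivAt_euler τ HF (fun s => (P (γ s)).reg0.of_le two_le_infty) x
    simp only [H.start] at h1
    refine h1.congr_of_eventuallyEq ?_
    filter_upwards [hmem] with s hs
    exact hU.mu_eq_euler hτ hs x
  obtain ⟨x₀⟩ := (hU.minimizer g hg).1.nonempty
  set v : M → ℝ := fun x => p x - (1 / 2) * tr g h.field x with hv
  have hv2 : Reg0 (n := n) 2 v := HF.reg0.sub ((reg0_const _).mul (hh2.tr g (k := 2)))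
  set c := τ * (2 * driftLap g f v x₀ + driftDiv1 g f (driftDiv2 g f h.field) x₀
    - inner2 g (fun x v w => ricci g x v w + hess g f x v w) h.field x₀) + p x₀ with hc
  have hconst : ∀ x, τ * (2 * driftLap g f v x
          + driftDiv1 g f (driftDiv2 g f h.field) x
          - inner2 g (fun x v w => ricci g x v w + hess g f x v w) h.field x) + p x = c :=
    fun x => (hd x).unique (hd x₀)
  have cD : Continuous (driftDiv1 g f (driftDiv2 g f h.field)) :=
    (Reg1.driftDiv1 g (k := 0) (l := 1) (by norm_num) hf1
      (Reg2.driftDiv2 g (k := 1) (l := 2) (by norm_num) hf2 hh2)).continuous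
  have cL : Continuous (driftLap g f v) := (driftLap_reg0 g hf2 hv2).continuous
  have cG : Continuous (inner2 g (gradMu τ g f) h.field) :=
    ((gradMu_reg2 g τ (k := 0) (l := 2) (by norm_num) hf2).inner2 g hh0).continuous
  have cT : Continuous (tr g h.field) := (hh0.tr g (k := 0)).continuous
  have cp : Continuous p := HF.reg0.continuous
  have e : (fun _ : M => c * 1) = fun x => (2 * τ * driftLap g f v x
      + τ * driftDiv1 g f (driftDiv2 g f h.field) x)
      + (inner2 g (gradMu τ g f) h.field x - ((1 / 2) * tr g h.field x - p x)) := by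
    ext x
    rw [inner2_gradMu hτ.ne' g f hh0.lin, ← hconst x]
    ring
  have n1 : nuIntegral τ g f (driftLap g f v) = 0 := by
    rw [show driftLap g f v = driftDiv1 g f (diff (n := n) v) from
      funext fun x => driftLap_eq g hv2 x]
    exact nuIntegral_driftDiv1 g hf1 (hv2.diff (k := 1) (l := 2) (by norm_num))
  have n2 : nuIntegral τ g f (driftDiv1 g f (driftDiv2 g f h.field)) = 0 :=
    nuIntegral_driftDiv1 g hf1 (Reg2.driftDiv2 g (k := 1) (l := 2) (by norm_num) hf2 hh2)
  have n3 := hU.nuIntegral_velocity hg H HF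
  have hn : nuIntegral τ g f (fun _ => 1) = 1 := (hU.minimizer g hg).1
  have hfin : c = nuIntegral τ g f (inner2 g (gradMu τ g f) h.field) := by
    have h1 := congrArg (nuIntegral τ g f) e
    rw [nuIntegral_const_mul, hn, mul_one, nuIntegral_add (u := fun x => 2 * τ * driftLap g f v x
      + τ * driftDiv1 g f (driftDiv2 g f h.field) x)
      (v := fun x => inner2 g (gradMu τ g f) h.field x - ((1 / 2) * tr g h.field x - p x)) g hf1
      ((continuous_const.mul cL).add (continuous_const.mul cD))
      (cG.sub ((continuous_const.mul cT).sub cp)),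
      nuIntegral_add (u := fun x => 2 * τ * driftLap g f v x)
      (v := fun x => τ * driftDiv1 g f (driftDiv2 g f h.field) x) g hf1 (continuous_const.mul cL)
      (continuous_const.mul cD), nuIntegral_const_mul, nuIntegral_const_mul, n1, n2,
      nuIntegral_sub (v := fun x => (1 / 2) * tr g h.field x - p x) g hf1 cG
      ((continuous_const.mul cT).sub cp), n3] at h1
    linarith
  rw [← hfin]
  exact ⟨hd x₀, hconst⟩

end Variational

/-! ### Constructing paths -/

section Construction

variable {n : ℕ} {M : Type*} [TopologicalSpace M] [ChartedSpace (Coord n) M]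

theorem IsLin2.expand {h : Field2 n M} (hh : IsLin2 h) (x : M) (b : Fin n → Coord n)
    (c : Fin n → ℝ) : h x (∑ a, c a • b a : Coord n) (∑ a, c a • b a : Coord n)
      = ∑ a, ∑ d, c a * c d * h x (b a) (b d) := by
  obtain ⟨A, hA⟩ := hh x
  have h1 := hA (∑ a, c a • b a) (∑ a, c a • b a)
  have h2 : ∀ a d, h x (b a) (b d) = A (b a) (b d) := fun a d => hA _ _
  refine h1.trans ?_
  simp only [map_sum, map_smul, ContinuousLinearMap.sum_apply, ContinuousLinearMap.smul_apply,
    smul_eq_mul, h2, Finset.mul_sum]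
  rw [Finset.sum_comm]
  exact Finset.sum_congr rfl fun a _ => Finset.sum_congr rfl fun d _ => by ring

theorem Tame.congr {X : Type*} [TopologicalSpace X] {H K : ℝ → X → ℝ} {x₀ : X} (hK : Tame K x₀)
    {ε : ℝ} (hε : 0 < ε) {V : Set X} (hV : V ∈ 𝓝 x₀)
    (h : ∀ s ∈ Ioo (-ε) ε, ∀ x ∈ V, H s x = K s x) : Tame H x₀ := by
  have h0 : (0 : ℝ) ∈ Ioo (-ε) ε := ⟨by linarith, hε⟩
  refine ⟨hK.1.congr ?_, hK.2.congr' ?_ EventuallyEq.rfl⟩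
  · filter_upwards [hV] with x hx
    exact (h 0 h0 x hx).symm
  · filter_upwards [prod_mem_nhds (isOpen_Ioo.mem_nhds h0) hV] with p hp
    rw [h _ hp.1 _ hp.2, h _ h0 _ hp.2]

theorem Tame.continuousAt {X : Type*} [TopologicalSpace X] {H : ℝ → X → ℝ} {x₀ : X}
    (hH : Tame H x₀) : ContinuousAt (fun s => H s x₀) 0 :=
  hH.tendsto.comp ((continuous_id.prodMk continuous_const).tendsto' (0 : ℝ) (0, x₀) rfl)

/-- The product rule at a zero of one factor, where the other factor only has to be continuous. -/
theorem hasDerivAt_mul_of_zero {b c : ℝ → ℝ} {b' : ℝ} (hb : HasDerivAt b b' 0) (h0 : b 0 = 0)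
    (hc : ContinuousAt c 0) : HasDerivAt (fun s => c s * b s) (c 0 * b') 0 := by
  rw [hasDerivAt_zero_iff] at hb ⊢
  refine ((hc.tendsto.mono_left nhdsWithin_le_nhds).mul hb).congr fun s => ?_
  rw [h0]
  ring

theorem JointSmooth.deriv {ε : ℝ} {V : Set (Coord n)} {f : ℝ → Coord n → ℝ}
    (hf : JointSmooth ε V f) (hV : IsOpen V) :
    JointSmooth ε V (fun s z => _root_.deriv (fun t => f t z) s) := by
  have hO := (isOpen_Ioo (a := -ε) (b := ε)).prod hV
  have h1 : ContDiffOn ℝ ∞ (fun p => fderiv ℝ (fun p : ℝ × Coord n => f p.1 p.2) p (1, 0))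
      (Ioo (-ε) ε ×ˢ V) :=
    (hf.fderiv_of_isOpen hO (by simp)).clm_apply contDiffOn_const
  exact h1.congr fun q hq => (hf.hasDerivAt hV hq.1 hq.2).deriv

variable [IsManifold (𝓡 n) ∞ M] (g : RMetric n M) (h : SymTensor n M)

/-- On a closed manifold every symmetric tensor is dominated by a multiple of the metric. -/
theorem exists_abs_le [CompactSpace M] :
    ∃ C : ℝ, 0 ≤ C ∧ ∀ (x : M) (v : TM n x), |h.val x v v| ≤ C * g.inner x v v := by
  have hc : Continuous (inner2 g h.field h.field) :=
    ((h.reg2.of_le (k := 0) (by simp)).inner2 g (k := 0) (h.reg2.of_le (by simp))).continuous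
  -- `|h|²` is bounded, which bounds the components of `h` in orthonormal frames
  obtain ⟨N, hN⟩ := isCompact_univ.bddAbove_image hc.continuousOn
  have hN' : ∀ x, inner2 g h.field h.field x ≤ |N| := fun x =>
    (hN (mem_image_of_mem _ (mem_univ x))).trans (le_abs_self N)
  refine ⟨(|N| + 1) * n, by positivity, fun x v => ?_⟩
  obtain ⟨b, hb⟩ := exists_frame_at g x
  set c : Fin n → ℝ := fun a => m2 (locG g x (crd n x x)) (b a) v with hcd
  have hv : (∑ a, c a • b a : Coord n) = v := hb.expand (v : Coord n)
  have e1 : h.val x v v = ∑ a, ∑ d, c a * c d * h.field x (b a) (b d) := by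
    have := IsLin2.expand h.reg2.lin x b c
    rw [hv] at this
    exact this
  have e2 : g.inner x v v = ∑ a, c a ^ 2 := by
    have := IsLin2.expand (RMetric.reg2 g).lin x b c
    rw [hv] at this
    refine Eq.trans this ?_
    refine Finset.sum_congr rfl fun a _ => ?_
    rw [Finset.sum_eq_single a]
    · rw [show RMetric.field g x (b a) (b a) = _ from frame_orthonormal hb a a]
      simp [sq]
    · intro d _ hd
      rw [show RMetric.field g x (b a) (b d) = _ from frame_orthonormal hb a d]
      simp [hd.symm]
    · simp
  have e3 : ∀ a d, |h.field x (b a) (b d)| ≤ |N| + 1 := by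
    intro a d
    have h1 := hN' x
    rw [inner2_frame hb h.reg2.lin h.reg2.lin] at h1
    have h2 : h.field x (b a) (b d) * h.field x (b a) (b d) ≤ |N| := by
      refine le_trans ?_ h1
      refine le_trans ?_ (Finset.single_le_sum (f := fun a => ∑ d, h.field x (b a) (b d)
        * h.field x (b a) (b d)) (fun a _ => Finset.sum_nonneg fun d _ => mul_self_nonneg _)
        (Finset.mem_univ a))
      exact Finset.single_le_sum (f := fun d => h.field x (b a) (b d) * h.field x (b a) (b d))
        (fun d _ => mul_self_nonneg _) (Finset.mem_univ d)
    rw [abs_le]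
    constructor <;> nlinarith [sq_nonneg (h.field x (b a) (b d) + 1),
      sq_nonneg (h.field x (b a) (b d) - 1)]
  rw [e1, e2]
  calc |∑ a, ∑ d, c a * c d * h.field x (b a) (b d)|
      ≤ ∑ a, ∑ d, |c a * c d * h.field x (b a) (b d)| :=
        (Finset.abs_sum_le_sum_abs _ _).trans
          (Finset.sum_le_sum fun a _ => Finset.abs_sum_le_sum_abs _ _)
    _ ≤ ∑ a, ∑ d, ((c a ^ 2 + c d ^ 2) / 2) * (|N| + 1) := by
        refine Finset.sum_le_sum fun a _ => Finset.sum_le_sum fun d _ => ?_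
        rw [abs_mul]
        refine mul_le_mul ?_ (e3 a d) (abs_nonneg _) (by positivity)
        rw [abs_le]
        constructor <;> nlinarith [sq_nonneg (c a + c d), sq_nonneg (c a - c d)]
    _ = (|N| + 1) * n * ∑ a, c a ^ 2 := by
        simp only [← Finset.sum_mul, ← Finset.sum_div, Finset.sum_add_distrib, Finset.sum_const,
          Finset.card_univ, Fintype.card_fin, nsmul_eq_mul, ← Finset.mul_sum]
        ring

/-- The metric `g + s h`. The lower bound on it gives positivity, and the boundedness of its unit
balls that the structure of a Riemannian metric asks for. -/
def linearMetric (s : ℝ)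
    (hs : ∀ (x : M) (v : TM n x), (1 / 2) * g.inner x v v ≤ g.inner x v v + s * h.val x v v) :
    RMetric n M where
  inner x := g.inner x + s • h.val x
  symm x v w := congrArg₂ (fun a b => a + s * b) (g.symm x v w) (h.symm x v w)
  pos x v hv := lt_of_lt_of_le (by have := g.pos x v hv; linarith) (hs x v)
  isVonNBounded x := by
    refine ((g.isVonNBounded x).image
      ((2 : ℝ) • ContinuousLinearMap.id ℝ (TangentSpace (𝓡 n) x))).subset fun v hv => ?_
    refine ⟨(1 / 2 : ℝ) • v, ?_, ?_⟩
    · have h1 : g.inner x v v + s * h.val x v v < 1 := hv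
      have h2 := hs x v
      simp only [mem_setOf_eq, map_smul, ContinuousLinearMap.smul_apply, smul_eq_mul]
      linarith
    · simp [smul_smul]
  contMDiff := (contMDiff_section_iff _).2 fun a i j =>
    ((RMetric.reg2 g).comp a i j).add (contDiffOn_const.mul (h.reg2.comp a i j))

/-- Every symmetric tensor is the velocity of a path of metrics. -/
theorem exists_isPathThrough [CompactSpace M] : ∃ γ : ℝ → RMetric n M, IsPathThrough γ g h := by
  classical
  obtain ⟨C, hC, hb⟩ := exists_abs_le g h
  have hε : 0 < 1 / (2 * (C + 1)) := by positivity
  set ε := 1 / (2 * (C + 1)) with hεd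
  have hs : ∀ s ∈ Ioo (-ε) ε, ∀ (x : M) (v : TM n x),
      (1 / 2) * g.inner x v v ≤ g.inner x v v + s * h.val x v v := by
    intro s hs x v
    have h0 : 0 ≤ g.inner x v v := by
      by_cases hv : v = 0
      · simp [hv]
      · exact (g.pos x v hv).le
    have h1 : |s * h.val x v v| ≤ (1 / 2) * g.inner x v v := by
      rw [abs_mul]
      have h2 : |s| ≤ ε := (abs_lt.2 hs).le
      calc |s| * |h.val x v v| ≤ ε * (C * g.inner x v v) :=
            mul_le_mul h2 (hb x v) (abs_nonneg _) hε.le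
        _ ≤ (1 / 2) * g.inner x v v := by
            rw [← mul_assoc]
            refine mul_le_mul_of_nonneg_right ?_ h0
            rw [hεd, div_mul_eq_mul_div, div_le_div_iff₀ (by positivity) (by norm_num)]
            linarith
    linarith [neg_abs_le (s * h.val x v v)]
  set γ : ℝ → RMetric n M := fun s =>
    if hh : s ∈ Ioo (-ε) ε then linearMetric g h s (hs s hh) else g with hγ
  have e : ∀ s ∈ Ioo (-ε) ε, ∀ (x : M) (v w : TM n x),
      (γ s).inner x v w = g.inner x v w + s * h.val x v w := by
    intro s hh x v w
    simp only [hγ, dif_pos hh]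
    rfl
  have h0 : (0 : ℝ) ∈ Ioo (-ε) ε := ⟨by linarith, hε⟩
  refine ⟨γ, isSmoothPath_iff.2 ⟨ε, hε, fun a i j => ?_⟩, ?_, fun x v w => ?_⟩
  · have h1 : ContDiffOn ℝ ∞ (fun q : ℝ × Coord n => locG g a q.2 i j
        + q.1 * comp2 a h.field q.2 i j) (Ioo (-ε) ε ×ˢ (crd n a).target) :=
      (((patchMetric g a).smooth i j).comp contDiffOn_snd fun q hq => hq.2).add
        (contDiffOn_fst.mul ((h.reg2.comp a i j).comp contDiffOn_snd fun q hq => hq.2))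
    exact h1.congr fun q hq => e _ hq.1 _ _ _
  · simp only [hγ, dif_pos h0]
    unfold linearMetric
    cases g
    congr
    ext x v
    simp
  · have h1 : HasDerivAt (fun s : ℝ => g.inner x v w + s * h.val x v w) (h.val x v w) 0 :=
      (((hasDerivAt_id (0 : ℝ)).mul_const (h.val x v w)).const_add _).congr_deriv (one_mul _)
    refine h1.congr_of_eventuallyEq ?_
    filter_upwards [isOpen_Ioo.mem_nhds h0] with s hh
    exact e s hh x v w

variable {g h}

/-- A smooth path of metrics has a velocity, a smooth symmetric tensor, at every parameter. -/
theorem exists_velocity {γ : ℝ → RMetric n M} {ε : ℝ}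
    (hγ : ∀ (a : M) (i j : Fin n),
      JointSmooth ε (crd n a).target (fun s z => locG (γ s) a z i j)) {s : ℝ}
    (hs : s ∈ Ioo (-ε) ε) : ∃ k : SymTensor n M, IsPathThrough (fun t => γ (s + t)) (γ s) k := by
  set B : M → Coord n →L[ℝ] Coord n →L[ℝ] ℝ := fun x =>
    m2 fun i j => deriv (fun t => locG (γ t) x (crd n x x) i j) s with hB
  have hd : ∀ (x : M) (v w : Coord n),
      HasDerivAt (fun t => RMetric.field (γ t) x v w) (B x v w) s := by
    intro x v w
    have h1 := hasDerivAt_m2 (A := fun t => locG (γ t) x (crd n x x)) (fun i j =>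
      ((hγ x i j).hasDerivAt (isOpen_target x) hs (mem_extChartAt_target x)).differentiableAt.hasDerivAt)
      v w
    refine h1.congr_of_eventuallyEq (Eventually.of_forall fun t => ?_)
    exact (comp2_self (RMetric.reg2 (γ t)).lin x v w).symm
  refine ⟨⟨B, fun x v w => ?_, ?_⟩, isSmoothPath_iff.2 ⟨ε - |s|, ?_, fun a i j => ?_⟩, ?_, ?_⟩
  · refine (hd x v w).unique ((hd x w v).congr_of_eventuallyEq (Eventually.of_forall fun t => ?_))
    exact (γ t).symm x v w
  · refine (contMDiff_section_iff B).2 fun a i j => ?_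
    refine ((hγ a i j).contDiffOn_deriv (isOpen_target a) hs).congr fun z hz => ?_
    exact (hd _ _ _).deriv.symm
  · have := abs_lt.2 hs
    linarith
  · refine ContDiffOn.comp (g := fun q : ℝ × Coord n => locG (γ q.1) a q.2 i j)
      (f := fun q : ℝ × Coord n => (s + q.1, q.2)) (hγ a i j) (by fun_prop) fun q hq => ⟨?_, hq.2⟩
    have h1 := abs_lt.2 hq.1
    exact abs_lt.1 (by linarith [abs_add_le s q.1])
  · simp
  · intro x v w
    refine HasDerivAt.comp_const_add (f := fun t => (γ t).inner x v w) s 0 ?_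
    rw [add_zero]
    exact hd x v w

end Construction

/-! ### The second variation at a soliton -/

section SecondVariation

variable {n : ℕ} {M : Type*} [TopologicalSpace M] [ChartedSpace (Coord n) M]
  [IsManifold (𝓡 n) ∞ M] {γ : ℝ → RMetric n M} {g : RMetric n M} {h : SymTensor n M}
  {F : ℝ → M → ℝ} {p : M → ℝ}

theorem driftLap_sub (g : RMetric n M) (f : M → ℝ) {u v : M → ℝ} (hu : Reg0 (n := n) 2 u)
    (hv : Reg0 (n := n) 2 v) (x : M) :
    driftLap g f (fun x => u x - v x) x = driftLap g f u x - driftLap g f v x := by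
  obtain ⟨b, hb⟩ := exists_frame_at g x
  unfold driftLap
  rw [tr_frame hb (isLin2_hess g _), tr_frame hb (isLin2_hess g _), tr_frame hb (isLin2_hess g _),
    inner1_frame hb (isLin1_diff _) (isLin1_diff _), inner1_frame hb (isLin1_diff _) (isLin1_diff _),
    inner1_frame hb (isLin1_diff _) (isLin1_diff _)]
  simp only [← Finset.sum_sub_distrib]
  refine Finset.sum_congr rfl fun a _ => ?_
  have h1 := hess_sub g hu hv x (b a) (b a)
  have h2 : diff (n := n) (fun x => u x - v x) x (b a)
      = diff (n := n) u x (b a) + -1 * diff (n := n) v x (b a) := by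
    rw [← diff_add_mul (hu.of_le (by norm_num)) (hv.of_le (by norm_num)) (-1) x (b a)]
    congr 1
    ext x
    ring
  refine (congrArg₂ (fun r t => r - t * diff (n := n) f x (b a)) h1 h2).trans ?_
  ring

theorem driftDiv1_zero (g : RMetric n M) (f : M → ℝ) (x : M) :
    driftDiv1 g f (fun _ _ => 0 : Field1 n M) x = 0 := by
  have h1 : comp1 x (fun _ _ => 0 : Field1 n M) = fun _ _ => 0 := rfl
  unfold driftDiv1 div1 traceC inner1
  rw [h1]
  simp [nabla1, pd]

/-- The components of `∇μ` along a path vary continuously with the parameter, at a linear rate. -/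
theorem IsPathThrough.tame_gradMu (H : IsPathThrough γ g h) (τ : ℝ)
    (HF : HasC2DerivAt (n := n) F p) (hF : ∀ s, Reg0 (n := n) 2 (F s)) (x : M) (i j : Fin n) :
    Tame (fun s z => comp2 x (gradMu τ (γ s) (F s)) z i j) (crd n x x) := by
  obtain ⟨ε, hP⟩ := H.exists_patchPath
  have hy := mem_extChartAt_target (I := 𝓡 n) x
  have hO := isOpen_target (n := n) x
  have hε := (hP x).pos
  refine Tame.congr (K := fun s z => -τ * (ricciC (locG (γ s) x) z i j
      + (pd i (pd j (comp0 x (F s))) z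
        - ∑ l, christoffel (locG (γ s) x) z l i j * pd l (comp0 x (F s)) z)
      + (-(1 / (2 * τ))) * locG (γ s) x z i j)) ?_ one_pos (hO.mem_nhds hy)
    fun s _ z hz => comp2_gradMu (γ s) τ (hF s) hz i j
  exact (((((hP x).jointSmooth_ricciC i j).tame hε hO hy).add ((HF.tame_pd_pd hF hy i j).sub
    (Tame.sum _ fun l _ => (((hP x).jointSmooth_christoffel l i j).tame hε hO hy).mul
      (HF.tame_pd hF hy l)))).add ((((hP x).smooth i j).tame hε hO hy).const_mul _)).const_mul _

variable [CompactSpace M] [T2Space M] [MeasurableSpace M] [BorelSpace M] {τ : ℝ}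

/-- Where `∇μ` vanishes, the derivative of its pairing with a family of tensors only sees the
derivative of `∇μ`: the variations of the metric in the inner product, of the measure and of the
tensors are all multiplied by zero. -/
theorem IsPathThrough.hasDerivAt_nuIntegral_gradMu (H : IsPathThrough γ g h) (τ : ℝ)
    (HF : HasC2DerivAt (n := n) F p) (hF : ∀ s, Reg0 (n := n) 2 (F s))
    (h0 : ∀ (x : M) (v w : Coord n), gradMu τ g (F 0) x v w = 0) {k : ℝ → SymTensor n M}
    (hk : ∀ (x : M) (i j : Fin n), Tame (fun s z => comp2 x (k s).field z i j) (crd n x x)) :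
    HasDerivAt (fun s => nuIntegral τ (γ s) (F s) (inner2 (γ s) (gradMu τ (γ s) (F s)) (k s).field))
      (nuIntegral τ g (F 0) (inner2 g (opL τ g (F 0) h (fun x => p x - (1 / 2) * tr g h.field x))
        (k 0).field)) 0 := by
  obtain ⟨ε, hP⟩ := H.exists_patchPath
  have hinv : ∀ (x : M) (i j : Fin n), Tame (fun s z => invG (locG (γ s) x) z i j) (crd n x x) :=
    fun x i j => ((hP x).jointSmooth_invG i j).tame (hP x).pos (isOpen_target x)
      (mem_extChartAt_target x)
  have hG := H.tame_gradMu τ HF hF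
  have hz : ∀ (x : M) (i j : Fin n),
      comp2 x (gradMu τ (γ 0) (F 0)) (crd n x x) i j = 0 := by
    intro x i j
    rw [H.start]
    exact h0 _ _ _
  have hz' : ∀ x, inner2 (γ 0) (gradMu τ (γ 0) (F 0)) (k 0).field x = 0 := by
    intro x
    unfold inner2
    simp only [hz, mul_zero, zero_mul, Finset.sum_const_zero]
  have key := H.hasDerivAt_nuIntegral τ HF hF
    (A := fun s => inner2 (γ s) (gradMu τ (γ s) (F s)) (k s).field)
    (A' := inner2 g (opL τ g (F 0) h (fun x => p x - (1 / 2) * tr g h.field x)) (k 0).field)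
    (fun x => Tame.of_coord (K := fun s z => innerC2 (locG (γ s) x) z
        (comp2 x (gradMu τ (γ s) (F s)) z) (comp2 x (k s).field z))
      (Tame.sum _ fun i _ => Tame.sum _ fun j _ => Tame.sum _ fun a _ => Tame.sum _ fun b _ =>
        (((hinv x i a).mul (hinv x j b)).mul (hG x i j)).mul (hk x a b))
      fun s y hy => comp0_inner2 (γ s) hy (isLin2_gradMu (γ s) τ (F s)) (k s).reg2.lin)
    (fun s => ((gradMu_reg2 (γ s) τ (k := 0) (l := 2) (by norm_num) (hF s)).inner2 (γ s)
      ((k s).reg2.of_le (by simp))).continuous)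
    (fun x => ?_)
  · refine key.congr_deriv ?_
    simp only [hz', zero_mul, add_zero]
  · unfold inner2
    refine HasDerivAt.fun_sum fun i _ => HasDerivAt.fun_sum fun j _ =>
      HasDerivAt.fun_sum fun a _ => HasDerivAt.fun_sum fun b _ => ?_
    have h1 : HasDerivAt (fun s => comp2 x (gradMu τ (γ s) (F s)) (crd n x x) i j)
        (comp2 x (opL τ g (F 0) h (fun x => p x - (1 / 2) * tr g h.field x)) (crd n x x) i j) 0 :=
      H.hasDerivAt_gradMu τ HF hF _ _ _
    have h2 := hasDerivAt_mul_of_zero h1 (hz x i j)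
      (c := fun s => invG (locG (γ s) x) (crd n x x) i a * invG (locG (γ s) x) (crd n x x) j b
        * comp2 x (k s).field (crd n x x) a b)
      (((hinv x i a).mul (hinv x j b)).mul (hk x a b)).continuousAt
    refine (h2.congr_of_eventuallyEq (Eventually.of_forall fun s => ?_)).congr_deriv ?_
    · ring
    · rw [H.start]
      ring

variable {U : Set (RMetric n M)} {P : RMetric n M → SmoothFun n M} {g₀ : RMetric n M}
  {f₀ : SmoothFun n M}

section Soliton

variable (hτ : 0 < τ) (hsol : IsShrinkingSoliton τ g₀ f₀) (hU : IsRegularNeighborhood τ g₀ U P)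
include hτ hsol hU

theorem IsRegularNeighborhood.hess_sub_eq_zero (x : M) (v w : Coord n) :
    hess g₀ (fun x => P g₀ x - f₀ x) x v w = 0 :=
  hess_sub_eq_zero_of_euler_const g₀ hτ hsol (fun x => (hU.minimizer g₀ hU.mem).euler_eq hτ x) x v w

/-- A shrinking soliton is a critical point of `μ`. -/
theorem IsRegularNeighborhood.gradMu_eq_zero (x : M) (v w : Coord n) :
    gradMu τ g₀ (P g₀) x v w = 0 := by
  have h1 := hess_sub g₀ ((P g₀).reg0.of_le two_le_infty) (f₀.reg0.of_le two_le_infty) x v w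
  have h2 := hU.hess_sub_eq_zero hτ hsol x v w
  have h3 := hsol x v w
  have h4 : hess g₀ (P g₀) x v w = hess g₀ f₀ x v w := sub_eq_zero.1 (h1.symm.trans h2)
  refine (congrArg (fun r => -τ * (ricci g₀ x v w + r - (1 / (2 * τ)) * g₀.inner x v w)) h4).trans ?_
  exact (congrArg (fun r => -τ * r) h3).trans (mul_zero _)

/-- The minimizer and the potential of the soliton differ by a locally constant function, so all
operators that only involve the differential of the potential are the same for both. -/
theorem IsRegularNeighborhood.diff_eq : diff (n := n) (P g₀) = diff (n := n) f₀ := by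
  funext x v
  have h2 := (P g₀).reg0.of_le (k := 2) two_le_infty
  have h3 := f₀.reg0.of_le (k := 2) two_le_infty
  have h1 := diff_eq_zero_of_harmonic g₀ (u := fun x => P g₀ x - f₀ x) (h2.sub h3) (fun x => by
    obtain ⟨b, hb⟩ := exists_frame_at g₀ x
    rw [tr_frame hb (isLin2_hess g₀ _)]
    exact Finset.sum_eq_zero fun a _ => hU.hess_sub_eq_zero hτ hsol x (b a) (b a)) x v
  have h4 := diff_add_mul (f := P g₀) (η := f₀) (h2.of_le (by norm_num)) (h3.of_le (by norm_num))
    (-1) x v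
  have h5 : (fun x => P g₀ x + -1 * f₀ x) = fun x => P g₀ x - f₀ x := by
    ext x
    ring
  rw [h5] at h4
  have h6 := h4.symm.trans h1
  linarith

theorem IsRegularNeighborhood.opL_eq (h : SymTensor n M) (φ : M → ℝ) :
    opL τ g₀ (P g₀) h φ = opL τ g₀ f₀ h φ := by
  have h1 : ∀ x i, pd i (comp0 x (P g₀)) (crd n x x) = pd i (comp0 x f₀) (crd n x x) := by
    intro x i
    have hy := mem_extChartAt_target (I := 𝓡 n) x
    have e1 := comp1_diff hy ((P g₀).reg0.of_le (k := 1) (by simp))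
    have e2 := comp1_diff hy (f₀.reg0.of_le (k := 1) (by simp))
    rw [hU.diff_eq hτ hsol, e2] at e1
    exact (congrFun e1 i).symm
  unfold opL psi psiC
  simp only [h1]

/-- `p - ½ tr h` solves the equation that defines `Φ`. This is the pointwise form of the first
variation of `μ`, whose constant vanishes because the soliton is critical. -/
theorem IsRegularNeighborhood.driftLap_velocity (H : IsPathThrough γ g₀ h)
    (HF : HasC2DerivAt (n := n) (fun s => P (γ s)) p) (x : M) :
    driftLap g₀ f₀ (fun x => p x - (1 / 2) * tr g₀ h.field x) x
        + (1 / (2 * τ)) * (p x - (1 / 2) * tr g₀ h.field x)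
      = -(1 / 2) * driftDiv1 g₀ f₀ (driftDiv2 g₀ f₀ h.field) x := by
  have hd := hU.diff_eq hτ hsol
  have h0 : ∀ x, inner2 g₀ (gradMu τ g₀ (P g₀)) h.field x = 0 := by
    intro x
    obtain ⟨b, hb⟩ := exists_frame_at g₀ x
    rw [inner2_frame hb (isLin2_gradMu g₀ τ _) h.reg2.lin]
    refine Finset.sum_eq_zero fun a _ => Finset.sum_eq_zero fun c _ => ?_
    rw [show gradMu τ g₀ (P g₀) x (b a) (b c) = 0 from hU.gradMu_eq_zero hτ hsol x _ _, zero_mul]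
  have h1 := (hU.hasDerivAt_mu hτ hU.mem H HF).2 x
  have h2 := inner2_gradMu hτ.ne' g₀ (P g₀) h.reg2.lin x
  have h3 : nuIntegral τ g₀ (P g₀) (inner2 g₀ (gradMu τ g₀ (P g₀)) h.field) = 0 := by
    rw [show inner2 g₀ (gradMu τ g₀ (P g₀)) h.field = fun _ => 0 from funext h0]
    simp [nuIntegral]
  have h4 : driftDiv2 g₀ (P g₀) h.field = driftDiv2 g₀ f₀ h.field := by
    funext y v
    rw [driftDiv2_eq g₀ ((P g₀).reg0.of_le (by simp)), driftDiv2_eq g₀ (f₀.reg0.of_le (by simp)), hd]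
  have h5 : driftLap g₀ (P g₀) (fun x => p x - (1 / 2) * tr g₀ h.field x) x
      = driftLap g₀ f₀ (fun x => p x - (1 / 2) * tr g₀ h.field x) x := by
    unfold driftLap
    rw [hd]
  have h6 : driftDiv1 g₀ (P g₀) (driftDiv2 g₀ f₀ h.field) x
      = driftDiv1 g₀ f₀ (driftDiv2 g₀ f₀ h.field) x := by
    unfold driftDiv1
    rw [hd]
  rw [h3, h4, h5, h6] at h1
  rw [h0] at h2
  have h7 : 1 / (2 * τ) * τ = 1 / 2 := by field_simp
  refine mul_left_cancel₀ (mul_pos two_pos hτ).ne' ?_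
  linear_combination h1 + h2 + 2 * (p x - (1 / 2) * tr g₀ h.field x) * h7

/-- Existence of `Φ(h)` without elliptic theory: the derivative of `P` along any path with velocity `h`
provides the solution. -/
theorem IsRegularNeighborhood.exists_potential (h : SymTensor n M) : ∃ φ : M → ℝ,
    Reg0 (n := n) 2 φ ∧ ∀ x, driftLap g₀ f₀ φ x + (1 / (2 * τ)) * φ x
      = -(1 / 2) * driftDiv1 g₀ f₀ (driftDiv2 g₀ f₀ h.field) x := by
  obtain ⟨γ, H⟩ := exists_isPathThrough g₀ h
  obtain ⟨p, HF⟩ := hU.path_deriv γ H.smooth (by rw [H.start]; exact hU.mem)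
  exact ⟨_, HF.reg0.sub ((reg0_const _).mul ((h.reg2.of_le two_le_infty).tr g₀ (k := 2))),
    hU.driftLap_velocity hτ hsol H HF⟩

/-- Uniqueness of `Φ`, from the existence of solutions for conformal velocities. -/
theorem IsRegularNeighborhood.potential_unique {u v r : M → ℝ} (hu : Reg0 (n := n) 2 u)
    (hv : Reg0 (n := n) 2 v) (eu : ∀ x, driftLap g₀ f₀ u x + (1 / (2 * τ)) * u x = r x)
    (ev : ∀ x, driftLap g₀ f₀ v x + (1 / (2 * τ)) * v x = r x) : u = v := by
  funext x
  refine sub_eq_zero.1 (kernel_eq_zero (u := fun x => u x - v x) g₀ hτ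
    (f₀.reg0.of_le two_le_infty)
    (fun w => hU.exists_potential hτ hsol (conformal g₀ w)) (hu.sub hv) (fun x => ?_) x)
  rw [driftLap_sub g₀ f₀ hu hv]
  linear_combination eu x - ev x

end Soliton

/-- Where the gradient of `μ` vanishes at the start of a path, the second derivative of `μ` is
the quadratic form of the linearized gradient. Near the parameter `0` the derivative of `μ` is the
pairing of `∇μ(g_s)` with the velocity of the path at `s`. -/
theorem IsRegularNeighborhood.hasDerivAt_deriv_mu (hτ : 0 < τ)
    (hU : IsRegularNeighborhood τ g₀ U P) (hg : g ∈ U) (H : IsPathThrough γ g h)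
    (HF : HasC2DerivAt (n := n) (fun s => P (γ s)) p)
    (h0 : ∀ (x : M) (v w : Coord n), gradMu τ g (P g) x v w = 0) :
    HasDerivAt (deriv fun s => mu τ (γ s)) (nuIntegral τ g (P g)
      (inner2 g (opL τ g (P g) h (fun x => p x - (1 / 2) * tr g h.field x)) h.field)) 0 := by
  classical
  obtain ⟨ε, hε, hγ⟩ := isSmoothPath_iff.1 H.smooth
  have hs0 : (0 : ℝ) ∈ Ioo (-ε) ε := ⟨by linarith, hε⟩
  set k : ℝ → SymTensor n M := fun s =>
    if hs : s ∈ Ioo (-ε) ε then (exists_velocity hγ hs).choose else h with hkd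
  have hk : ∀ s ∈ Ioo (-ε) ε, IsPathThrough (fun t => γ (s + t)) (γ s) (k s) := by
    intro s hs
    simp only [hkd, dif_pos hs]
    exact (exists_velocity hγ hs).choose_spec
  -- derivatives of a path at `s` and derivatives at `0` of the shifted path
  have hshift : ∀ (s a : ℝ) (u : ℝ → ℝ), HasDerivAt (fun t => u (s + t)) a 0 → HasDerivAt u a s := by
    intro s a u hu
    have h1 : HasDerivAt (fun t => u (s + t)) a (s + -s) := by rwa [add_neg_cancel]
    have h2 := HasDerivAt.comp_add_const (f := fun t => u (s + t)) s (-s) h1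
    simpa using h2
  have hkt : ∀ (x : M) (i j : Fin n), Tame (fun s z => comp2 x (k s).field z i j) (crd n x x) := by
    intro x i j
    have hO := isOpen_target (n := n) x
    have hy := mem_extChartAt_target (I := 𝓡 n) x
    refine Tame.congr (((hγ x i j).deriv hO).tame hε hO hy) hε (hO.mem_nhds hy) fun s hs z _ => ?_
    exact (hshift s _ (fun t => locG (γ t) x z i j) ((hk s hs).velocity _ _ _)).deriv.symm
  have hk0 : (k 0).field = h.field := by
    funext x v w
    have h1 := (hk 0 hs0).velocity x v w
    simp only [zero_add] at h1
    exact h1.unique (H.velocity x v w)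
  have hF : ∀ s, Reg0 (n := n) 2 (P (γ s)) := fun s => (P (γ s)).reg0.of_le two_le_infty
  have key := H.hasDerivAt_nuIntegral_gradMu τ HF hF (by rwa [H.start]) hkt
  rw [hk0, H.start] at key
  refine key.congr_of_eventuallyEq ?_
  filter_upwards [hU.path_mem γ H.smooth (by rwa [H.start]), isOpen_Ioo.mem_nhds hs0] with s hs hs'
  have Hs := hk s hs'
  obtain ⟨q, hq⟩ := hU.path_deriv _ Hs.smooth (by rwa [Hs.start])
  exact (hshift s _ (fun t => mu τ (γ t)) (hU.hasDerivAt_mu hτ hs Hs hq).1).deriv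

end SecondVariation

end SolitonVariation

end

theorem lemmaA3 {n : ℕ} {M : Type*} [TopologicalSpace M] [ChartedSpace (Coord n) M]
    [IsManifold (𝓡 n) ∞ M] [CompactSpace M] [T2Space M] [MeasurableSpace M] [BorelSpace M]
    (τ : ℝ) (hτ : 0 < τ) (g₀ : RMetric n M) (f₀ : SmoothFun n M)
    (hsol : IsShrinkingSoliton τ g₀ f₀)
    (U : Set (RMetric n M)) (P : RMetric n M → SmoothFun n M)
    (hU : IsRegularNeighborhood τ g₀ U P) :
    ∃ Φ : SymTensor n M → M → ℝ,
      -- `Φ(h)` is the unique solution of `Δ^{f₀} φ + φ / (2τ) = -½ δ^{f₀} δ^{f₀} h`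
      (∀ h : SymTensor n M,
        (ContMDiff (𝓡 n) 𝓘(ℝ, ℝ) 2 (Φ h) ∧
          ∀ x, driftLap g₀ f₀ (Φ h) x + (1 / (2 * τ)) * Φ h x
            = -(1 / 2) * driftDiv1 g₀ f₀ (driftDiv2 g₀ f₀ h.field) x) ∧
        ∀ φ : M → ℝ, ContMDiff (𝓡 n) 𝓘(ℝ, ℝ) 2 φ →
          (∀ x, driftLap g₀ f₀ φ x + (1 / (2 * τ)) * φ x
            = -(1 / 2) * driftDiv1 g₀ f₀ (driftDiv2 g₀ f₀ h.field) x) → φ = Φ h) ∧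
      -- it vanishes identically if `δ^{f₀} h = 0`
      (∀ h : SymTensor n M, (∀ x v, driftDiv2 g₀ f₀ h.field x v = 0) → ∀ x, Φ h x = 0) ∧
      -- `δ^*` is the dual of `δ` for the `L²` inner product of `dV_{g₀}`
      (∀ (α : OneForm n M) (k : SymTensor n M),
        ∫ x, inner2 g₀ (deltaStar g₀ α.field) k.field x ∂(vol g₀)
          = ∫ x, inner1 g₀ α.field (div2 g₀ k.field) x ∂(vol g₀)) ∧
      -- `∇μ(g) = -τ (Ric(g) + ∇² P(g) - g / (2τ))` is the gradient of `μ(·, τ)` on `U`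
      (∀ g ∈ U, ∀ (γ : ℝ → RMetric n M) (h : SymTensor n M),
        IsPathThrough γ g h →
        HasDerivAt (fun s => mu τ (γ s))
          (nuIntegral τ g (P g) (inner2 g (gradMu τ g (P g)) h.field)) 0) ∧
      -- the second variation along any path of metrics through `g₀` with velocity `h`
      (∀ (γ : ℝ → RMetric n M) (h : SymTensor n M), IsPathThrough γ g₀ h →
        -- `Φ(h) = P'(h) - ½ tr h`
        HasC2DerivAt (n := n) (fun s => P (γ s)) (fun x => Φ h x + (1 / 2) * tr g₀ h.field x) ∧
        -- the linearization of `∇μ` at `g₀` is `L`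
        (∀ (x : M) (v w : TM n x),
          HasDerivAt (fun s => gradMu τ (γ s) (P (γ s)) x v w) (opL τ g₀ f₀ h (Φ h) x v w) 0) ∧
        -- the second variation as a bilinear form
        (∀ k : SymTensor n M,
          HasDerivAt
            (fun s => nuIntegral τ (γ s) (P (γ s))
              (inner2 (γ s) (gradMu τ (γ s) (P (γ s))) k.field))
            (nuIntegral τ g₀ (P g₀) (inner2 g₀ (opL τ g₀ f₀ h (Φ h)) k.field)) 0) ∧
        -- the second derivative of `μ` along the path
        HasDerivAt (deriv fun s => mu τ (γ s))
          (nuIntegral τ g₀ (P g₀) (inner2 g₀ (opL τ g₀ f₀ h (Φ h)) h.field)) 0) := by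
  have hg : ∀ {γ : ℝ → RMetric n M} {h : SymTensor n M}, IsPathThrough γ g₀ h →
      ∃ p, HasC2DerivAt (n := n) (fun s => P (γ s)) p := fun H =>
    hU.path_deriv _ H.smooth (by rw [H.start]; exact hU.mem)
  have hz := hU.gradMu_eq_zero hτ hsol
  choose Φ hΦ1 hΦ2 using hU.exists_potential hτ hsol
  have huniq : ∀ (h : SymTensor n M) (φ : M → ℝ), Reg0 (n := n) 2 φ →
      (∀ x, driftLap g₀ f₀ φ x + (1 / (2 * τ)) * φ x
        = -(1 / 2) * driftDiv1 g₀ f₀ (driftDiv2 g₀ f₀ h.field) x) → φ = Φ h :=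
    fun h φ hφ e => hU.potential_unique hτ hsol hφ (hΦ1 h) e (hΦ2 h)
  refine ⟨Φ, fun h => ⟨⟨(hΦ1 h).contMDiff (k := 2), hΦ2 h⟩, fun φ hφ =>
    huniq h φ (reg0_of_contMDiff (k := 2) hφ)⟩, fun h hh => ?_, fun α k => ?_,
    fun g hg γ h H => ?_, fun γ h H => ?_⟩
  -- for `δ^{f₀} h = 0` the function `Φ h` solves the homogeneous equation
  · refine kernel_eq_zero g₀ hτ (f₀.reg0.of_le two_le_infty)
      (fun w => hU.exists_potential hτ hsol (conformal g₀ w)) (hΦ1 h) fun x => ?_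
    rw [hΦ2 h x, show driftDiv2 g₀ f₀ h.field = fun _ _ => 0 from
      funext fun x => funext fun v => hh x v, driftDiv1_zero, mul_zero]
  · exact integral_deltaStar g₀ (α.reg1.of_le (by simp)) (k.reg2.of_le (by simp))
      fun x v w => k.symm x v w
  · obtain ⟨p, hp⟩ := hU.path_deriv γ H.smooth (by rwa [H.start])
    exact (hU.hasDerivAt_mu hτ hg H hp).1
  · obtain ⟨p, hp⟩ := hg H
    have hF : ∀ s, Reg0 (n := n) 2 (P (γ s)) := fun s => (P (γ s)).reg0.of_le two_le_infty
    have hv : (fun x => p x - (1 / 2) * tr g₀ h.field x) = Φ h :=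
      huniq h _ (hp.reg0.sub ((reg0_const _).mul ((h.reg2.of_le two_le_infty).tr g₀ (k := 2))))
        (hU.driftLap_velocity hτ hsol H hp)
    -- the linearization is computed with the potential `P g₀`, and only its differential enters
    have hL := hU.opL_eq hτ hsol h (Φ h)
    refine ⟨?_, fun x v w => ?_, fun k => ?_, ?_⟩
    · have e : (fun x => Φ h x + (1 / 2) * tr g₀ h.field x) = p := by
        rw [← hv]
        ext x
        ring
      rwa [e]
    · have := H.hasDerivAt_gradMu τ hp hF x v w
      rwa [hv, H.start, hL] at this
    · have := H.hasDerivAt_nuIntegral_gradMu τ hp hF (by rwa [H.start]) (k := fun _ => k)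
        fun x i j => tame_const ((k.reg2.comp x i j).continuousOn.continuousAt
          ((isOpen_target x).mem_nhds (mem_extChartAt_target x)))
      rwa [hv, H.start, hL] at this
    · have := hU.hasDerivAt_deriv_mu hτ hU.mem H hp hz
      rwa [hv, hL] at this
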